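/- Let $\Lambda=\mathbb C\oplus\mathbb C v$ with $v^2=0$, $|v|=1$, $\mathrm{tr}(1)=0$, $\mathrm{tr}(v)=1$. Consider the $\mathbb C$-linear graded category whose objects are the words in two letters $P,Q$ (the empty word is $\mathbf 1$, composition of $1$-morphisms is concatenation) and whose morphisms are linear combinations of planar oriented string diagrams, read from bottom to top (an upward strand is $\mathrm{id}_P$, a downward strand is $\mathrm{id}_Q$), built from crossings of two strands in all orientations (degree $0$), dots labelled by $b\in\Lambda$ on strands (degree $|b|$, linear in $b$, a dot labelled by $1$ being trivial), clockwise cups $\mathbf 1\to PQ$ (degree $0$), counterclockwise cups $\mathbf 1\to QP$ (degree $-1$), clockwise caps $PQ\to\mathbf 1$ (degree $1$) and counterclockwise caps $QP\to\mathbf 1$ (degree $0$). Diagrams are taken up to the following relations, parity being degree mod $2$. * Exchanging the heights of two pieces $f,g$ lying side by side costs the sign $(-1)^{\deg f\deg g}$ (in particular dots on different strands supercommute). * Isotopy: zigzags can be straightened (with the sign $-1$, forced by the sign rule, for $(\mathrm{id}_Q\otimes\mathrm{cap}_{PQ})\circ(\mathrm{cup}_{QP}\otimes\mathrm{id}_Q)=-\mathrm{id}_Q$,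 and without sign for the other three zigzags), a strand can be moved over a cup or cap, and dots move freely through cups, caps and crossings. * Dots multiply as in $\Lambda$; triple points can be moved; the double crossings $PP\to PP$, $QQ\to QQ$ and $PQ\to QP\to PQ$ are identities. * On $QP$, with $c:QP\to\mathbf 1$ the cap, $k:\mathbf 1\to QP$ the cup and $d$ the dot $v$ on the strand $P$: the double crossing $QP\to PQ\to QP$ equals $\mathrm{id}_{QP}-d\,k\,c-k\,c\,d$. * A left curl on an upward strand is $0$; a counterclockwise circle with a dot labelled by $b$ (on its upward part) equals $\mathrm{tr}(b)$. Define the shifted degree by giving crossings $0$, a dot labelled by $b$ the value $|b|$, clockwise cups and caps $+\tfrac12$, counterclockwise cups and caps $-\tfrac12$. Let $'\mathcal H'$ be the additive category of finite direct sums of formally shifted words $X\langle l\rangle$, $l\in\mathbb Z$, where $\mathrm{Hom}(X\langle l_1\rangle,Y\langle l_2\rangle)_0$ consists of the diagrams $X\to Y$ homogeneous of degree $l_2-l_1$; let $'\mathcal H$ be its Karoubi envelope, whose objects are pairs $(M,e)$ with $e$ an idempotent endomorphism of $M$ of degree zero. Concatenation $X\langle k\rangle\cdot Y\langle l\rangle=XY\langle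 k+l\rangle$ (with the Koszul sign rule on morphisms) induces a multiplication on the split Grothendieck group $K_0('\mathcal H)$. Put $t^l=[\mathbf 1\langle l\rangle]$. For a ring $R$, $K_0(R)$ is the Grothendieck group of finitely generated projective right $R$-modules. **Statement.** Let $k\ge 0$, $m_i,n_i\in\mathbb Z_{\ge0}$, $l_i\in\mathbb Z$ for $1\le i\le k$, let $M=\bigoplus_{i=1}^k P^{m_i}Q^{n_i}\langle l_i\rangle$, let $R=\mathrm{End}(M)_0$ be its ring of degree-zero endomorphisms, $R^0\subseteq R$ the subring of the matrices all of whose entries are homogeneous of shifted degree $0$, and $X=\{(m_i,n_i,l_i):1\le i\le k\}$ (a set, without repetitions). Then, as abelian groups, $$K_0(R)\cong K_0(R^0)\cong\bigoplus_{(m,n,l)\in X}K_0(\mathrm{End}(P^mQ^n)_0)\cong\bigoplus_{(m,n,l)\in X}K_0(\mathbb C[S_m]\otimes\mathbb C[S_n]).$$ Moreover, there are algebra homomorphisms $\mathbb C[S_m]\to\mathrm{End}(P^m)_0$ and $\mathbb C[S_n]\to\mathrm{End}(Q^n)_0$ that send the transposition $(i,i+1)$ to the crossing of the strands $i$ and $i+1$.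 For a partition $\lambda$ of $r$ and a Young tableau of shape $\lambda$ (any numbering of its boxes by $1,\dots,r$) let $e_\lambda=\frac{\dim V_\lambda}{r!}\,a_\lambda b_\lambda\in\mathbb C[S_r]$ be the Young symmetrizer, where $a_\lambda$ is the sum of the permutations that preserve the rows, $b_\lambda$ is the signed sum of the permutations that preserve the columns, and $V_\lambda=\mathbb C[S_r]a_\lambda b_\lambda$. For every choice of tableaux, the images of the $e_\lambda$ are idempotent, and for every idempotent $e\in R$ there are non-negative integers $c_{m,n,l,\lambda,\mu}$ such that in $K_0('\mathcal H)$ $$[(M,e)]=\sum_{(m,n,l)\in X}\ \sum_{\lambda\vdash m,\ \mu\vdash n}c_{m,n,l,\lambda,\mu}\,[(P^m,e_\lambda)]\cdot[(Q^n,e_\mu)]\cdot t^l .$$ Likewise, the class $[A]\in K_0('\mathcal H)$ of every object $A$ of $'\mathcal H$ is a finite sum of this form with non-negative integer coefficients, for a suitable finite set of triples $(m,n,l)\in\mathbb Z_{\ge0}^2\times\mathbb Z$. -/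

import Mathlib

open CategoryTheory CategoryTheory.Limits CategoryTheory.Idempotents
open scoped TensorProduct DirectSum ZeroObject

noncomputable section

namespace HeisCat

/-! ### Grothendieck groups -/

/-- Isomorphism classes of objects of a category. -/
def IsoClass (C : Type*) [Category C] := Quotient (isIsomorphicSetoid C)

namespace IsoClass

variable {C : Type*} [Category C]

/-- The isomorphism class of an object. -/
def mk (X : C) : IsoClass C := Quotient.mk (isIsomorphicSetoid C) X

theorem sound {X Y : C} (e : X ≅ Y) : mk X = mk Y :=
  Quotient.sound (s := isIsomorphicSetoid C) ⟨e⟩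

/-- A function on objects that is constant on isomorphism classes. -/
def lift {β : Type*} (f : C → β) (h : ∀ X Y : C, (X ≅ Y) → f X = f Y) : IsoClass C → β :=
  Quotient.lift (s := isIsomorphicSetoid C) f (fun X Y ⟨e⟩ => h X Y e)

theorem ind {p : IsoClass C → Prop} (h : ∀ X : C, p (mk X)) (x : IsoClass C) : p x :=
  Quotient.ind (s := isIsomorphicSetoid C) h x

variable [Preadditive C] [HasBinaryBiproducts C] [HasZeroObject C]

set_option linter.unusedSectionVars false

/-! Isomorphism classes of an additive category form a commutative monoid under `⊕`. -/

instance : Zero (IsoClass C) := ⟨mk 0⟩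

instance : Add (IsoClass C) :=
  ⟨Quotient.map₂ (sa := isIsomorphicSetoid C) (sb := isIsomorphicSetoid C)
    (sc := isIsomorphicSetoid C) (fun X Y => X ⊞ Y)
    (fun _ _ ⟨e⟩ _ _ ⟨f⟩ => ⟨biprod.mapIso e f⟩)⟩

instance : AddCommMonoid (IsoClass C) where
  add_assoc := by
    intro x y z
    induction x using ind with | h X => ?_
    induction y using ind with | h Y => ?_
    induction z using ind with | h Z => ?_
    exact sound (biprod.associator X Y Z)
  zero_add := by
    intro x
    induction x using ind with | h X => ?_
    exact sound (isoZeroBiprod (isZero_zero C)).symm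
  add_zero := by
    intro x
    induction x using ind with | h X => ?_
    exact sound (isoBiprodZero (isZero_zero C)).symm
  add_comm := by
    intro x y
    induction x using ind with | h X => ?_
    induction y using ind with | h Y => ?_
    exact sound (biprod.braiding X Y)
  nsmul := nsmulRec

theorem mk_biprod (X Y : C) : mk (X ⊞ Y) = mk X + mk Y := rfl

theorem mk_zero : mk (0 : C) = 0 := rfl

end IsoClass

/-- The (split) Grothendieck group of an additive category. -/
abbrev SplitK0 (C : Type*) [Category C] [Preadditive C] [HasBinaryBiproducts C]
    [HasZeroObject C] :=
  Algebra.GrothendieckAddGroup (IsoClass C)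

/-- The class `[X]` of an object in the Grothendieck group. -/
def cls {C : Type*} [Category C] [Preadditive C] [HasBinaryBiproducts C]
    [HasZeroObject C] (X : C) : SplitK0 C :=
  Algebra.GrothendieckAddGroup.of (IsoClass.mk X)

/-- Finitely generated projective right modules over a ring. -/
structure FGProj (R : Type) [Ring R] where
  carrier : Type
  [grp : AddCommGroup carrier]
  [mod : Module Rᵐᵒᵖ carrier]
  [fin : Module.Finite Rᵐᵒᵖ carrier]
  [proj : Module.Projective Rᵐᵒᵖ carrier]

attribute [instance] FGProj.grp FGProj.mod FGProj.fin FGProj.proj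

/-- Isomorphism of finitely generated projective modules. -/
instance FGProj.setoid (R : Type) [Ring R] : Setoid (FGProj R) where
  r M N := Nonempty (M.carrier ≃ₗ[Rᵐᵒᵖ] N.carrier)
  iseqv := ⟨fun _ => ⟨LinearEquiv.refl _ _⟩, fun ⟨e⟩ => ⟨e.symm⟩, fun ⟨e⟩ ⟨f⟩ => ⟨e.trans f⟩⟩

/-- Isomorphism classes of finitely generated projective right `R`-modules. -/
def ProjClass (R : Type) [Ring R] := Quotient (FGProj.setoid R)

instance (R : Type) [Ring R] : Zero (ProjClass R) := ⟨Quotient.mk _ ⟨PUnit⟩⟩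

instance (R : Type) [Ring R] : Add (ProjClass R) :=
  ⟨Quotient.map₂ (fun M N => ⟨M.carrier × N.carrier⟩)
    (fun _ _ ⟨e⟩ _ _ ⟨f⟩ => ⟨e.prodCongr f⟩)⟩

instance (R : Type) [Ring R] : AddCommMonoid (ProjClass R) where
  add_assoc := by
    rintro ⟨M⟩ ⟨N⟩ ⟨K⟩
    exact Quotient.sound ⟨LinearEquiv.prodAssoc _ _ _ _⟩
  zero_add := by
    rintro ⟨M⟩
    exact Quotient.sound ⟨LinearEquiv.uniqueProd⟩
  add_zero := by
    rintro ⟨M⟩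
    exact Quotient.sound ⟨LinearEquiv.prodUnique⟩
  add_comm := by
    rintro ⟨M⟩ ⟨N⟩
    exact Quotient.sound ⟨LinearEquiv.prodComm _ _ _⟩
  nsmul := nsmulRec

/-- The Grothendieck group `K₀(R)` of a ring. -/
abbrev K0 (R : Type) [Ring R] := Algebra.GrothendieckAddGroup (ProjClass R)

/-! ### Planar diagrams -/

/-- The two generating `1`-morphisms: an upward strand is `P`, a downward strand is `Q`. -/
inductive Strand
  | P
  | Q

/-- Reversal of orientation. -/
def Strand.dual : Strand → Strand
  | .P => .Q
  | .Q => .P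

/-- Finite compositions of `P` and `Q`; the empty word is the identity `1`-morphism. -/
abbrev Word := List Strand

open Strand

/-- The elementary planar diagrams, read from bottom to top. -/
inductive Gen : Word → Word → Type
  /-- the crossing of two strands -/
  | cross (a b : Strand) : Gen [a, b] [b, a]
  /-- a dot labelled by `v`; a dot labelled by `α + β v` is the combination `α • id + β • dot` -/
  | dot (a : Strand) : Gen [a] [a]
  /-- `cup P : 𝟏 → PQ` is the clockwise cup, `cup Q : 𝟏 → QP` the counterclockwise one -/
  | cup (a : Strand) : Gen [] [a, a.dual]
  /-- `cap P : PQ → 𝟏` is the clockwise cap, `cap Q : QP → 𝟏` the counterclockwise one -/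
  | cap (a : Strand) : Gen [a, a.dual] []

/-- The degree of the elementary diagrams. -/
def deg : ∀ a b : Word, Gen a b → ℤ
  | _, _, .cross _ _ => 0
  | _, _, .dot _ => 1
  | _, _, .cup P => 0
  | _, _, .cup Q => -1
  | _, _, .cap P => 1
  | _, _, .cap Q => 0

/-- Twice the shifted degree of the elementary diagrams: clockwise cups and caps have shifted
degree `1/2`, counterclockwise ones `-1/2`, a dot has shifted degree `1`. -/
def sdegTwo : ∀ a b : Word, Gen a b → ℤ
  | _, _, .cross _ _ => 0
  | _, _, .dot _ => 2
  | _, _, .cup P => 1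
  | _, _, .cup Q => -1
  | _, _, .cap P => 1
  | _, _, .cap Q => -1

/-- Formal linear combinations of formal composites of diagrams. A `layer` is an elementary
diagram with vertical strands `u` to its left and `v` to its right. -/
inductive Term : Word → Word → Type
  | id (w : Word) : Term w w
  | layer {w w' : Word} (u v : Word) {a b : Word} (g : Gen a b)
      (h : w = u ++ a ++ v) (h' : w' = u ++ b ++ v) : Term w w'
  /-- `comp f g` is `g` drawn on top of `f` -/
  | comp {w w' w'' : Word} (f : Term w w') (g : Term w' w'') : Term w w''
  | zero (w w' : Word) : Term w w'
  | add {w w' : Word} (f g : Term w w') : Term w w'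
  | smul {w w' : Word} (c : ℂ) (f : Term w w') : Term w w'

namespace Term

/-- Adding vertical strands `x` on the left. -/
def whiskL (x : Word) : ∀ {w w' : Word}, Term w w' → Term (x ++ w) (x ++ w')
  | _, _, .id w => .id (x ++ w)
  | _, _, .layer u v g h h' => .layer (x ++ u) v g (by simp [h]) (by simp [h'])
  | _, _, .comp f g => .comp (whiskL x f) (whiskL x g)
  | _, _, .zero _ _ => .zero _ _
  | _, _, .add f g => .add (whiskL x f) (whiskL x g)
  | _, _, .smul c f => .smul c (whiskL x f)

/-- Adding vertical strands `x` on the right. -/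
def whiskR (x : Word) : ∀ {w w' : Word}, Term w w' → Term (w ++ x) (w' ++ x)
  | _, _, .id w => .id (w ++ x)
  | _, _, .layer u v g h h' => .layer u (v ++ x) g (by simp [h]) (by simp [h'])
  | _, _, .comp f g => .comp (whiskR x f) (whiskR x g)
  | _, _, .zero _ _ => .zero _ _
  | _, _, .add f g => .add (whiskR x f) (whiskR x g)
  | _, _, .smul c f => .smul c (whiskR x f)

/-- An elementary diagram as a term. -/
def gen {a b : Word} (g : Gen a b) : Term a b := .layer [] [] g (by simp) (by simp)

/-- Homogeneous terms of a given degree, for a given degree function on elementary diagrams. -/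
inductive IsHomog (wt : ∀ a b : Word, Gen a b → ℤ) : ∀ {w w' : Word}, Term w w' → ℤ → Prop
  | id (w : Word) : IsHomog wt (.id w) 0
  | layer {w w' : Word} (u v : Word) {a b : Word} (g : Gen a b)
      (h : w = u ++ a ++ v) (h' : w' = u ++ b ++ v) : IsHomog wt (.layer u v g h h') (wt a b g)
  | comp {w w' w'' : Word} {f : Term w w'} {g : Term w' w''} {d e : ℤ}
      (hf : IsHomog wt f d) (hg : IsHomog wt g e) : IsHomog wt (.comp f g) (d + e)
  | zero (w w' : Word) (d : ℤ) : IsHomog wt (.zero w w') d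
  | add {w w' : Word} {f g : Term w w'} {d : ℤ}
      (hf : IsHomog wt f d) (hg : IsHomog wt g d) : IsHomog wt (.add f g) d
  | smul {w w' : Word} (c : ℂ) {f : Term w w'} {d : ℤ}
      (hf : IsHomog wt f d) : IsHomog wt (.smul c f) d

/-- Elementary diagrams as terms. -/
abbrev X (a b : Strand) : Term [a, b] [b, a] := gen (.cross a b)
/-- The dot labelled by `v`. -/
abbrev dot (a : Strand) : Term [a] [a] := gen (.dot a)
/-- Cups. -/
abbrev cup (a : Strand) : Term [] [a, a.dual] := gen (.cup a)
/-- Caps. -/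
abbrev cap (a : Strand) : Term [a, a.dual] [] := gen (.cap a)

/-- The relations among planar diagrams. Dots, counterclockwise cups and clockwise caps are
odd, the other elementary diagrams are even, and everything is read with the Koszul sign rule.
Since `cup Q` and `cap P` are odd, their two zigzags have opposite signs: the interchange law turns
one of the two straightening relations into the other with the opposite sign. -/
inductive LocalRel : ∀ {w w' : Word}, Term w w' → Term w w' → Prop
  -- isotopy: zigzags can be straightened
  | zigzag_capP : LocalRel
      (.comp (whiskL [P] (cup Q)) (whiskR [P] (cap P)) : Term [P] [P]) (.id [P])
  | zigzag_capP' : LocalRel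
      (.comp (whiskR [Q] (cup Q)) (whiskL [Q] (cap P)) : Term [Q] [Q]) (.smul (-1) (.id [Q]))
  | zigzag_capQ : LocalRel
      (.comp (whiskL [Q] (cup P)) (whiskR [Q] (cap Q)) : Term [Q] [Q]) (.id [Q])
  | zigzag_capQ' : LocalRel
      (.comp (whiskR [P] (cup P)) (whiskL [P] (cap Q)) : Term [P] [P]) (.id [P])
  -- isotopy: a strand can be moved over a cup or a cap
  | pitchfork_cup (a c : Strand) : LocalRel
      (.comp (whiskL [c] (cup a)) (whiskR [a.dual] (X c a)) : Term [c] [a, c, a.dual])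
      (.comp (whiskR [c] (cup a)) (whiskL [a] (X a.dual c)))
  | pitchfork_cap (a c : Strand) : LocalRel
      (.comp (whiskL [a] (X c a.dual)) (whiskR [c] (cap a)) : Term [a, c, a.dual] [c])
      (.comp (whiskR [a.dual] (X a c)) (whiskL [c] (cap a)))
  -- dots move freely along strands and through crossings
  | dot_cup (a : Strand) : LocalRel
      (.comp (cup a) (whiskR [a.dual] (dot a)) : Term [] [a, a.dual])
      (.comp (cup a) (whiskL [a] (dot a.dual)))
  | dot_cap (a : Strand) : LocalRel
      (.comp (whiskR [a.dual] (dot a)) (cap a) : Term [a, a.dual] [])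
      (.comp (whiskL [a] (dot a.dual)) (cap a))
  | dot_cross (a b : Strand) : LocalRel
      (.comp (whiskR [b] (dot a)) (X a b) : Term [a, b] [b, a])
      (.comp (X a b) (whiskL [b] (dot a)))
  | dot_cross' (a b : Strand) : LocalRel
      (.comp (whiskL [a] (dot b)) (X a b) : Term [a, b] [b, a])
      (.comp (X a b) (whiskR [a] (dot b)))
  -- collision of dots: `v * v = 0`
  | dot_dot (a : Strand) : LocalRel (.comp (dot a) (dot a)) (.zero [a] [a])
  -- double crossings
  | cross_cross (a b : Strand) (h : ¬(a = Q ∧ b = P)) : LocalRel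
      (.comp (X a b) (X b a)) (.id [a, b])
  | cross_cross_QP : LocalRel
      (.add (.comp (X Q P) (X P Q))
        (.add (.comp (.comp (cap Q) (cup Q)) (whiskL [Q] (dot P)) : Term [Q, P] [Q, P])
          (.comp (whiskL [Q] (dot P)) (.comp (cap Q) (cup Q)))))
      (.id [Q, P])
  -- triple crossings
  | triple (a b c : Strand) : LocalRel
      (.comp (.comp (whiskR [c] (X a b)) (whiskL [b] (X a c))) (whiskR [a] (X b c)) :
        Term [a, b, c] [c, b, a])
      (.comp (.comp (whiskL [a] (X b c)) (whiskR [b] (X a c))) (whiskL [c] (X a b)))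
  -- a left curl is zero
  | curl : LocalRel
      (.comp (.comp (whiskR [P] (cup Q)) (whiskL [Q] (X P P))) (whiskR [P] (cap Q)) :
        Term [P] [P])
      (.zero [P] [P])
  -- a counterclockwise circle with a dot labelled by `b` is `tr b`
  | circle : LocalRel (.comp (cup Q) (cap Q)) (.zero [] [])
  | circle_dot : LocalRel
      (.comp (.comp (cup Q) (whiskL [Q] (dot P))) (cap Q) : Term [] []) (.id [])

/-- Equality of diagrams: the smallest congruence (for linear combinations, vertical composition,
and adding strands on either side) that contains the axioms of a linear category, the super
interchange law and the local relations. -/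
inductive Rel : ∀ {w w' : Word}, Term w w' → Term w w' → Prop
  | refl {w w' : Word} (f : Term w w') : Rel f f
  | symm {w w' : Word} {f g : Term w w'} : Rel f g → Rel g f
  | trans {w w' : Word} {f g h : Term w w'} : Rel f g → Rel g h → Rel f h
  | congr_comp {w w' w'' : Word} {f f' : Term w w'} {g g' : Term w' w''} :
      Rel f f' → Rel g g' → Rel (.comp f g) (.comp f' g')
  | congr_add {w w' : Word} {f f' g g' : Term w w'} :
      Rel f f' → Rel g g' → Rel (.add f g) (.add f' g')
  | congr_smul {w w' : Word} (c : ℂ) {f f' : Term w w'} : Rel f f' → Rel (.smul c f) (.smul c f')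
  | congr_whiskL (x : Word) {w w' : Word} {f f' : Term w w'} :
      Rel f f' → Rel (whiskL x f) (whiskL x f')
  | congr_whiskR (x : Word) {w w' : Word} {f f' : Term w w'} :
      Rel f f' → Rel (whiskR x f) (whiskR x f')
  -- vector space axioms
  | add_assoc {w w' : Word} (f g h : Term w w') : Rel (.add (.add f g) h) (.add f (.add g h))
  | add_comm {w w' : Word} (f g : Term w w') : Rel (.add f g) (.add g f)
  | zero_add {w w' : Word} (f : Term w w') : Rel (.add (.zero w w') f) f
  | neg_add {w w' : Word} (f : Term w w') : Rel (.add (.smul (-1) f) f) (.zero w w')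
  | smul_add {w w' : Word} (c : ℂ) (f g : Term w w') :
      Rel (.smul c (.add f g)) (.add (.smul c f) (.smul c g))
  | add_smul {w w' : Word} (c d : ℂ) (f : Term w w') :
      Rel (.smul (c + d) f) (.add (.smul c f) (.smul d f))
  | mul_smul {w w' : Word} (c d : ℂ) (f : Term w w') :
      Rel (.smul (c * d) f) (.smul c (.smul d f))
  | one_smul {w w' : Word} (f : Term w w') : Rel (.smul 1 f) f
  -- category axioms and bilinearity of composition
  | id_comp {w w' : Word} (f : Term w w') : Rel (.comp (.id w) f) f
  | comp_id {w w' : Word} (f : Term w w') : Rel (.comp f (.id w')) f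
  | assoc {w₁ w₂ w₃ w₄ : Word} (f : Term w₁ w₂) (g : Term w₂ w₃) (h : Term w₃ w₄) :
      Rel (.comp (.comp f g) h) (.comp f (.comp g h))
  | add_comp {w w' w'' : Word} (f f' : Term w w') (g : Term w' w'') :
      Rel (.comp (.add f f') g) (.add (.comp f g) (.comp f' g))
  | comp_add {w w' w'' : Word} (f : Term w w') (g g' : Term w' w'') :
      Rel (.comp f (.add g g')) (.add (.comp f g) (.comp f g'))
  | smul_comp {w w' w'' : Word} (c : ℂ) (f : Term w w') (g : Term w' w'') :
      Rel (.comp (.smul c f) g) (.smul c (.comp f g))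
  | comp_smul {w w' w'' : Word} (c : ℂ) (f : Term w w') (g : Term w' w'') :
      Rel (.comp f (.smul c g)) (.smul c (.comp f g))
  -- diagrams side by side can change height, up to the Koszul sign
  | interchange {a b c d : Word} {f : Term a b} {g : Term c d} {i j : ℤ}
      (hf : IsHomog deg f i) (hg : IsHomog deg g j) :
      Rel (.comp (whiskR c f) (whiskL b g))
        (.smul ((-1 : ℂ) ^ (i * j)) (.comp (whiskL a g) (whiskR d f)))
  | of {w w' : Word} {f g : Term w w'} : LocalRel f g → Rel f g

instance setoid (w w' : Word) : Setoid (Term w w') := ⟨Rel, .refl, .symm, .trans⟩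

end Term

/-- The space `Hom(w, w')` of all `2`-morphisms between unshifted words: linear combinations of
planar diagrams modulo the relations. -/
def Mor (w w' : Word) := Quotient (Term.setoid w w')

namespace Mor

open Term

/-- The `2`-morphism represented by a term. -/
def mk {w w' : Word} (f : Term w w') : Mor w w' := Quotient.mk _ f

theorem sound {w w' : Word} {f g : Term w w'} (h : Rel f g) : mk f = mk g := Quotient.sound h

theorem ind {w w' : Word} {p : Mor w w' → Prop} (h : ∀ f, p (mk f)) (x : Mor w w') : p x :=
  Quotient.ind h x

/-- Vertical composition. -/
def comp {w w' w'' : Word} : Mor w w' → Mor w' w'' → Mor w w'' :=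
  Quotient.map₂ Term.comp (fun _ _ h _ _ h' => Rel.congr_comp h h')

/-- Adding vertical strands on the left. -/
def whiskL (x : Word) {w w' : Word} : Mor w w' → Mor (x ++ w) (x ++ w') :=
  Quotient.map (Term.whiskL x) (fun _ _ h => Rel.congr_whiskL x h)

/-- Adding vertical strands on the right. -/
def whiskR (x : Word) {w w' : Word} : Mor w w' → Mor (w ++ x) (w' ++ x) :=
  Quotient.map (Term.whiskR x) (fun _ _ h => Rel.congr_whiskR x h)

instance (w w' : Word) : Add (Mor w w') :=
  ⟨Quotient.map₂ Term.add (fun _ _ h _ _ h' => Rel.congr_add h h')⟩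

instance (w w' : Word) : Zero (Mor w w') := ⟨mk (.zero w w')⟩

instance (w w' : Word) : Neg (Mor w w') :=
  ⟨Quotient.map (Term.smul (-1)) (fun _ _ h => Rel.congr_smul _ h)⟩

instance (w w' : Word) : AddCommGroup (Mor w w') where
  add_assoc := by rintro ⟨f⟩ ⟨g⟩ ⟨h⟩; exact sound (.add_assoc f g h)
  zero_add := by rintro ⟨f⟩; exact sound (.zero_add f)
  add_zero := by rintro ⟨f⟩; exact sound (.trans (.add_comm _ _) (.zero_add f))
  add_comm := by rintro ⟨f⟩ ⟨g⟩; exact sound (.add_comm f g)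
  neg_add_cancel := by rintro ⟨f⟩; exact sound (.neg_add f)
  nsmul := nsmulRec
  zsmul := zsmulRec

instance (w w' : Word) : SMul ℂ (Mor w w') where
  smul c := Quotient.map (Term.smul c) (fun _ _ h => Rel.congr_smul c h)

theorem mk_add {w w' : Word} (f g : Term w w') : mk (.add f g) = mk f + mk g := rfl
theorem mk_smul {w w' : Word} (c : ℂ) (f : Term w w') : mk (.smul c f) = c • mk f := rfl
theorem mk_zero (w w' : Word) : mk (.zero w w') = 0 := rfl
theorem mk_comp {w w' w'' : Word} (f : Term w w') (g : Term w' w'') :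
    mk (.comp f g) = (mk f).comp (mk g) := rfl

theorem smul_add' {w w' : Word} (c : ℂ) (f g : Mor w w') : c • (f + g) = c • f + c • g := by
  induction f using ind with | h f => ?_
  induction g using ind with | h g => ?_
  exact sound (.smul_add c f g)

theorem add_smul' {w w' : Word} (c d : ℂ) (f : Mor w w') : (c + d) • f = c • f + d • f := by
  induction f using ind with | h f => ?_
  exact sound (.add_smul c d f)

instance (w w' : Word) : Module ℂ (Mor w w') where
  one_smul := by rintro ⟨f⟩; exact sound (.one_smul f)
  mul_smul := by rintro c d ⟨f⟩; exact sound (.mul_smul c d f)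
  smul_add := smul_add'
  add_smul := add_smul'
  smul_zero c := by
    have h := smul_add' c (0 : Mor w w') 0
    rw [_root_.add_zero] at h
    exact left_eq_add.mp h
  zero_smul f := by
    have h := add_smul' 0 0 f
    rw [_root_.add_zero] at h
    exact left_eq_add.mp h

theorem id_comp {w w' : Word} (f : Mor w w') : (mk (.id w)).comp f = f := by
  induction f using ind with | h f => ?_
  exact sound (.id_comp f)

theorem comp_id {w w' : Word} (f : Mor w w') : f.comp (mk (.id w')) = f := by
  induction f using ind with | h f => ?_
  exact sound (.comp_id f)

theorem assoc {w₁ w₂ w₃ w₄ : Word} (f : Mor w₁ w₂) (g : Mor w₂ w₃) (h : Mor w₃ w₄) :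
    (f.comp g).comp h = f.comp (g.comp h) := by
  induction f using ind with | h f => ?_
  induction g using ind with | h g => ?_
  induction h using ind with | h h => ?_
  exact sound (.assoc f g h)

theorem add_comp {w w' w'' : Word} (f f' : Mor w w') (g : Mor w' w'') :
    (f + f').comp g = f.comp g + f'.comp g := by
  induction f using ind with | h f => ?_
  induction f' using ind with | h f' => ?_
  induction g using ind with | h g => ?_
  exact sound (.add_comp f f' g)

theorem comp_add {w w' w'' : Word} (f : Mor w w') (g g' : Mor w' w'') :
    f.comp (g + g') = f.comp g + f.comp g' := by
  induction f using ind with | h f => ?_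
  induction g using ind with | h g => ?_
  induction g' using ind with | h g' => ?_
  exact sound (.comp_add f g g')

theorem smul_comp {w w' w'' : Word} (c : ℂ) (f : Mor w w') (g : Mor w' w'') :
    (c • f).comp g = c • f.comp g := by
  induction f using ind with | h f => ?_
  induction g using ind with | h g => ?_
  exact sound (.smul_comp c f g)

theorem comp_smul {w w' w'' : Word} (c : ℂ) (f : Mor w w') (g : Mor w' w'') :
    f.comp (c • g) = c • f.comp g := by
  induction f using ind with | h f => ?_
  induction g using ind with | h g => ?_
  exact sound (.comp_smul c f g)

theorem whiskL_comp (x : Word) {w w' w'' : Word} (f : Mor w w') (g : Mor w' w'') :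
    whiskL x (f.comp g) = (whiskL x f).comp (whiskL x g) := by
  induction f using ind with | h f => ?_
  induction g using ind with | h g => ?_
  rfl

theorem whiskR_comp (x : Word) {w w' w'' : Word} (f : Mor w w') (g : Mor w' w'') :
    whiskR x (f.comp g) = (whiskR x f).comp (whiskR x g) := by
  induction f using ind with | h f => ?_
  induction g using ind with | h g => ?_
  rfl

theorem whiskL_add (x : Word) {w w' : Word} (f g : Mor w w') :
    whiskL x (f + g) = whiskL x f + whiskL x g := by
  induction f using ind with | h f => ?_
  induction g using ind with | h g => ?_
  rfl

theorem whiskR_add (x : Word) {w w' : Word} (f g : Mor w w') :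
    whiskR x (f + g) = whiskR x f + whiskR x g := by
  induction f using ind with | h f => ?_
  induction g using ind with | h g => ?_
  rfl

/-- The homogeneous `2`-morphisms of degree `d`, for a degree function on elementary diagrams. -/
def homog (wt : ∀ a b : Word, Gen a b → ℤ) (w w' : Word) (d : ℤ) : Submodule ℂ (Mor w w') where
  carrier := {x | ∃ f : Term w w', IsHomog wt f d ∧ mk f = x}
  zero_mem' := ⟨_, .zero w w' d, rfl⟩
  add_mem' := by
    rintro _ _ ⟨f, hf, rfl⟩ ⟨g, hg, rfl⟩
    exact ⟨_, .add hf hg, rfl⟩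
  smul_mem' := by
    rintro c _ ⟨f, hf, rfl⟩
    exact ⟨_, .smul c hf, rfl⟩

theorem homog_id (wt : ∀ a b : Word, Gen a b → ℤ) (w : Word) : mk (.id w) ∈ homog wt w w 0 :=
  ⟨_, .id w, rfl⟩

theorem homog_comp {wt : ∀ a b : Word, Gen a b → ℤ} {w w' w'' : Word} {f : Mor w w'}
    {g : Mor w' w''} {d e : ℤ} (hf : f ∈ homog wt w w' d) (hg : g ∈ homog wt w' w'' e) :
    f.comp g ∈ homog wt w w'' (d + e) := by
  obtain ⟨f, hf, rfl⟩ := hf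
  obtain ⟨g, hg, rfl⟩ := hg
  exact ⟨_, .comp hf hg, rfl⟩

theorem _root_.HeisCat.Term.IsHomog.whiskL {wt : ∀ a b : Word, Gen a b → ℤ} (x : Word)
    {w w' : Word} {f : Term w w'} {d : ℤ} (hf : IsHomog wt f d) :
    IsHomog wt (Term.whiskL x f) d := by
  induction hf with
  | id w => exact .id _
  | layer u v g h h' => exact .layer _ _ _ _ _
  | comp _ _ h h' => exact .comp h h'
  | zero => exact .zero _ _ _
  | add _ _ h h' => exact .add h h'
  | smul c _ h => exact .smul c h

theorem _root_.HeisCat.Term.IsHomog.whiskR {wt : ∀ a b : Word, Gen a b → ℤ} (x : Word)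
    {w w' : Word} {f : Term w w'} {d : ℤ} (hf : IsHomog wt f d) :
    IsHomog wt (Term.whiskR x f) d := by
  induction hf with
  | id w => exact .id _
  | layer u v g h h' => exact .layer _ _ _ _ _
  | comp _ _ h h' => exact .comp h h'
  | zero => exact .zero _ _ _
  | add _ _ h h' => exact .add h h'
  | smul c _ h => exact .smul c h

theorem homog_whiskL {wt : ∀ a b : Word, Gen a b → ℤ} (x : Word) {w w' : Word} {f : Mor w w'}
    {d : ℤ} (hf : f ∈ homog wt w w' d) : whiskL x f ∈ homog wt (x ++ w) (x ++ w') d := by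
  obtain ⟨f, hf, rfl⟩ := hf
  exact ⟨_, hf.whiskL x, rfl⟩

theorem homog_whiskR {wt : ∀ a b : Word, Gen a b → ℤ} (x : Word) {w w' : Word} {f : Mor w w'}
    {d : ℤ} (hf : f ∈ homog wt w w' d) : whiskR x f ∈ homog wt (w ++ x) (w' ++ x) d := by
  obtain ⟨f, hf, rfl⟩ := hf
  exact ⟨_, hf.whiskR x, rfl⟩

theorem interchange {a b c d : Word} {f : Mor a b} {g : Mor c d} {i j : ℤ}
    (hf : f ∈ homog deg a b i) (hg : g ∈ homog deg c d j) :
    (whiskR c f).comp (whiskL b g) =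
      ((-1 : ℂ) ^ (i * j)) • (whiskL a g).comp (whiskR d f) := by
  obtain ⟨f, hf, rfl⟩ := hf
  obtain ⟨g, hg, rfl⟩ := hg
  exact sound (.interchange hf hg)

end Mor

/-! ### The categories `'H'` and `'H` -/

/-- A shifted word `w⟨l⟩`. -/
structure Shifted where
  word : Word
  shift : ℤ

/-- The morphisms `X⟨l₁⟩ → Y⟨l₂⟩` are the `2`-morphisms of degree zero, i.e. the diagrams
`f : X → Y` with `deg f + l₁ - l₂ = 0`. -/
instance : Category Shifted where
  Hom A B := Mor.homog deg A.word B.word (B.shift - A.shift)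
  id A := ⟨Mor.mk (.id A.word), by simpa using Mor.homog_id deg A.word⟩
  comp f g := ⟨f.1.comp g.1, by simpa using Mor.homog_comp f.2 g.2⟩
  id_comp f := Subtype.ext (Mor.id_comp f.1)
  comp_id f := Subtype.ext (Mor.comp_id f.1)
  assoc f g h := Subtype.ext (Mor.assoc f.1 g.1 h.1)

namespace Shifted

/-- The underlying `2`-morphism. -/
def val {A B : Shifted} (f : A ⟶ B) : Mor A.word B.word := f.1

theorem val_mem {A B : Shifted} (f : A ⟶ B) :
    val f ∈ Mor.homog deg A.word B.word (B.shift - A.shift) := f.2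

@[ext] theorem hom_ext {A B : Shifted} {f g : A ⟶ B} (h : val f = val g) : f = g := Subtype.ext h

instance (A B : Shifted) : AddCommGroup (A ⟶ B) :=
  inferInstanceAs (AddCommGroup (Mor.homog deg A.word B.word (B.shift - A.shift)))

instance (A B : Shifted) : Module ℂ (A ⟶ B) :=
  inferInstanceAs (Module ℂ (Mor.homog deg A.word B.word (B.shift - A.shift)))

@[simp] theorem val_add {A B : Shifted} (f g : A ⟶ B) : val (f + g) = val f + val g := rfl
@[simp] theorem val_smul {A B : Shifted} (c : ℂ) (f : A ⟶ B) : val (c • f) = c • val f := rfl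
@[simp] theorem val_zero {A B : Shifted} : val (0 : A ⟶ B) = 0 := rfl
@[simp] theorem val_id (A : Shifted) : val (𝟙 A) = Mor.mk (.id A.word) := rfl
@[simp] theorem val_comp {A B C : Shifted} (f : A ⟶ B) (g : B ⟶ C) :
    val (f ≫ g) = (val f).comp (val g) := rfl

theorem val_sum {A B : Shifted} {ι : Type} (s : Finset ι) (f : ι → (A ⟶ B)) :
    val (∑ i ∈ s, f i) = ∑ i ∈ s, val (f i) :=
  map_sum (Mor.homog deg A.word B.word (B.shift - A.shift)).subtype f s

instance : Preadditive Shifted where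
  add_comp _ _ _ f f' g := by
    apply hom_ext
    exact Mor.add_comp (val f) (val f') (val g)
  comp_add _ _ _ f g g' := by
    apply hom_ext
    exact Mor.comp_add (val f) (val g) (val g')

instance : Linear ℂ Shifted where
  smul_comp _ _ _ c f g := by
    apply hom_ext
    exact Mor.smul_comp c (val f) (val g)
  comp_smul _ _ _ f c g := by
    apply hom_ext
    exact Mor.comp_smul c (val f) (val g)

/-- Composition of shifted words, `A⟨k⟩ · B⟨l⟩ = AB⟨k + l⟩`. -/
abbrev tensorObj (A B : Shifted) : Shifted := ⟨A.word ++ B.word, A.shift + B.shift⟩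

/-- Horizontal composition of `2`-morphisms. The sign, which is trivial when nothing is shifted
or all diagrams are even, is the Koszul sign that makes this compatible with vertical
composition. -/
def tensorHom {A A' B B' : Shifted} (f : A ⟶ A') (g : B ⟶ B') :
    tensorObj A B ⟶ tensorObj A' B' :=
  ⟨((-1 : ℂ) ^ ((A'.shift - A.shift) * B'.shift)) •
      (Mor.whiskL A.word (val g)).comp (Mor.whiskR B'.word (val f)), by
    apply Submodule.smul_mem
    have h := Mor.homog_comp (Mor.homog_whiskL A.word (val_mem g))
      (Mor.homog_whiskR B'.word (val_mem f))
    have e : (tensorObj A' B').shift - (tensorObj A B).shift =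
        (B'.shift - B.shift) + (A'.shift - A.shift) := by ring
    rw [e]
    exact h⟩

theorem val_tensorHom {A A' B B' : Shifted} (f : A ⟶ A') (g : B ⟶ B') :
    val (tensorHom f g) = ((-1 : ℂ) ^ ((A'.shift - A.shift) * B'.shift)) •
      (Mor.whiskL A.word (val g)).comp (Mor.whiskR B'.word (val f)) := rfl

theorem tensorHom_id (A B : Shifted) : tensorHom (𝟙 A) (𝟙 B) = 𝟙 (tensorObj A B) := by
  apply hom_ext
  rw [val_tensorHom, sub_self, zero_mul, zpow_zero, one_smul]
  exact Mor.id_comp _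

theorem tensorHom_comp {A A' A'' B B' B'' : Shifted} (f : A ⟶ A') (f' : A' ⟶ A'')
    (g : B ⟶ B') (g' : B' ⟶ B'') :
    tensorHom (f ≫ f') (g ≫ g') = tensorHom f g ≫ tensorHom f' g' := by
  apply hom_ext
  rw [val_comp, val_tensorHom, val_tensorHom, val_tensorHom, val_comp, val_comp,
    Mor.whiskL_comp, Mor.whiskR_comp, Mor.smul_comp, Mor.comp_smul, Mor.assoc, Mor.assoc,
    ← Mor.assoc (Mor.whiskR B'.word (val f)), Mor.interchange (val_mem f) (val_mem g'),
    Mor.smul_comp, Mor.comp_smul, smul_smul, smul_smul, Mor.assoc]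
  congr 1
  rw [← zpow_add₀ (by norm_num), ← zpow_add₀ (by norm_num)]
  congr 1
  ring

theorem tensorHom_add_left {A A' B B' : Shifted} (f f' : A ⟶ A') (g : B ⟶ B') :
    tensorHom (f + f') g = tensorHom f g + tensorHom f' g := by
  apply hom_ext
  simp only [val_tensorHom, val_add, Mor.whiskR_add, Mor.comp_add, smul_add]

theorem tensorHom_add_right {A A' B B' : Shifted} (f : A ⟶ A') (g g' : B ⟶ B') :
    tensorHom f (g + g') = tensorHom f g + tensorHom f g' := by
  apply hom_ext
  simp only [val_tensorHom, val_add, Mor.whiskL_add, Mor.add_comp, smul_add]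

/-- Horizontal composition as a biadditive map. -/
def tensorAdd (A A' B B' : Shifted) :
    (A ⟶ A') →+ (B ⟶ B') →+ (tensorObj A B ⟶ tensorObj A' B') :=
  AddMonoidHom.mk' (fun f => AddMonoidHom.mk' (tensorHom f) (tensorHom_add_right f))
    (fun f f' => AddMonoidHom.ext (tensorHom_add_left f f'))

theorem tensorHom_sum {A A' B B' : Shifted} {ι κ : Type} [Fintype ι] [Fintype κ]
    (f : ι → (A ⟶ A')) (g : κ → (B ⟶ B')) :
    tensorHom (∑ i, f i) (∑ j, g j) = ∑ x : ι × κ, tensorHom (f x.1) (g x.2) := by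
  rw [Fintype.sum_prod_type]
  change tensorAdd A A' B B' (∑ i, f i) (∑ j, g j) = ∑ i, ∑ j, tensorAdd A A' B B' (f i) (g j)
  simp only [map_sum, AddMonoidHom.finsetSum_apply]
  rw [Finset.sum_comm]

end Shifted

/-- The category `'H'`: finite direct sums of shifted words, with morphisms the matrices of
`2`-morphisms of degree zero. -/
abbrev HPre := Mat_ Shifted

/-- The category `'H`: the Karoubi envelope of `'H'`. -/
abbrev HCat := Karoubi HPre

namespace HPre

/-- Composition of `1`-morphisms of `'H'`. -/
abbrev tensorObj (M N : HPre) : HPre :=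
  ⟨M.ι × N.ι, fun x => Shifted.tensorObj (M.X x.1) (N.X x.2)⟩

/-- Horizontal composition of matrices of `2`-morphisms. -/
def tensorHom {M M' N N' : HPre} (f : M ⟶ M') (g : N ⟶ N') : tensorObj M N ⟶ tensorObj M' N' :=
  fun x y => Shifted.tensorHom (f x.1 y.1) (g x.2 y.2)

theorem tensorHom_apply {M M' N N' : HPre} (f : M ⟶ M') (g : N ⟶ N') (x : M.ι × N.ι)
    (y : M'.ι × N'.ι) : tensorHom f g x y = Shifted.tensorHom (f x.1 y.1) (g x.2 y.2) := rfl

theorem tensorHom_add_left {M M' N N' : HPre} (f f' : M ⟶ M') (g : N ⟶ N') :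
    tensorHom (f + f') g = tensorHom f g + tensorHom f' g := by
  apply Mat_.hom_ext
  intro x y
  exact Shifted.tensorHom_add_left _ _ _

theorem tensorHom_add_right {M M' N N' : HPre} (f : M ⟶ M') (g g' : N ⟶ N') :
    tensorHom f (g + g') = tensorHom f g + tensorHom f g' := by
  apply Mat_.hom_ext
  intro x y
  exact Shifted.tensorHom_add_right _ _ _

theorem tensorHom_comp {M M' M'' N N' N'' : HPre} (f : M ⟶ M') (f' : M' ⟶ M'')
    (g : N ⟶ N') (g' : N' ⟶ N'') :
    tensorHom (f ≫ f') (g ≫ g') = tensorHom f g ≫ tensorHom f' g' := by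
  apply Mat_.hom_ext
  rintro ⟨i, j⟩ ⟨i'', j''⟩
  refine (Shifted.tensorHom_sum _ _).trans (Finset.sum_congr rfl fun x _ => ?_)
  exact Shifted.tensorHom_comp _ _ _ _

end HPre

namespace HCat

/-- Composition of `1`-morphisms of `'H`: `(M, e) · (N, f) = (MN, ef)`. -/
abbrev tensorObj (A B : HCat) : HCat where
  X := HPre.tensorObj A.X B.X
  p := HPre.tensorHom A.p B.p
  idem := by rw [← HPre.tensorHom_comp, A.idem, B.idem]

/-- Composition with `B` on the right, as a functor. -/
def tensorRight (B : HCat) : HCat ⥤ HCat where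
  obj A := tensorObj A B
  map {A A'} f := ⟨HPre.tensorHom f.f B.p, by
    change HPre.tensorHom _ _ ≫ _ ≫ HPre.tensorHom _ _ = _
    rw [← HPre.tensorHom_comp, ← HPre.tensorHom_comp, B.idem, B.idem, f.comm]⟩
  map_id A := rfl
  map_comp f g := by
    apply Karoubi.hom_ext
    change HPre.tensorHom (f.f ≫ g.f) B.p = HPre.tensorHom _ _ ≫ HPre.tensorHom _ _
    rw [← HPre.tensorHom_comp, B.idem]

/-- Composition with `A` on the left, as a functor. -/
def tensorLeft (A : HCat) : HCat ⥤ HCat where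
  obj B := tensorObj A B
  map {B B'} f := ⟨HPre.tensorHom A.p f.f, by
    change HPre.tensorHom _ _ ≫ _ ≫ HPre.tensorHom _ _ = _
    rw [← HPre.tensorHom_comp, ← HPre.tensorHom_comp, A.idem, A.idem, f.comm]⟩
  map_id A := rfl
  map_comp f g := by
    apply Karoubi.hom_ext
    change HPre.tensorHom A.p (f.f ≫ g.f) = HPre.tensorHom _ _ ≫ HPre.tensorHom _ _
    rw [← HPre.tensorHom_comp, A.idem]

instance (B : HCat) : (tensorRight B).Additive where
  map_add {_ _ f g} := by
    apply Karoubi.hom_ext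
    exact HPre.tensorHom_add_left f.f g.f B.p

instance (A : HCat) : (tensorLeft A).Additive where
  map_add {_ _ f g} := by
    apply Karoubi.hom_ext
    exact HPre.tensorHom_add_right A.p f.f g.f

end HCat

instance : HasBinaryBiproducts HCat := hasBinaryBiproducts_of_finite_biproducts HCat

/-- The Grothendieck ring `K₀('H)`. -/
abbrev K0H := SplitK0 HCat

theorem cls_iso {C : Type*} [Category C] [Preadditive C] [HasBinaryBiproducts C]
    [HasZeroObject C] {X Y : C} (e : X ≅ Y) : cls X = cls Y :=
  congrArg Algebra.GrothendieckAddGroup.of (IsoClass.sound e)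

theorem cls_biprod {C : Type*} [Category C] [Preadditive C] [HasBinaryBiproducts C]
    [HasZeroObject C] (X Y : C) : cls (X ⊞ Y) = cls X + cls Y :=
  (congrArg Algebra.GrothendieckAddGroup.of (IsoClass.mk_biprod X Y)).trans (map_add _ _ _)

theorem cls_isZero {C : Type*} [Category C] [Preadditive C] [HasBinaryBiproducts C]
    [HasZeroObject C] {X : C} (h : IsZero X) : cls X = 0 :=
  (cls_iso h.isoZero).trans (map_zero _)

/-- The map `[B] ↦ [A · B]`. -/
def mulLeft (A : HCat) : IsoClass HCat →+ K0H where
  toFun := IsoClass.lift (fun B => cls (HCat.tensorObj A B))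
    (fun _ _ e => cls_iso ((HCat.tensorLeft A).mapIso e))
  map_zero' := cls_isZero ((HCat.tensorLeft A).map_isZero (isZero_zero HCat))
  map_add' := by
    intro x y
    induction x using IsoClass.ind with | h B => ?_
    induction y using IsoClass.ind with | h B' => ?_
    have := preservesBinaryBiproduct_of_preservesBiproduct (HCat.tensorLeft A) B B'
    exact (cls_iso ((HCat.tensorLeft A).mapBiprod B B')).trans (cls_biprod _ _)

/-- The map `[A] ↦ ([B] ↦ [A · B])`. -/
def mulRight : IsoClass HCat →+ (IsoClass HCat →+ K0H) where
  toFun := IsoClass.lift mulLeft (fun A A' e => by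
    ext x
    induction x using IsoClass.ind with | h B => ?_
    exact cls_iso ((HCat.tensorRight B).mapIso e))
  map_zero' := by
    ext x
    induction x using IsoClass.ind with | h B => ?_
    exact cls_isZero ((HCat.tensorRight B).map_isZero (isZero_zero HCat))
  map_add' := by
    intro x y
    induction x using IsoClass.ind with | h A => ?_
    induction y using IsoClass.ind with | h A' => ?_
    ext z
    induction z using IsoClass.ind with | h B => ?_
    have := preservesBinaryBiproduct_of_preservesBiproduct (HCat.tensorRight B) A A'
    exact (cls_iso ((HCat.tensorRight B).mapBiprod A A')).trans (cls_biprod _ _)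

theorem lift_of {M G : Type*} [AddCommMonoid M] [AddCommGroup G] (f : M →+ G) (x : M) :
    Algebra.GrothendieckAddGroup.lift f (Algebra.GrothendieckAddGroup.of x) = f x :=
  DFunLike.congr_fun (Algebra.GrothendieckAddGroup.lift.symm_apply_apply f) x

/-- The multiplication of `K₀('H)` as a biadditive map, the biadditive extension of
`([A], [B]) ↦ [A · B]`. -/
def mulHom : K0H →+ K0H →+ K0H :=
  Algebra.GrothendieckAddGroup.lift
    ((AddMonoidHom.mk' Algebra.GrothendieckAddGroup.lift (fun f g =>
      Algebra.GrothendieckAddGroup.lift.symm.injective (by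
        rw [Equiv.symm_apply_apply]
        ext x
        refine Eq.trans ?_ (AddMonoidHom.add_apply _ _ _).symm
        rw [lift_of, lift_of]
        rfl))).comp mulRight)

instance : NonUnitalNonAssocRing K0H where
  mul x y := mulHom x y
  left_distrib x y z := map_add (mulHom x) y z
  right_distrib x y z := by
    change mulHom (x + y) z = mulHom x z + mulHom y z
    rw [map_add, AddMonoidHom.add_apply]
  zero_mul x := by
    change mulHom 0 x = 0
    rw [map_zero, AddMonoidHom.zero_apply]
  mul_zero x := map_zero (mulHom x)

/-- Multiplication in `K₀('H)` is induced by composition of `1`-morphisms. -/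
theorem cls_mul_cls (A B : HCat) : cls A * cls B = cls (HCat.tensorObj A B) := by
  change mulHom (Algebra.GrothendieckAddGroup.of _) (Algebra.GrothendieckAddGroup.of _) = _
  unfold mulHom
  rw [lift_of]
  exact lift_of _ _

/-! ### The objects of the statement -/

/-- The `1`-morphism `P^m Q^n ⟨l⟩`. -/
def PQ (m n : ℕ) (l : ℤ) : Shifted := ⟨List.replicate m P ++ List.replicate n Q, l⟩

/-- The `1`-morphism `a^m`, for a strand `a`. -/
def strandPow (a : Strand) (m : ℕ) : Shifted := ⟨List.replicate m a, 0⟩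

/-- The `1`-morphism `M = ⊕ P^{m_i} Q^{n_i} ⟨l_i⟩` of `'H'`. -/
def sumPQ {k : ℕ} (m n : Fin k → ℕ) (l : Fin k → ℤ) : HPre :=
  ⟨Fin k, fun i => PQ (m i) (n i) (l i)⟩

/-- The set of different triples `(m_i, n_i, l_i)`. -/
def triples {k : ℕ} (m n : Fin k → ℕ) (l : Fin k → ℤ) : Finset (ℕ × ℕ × ℤ) :=
  Finset.univ.image fun i => (m i, n i, l i)

/-- The entries of an endomorphism of `⊕ P^{m_i} Q^{n_i} ⟨l_i⟩`. -/
def entry {k : ℕ} {m n : Fin k → ℕ} {l : Fin k → ℤ} (A : End (sumPQ m n l)) (i j : Fin k) :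
    PQ (m i) (n i) (l i) ⟶ PQ (m j) (n j) (l j) :=
  (show sumPQ m n l ⟶ sumPQ m n l from A) i j

/-- The ring `R⁰` of those endomorphisms of degree zero of `⊕ P^{m_i} Q^{n_i} ⟨l_i⟩` all of whose
entries are homogeneous of shifted degree zero. -/
def subringR0 {k : ℕ} (m n : Fin k → ℕ) (l : Fin k → ℤ) : Subring (End (sumPQ m n l)) where
  carrier := {A | ∀ i j, Shifted.val (entry A i j) ∈ Mor.homog sdegTwo _ _ 0}
  zero_mem' := fun _ _ => Submodule.zero_mem _
  add_mem' := fun hA hB i j => Submodule.add_mem _ (hA i j) (hB i j)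
  neg_mem' := fun hA i j => Submodule.neg_mem _ (hA i j)
  one_mem' := by
    intro i j
    by_cases h : i = j
    · subst h
      have e : entry (1 : End (sumPQ m n l)) i i = 𝟙 _ := Mat_.id_apply_self (sumPQ m n l) i
      rw [e]
      exact Mor.homog_id _ _
    · have e : entry (1 : End (sumPQ m n l)) i j = 0 := Mat_.id_apply_of_ne (sumPQ m n l) i j h
      rw [e]
      exact Submodule.zero_mem _
  mul_mem' := by
    intro A B hA hB i j
    have e : entry (A * B) i j = ∑ x, entry B i x ≫ entry A x j := rfl
    rw [e, Shifted.val_sum]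
    refine Submodule.sum_mem _ fun x _ => ?_
    exact Mor.homog_comp (hB i x) (hA x j)

theorem replicate_split (a : Strand) {m i : ℕ} (h : i + 1 < m) :
    List.replicate m a = List.replicate i a ++ [a, a] ++ List.replicate (m - i - 2) a := by
  have e : [a, a] = List.replicate 2 a := rfl
  rw [e, List.replicate_append_replicate, List.replicate_append_replicate]
  congr 1
  omega

/-- The crossing of the strands `i` and `i + 1` (counted from the left, starting with `0`) among
`m` parallel strands. -/
def crossing (a : Strand) (m i : ℕ) (h : i + 1 < m) : End (strandPow a m) :=
  ⟨Mor.mk (.layer (List.replicate i a) (List.replicate (m - i - 2) a) (.cross a a)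
      (replicate_split a h) (replicate_split a h)), by
    have e : (strandPow a m).shift - (strandPow a m).shift = deg _ _ (.cross a a) := sub_self _
    rw [e]
    exact ⟨_, .layer _ _ _ _ _, rfl⟩⟩

/-- The group algebra of the symmetric group. -/
abbrev SymAlg (n : ℕ) := MonoidAlgebra ℂ (Equiv.Perm (Fin n))

/-- `ρ` is the canonical homomorphism `ℂ[S_m] → End(a^m)₀`: the transposition `(i, i + 1)` goes to
the crossing of the strands `i` and `i + 1`. -/
def IsCanonical (a : Strand) (m : ℕ) (ρ : SymAlg m →ₐ[ℂ] End (strandPow a m)) : Prop :=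
  ∀ (i : ℕ) (h : i + 1 < m),
    ρ (MonoidAlgebra.of ℂ _ (Equiv.swap ⟨i, Nat.lt_of_succ_lt h⟩ ⟨i + 1, h⟩)) = crossing a m i h

/-- The row lengths of a partition, in decreasing order. -/
def rowLens {n : ℕ} (lam : n.Partition) : List ℕ := lam.parts.sort (· ≥ ·)

/-- The boxes of the Young diagram of a partition: the row, and the position in the row. -/
abbrev Box {n : ℕ} (lam : n.Partition) :=
  (i : Fin (rowLens lam).length) × Fin ((rowLens lam).get i)

/-- A Young tableau of shape `λ`: a numbering of the boxes by `0, …, n - 1`. -/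
abbrev Tableau {n : ℕ} (lam : n.Partition) := Box lam ≃ Fin n

theorem sum_rowLens {n : ℕ} (lam : n.Partition) :
    ∑ i, (rowLens lam).get i = n := by
  have h : (rowLens lam).sum = n := by
    rw [← Multiset.sum_coe, rowLens, Multiset.sort_eq, lam.parts_sum]
  refine Eq.trans ?_ h
  simp [Fin.sum_univ_getElem]

/-- The tableau numbered row by row. -/
instance {n : ℕ} (lam : n.Partition) : Inhabited (Tableau lam) :=
  ⟨finSigmaFinEquiv.trans (finCongr (sum_rowLens lam))⟩

namespace Tableau

variable {n : ℕ} {lam : n.Partition} (T : Tableau lam)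

/-- The row of an entry of a tableau. -/
def row (x : Fin n) : ℕ := (T.symm x).1

/-- The column of an entry of a tableau. -/
def col (x : Fin n) : ℕ := (T.symm x).2

/-- The sum `a_λ` of the permutations that preserve each row. -/
def rowSum : SymAlg n :=
  ∑ g : Equiv.Perm (Fin n) with ∀ x, T.row (g x) = T.row x, MonoidAlgebra.of ℂ _ g

/-- The signed sum `b_λ` of the permutations that preserve each column. -/
def colSum : SymAlg n :=
  ∑ g : Equiv.Perm (Fin n) with ∀ x, T.col (g x) = T.col x,
    ((Equiv.Perm.sign g : ℤ) : ℂ) • MonoidAlgebra.of ℂ _ g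

/-- The dimension of the irreducible representation `V_λ = ℂ[S_n] a_λ b_λ`. -/
def dimIrrep : ℕ :=
  Module.finrank ℂ (LinearMap.range (LinearMap.mulRight ℂ (T.rowSum * T.colSum)))

/-- The Young symmetrizer `e_λ = a_λ b_λ / n_λ`, with `n_λ = n! / dim V_λ`. -/
def youngSymmetrizer : SymAlg n :=
  ((n.factorial : ℂ) / (T.dimIrrep : ℂ))⁻¹ • (T.rowSum * T.colSum)

end Tableau

/-- The `1`-morphism `(X, e)` of `'H`, for a shifted word `X`. -/
def wordSummand (X : Shifted) (e : End X) (he : IsIdempotentElem e) : HCat where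
  X := (Mat_.embedding Shifted).obj X
  p := (Mat_.embedding Shifted).map e
  idem := by
    rw [← Functor.map_comp]
    exact congrArg _ he

/-- The `1`-morphism `(M, e)` of `'H`, for a `1`-morphism `M` of `'H'`. -/
def summand (M : HPre) (e : End M) (he : IsIdempotentElem e) : HCat where
  X := M
  p := e
  idem := he

/-- The class `t^l = [𝟏⟨l⟩]`. -/
def tPow (l : ℤ) : K0H := cls ((toKaroubi HPre).obj ((Mat_.embedding Shifted).obj ⟨[], l⟩))

end HeisCat

end

open HeisCat

/-! The double crossing relation on QP writes the identity of QP as a sum of three maps that factor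
through PQ, through the empty word, and through a shift of the empty word (`id_eq_QP`). These words
have fewer inversions, an inversion being a Q with a P somewhere to its right. By induction the
identity of every word factors through finite sums of P^m Q^n⟨l⟩ (`id_mem_pqIdeal`), and every
2-morphism into a word without a factor QP is a combination of diagrams that first resolve factors
QP and afterwards stay among such standard words (`Reduced.of_std`).

Layers between standard words are crossings of equally oriented strands, of shifted degree 0, or
dots and clockwise cups and caps, of positive shifted degree: mixed crossings and counterclockwise
cups and caps have QP at one end. The local relations are homogeneous for the shifted degree, so the
homogeneous parts are independent, being contained in eigenspaces of a scaling operator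
(`iSupIndep_homog`). Hence between standard words nothing has negative shifted degree, and shifted
degree 0 consists of combinations of permutations (`eq_zero_of_homog_neg`, `crossComb_of_homog`).

Twice the shifted degree equals twice the degree plus the change in the number of letters P. So the
shifted degree of a degree zero morphism between objects P^m Q^n⟨l⟩ is determined by its ends. Two
consequences follow. Degree zero endomorphisms of P^m Q^n are the image of ℂ[S_m] ⊗ ℂ[S_n]; and
morphisms between different objects P^m Q^n⟨l⟩ vanish unless the weight 2l + m strictly increases,
so R is triangular over R⁰.

The map from ℂ[S_m] ⊗ ℂ[S_n] is injective (`pqBraid_injective`) because closing all strands by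
counterclockwise arcs with dots sends a pair of permutations to the empty diagram if both are
trivial and to 0 otherwise: a dotted circle is 1 and a left curl is 0. The empty diagram is not zero
since the category acts on linear species, with Q the derivative and P the product with the species
of singletons with coefficients in Λ (`Mor.id_nil_ne_zero`).

The Young symmetrizers form a complete family of primitive idempotents with scalar corners, one per
block (`splitFamily_young`): the classical row and column argument gives corners and orthogonality,
and the number of blocks is at most the number of partitions. It remains to apply a Krull–Schmidt
argument. For objects with only scalar endomorphisms and triangular morphisms, every idempotent on a
summand of a finite sum of them splits into copies of these objects, with unique multiplicities
(`SplitData.exists_splits`, `SplitData.eq_of_splits`). Applied to right ideals it computes all the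
groups K₀ as free groups on pairs of partitions (`SplitSystem.K0Equiv`); applied in the Karoubi
envelope it expands the classes [(M, e)] and [A], where the summand of P^m Q^n⟨l⟩ cut out by e_λ ⊗
e_μ is the product of the three stated classes. -/

noncomputable section

/-! ### Elementary layers and the interchange law -/

namespace HeisCat

open Strand

namespace Mor

open Term

/-- Composition of `2`-morphisms, read from bottom to top. -/
local infixr:80 " ⊚ " => Mor.comp

/-- The `2`-morphism given by an elementary diagram between vertical strands. -/
def lay {w w' : Word} (u : Word) {a b : Word} (g : Gen a b) (v : Word)
    (h : w = u ++ a ++ v := by first | (simp [Strand.dual]; done) | (simp [Strand.dual]; rfl))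
    (h' : w' = u ++ b ++ v := by first | (simp [Strand.dual]; done) | (simp [Strand.dual]; rfl)) :
    Mor w w' :=
  mk (.layer u v g h h')

/-- Words often agree only up to reassociation of `++`, which is not definitional. The position of a
layer is therefore changed by propositional equalities while its two ends stay fixed. -/
theorem lay_congr {w w' u₁ u₂ v₁ v₂ a b : Word} (g : Gen a b) (hu : u₁ = u₂) (hv : v₁ = v₂)
    (h₁ : w = u₁ ++ a ++ v₁) (h₁' : w' = u₁ ++ b ++ v₁) (h₂ : w = u₂ ++ a ++ v₂)
    (h₂' : w' = u₂ ++ b ++ v₂) : lay u₁ g v₁ h₁ h₁' = lay u₂ g v₂ h₂ h₂' := by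
  subst hu hv; rfl

theorem lay_homog (wt : ∀ a b : Word, Gen a b → ℤ) {w w' u v a b : Word} (g : Gen a b)
    (h : w = u ++ a ++ v) (h' : w' = u ++ b ++ v) : lay u g v h h' ∈ homog wt w w' (wt a b g) :=
  ⟨_, .layer _ _ _ _ _, rfl⟩

theorem zero_comp {w w' w'' : Word} (g : Mor w' w'') : (0 : Mor w w').comp g = 0 := by
  simpa using smul_comp 0 (0 : Mor w w') g

theorem comp_zero {w w' w'' : Word} (f : Mor w w') : f.comp (0 : Mor w' w'') = 0 := by
  simpa using comp_smul 0 f (0 : Mor w' w'')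

theorem neg_comp {w w' w'' : Word} (f : Mor w w') (g : Mor w' w'') :
    (-f).comp g = -(f.comp g) := by
  simpa using smul_comp (-1) f g

theorem comp_neg {w w' w'' : Word} (f : Mor w w') (g : Mor w' w'') :
    f.comp (-g) = -(f.comp g) := by
  simpa using comp_smul (-1) f g

theorem interchange_lay {w₁ w₂ w₂' w₃ u m v a b c d : Word} (g : Gen a b) (k : Gen c d)
    (h₁ : w₁ = u ++ a ++ (m ++ c ++ v)) (h₂ : w₂ = u ++ b ++ (m ++ c ++ v))
    (h₂' : w₂ = (u ++ b ++ m) ++ c ++ v) (h₃ : w₃ = (u ++ b ++ m) ++ d ++ v)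
    (k₁ : w₁ = (u ++ a ++ m) ++ c ++ v) (k₂ : w₂' = (u ++ a ++ m) ++ d ++ v)
    (k₂' : w₂' = u ++ a ++ (m ++ d ++ v)) (k₃ : w₃ = u ++ b ++ (m ++ d ++ v)) :
    lay u g (m ++ c ++ v) h₁ h₂ ⊚ lay (u ++ b ++ m) k v h₂' h₃ =
      ((-1 : ℂ) ^ (deg a b g * deg c d k)) •
        (lay (u ++ a ++ m) k v k₁ k₂ ⊚ lay u g (m ++ d ++ v) k₂' k₃) := by
  have e := congrArg (fun x => whiskL u (whiskR v x))
    (sound (.interchange (f := gen g) (g := Term.whiskL m (gen k))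
      (IsHomog.layer _ _ _ _ _) ((IsHomog.layer _ _ _ _ _).whiskL m)))
  obtain rfl : w₁ = u ++ ((a ++ (m ++ c)) ++ v) := by simp [h₁]
  obtain rfl : w₂ = u ++ ((b ++ (m ++ c)) ++ v) := by simp [h₂]
  obtain rfl : w₂' = u ++ ((a ++ (m ++ d)) ++ v) := by simp [k₂]
  obtain rfl : w₃ = u ++ ((b ++ (m ++ d)) ++ v) := by simp [h₃]
  -- Whiskering the interchange relation by `u` and `v` produces layers at positions such as `u ++
  -- []`; `q1` to `q4` bring the four layers to the required positions.
  have q1 : ∀ (h : u ++ ((a ++ (m ++ c)) ++ v) = (u ++ []) ++ a ++ ((m ++ c) ++ v))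
    (h' : u ++ ((b ++ (m ++ c)) ++ v) = (u ++ []) ++ b ++ ((m ++ c) ++ v)),
    lay (u ++ []) g ((m ++ c) ++ v) h h' = lay u g (m ++ c ++ v) h₁ h₂ := fun _ _ =>
      lay_congr _ (by simp) rfl _ _ _ _
  have q2 : ∀ (h : u ++ ((b ++ (m ++ c)) ++ v) = (u ++ (b ++ (m ++ []))) ++ c ++ v)
    (h' : u ++ ((b ++ (m ++ d)) ++ v) = (u ++ (b ++ (m ++ []))) ++ d ++ v),
    lay (u ++ (b ++ (m ++ []))) k v h h' = lay (u ++ b ++ m) k v h₂' h₃ := fun _ _ =>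
      lay_congr _ (by simp) rfl _ _ _ _
  have q3 : ∀ (h : u ++ ((a ++ (m ++ c)) ++ v) = (u ++ (a ++ (m ++ []))) ++ c ++ v)
    (h' : u ++ ((a ++ (m ++ d)) ++ v) = (u ++ (a ++ (m ++ []))) ++ d ++ v),
    lay (u ++ (a ++ (m ++ []))) k v h h' = lay (u ++ a ++ m) k v k₁ k₂ := fun _ _ =>
      lay_congr _ (by simp) rfl _ _ _ _
  have q4 : ∀ (h : u ++ ((a ++ (m ++ d)) ++ v) = (u ++ []) ++ a ++ ((m ++ d) ++ v))
    (h' : u ++ ((b ++ (m ++ d)) ++ v) = (u ++ []) ++ b ++ ((m ++ d) ++ v)),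
    lay (u ++ []) g ((m ++ d) ++ v) h h' = lay u g (m ++ d ++ v) k₂' k₃ := fun _ _ =>
      lay_congr _ (by simp) rfl _ _ _ _
  rw [← q1 (by simp) (by simp), ← q2 (by simp) (by simp), ← q3 (by simp) (by simp),
    ← q4 (by simp) (by simp)]
  exact e

theorem interchange_of {w₁ w₂ w₂' w₃ u v v₁ u₂ u₃ v₄ a b c d : Word} (m : Word) (g : Gen a b)
    (k : Gen c d) (h₁ : w₁ = u ++ a ++ v₁) (h₂ : w₂ = u ++ b ++ v₁)
    (h₂' : w₂ = u₂ ++ c ++ v) (h₃ : w₃ = u₂ ++ d ++ v)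
    (k₁ : w₁ = u₃ ++ c ++ v) (k₂ : w₂' = u₃ ++ d ++ v)
    (k₂' : w₂' = u ++ a ++ v₄) (k₃ : w₃ = u ++ b ++ v₄)
    (hv₁ : v₁ = m ++ c ++ v := by simp) (hu₂ : u₂ = u ++ b ++ m := by simp)
    (hu₃ : u₃ = u ++ a ++ m := by simp) (hv₄ : v₄ = m ++ d ++ v := by simp) :
    lay u g v₁ h₁ h₂ ⊚ lay u₂ k v h₂' h₃ =
      ((-1 : ℂ) ^ (deg a b g * deg c d k)) • (lay u₃ k v k₁ k₂ ⊚ lay u g v₄ k₂' k₃) := by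
  subst hv₁ hu₂ hu₃ hv₄
  exact interchange_lay g k _ _ _ _ _ _ _ _

/-! ### The relations in context -/

section Context

variable (u v : Word)

theorem ctx_local {a b : Word} {f g : Term a b} (h : LocalRel f g) :
    whiskL u (whiskR v (mk f)) = whiskL u (whiskR v (mk g)) := by
  rw [sound (.of h)]

theorem layer_congr {w w' u₁ u₂ v₁ v₂ a b : Word} (g : Gen a b) (hu : u₁ = u₂) (hv : v₁ = v₂)
    (h₁ : w = u₁ ++ a ++ v₁) (h₁' : w' = u₁ ++ b ++ v₁) (h₂ : w = u₂ ++ a ++ v₂)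
    (h₂' : w' = u₂ ++ b ++ v₂) : Term.layer u₁ v₁ g h₁ h₁' = Term.layer u₂ v₂ g h₂ h₂' := by
  subst hu hv; rfl

/-- The congruence is closed under adding strands on both sides, so a local relation holds between
any strands `u` and `v`. The terms `F` and `G` leave room for positions written in simplified form.
-/
theorem ctx_of {a b : Word} {f g : Term a b} (h : LocalRel f g)
    {F G : Term (u ++ (a ++ v)) (u ++ (b ++ v))} (hF : F = Term.whiskL u (Term.whiskR v f))
    (hG : G = Term.whiskL u (Term.whiskR v g)) : mk F = mk G := by
  subst hF hG; exact ctx_local u v h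

theorem zigzag_capP :
    (lay (u ++ [P]) (.cup Q) v ⊚ lay u (.cap P) (P :: v) : Mor (u ++ P :: v) (u ++ P :: v)) =
      mk (.id _) := by
  refine ctx_of u v .zigzag_capP ?_ ?_ <;> repeat' first
    | rfl
    | exact layer_congr _ (by simp) (by simp) _ _ _ _
    | refine congrArg₂ Term.comp ?_ ?_

theorem zigzag_capP' :
    (lay u (.cup Q) (Q :: v) ⊚ lay (u ++ [Q]) (.cap P) v : Mor (u ++ Q :: v) (u ++ Q :: v)) =
      -mk (.id _) := by
  refine ctx_of u v .zigzag_capP' ?_ ?_ <;> repeat' first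
    | rfl
    | exact layer_congr _ (by simp) (by simp) _ _ _ _
    | refine congrArg₂ Term.comp ?_ ?_

theorem zigzag_capQ :
    (lay (u ++ [Q]) (.cup P) v ⊚ lay u (.cap Q) (Q :: v) : Mor (u ++ Q :: v) (u ++ Q :: v)) =
      mk (.id _) := by
  refine ctx_of u v .zigzag_capQ ?_ ?_ <;> repeat' first
    | rfl
    | exact layer_congr _ (by simp) (by simp) _ _ _ _
    | refine congrArg₂ Term.comp ?_ ?_

theorem zigzag_capQ' :
    (lay u (.cup P) (P :: v) ⊚ lay (u ++ [P]) (.cap Q) v : Mor (u ++ P :: v) (u ++ P :: v)) =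
      mk (.id _) := by
  refine ctx_of u v .zigzag_capQ' ?_ ?_ <;> repeat' first
    | rfl
    | exact layer_congr _ (by simp) (by simp) _ _ _ _
    | refine congrArg₂ Term.comp ?_ ?_

theorem pitchfork_cup (a c : Strand) :
    (lay (u ++ [c]) (.cup a) v ⊚ lay u (.cross c a) (a.dual :: v) :
      Mor (u ++ c :: v) (u ++ a :: c :: a.dual :: v)) =
    lay u (.cup a) (c :: v) ⊚ lay (u ++ [a]) (.cross a.dual c) v := by
  refine ctx_of u v (.pitchfork_cup a c) ?_ ?_ <;> repeat' first
    | rfl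
    | exact layer_congr _ (by simp) (by simp) _ _ _ _
    | refine congrArg₂ Term.comp ?_ ?_

theorem pitchfork_cap (a c : Strand) :
    (lay (u ++ [a]) (.cross c a.dual) v ⊚ lay u (.cap a) (c :: v) :
      Mor (u ++ a :: c :: a.dual :: v) (u ++ c :: v)) =
    lay u (.cross a c) (a.dual :: v) ⊚ lay (u ++ [c]) (.cap a) v := by
  refine ctx_of u v (.pitchfork_cap a c) ?_ ?_ <;> repeat' first
    | rfl
    | exact layer_congr _ (by simp) (by simp) _ _ _ _
    | refine congrArg₂ Term.comp ?_ ?_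

theorem dot_cup (a : Strand) :
    (lay u (.cup a) v ⊚ lay u (.dot a) (a.dual :: v) : Mor (u ++ v) (u ++ a :: a.dual :: v)) =
    lay u (.cup a) v ⊚ lay (u ++ [a]) (.dot a.dual) v := by
  refine ctx_of u v (.dot_cup a) ?_ ?_ <;> repeat' first
    | rfl
    | exact layer_congr _ (by simp) (by simp) _ _ _ _
    | refine congrArg₂ Term.comp ?_ ?_

theorem dot_cap (a : Strand) :
    (lay u (.dot a) (a.dual :: v) ⊚ lay u (.cap a) v : Mor (u ++ a :: a.dual :: v) (u ++ v)) =
    lay (u ++ [a]) (.dot a.dual) v ⊚ lay u (.cap a) v := by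
  refine ctx_of u v (.dot_cap a) ?_ ?_ <;> repeat' first
    | rfl
    | exact layer_congr _ (by simp) (by simp) _ _ _ _
    | refine congrArg₂ Term.comp ?_ ?_

theorem dot_cross (a b : Strand) :
    (lay u (.dot a) (b :: v) ⊚ lay u (.cross a b) v : Mor (u ++ a :: b :: v) (u ++ b :: a :: v)) =
    lay u (.cross a b) v ⊚ lay (u ++ [b]) (.dot a) v := by
  refine ctx_of u v (.dot_cross a b) ?_ ?_ <;> repeat' first
    | rfl
    | exact layer_congr _ (by simp) (by simp) _ _ _ _
    | refine congrArg₂ Term.comp ?_ ?_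

theorem dot_cross' (a b : Strand) :
    (lay (u ++ [a]) (.dot b) v ⊚ lay u (.cross a b) v :
      Mor (u ++ a :: b :: v) (u ++ b :: a :: v)) =
    lay u (.cross a b) v ⊚ lay u (.dot b) (a :: v) := by
  refine ctx_of u v (.dot_cross' a b) ?_ ?_ <;> repeat' first
    | rfl
    | exact layer_congr _ (by simp) (by simp) _ _ _ _
    | refine congrArg₂ Term.comp ?_ ?_

theorem dot_dot (a : Strand) :
    (lay u (.dot a) v ⊚ lay u (.dot a) v : Mor (u ++ a :: v) (u ++ a :: v)) = 0 := by
  refine ctx_of u v (.dot_dot a) ?_ ?_ <;> repeat' first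
    | rfl
    | exact layer_congr _ (by simp) (by simp) _ _ _ _
    | refine congrArg₂ Term.comp ?_ ?_

theorem cross_cross (a b : Strand) (h : ¬(a = Q ∧ b = P)) :
    (lay u (.cross a b) v ⊚ lay u (.cross b a) v : Mor (u ++ a :: b :: v) (u ++ a :: b :: v)) =
    mk (.id _) := by
  refine ctx_of u v (.cross_cross a b h) ?_ ?_ <;> repeat' first
    | rfl
    | exact layer_congr _ (by simp) (by simp) _ _ _ _
    | refine congrArg₂ Term.comp ?_ ?_

theorem cross_cross_QP :
    (lay u (.cross Q P) v ⊚ lay u (.cross P Q) v : Mor (u ++ Q :: P :: v) (u ++ Q :: P :: v)) +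
      ((lay u (.cap Q) v ⊚ (lay u (.cup Q) v : Mor (u ++ v) _)) ⊚ lay (u ++ [Q]) (.dot P) v +
        lay (u ++ [Q]) (.dot P) v ⊚ lay u (.cap Q) v ⊚ (lay u (.cup Q) v : Mor (u ++ v) _)) =
    mk (.id _) := by
  refine ctx_of u v .cross_cross_QP ?_ ?_ <;> repeat' first
    | rfl
    | exact layer_congr _ (by simp) (by simp) _ _ _ _
    | refine congrArg₂ Term.comp ?_ ?_
    | refine congrArg₂ Term.add ?_ ?_

theorem triple (a b c : Strand) :
    ((lay u (.cross a b) (c :: v) ⊚ (lay (u ++ [b]) (.cross a c) v :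
      Mor _ (u ++ b :: c :: a :: v))) ⊚ lay u (.cross b c) (a :: v) :
        Mor (u ++ a :: b :: c :: v) (u ++ c :: b :: a :: v)) =
    (lay (u ++ [a]) (.cross b c) v ⊚ (lay u (.cross a c) (b :: v) :
      Mor _ (u ++ c :: a :: b :: v))) ⊚ lay (u ++ [c]) (.cross a b) v := by
  refine ctx_of u v (.triple a b c) ?_ ?_ <;> repeat' first
    | rfl
    | exact layer_congr _ (by simp) (by simp) _ _ _ _
    | refine congrArg₂ Term.comp ?_ ?_

theorem curl :
    ((lay u (.cup Q) (P :: v) ⊚ (lay (u ++ [Q]) (.cross P P) v :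
      Mor _ (u ++ Q :: P :: P :: v))) ⊚ lay u (.cap Q) (P :: v) :
        Mor (u ++ P :: v) (u ++ P :: v)) = 0 := by
  refine ctx_of u v .curl ?_ ?_ <;> repeat' first
    | rfl
    | exact layer_congr _ (by simp) (by simp) _ _ _ _
    | refine congrArg₂ Term.comp ?_ ?_

theorem circle :
    (lay u (.cup Q) v ⊚ lay u (.cap Q) v : Mor (u ++ v) (u ++ v)) = 0 := by
  refine ctx_of u v .circle ?_ ?_ <;> repeat' first
    | rfl
    | exact layer_congr _ (by simp) (by simp) _ _ _ _
    | refine congrArg₂ Term.comp ?_ ?_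

theorem circle_dot :
    ((lay u (.cup Q) v ⊚ lay (u ++ [Q]) (.dot P) v) ⊚ lay u (.cap Q) v :
      Mor (u ++ v) (u ++ v)) = mk (.id _) := by
  refine ctx_of u v .circle_dot ?_ ?_ <;> repeat' first
    | rfl
    | exact layer_congr _ (by simp) (by simp) _ _ _ _
    | refine congrArg₂ Term.comp ?_ ?_

end Context

end Mor

end HeisCat

end

noncomputable section

namespace HeisCat

open Strand

namespace Mor

open Term

local infixr:80 " ⊚ " => Mor.comp

/-! ### The relations between arbitrary words, followed by a `2`-morphism -/

/-- Composites are kept associated to the right, so a relation is applied to the first layers of a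
composite with an arbitrary continuation `y`. All words and positions are variables tied by
equations, which lets the relation apply to words that agree only propositionally. -/
theorem zigzag_capP_tail {u v w0 w1 ua0 va1 s : Word} (y : Mor w0 s)
    (eua0 : ua0 = u ++ [P] := by (try simp [Strand.dual]) <;> rfl)
    (eva1 : va1 = P :: v := by (try simp [Strand.dual]) <;> rfl)
    (ha0 : w0 = ua0 ++ [] ++ v := by (try simp [Strand.dual]) <;> rfl)
    (ka0 : w1 = ua0 ++ [Q, P] ++ v := by (try simp [Strand.dual]) <;> rfl)
    (ha1 : w1 = u ++ [P, Q] ++ va1 := by (try simp [Strand.dual]) <;> rfl)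
    (ka1 : w0 = u ++ [] ++ va1 := by (try simp [Strand.dual]) <;> rfl) :
    lay ua0 (.cup Q) v ha0 ka0 ⊚ lay u (.cap P) va1 ha1 ka1 ⊚ y =
      y := by
  subst eua0 eva1
  obtain rfl : w0 = u ++ P :: v := by simp [ha0]
  obtain rfl : w1 = u ++ P :: Q :: P :: v := by simp [ka0]
  rw [← assoc]
  exact (congrArg (fun z => z ⊚ y) (zigzag_capP u v)).trans (id_comp y)

theorem zigzag_capP'_tail {u v w0 w1 va0 ua1 s : Word} (y : Mor w0 s)
    (eva0 : va0 = Q :: v := by (try simp [Strand.dual]) <;> rfl)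
    (eua1 : ua1 = u ++ [Q] := by (try simp [Strand.dual]) <;> rfl)
    (ha0 : w0 = u ++ [] ++ va0 := by (try simp [Strand.dual]) <;> rfl)
    (ka0 : w1 = u ++ [Q, P] ++ va0 := by (try simp [Strand.dual]) <;> rfl)
    (ha1 : w1 = ua1 ++ [P, Q] ++ v := by (try simp [Strand.dual]) <;> rfl)
    (ka1 : w0 = ua1 ++ [] ++ v := by (try simp [Strand.dual]) <;> rfl) :
    lay u (.cup Q) va0 ha0 ka0 ⊚ lay ua1 (.cap P) v ha1 ka1 ⊚ y =
      -y := by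
  subst eva0 eua1
  obtain rfl : w0 = u ++ Q :: v := by simp [ha0]
  obtain rfl : w1 = u ++ Q :: P :: Q :: v := by simp [ka0]
  rw [← assoc]
  exact (congrArg (fun z => z ⊚ y) (zigzag_capP' u v)).trans ((neg_comp _ y).trans (congrArg _
    (id_comp y)))

theorem zigzag_capQ_tail {u v w0 w1 ua0 va1 s : Word} (y : Mor w0 s)
    (eua0 : ua0 = u ++ [Q] := by (try simp [Strand.dual]) <;> rfl)
    (eva1 : va1 = Q :: v := by (try simp [Strand.dual]) <;> rfl)
    (ha0 : w0 = ua0 ++ [] ++ v := by (try simp [Strand.dual]) <;> rfl)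
    (ka0 : w1 = ua0 ++ [P, Q] ++ v := by (try simp [Strand.dual]) <;> rfl)
    (ha1 : w1 = u ++ [Q, P] ++ va1 := by (try simp [Strand.dual]) <;> rfl)
    (ka1 : w0 = u ++ [] ++ va1 := by (try simp [Strand.dual]) <;> rfl) :
    lay ua0 (.cup P) v ha0 ka0 ⊚ lay u (.cap Q) va1 ha1 ka1 ⊚ y =
      y := by
  subst eua0 eva1
  obtain rfl : w0 = u ++ Q :: v := by simp [ha0]
  obtain rfl : w1 = u ++ Q :: P :: Q :: v := by simp [ka0]
  rw [← assoc]
  exact (congrArg (fun z => z ⊚ y) (zigzag_capQ u v)).trans (id_comp y)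

theorem zigzag_capQ'_tail {u v w0 w1 va0 ua1 s : Word} (y : Mor w0 s)
    (eva0 : va0 = P :: v := by (try simp [Strand.dual]) <;> rfl)
    (eua1 : ua1 = u ++ [P] := by (try simp [Strand.dual]) <;> rfl)
    (ha0 : w0 = u ++ [] ++ va0 := by (try simp [Strand.dual]) <;> rfl)
    (ka0 : w1 = u ++ [P, Q] ++ va0 := by (try simp [Strand.dual]) <;> rfl)
    (ha1 : w1 = ua1 ++ [Q, P] ++ v := by (try simp [Strand.dual]) <;> rfl)
    (ka1 : w0 = ua1 ++ [] ++ v := by (try simp [Strand.dual]) <;> rfl) :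
    lay u (.cup P) va0 ha0 ka0 ⊚ lay ua1 (.cap Q) v ha1 ka1 ⊚ y =
      y := by
  subst eva0 eua1
  obtain rfl : w0 = u ++ P :: v := by simp [ha0]
  obtain rfl : w1 = u ++ P :: Q :: P :: v := by simp [ka0]
  rw [← assoc]
  exact (congrArg (fun z => z ⊚ y) (zigzag_capQ' u v)).trans (id_comp y)

theorem pitchfork_cupP_tail {u v w0 w1 w2 x1 ua0 va1 vb0 ub1 s : Word} (c : Strand) (y : Mor w2 s)
    (eua0 : ua0 = u ++ [c] := by (try simp [Strand.dual]) <;> rfl)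
    (eva1 : va1 = Q :: v := by (try simp [Strand.dual]) <;> rfl)
    (evb0 : vb0 = c :: v := by (try simp [Strand.dual]) <;> rfl)
    (eub1 : ub1 = u ++ [P] := by (try simp [Strand.dual]) <;> rfl)
    (ha0 : w0 = ua0 ++ [] ++ v := by (try simp [Strand.dual]) <;> rfl)
    (ka0 : w1 = ua0 ++ [P, Q] ++ v := by (try simp [Strand.dual]) <;> rfl)
    (ha1 : w1 = u ++ [c, P] ++ va1 := by (try simp [Strand.dual]) <;> rfl)
    (ka1 : w2 = u ++ [P, c] ++ va1 := by (try simp [Strand.dual]) <;> rfl)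
    (hb0 : w0 = u ++ [] ++ vb0 := by (try simp [Strand.dual]) <;> rfl)
    (kb0 : x1 = u ++ [P, Q] ++ vb0 := by (try simp [Strand.dual]) <;> rfl)
    (hb1 : x1 = ub1 ++ [Q, c] ++ v := by (try simp [Strand.dual]) <;> rfl)
    (kb1 : w2 = ub1 ++ [c, Q] ++ v := by (try simp [Strand.dual]) <;> rfl) :
    lay ua0 (.cup P) v ha0 ka0 ⊚ lay u (.cross c P) va1 ha1 ka1 ⊚ y =
      lay u (.cup P) vb0 hb0 kb0 ⊚ lay ub1 (.cross Q c) v hb1 kb1 ⊚ y := by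
  subst eua0 eva1 evb0 eub1
  obtain rfl : w0 = u ++ c :: v := by simp [ha0]
  obtain rfl : w1 = u ++ c :: P :: Q :: v := by simp [ka0]
  obtain rfl : w2 = u ++ P :: c :: Q :: v := by simp [ka1]
  obtain rfl : x1 = u ++ P :: Q :: c :: v := by simp [kb0]
  rw [← assoc, ← assoc]
  exact congrArg (fun z => z ⊚ y) (pitchfork_cup u v P c)

theorem pitchfork_capP_tail {u v w0 w1 w2 x1 ua0 va1 vb0 ub1 s : Word} (c : Strand) (y : Mor w2 s)
    (eua0 : ua0 = u ++ [P] := by (try simp [Strand.dual]) <;> rfl)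
    (eva1 : va1 = c :: v := by (try simp [Strand.dual]) <;> rfl)
    (evb0 : vb0 = Q :: v := by (try simp [Strand.dual]) <;> rfl)
    (eub1 : ub1 = u ++ [c] := by (try simp [Strand.dual]) <;> rfl)
    (ha0 : w0 = ua0 ++ [c, Q] ++ v := by (try simp [Strand.dual]) <;> rfl)
    (ka0 : w1 = ua0 ++ [Q, c] ++ v := by (try simp [Strand.dual]) <;> rfl)
    (ha1 : w1 = u ++ [P, Q] ++ va1 := by (try simp [Strand.dual]) <;> rfl)
    (ka1 : w2 = u ++ [] ++ va1 := by (try simp [Strand.dual]) <;> rfl)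
    (hb0 : w0 = u ++ [P, c] ++ vb0 := by (try simp [Strand.dual]) <;> rfl)
    (kb0 : x1 = u ++ [c, P] ++ vb0 := by (try simp [Strand.dual]) <;> rfl)
    (hb1 : x1 = ub1 ++ [P, Q] ++ v := by (try simp [Strand.dual]) <;> rfl)
    (kb1 : w2 = ub1 ++ [] ++ v := by (try simp [Strand.dual]) <;> rfl) :
    lay ua0 (.cross c Q) v ha0 ka0 ⊚ lay u (.cap P) va1 ha1 ka1 ⊚ y =
      lay u (.cross P c) vb0 hb0 kb0 ⊚ lay ub1 (.cap P) v hb1 kb1 ⊚ y := by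
  subst eua0 eva1 evb0 eub1
  obtain rfl : w0 = u ++ P :: c :: Q :: v := by simp [ha0]
  obtain rfl : w1 = u ++ P :: Q :: c :: v := by simp [ka0]
  obtain rfl : w2 = u ++ c :: v := by simp [ka1]
  obtain rfl : x1 = u ++ c :: P :: Q :: v := by simp [kb0]
  rw [← assoc, ← assoc]
  exact congrArg (fun z => z ⊚ y) (pitchfork_cap u v P c)

theorem dot_cupP_tail {u v w0 w1 w2 x1 va1 ub1 s : Word} (y : Mor w2 s)
    (eva1 : va1 = Q :: v := by (try simp [Strand.dual]) <;> rfl)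
    (eub1 : ub1 = u ++ [P] := by (try simp [Strand.dual]) <;> rfl)
    (ha0 : w0 = u ++ [] ++ v := by (try simp [Strand.dual]) <;> rfl)
    (ka0 : w1 = u ++ [P, Q] ++ v := by (try simp [Strand.dual]) <;> rfl)
    (ha1 : w1 = u ++ [P] ++ va1 := by (try simp [Strand.dual]) <;> rfl)
    (ka1 : w2 = u ++ [P] ++ va1 := by (try simp [Strand.dual]) <;> rfl)
    (hb0 : w0 = u ++ [] ++ v := by (try simp [Strand.dual]) <;> rfl)
    (kb0 : x1 = u ++ [P, Q] ++ v := by (try simp [Strand.dual]) <;> rfl)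
    (hb1 : x1 = ub1 ++ [Q] ++ v := by (try simp [Strand.dual]) <;> rfl)
    (kb1 : w2 = ub1 ++ [Q] ++ v := by (try simp [Strand.dual]) <;> rfl) :
    lay u (.cup P) v ha0 ka0 ⊚ lay u (.dot P) va1 ha1 ka1 ⊚ y =
      lay u (.cup P) v hb0 kb0 ⊚ lay ub1 (.dot Q) v hb1 kb1 ⊚ y := by
  subst eva1 eub1
  obtain rfl : w0 = u ++ v := by simp [ha0]
  obtain rfl : w1 = u ++ P :: Q :: v := by simp [ka0]
  obtain rfl : w2 = u ++ P :: Q :: v := by simp [ka1]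
  obtain rfl : x1 = u ++ P :: Q :: v := by simp [kb0]
  rw [← assoc, ← assoc]
  exact congrArg (fun z => z ⊚ y) (dot_cup u v P)

theorem dot_capP_tail {u v w0 w1 w2 x1 va0 ub0 s : Word} (y : Mor w2 s)
    (eva0 : va0 = Q :: v := by (try simp [Strand.dual]) <;> rfl)
    (eub0 : ub0 = u ++ [P] := by (try simp [Strand.dual]) <;> rfl)
    (ha0 : w0 = u ++ [P] ++ va0 := by (try simp [Strand.dual]) <;> rfl)
    (ka0 : w1 = u ++ [P] ++ va0 := by (try simp [Strand.dual]) <;> rfl)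
    (ha1 : w1 = u ++ [P, Q] ++ v := by (try simp [Strand.dual]) <;> rfl)
    (ka1 : w2 = u ++ [] ++ v := by (try simp [Strand.dual]) <;> rfl)
    (hb0 : w0 = ub0 ++ [Q] ++ v := by (try simp [Strand.dual]) <;> rfl)
    (kb0 : x1 = ub0 ++ [Q] ++ v := by (try simp [Strand.dual]) <;> rfl)
    (hb1 : x1 = u ++ [P, Q] ++ v := by (try simp [Strand.dual]) <;> rfl)
    (kb1 : w2 = u ++ [] ++ v := by (try simp [Strand.dual]) <;> rfl) :
    lay u (.dot P) va0 ha0 ka0 ⊚ lay u (.cap P) v ha1 ka1 ⊚ y =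
      lay ub0 (.dot Q) v hb0 kb0 ⊚ lay u (.cap P) v hb1 kb1 ⊚ y := by
  subst eva0 eub0
  obtain rfl : w0 = u ++ P :: Q :: v := by simp [ha0]
  obtain rfl : w1 = u ++ P :: Q :: v := by simp [ka0]
  obtain rfl : w2 = u ++ v := by simp [ka1]
  obtain rfl : x1 = u ++ P :: Q :: v := by simp [kb0]
  rw [← assoc, ← assoc]
  exact congrArg (fun z => z ⊚ y) (dot_cap u v P)

theorem pitchfork_cupQ_tail {u v w0 w1 w2 x1 ua0 va1 vb0 ub1 s : Word} (c : Strand) (y : Mor w2 s)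
    (eua0 : ua0 = u ++ [c] := by (try simp [Strand.dual]) <;> rfl)
    (eva1 : va1 = P :: v := by (try simp [Strand.dual]) <;> rfl)
    (evb0 : vb0 = c :: v := by (try simp [Strand.dual]) <;> rfl)
    (eub1 : ub1 = u ++ [Q] := by (try simp [Strand.dual]) <;> rfl)
    (ha0 : w0 = ua0 ++ [] ++ v := by (try simp [Strand.dual]) <;> rfl)
    (ka0 : w1 = ua0 ++ [Q, P] ++ v := by (try simp [Strand.dual]) <;> rfl)
    (ha1 : w1 = u ++ [c, Q] ++ va1 := by (try simp [Strand.dual]) <;> rfl)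
    (ka1 : w2 = u ++ [Q, c] ++ va1 := by (try simp [Strand.dual]) <;> rfl)
    (hb0 : w0 = u ++ [] ++ vb0 := by (try simp [Strand.dual]) <;> rfl)
    (kb0 : x1 = u ++ [Q, P] ++ vb0 := by (try simp [Strand.dual]) <;> rfl)
    (hb1 : x1 = ub1 ++ [P, c] ++ v := by (try simp [Strand.dual]) <;> rfl)
    (kb1 : w2 = ub1 ++ [c, P] ++ v := by (try simp [Strand.dual]) <;> rfl) :
    lay ua0 (.cup Q) v ha0 ka0 ⊚ lay u (.cross c Q) va1 ha1 ka1 ⊚ y =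
      lay u (.cup Q) vb0 hb0 kb0 ⊚ lay ub1 (.cross P c) v hb1 kb1 ⊚ y := by
  subst eua0 eva1 evb0 eub1
  obtain rfl : w0 = u ++ c :: v := by simp [ha0]
  obtain rfl : w1 = u ++ c :: Q :: P :: v := by simp [ka0]
  obtain rfl : w2 = u ++ Q :: c :: P :: v := by simp [ka1]
  obtain rfl : x1 = u ++ Q :: P :: c :: v := by simp [kb0]
  rw [← assoc, ← assoc]
  exact congrArg (fun z => z ⊚ y) (pitchfork_cup u v Q c)

theorem pitchfork_capQ_tail {u v w0 w1 w2 x1 ua0 va1 vb0 ub1 s : Word} (c : Strand) (y : Mor w2 s)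
    (eua0 : ua0 = u ++ [Q] := by (try simp [Strand.dual]) <;> rfl)
    (eva1 : va1 = c :: v := by (try simp [Strand.dual]) <;> rfl)
    (evb0 : vb0 = P :: v := by (try simp [Strand.dual]) <;> rfl)
    (eub1 : ub1 = u ++ [c] := by (try simp [Strand.dual]) <;> rfl)
    (ha0 : w0 = ua0 ++ [c, P] ++ v := by (try simp [Strand.dual]) <;> rfl)
    (ka0 : w1 = ua0 ++ [P, c] ++ v := by (try simp [Strand.dual]) <;> rfl)
    (ha1 : w1 = u ++ [Q, P] ++ va1 := by (try simp [Strand.dual]) <;> rfl)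
    (ka1 : w2 = u ++ [] ++ va1 := by (try simp [Strand.dual]) <;> rfl)
    (hb0 : w0 = u ++ [Q, c] ++ vb0 := by (try simp [Strand.dual]) <;> rfl)
    (kb0 : x1 = u ++ [c, Q] ++ vb0 := by (try simp [Strand.dual]) <;> rfl)
    (hb1 : x1 = ub1 ++ [Q, P] ++ v := by (try simp [Strand.dual]) <;> rfl)
    (kb1 : w2 = ub1 ++ [] ++ v := by (try simp [Strand.dual]) <;> rfl) :
    lay ua0 (.cross c P) v ha0 ka0 ⊚ lay u (.cap Q) va1 ha1 ka1 ⊚ y =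
      lay u (.cross Q c) vb0 hb0 kb0 ⊚ lay ub1 (.cap Q) v hb1 kb1 ⊚ y := by
  subst eua0 eva1 evb0 eub1
  obtain rfl : w0 = u ++ Q :: c :: P :: v := by simp [ha0]
  obtain rfl : w1 = u ++ Q :: P :: c :: v := by simp [ka0]
  obtain rfl : w2 = u ++ c :: v := by simp [ka1]
  obtain rfl : x1 = u ++ c :: Q :: P :: v := by simp [kb0]
  rw [← assoc, ← assoc]
  exact congrArg (fun z => z ⊚ y) (pitchfork_cap u v Q c)

theorem dot_capQ_tail {u v w0 w1 w2 x1 va0 ub0 s : Word} (y : Mor w2 s)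
    (eva0 : va0 = P :: v := by (try simp [Strand.dual]) <;> rfl)
    (eub0 : ub0 = u ++ [Q] := by (try simp [Strand.dual]) <;> rfl)
    (ha0 : w0 = u ++ [Q] ++ va0 := by (try simp [Strand.dual]) <;> rfl)
    (ka0 : w1 = u ++ [Q] ++ va0 := by (try simp [Strand.dual]) <;> rfl)
    (ha1 : w1 = u ++ [Q, P] ++ v := by (try simp [Strand.dual]) <;> rfl)
    (ka1 : w2 = u ++ [] ++ v := by (try simp [Strand.dual]) <;> rfl)
    (hb0 : w0 = ub0 ++ [P] ++ v := by (try simp [Strand.dual]) <;> rfl)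
    (kb0 : x1 = ub0 ++ [P] ++ v := by (try simp [Strand.dual]) <;> rfl)
    (hb1 : x1 = u ++ [Q, P] ++ v := by (try simp [Strand.dual]) <;> rfl)
    (kb1 : w2 = u ++ [] ++ v := by (try simp [Strand.dual]) <;> rfl) :
    lay u (.dot Q) va0 ha0 ka0 ⊚ lay u (.cap Q) v ha1 ka1 ⊚ y =
      lay ub0 (.dot P) v hb0 kb0 ⊚ lay u (.cap Q) v hb1 kb1 ⊚ y := by
  subst eva0 eub0
  obtain rfl : w0 = u ++ Q :: P :: v := by simp [ha0]
  obtain rfl : w1 = u ++ Q :: P :: v := by simp [ka0]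
  obtain rfl : w2 = u ++ v := by simp [ka1]
  obtain rfl : x1 = u ++ Q :: P :: v := by simp [kb0]
  rw [← assoc, ← assoc]
  exact congrArg (fun z => z ⊚ y) (dot_cap u v Q)

theorem dot_cross_tail {u v w0 w1 w2 x1 va0 ub1 s : Word} (a b : Strand) (y : Mor w2 s)
    (eva0 : va0 = b :: v := by (try simp [Strand.dual]) <;> rfl)
    (eub1 : ub1 = u ++ [b] := by (try simp [Strand.dual]) <;> rfl)
    (ha0 : w0 = u ++ [a] ++ va0 := by (try simp [Strand.dual]) <;> rfl)
    (ka0 : w1 = u ++ [a] ++ va0 := by (try simp [Strand.dual]) <;> rfl)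
    (ha1 : w1 = u ++ [a, b] ++ v := by (try simp [Strand.dual]) <;> rfl)
    (ka1 : w2 = u ++ [b, a] ++ v := by (try simp [Strand.dual]) <;> rfl)
    (hb0 : w0 = u ++ [a, b] ++ v := by (try simp [Strand.dual]) <;> rfl)
    (kb0 : x1 = u ++ [b, a] ++ v := by (try simp [Strand.dual]) <;> rfl)
    (hb1 : x1 = ub1 ++ [a] ++ v := by (try simp [Strand.dual]) <;> rfl)
    (kb1 : w2 = ub1 ++ [a] ++ v := by (try simp [Strand.dual]) <;> rfl) :
    lay u (.dot a) va0 ha0 ka0 ⊚ lay u (.cross a b) v ha1 ka1 ⊚ y =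
      lay u (.cross a b) v hb0 kb0 ⊚ lay ub1 (.dot a) v hb1 kb1 ⊚ y := by
  subst eva0 eub1
  obtain rfl : w0 = u ++ a :: b :: v := by simp [ha0]
  obtain rfl : w1 = u ++ a :: b :: v := by simp [ka0]
  obtain rfl : w2 = u ++ b :: a :: v := by simp [ka1]
  obtain rfl : x1 = u ++ b :: a :: v := by simp [kb0]
  rw [← assoc, ← assoc]
  exact congrArg (fun z => z ⊚ y) (dot_cross u v a b)

theorem dot_cross'_tail {u v w0 w1 w2 x1 ua0 vb1 s : Word} (a b : Strand) (y : Mor w2 s)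
    (eua0 : ua0 = u ++ [a] := by (try simp [Strand.dual]) <;> rfl)
    (evb1 : vb1 = a :: v := by (try simp [Strand.dual]) <;> rfl)
    (ha0 : w0 = ua0 ++ [b] ++ v := by (try simp [Strand.dual]) <;> rfl)
    (ka0 : w1 = ua0 ++ [b] ++ v := by (try simp [Strand.dual]) <;> rfl)
    (ha1 : w1 = u ++ [a, b] ++ v := by (try simp [Strand.dual]) <;> rfl)
    (ka1 : w2 = u ++ [b, a] ++ v := by (try simp [Strand.dual]) <;> rfl)
    (hb0 : w0 = u ++ [a, b] ++ v := by (try simp [Strand.dual]) <;> rfl)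
    (kb0 : x1 = u ++ [b, a] ++ v := by (try simp [Strand.dual]) <;> rfl)
    (hb1 : x1 = u ++ [b] ++ vb1 := by (try simp [Strand.dual]) <;> rfl)
    (kb1 : w2 = u ++ [b] ++ vb1 := by (try simp [Strand.dual]) <;> rfl) :
    lay ua0 (.dot b) v ha0 ka0 ⊚ lay u (.cross a b) v ha1 ka1 ⊚ y =
      lay u (.cross a b) v hb0 kb0 ⊚ lay u (.dot b) vb1 hb1 kb1 ⊚ y := by
  subst eua0 evb1
  obtain rfl : w0 = u ++ a :: b :: v := by simp [ha0]
  obtain rfl : w1 = u ++ a :: b :: v := by simp [ka0]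
  obtain rfl : w2 = u ++ b :: a :: v := by simp [ka1]
  obtain rfl : x1 = u ++ b :: a :: v := by simp [kb0]
  rw [← assoc, ← assoc]
  exact congrArg (fun z => z ⊚ y) (dot_cross' u v a b)

theorem dot_dot_tail {u v w0 w1 w2 s : Word} (a : Strand) (y : Mor w2 s)
    
    (ha0 : w0 = u ++ [a] ++ v := by (try simp [Strand.dual]) <;> rfl)
    (ka0 : w1 = u ++ [a] ++ v := by (try simp [Strand.dual]) <;> rfl)
    (ha1 : w1 = u ++ [a] ++ v := by (try simp [Strand.dual]) <;> rfl)
    (ka1 : w2 = u ++ [a] ++ v := by (try simp [Strand.dual]) <;> rfl) :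
    lay u (.dot a) v ha0 ka0 ⊚ lay u (.dot a) v ha1 ka1 ⊚ y =
      0 := by
  obtain rfl : w0 = u ++ a :: v := by simp [ha0]
  obtain rfl : w1 = u ++ a :: v := by simp [ka0]
  obtain rfl : w2 = u ++ a :: v := by simp [ka1]
  rw [← assoc]
  exact (congrArg (fun z => z ⊚ y) (dot_dot u v a)).trans (zero_comp y)

theorem cross_cross_tail {u v w0 w1 s : Word} (a b : Strand) (h : ¬(a = Q ∧ b = P)) (y : Mor w0 s)
    
    (ha0 : w0 = u ++ [a, b] ++ v := by (try simp [Strand.dual]) <;> rfl)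
    (ka0 : w1 = u ++ [b, a] ++ v := by (try simp [Strand.dual]) <;> rfl)
    (ha1 : w1 = u ++ [b, a] ++ v := by (try simp [Strand.dual]) <;> rfl)
    (ka1 : w0 = u ++ [a, b] ++ v := by (try simp [Strand.dual]) <;> rfl) :
    lay u (.cross a b) v ha0 ka0 ⊚ lay u (.cross b a) v ha1 ka1 ⊚ y =
      y := by
  obtain rfl : w0 = u ++ a :: b :: v := by simp [ha0]
  obtain rfl : w1 = u ++ b :: a :: v := by simp [ka0]
  rw [← assoc]
  exact (congrArg (fun z => z ⊚ y) (cross_cross u v a b h)).trans (id_comp y)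

theorem circle_tail {u v w0 w1 w2 s : Word} (y : Mor w2 s)
    
    (ha0 : w0 = u ++ [] ++ v := by (try simp [Strand.dual]) <;> rfl)
    (ka0 : w1 = u ++ [Q, P] ++ v := by (try simp [Strand.dual]) <;> rfl)
    (ha1 : w1 = u ++ [Q, P] ++ v := by (try simp [Strand.dual]) <;> rfl)
    (ka1 : w2 = u ++ [] ++ v := by (try simp [Strand.dual]) <;> rfl) :
    lay u (.cup Q) v ha0 ka0 ⊚ lay u (.cap Q) v ha1 ka1 ⊚ y =
      0 := by
  obtain rfl : w0 = u ++ v := by simp [ha0]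
  obtain rfl : w1 = u ++ Q :: P :: v := by simp [ka0]
  obtain rfl : w2 = u ++ v := by simp [ka1]
  rw [← assoc]
  exact (congrArg (fun z => z ⊚ y) (circle u v)).trans (zero_comp y)

theorem triple_tail {u v w0 w1 w2 w3 x1 x2 va0 ua1 va2 ub0 vb1 ub2 s : Word} (a b c : Strand) (y
    : Mor w3 s)
    (eva0 : va0 = c :: v := by (try simp [Strand.dual]) <;> rfl)
    (eua1 : ua1 = u ++ [b] := by (try simp [Strand.dual]) <;> rfl)
    (eva2 : va2 = a :: v := by (try simp [Strand.dual]) <;> rfl)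
    (eub0 : ub0 = u ++ [a] := by (try simp [Strand.dual]) <;> rfl)
    (evb1 : vb1 = b :: v := by (try simp [Strand.dual]) <;> rfl)
    (eub2 : ub2 = u ++ [c] := by (try simp [Strand.dual]) <;> rfl)
    (ha0 : w0 = u ++ [a, b] ++ va0 := by (try simp [Strand.dual]) <;> rfl)
    (ka0 : w1 = u ++ [b, a] ++ va0 := by (try simp [Strand.dual]) <;> rfl)
    (ha1 : w1 = ua1 ++ [a, c] ++ v := by (try simp [Strand.dual]) <;> rfl)
    (ka1 : w2 = ua1 ++ [c, a] ++ v := by (try simp [Strand.dual]) <;> rfl)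
    (ha2 : w2 = u ++ [b, c] ++ va2 := by (try simp [Strand.dual]) <;> rfl)
    (ka2 : w3 = u ++ [c, b] ++ va2 := by (try simp [Strand.dual]) <;> rfl)
    (hb0 : w0 = ub0 ++ [b, c] ++ v := by (try simp [Strand.dual]) <;> rfl)
    (kb0 : x1 = ub0 ++ [c, b] ++ v := by (try simp [Strand.dual]) <;> rfl)
    (hb1 : x1 = u ++ [a, c] ++ vb1 := by (try simp [Strand.dual]) <;> rfl)
    (kb1 : x2 = u ++ [c, a] ++ vb1 := by (try simp [Strand.dual]) <;> rfl)
    (hb2 : x2 = ub2 ++ [a, b] ++ v := by (try simp [Strand.dual]) <;> rfl)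
    (kb2 : w3 = ub2 ++ [b, a] ++ v := by (try simp [Strand.dual]) <;> rfl) :
    lay u (.cross a b) va0 ha0 ka0 ⊚ lay ua1 (.cross a c) v ha1 ka1 ⊚ lay u (.cross b c) va2 ha2
      ka2 ⊚ y =
      lay ub0 (.cross b c) v hb0 kb0 ⊚ lay u (.cross a c) vb1 hb1 kb1 ⊚ lay ub2 (.cross a b) v
        hb2 kb2 ⊚ y := by
  subst eva0 eua1 eva2 eub0 evb1 eub2
  obtain rfl : w0 = u ++ a :: b :: c :: v := by simp [ha0]
  obtain rfl : w1 = u ++ b :: a :: c :: v := by simp [ka0]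
  obtain rfl : w2 = u ++ b :: c :: a :: v := by simp [ka1]
  obtain rfl : w3 = u ++ c :: b :: a :: v := by simp [ka2]
  obtain rfl : x1 = u ++ a :: c :: b :: v := by simp [kb0]
  obtain rfl : x2 = u ++ c :: a :: b :: v := by simp [kb1]
  rw [← assoc, ← assoc, ← assoc (lay _ _ _ _ _) (lay _ _ _ _ _) (_ ⊚ y), ← assoc _ _ y]
  exact congrArg (fun z => z ⊚ y) (triple u v a b c)

theorem circle_dot_tail {u v w0 w1 w2 ua1 s : Word} (y : Mor w0 s)
    (eua1 : ua1 = u ++ [Q] := by (try simp [Strand.dual]) <;> rfl)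
    (ha0 : w0 = u ++ [] ++ v := by (try simp [Strand.dual]) <;> rfl)
    (ka0 : w1 = u ++ [Q, P] ++ v := by (try simp [Strand.dual]) <;> rfl)
    (ha1 : w1 = ua1 ++ [P] ++ v := by (try simp [Strand.dual]) <;> rfl)
    (ka1 : w2 = ua1 ++ [P] ++ v := by (try simp [Strand.dual]) <;> rfl)
    (ha2 : w2 = u ++ [Q, P] ++ v := by (try simp [Strand.dual]) <;> rfl)
    (ka2 : w0 = u ++ [] ++ v := by (try simp [Strand.dual]) <;> rfl) :
    lay u (.cup Q) v ha0 ka0 ⊚ lay ua1 (.dot P) v ha1 ka1 ⊚ lay u (.cap Q) v ha2 ka2 ⊚ y =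
      y := by
  subst eua1
  obtain rfl : w0 = u ++ v := by simp [ha0]
  obtain rfl : w1 = u ++ Q :: P :: v := by simp [ka0]
  obtain rfl : w2 = u ++ Q :: P :: v := by simp [ka1]
  rw [← assoc, ← assoc]
  exact (congrArg (fun z => z ⊚ y) (circle_dot u v)).trans (id_comp y)

theorem curl_tail {u v w0 w1 w2 w3 va0 ua1 va2 s : Word} (y : Mor w3 s)
    (eva0 : va0 = P :: v := by (try simp [Strand.dual]) <;> rfl)
    (eua1 : ua1 = u ++ [Q] := by (try simp [Strand.dual]) <;> rfl)
    (eva2 : va2 = P :: v := by (try simp [Strand.dual]) <;> rfl)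
    (ha0 : w0 = u ++ [] ++ va0 := by (try simp [Strand.dual]) <;> rfl)
    (ka0 : w1 = u ++ [Q, P] ++ va0 := by (try simp [Strand.dual]) <;> rfl)
    (ha1 : w1 = ua1 ++ [P, P] ++ v := by (try simp [Strand.dual]) <;> rfl)
    (ka1 : w2 = ua1 ++ [P, P] ++ v := by (try simp [Strand.dual]) <;> rfl)
    (ha2 : w2 = u ++ [Q, P] ++ va2 := by (try simp [Strand.dual]) <;> rfl)
    (ka2 : w3 = u ++ [] ++ va2 := by (try simp [Strand.dual]) <;> rfl) :
    lay u (.cup Q) va0 ha0 ka0 ⊚ lay ua1 (.cross P P) v ha1 ka1 ⊚ lay u (.cap Q) va2 ha2 ka2 ⊚ y =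
      0 := by
  subst eva0 eua1 eva2
  obtain rfl : w0 = u ++ P :: v := by simp [ha0]
  obtain rfl : w1 = u ++ Q :: P :: P :: v := by simp [ka0]
  obtain rfl : w2 = u ++ Q :: P :: P :: v := by simp [ka1]
  obtain rfl : w3 = u ++ P :: v := by simp [ka2]
  rw [← assoc, ← assoc]
  exact (congrArg (fun z => z ⊚ y) (curl u v)).trans (zero_comp y)

end Mor

end HeisCat

end

/-! ### Height exchange and the decomposition of QP -/

noncomputable section

namespace HeisCat

open Strand

namespace Mor

open Term

local infixr:80 " ⊚ " => Mor.comp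

theorem swap_tail {w₁ w₂ w₂' w₃ u v v₁ u₂ u₃ v₄ a b c d s : Word}
    (m : Word) (g : Gen a b) (k : Gen c d) (y : Mor w₃ s)
    (hv₁ : v₁ = m ++ c ++ v := by (try simp [Strand.dual]) <;> rfl)
    (hu₂ : u₂ = u ++ b ++ m := by (try simp [Strand.dual]) <;> rfl)
    (hu₃ : u₃ = u ++ a ++ m := by (try simp [Strand.dual]) <;> rfl)
    (hv₄ : v₄ = m ++ d ++ v := by (try simp [Strand.dual]) <;> rfl)
    (h₁ : w₁ = u ++ a ++ v₁ := by (try simp [Strand.dual]) <;> rfl)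
    (h₂ : w₂ = u ++ b ++ v₁ := by (try simp [Strand.dual]) <;> rfl)
    (h₂' : w₂ = u₂ ++ c ++ v := by (try simp [Strand.dual]) <;> rfl)
    (h₃ : w₃ = u₂ ++ d ++ v := by (try simp [Strand.dual]) <;> rfl)
    (k₁ : w₁ = u₃ ++ c ++ v := by (try simp [Strand.dual]) <;> rfl)
    (k₂ : w₂' = u₃ ++ d ++ v := by (try simp [Strand.dual]) <;> rfl)
    (k₂' : w₂' = u ++ a ++ v₄ := by (try simp [Strand.dual]) <;> rfl)
    (k₃ : w₃ = u ++ b ++ v₄ := by (try simp [Strand.dual]) <;> rfl) :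
    lay u g v₁ h₁ h₂ ⊚ lay u₂ k v h₂' h₃ ⊚ y =
      ((-1 : ℂ) ^ (deg a b g * deg c d k)) • (lay u₃ k v k₁ k₂ ⊚ lay u g v₄ k₂' k₃ ⊚ y) := by
  rw [← assoc, interchange_of m g k h₁ h₂ h₂' h₃ k₁ k₂ k₂' k₃ hv₁ hu₂ hu₃ hv₄, smul_comp, assoc]

theorem swap_even {w₁ w₂ w₂' w₃ u v v₁ u₂ u₃ v₄ a b c d s : Word}
    (m : Word) (g : Gen a b) (k : Gen c d) (y : Mor w₃ s)
    (hv₁ : v₁ = m ++ c ++ v := by (try simp [Strand.dual]) <;> rfl)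
    (hu₂ : u₂ = u ++ b ++ m := by (try simp [Strand.dual]) <;> rfl)
    (hu₃ : u₃ = u ++ a ++ m := by (try simp [Strand.dual]) <;> rfl)
    (hv₄ : v₄ = m ++ d ++ v := by (try simp [Strand.dual]) <;> rfl)
    (h₁ : w₁ = u ++ a ++ v₁ := by (try simp [Strand.dual]) <;> rfl)
    (h₂ : w₂ = u ++ b ++ v₁ := by (try simp [Strand.dual]) <;> rfl)
    (h₂' : w₂ = u₂ ++ c ++ v := by (try simp [Strand.dual]) <;> rfl)
    (h₃ : w₃ = u₂ ++ d ++ v := by (try simp [Strand.dual]) <;> rfl)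
    (k₁ : w₁ = u₃ ++ c ++ v := by (try simp [Strand.dual]) <;> rfl)
    (k₂ : w₂' = u₃ ++ d ++ v := by (try simp [Strand.dual]) <;> rfl)
    (k₂' : w₂' = u ++ a ++ v₄ := by (try simp [Strand.dual]) <;> rfl)
    (k₃ : w₃ = u ++ b ++ v₄ := by (try simp [Strand.dual]) <;> rfl)
    (hgk : deg a b g * deg c d k = 0 := by simp [deg]) :
    lay u g v₁ h₁ h₂ ⊚ lay u₂ k v h₂' h₃ ⊚ y = lay u₃ k v k₁ k₂ ⊚ lay u g v₄ k₂' k₃ ⊚ y := by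
  rw [swap_tail m g k y hv₁ hu₂ hu₃ hv₄ h₁ h₂ h₂' h₃ k₁ k₂ k₂' k₃, hgk, zpow_zero,
      _root_.one_smul]

theorem swap_odd {w₁ w₂ w₂' w₃ u v v₁ u₂ u₃ v₄ a b c d s : Word}
    (m : Word) (g : Gen a b) (k : Gen c d) (y : Mor w₃ s)
    (hv₁ : v₁ = m ++ c ++ v := by (try simp [Strand.dual]) <;> rfl)
    (hu₂ : u₂ = u ++ b ++ m := by (try simp [Strand.dual]) <;> rfl)
    (hu₃ : u₃ = u ++ a ++ m := by (try simp [Strand.dual]) <;> rfl)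
    (hv₄ : v₄ = m ++ d ++ v := by (try simp [Strand.dual]) <;> rfl)
    (h₁ : w₁ = u ++ a ++ v₁ := by (try simp [Strand.dual]) <;> rfl)
    (h₂ : w₂ = u ++ b ++ v₁ := by (try simp [Strand.dual]) <;> rfl)
    (h₂' : w₂ = u₂ ++ c ++ v := by (try simp [Strand.dual]) <;> rfl)
    (h₃ : w₃ = u₂ ++ d ++ v := by (try simp [Strand.dual]) <;> rfl)
    (k₁ : w₁ = u₃ ++ c ++ v := by (try simp [Strand.dual]) <;> rfl)
    (k₂ : w₂' = u₃ ++ d ++ v := by (try simp [Strand.dual]) <;> rfl)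
    (k₂' : w₂' = u ++ a ++ v₄ := by (try simp [Strand.dual]) <;> rfl)
    (k₃ : w₃ = u ++ b ++ v₄ := by (try simp [Strand.dual]) <;> rfl)
    (hgk : Odd (deg a b g * deg c d k) := by simp [deg]) :
    lay u g v₁ h₁ h₂ ⊚ lay u₂ k v h₂' h₃ ⊚ y =
      -(lay u₃ k v k₁ k₂ ⊚ lay u g v₄ k₂' k₃ ⊚ y) := by
  rw [swap_tail m g k y hv₁ hu₂ hu₃ hv₄ h₁ h₂ h₂' h₃ k₁ k₂ k₂' k₃, hgk.neg_one_zpow, neg_smul,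
      _root_.one_smul]

theorem swap_odd' {w₁ w₂ w₂' w₃ u v v₁ u₂ u₃ v₄ a b c d s : Word}
    (m : Word) (g : Gen a b) (k : Gen c d) (y : Mor w₃ s)
    (hgk : Odd (deg a b g * deg c d k) := by simp [deg])
    (hv₁ : v₁ = m ++ c ++ v := by (try simp [Strand.dual]) <;> rfl)
    (hu₂ : u₂ = u ++ b ++ m := by (try simp [Strand.dual]) <;> rfl)
    (hu₃ : u₃ = u ++ a ++ m := by (try simp [Strand.dual]) <;> rfl)
    (hv₄ : v₄ = m ++ d ++ v := by (try simp [Strand.dual]) <;> rfl)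
    (h₁ : w₁ = u ++ a ++ v₁ := by (try simp [Strand.dual]) <;> rfl)
    (h₂ : w₂ = u ++ b ++ v₁ := by (try simp [Strand.dual]) <;> rfl)
    (h₂' : w₂ = u₂ ++ c ++ v := by (try simp [Strand.dual]) <;> rfl)
    (h₃ : w₃ = u₂ ++ d ++ v := by (try simp [Strand.dual]) <;> rfl)
    (k₁ : w₁ = u₃ ++ c ++ v := by (try simp [Strand.dual]) <;> rfl)
    (k₂ : w₂' = u₃ ++ d ++ v := by (try simp [Strand.dual]) <;> rfl)
    (k₂' : w₂' = u ++ a ++ v₄ := by (try simp [Strand.dual]) <;> rfl)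
    (k₃ : w₃ = u ++ b ++ v₄ := by (try simp [Strand.dual]) <;> rfl) :
    lay u₃ k v k₁ k₂ ⊚ lay u g v₄ k₂' k₃ ⊚ y = -(lay u g v₁ h₁ h₂ ⊚ lay u₂ k v h₂' h₃ ⊚ y) :=
  neg_eq_iff_eq_neg.1
    (swap_odd m g k y hv₁ hu₂ hu₃ hv₄ h₁ h₂ h₂' h₃ k₁ k₂ k₂' k₃ hgk).symm

/-- The Koszul sign is its own inverse, so the exchange read backwards carries the same sign. -/
theorem swap_tail' {w₁ w₂ w₂' w₃ u v v₁ u₂ u₃ v₄ a b c d s : Word}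
    (m : Word) (g : Gen a b) (k : Gen c d) (y : Mor w₃ s)
    (hv₁ : v₁ = m ++ c ++ v := by (try simp [Strand.dual]) <;> rfl)
    (hu₂ : u₂ = u ++ b ++ m := by (try simp [Strand.dual]) <;> rfl)
    (hu₃ : u₃ = u ++ a ++ m := by (try simp [Strand.dual]) <;> rfl)
    (hv₄ : v₄ = m ++ d ++ v := by (try simp [Strand.dual]) <;> rfl)
    (h₁ : w₁ = u ++ a ++ v₁ := by (try simp [Strand.dual]) <;> rfl)
    (h₂ : w₂ = u ++ b ++ v₁ := by (try simp [Strand.dual]) <;> rfl)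
    (h₂' : w₂ = u₂ ++ c ++ v := by (try simp [Strand.dual]) <;> rfl)
    (h₃ : w₃ = u₂ ++ d ++ v := by (try simp [Strand.dual]) <;> rfl)
    (k₁ : w₁ = u₃ ++ c ++ v := by (try simp [Strand.dual]) <;> rfl)
    (k₂ : w₂' = u₃ ++ d ++ v := by (try simp [Strand.dual]) <;> rfl)
    (k₂' : w₂' = u ++ a ++ v₄ := by (try simp [Strand.dual]) <;> rfl)
    (k₃ : w₃ = u ++ b ++ v₄ := by (try simp [Strand.dual]) <;> rfl) :
    lay u₃ k v k₁ k₂ ⊚ lay u g v₄ k₂' k₃ ⊚ y =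
      ((-1 : ℂ) ^ (deg a b g * deg c d k)) • (lay u g v₁ h₁ h₂ ⊚ lay u₂ k v h₂' h₃ ⊚ y) := by
  rw [swap_tail m g k y hv₁ hu₂ hu₃ hv₄ h₁ h₂ h₂' h₃ k₁ k₂ k₂' k₃, smul_smul, ← mul_zpow]
  norm_num

/-- This is the double crossing relation for QP, solved for the identity: it exhibits QP as built
from PQ and two copies of the empty word, all with fewer inversions. Both reductions, of 2-morphisms
and of objects, rest on it. -/
theorem id_eq_QP {u v w w₁ w₂ s : Word} (h : w = u ++ Q :: P :: v) (h₁ : w₁ = u ++ P :: Q :: v)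
    (h₂ : w₂ = u ++ v) (z : Mor w s) :
    z = lay u (.cross Q P) v (by simp [h]) (by simp [h₁]) ⊚
        (lay u (.cross P Q) v (by simp [h₁]) (by simp [h]) : Mor w₁ w) ⊚ z +
      (lay u (.cap Q) v (by simp [h, Strand.dual]) (by simp [h₂]) ⊚
          (lay u (.cup Q) v (by simp [h₂]) (by simp [h, Strand.dual]) : Mor w₂ w) ⊚
          lay (u ++ [Q]) (.dot P) v (by simp [h]) (by simp [h]) ⊚ z +
        (lay (u ++ [Q]) (.dot P) v (by simp [h]) (by simp [h]) : Mor w w) ⊚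
          lay u (.cap Q) v (by simp [h, Strand.dual]) (by simp [h₂]) ⊚
          (lay u (.cup Q) v (by simp [h₂]) (by simp [h, Strand.dual]) : Mor w₂ w) ⊚ z) := by
  subst h h₁ h₂
  have e := cross_cross_QP u v
  have q : z = (mk (.id _)) ⊚ z := (id_comp z).symm
  conv_lhs => rw [q, ← e]
  simp only [add_comp, assoc]

/-- A rotated left curl. A zigzag inserted on the outgoing Q is pulled down to the bottom past the
crossing and the cup, and the pitchfork relation turns the crossing of Q with P into a crossing of
two upward strands between a cup and a cap. -/
theorem cupQ_crossQP {u v w w₁ w₂ s : Word} (y : Mor w₂ s) {h : w = u ++ [] ++ v}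
    {h' : w₁ = u ++ [Q, P] ++ v} {k : w₁ = u ++ [Q, P] ++ v} {k' : w₂ = u ++ [P, Q] ++ v} :
    lay u (.cup Q) v h h' ⊚ lay u (.cross Q P) v k k' ⊚ y = 0 := by
  obtain rfl : w = u ++ v := by simp [h]
  obtain rfl : w₁ = u ++ Q :: P :: v := by simp [h']
  obtain rfl : w₂ = u ++ P :: Q :: v := by simp [k']
  have e₁ : y = (lay (u ++ [P, Q]) (.cup P) v : Mor _ (u ++ P :: Q :: P :: Q :: v)) ⊚
      lay (u ++ [P]) (.cap Q) (Q :: v) ⊚ y :=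
    (zigzag_capQ_tail (u := u ++ [P]) (v := v) y).symm
  rw [e₁]
  have e₂ : lay u (.cross Q P) v ⊚
      (lay (u ++ [P, Q]) (.cup P) v : Mor _ (u ++ P :: Q :: P :: Q :: v)) ⊚
        lay (u ++ [P]) (.cap Q) (Q :: v) ⊚ y =
      (lay (u ++ [Q, P]) (.cup P) v : Mor _ (u ++ Q :: P :: P :: Q :: v)) ⊚
        lay u (.cross Q P) (P :: Q :: v) ⊚ lay (u ++ [P]) (.cap Q) (Q :: v) ⊚ y :=
    swap_even [] (.cross Q P) (.cup P) _
  have e₃ : (lay u (.cup Q) v : Mor (u ++ v) (u ++ Q :: P :: v)) ⊚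
      (lay (u ++ [Q, P]) (.cup P) v : Mor _ (u ++ Q :: P :: P :: Q :: v)) ⊚
        lay u (.cross Q P) (P :: Q :: v) ⊚ lay (u ++ [P]) (.cap Q) (Q :: v) ⊚ y =
      (lay u (.cup P) v : Mor (u ++ v) (u ++ P :: Q :: v)) ⊚ lay u (.cup Q) (P :: Q :: v) ⊚
        (lay u (.cross Q P) (P :: Q :: v) : Mor _ (u ++ P :: Q :: P :: Q :: v)) ⊚
          lay (u ++ [P]) (.cap Q) (Q :: v) ⊚ y :=
    swap_even [] (.cup Q) (.cup P) _
  have e₄ : (lay u (.cross Q P) (P :: Q :: v) :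
        Mor (u ++ Q :: P :: P :: Q :: v) (u ++ P :: Q :: P :: Q :: v)) ⊚
          lay (u ++ [P]) (.cap Q) (Q :: v) ⊚ y =
      (lay (u ++ [Q]) (.cross P P) (Q :: v) : Mor _ (u ++ Q :: P :: P :: Q :: v)) ⊚
        lay u (.cap Q) (P :: Q :: v) ⊚ y :=
    (pitchfork_capQ_tail (u := u) (v := Q :: v) P y).symm
  have e₅ : lay u (.cup Q) (P :: Q :: v) ⊚
      (lay (u ++ [Q]) (.cross P P) (Q :: v) : Mor _ (u ++ Q :: P :: P :: Q :: v)) ⊚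
        lay u (.cap Q) (P :: Q :: v) ⊚ y = 0 :=
    curl_tail (u := u) (v := Q :: v) y
  erw [e₂, e₃, e₄, e₅]
  exact comp_zero _

/-- The upside-down version of `cupQ_crossQP`, again by rotation to a left curl. The inserted zigzag
is the one that straightens with sign -1, which is harmless for a vanishing statement. -/
theorem crossPQ_capQ {u v w w₁ w₂ s : Word} (y : Mor w₂ s) {h : w = u ++ [P, Q] ++ v}
    {h' : w₁ = u ++ [Q, P] ++ v} {k : w₁ = u ++ [Q, P] ++ v} {k' : w₂ = u ++ [] ++ v} :
    lay u (.cross P Q) v h h' ⊚ lay u (.cap Q) v k k' ⊚ y = 0 := by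
  obtain rfl : w = u ++ P :: Q :: v := by simp [h]
  obtain rfl : w₁ = u ++ Q :: P :: v := by simp [h']
  obtain rfl : w₂ = u ++ v := by simp [k']
  have e₁ : (lay (u ++ [P]) (.cup Q) (Q :: v) : Mor _ (u ++ P :: Q :: P :: Q :: v)) ⊚
      lay (u ++ [P, Q]) (.cap P) v ⊚ lay u (.cross P Q) v ⊚
        (lay u (.cap Q) v : Mor (u ++ Q :: P :: v) _) ⊚ y =
      -(lay u (.cross P Q) v ⊚ (lay u (.cap Q) v : Mor (u ++ Q :: P :: v) _) ⊚ y) :=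
    zigzag_capP'_tail (u := u ++ [P]) (v := v) _
  have e₂ : (lay u (.cross P Q) (P :: Q :: v) : Mor (u ++ P :: Q :: P :: Q :: v) _) ⊚
      (lay (u ++ [Q, P]) (.cap P) v : Mor _ (u ++ Q :: P :: v)) ⊚
        lay u (.cap Q) v ⊚ y =
      lay (u ++ [P, Q]) (.cap P) v ⊚ (lay u (.cross P Q) v : Mor (u ++ P :: Q :: v) _) ⊚
        (lay u (.cap Q) v : Mor (u ++ Q :: P :: v) _) ⊚ y :=
    swap_even [] (.cross P Q) (.cap P) _
  have e₃ : (lay u (.cap Q) (P :: Q :: v) : Mor (u ++ Q :: P :: P :: Q :: v) _) ⊚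
        lay u (.cap P) v ⊚ y = lay (u ++ [Q, P]) (.cap P) v ⊚
          (lay u (.cap Q) v : Mor (u ++ Q :: P :: v) _) ⊚ y :=
    swap_even [] (.cap Q) (.cap P) y
  have e₄ : (lay (u ++ [P]) (.cup Q) (Q :: v) : Mor _ (u ++ P :: Q :: P :: Q :: v)) ⊚
      lay u (.cross P Q) (P :: Q :: v) ⊚
      (lay u (.cap Q) (P :: Q :: v) : Mor (u ++ Q :: P :: P :: Q :: v) _) ⊚
        lay u (.cap P) v ⊚ y =
      lay u (.cup Q) (P :: Q :: v) ⊚ lay (u ++ [Q]) (.cross P P) (Q :: v) ⊚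
      (lay u (.cap Q) (P :: Q :: v) : Mor (u ++ Q :: P :: P :: Q :: v) _) ⊚
        lay u (.cap P) v ⊚ y :=
    pitchfork_cupQ_tail (u := u) (v := Q :: v) P _
  have e₅ : lay u (.cup Q) (P :: Q :: v) ⊚ lay (u ++ [Q]) (.cross P P) (Q :: v) ⊚
      (lay u (.cap Q) (P :: Q :: v) : Mor (u ++ Q :: P :: P :: Q :: v) _) ⊚
        lay u (.cap P) v ⊚ y = 0 := curl_tail (u := u) (v := Q :: v) _
  rw [← neg_eq_zero]
  erw [← e₁, ← e₂, ← e₃, e₄, e₅]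

end Mor

end HeisCat

end

/-! ### Inversions, standard words and reduced diagrams -/

noncomputable section

namespace HeisCat

open Strand

/-- The number of letters `P` of a word. -/
def numP : Word → ℕ
  | [] => 0
  | P :: w => numP w + 1
  | Q :: w => numP w

/-- The number of pairs of a letter `Q` and a letter `P` to its right. -/
def inv : Word → ℕ
  | [] => 0
  | P :: w => inv w
  | Q :: w => inv w + numP w

theorem numP_append (u v : Word) : numP (u ++ v) = numP u + numP v := by
  induction u with
  | nil => simp [numP]
  | cons a u ih => cases a <;> simp [numP, ih]; omega

/-- Together with `inv_insert_QP`, this says that resolving a factor QP strictly lowers the number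
of inversions: it is the measure of all the inductions below. -/
theorem inv_swap (u v : Word) : inv (u ++ P :: Q :: v) < inv (u ++ Q :: P :: v) := by
  induction u with
  | nil => simp [inv, numP]
  | cons a u ih => cases a <;> simp [inv, numP_append, numP] <;> omega

theorem inv_insert (u x v : Word) : inv (u ++ v) ≤ inv (u ++ (x ++ v)) := by
  induction u with
  | nil =>
    induction x with
    | nil => simp
    | cons a x ih => cases a <;> simp_all [inv] <;> omega
  | cons a u ih => cases a <;> simp_all [inv, numP_append] <;> omega

theorem inv_insert_QP (u v : Word) : inv (u ++ v) < inv (u ++ Q :: P :: v) :=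
  (inv_insert u [P, Q] v).trans_lt (inv_swap u v)

/-- Words in which no `Q` is followed by a `P`. -/
def Std (w : Word) : Prop := ∀ u v, w ≠ u ++ Q :: P :: v

/-- A factor QP in the upper word of a layer is compared with the position of the layer. It lies
entirely to one side of the layer or meets it; here the layer has no upper ends, so the only meeting
is a factor cut in the middle. The next two lemmas treat one and two upper ends. -/
theorem overlap_nil {u v u' v' : Word} (h : u ++ v = u' ++ Q :: P :: v') :
    (∃ m, u' = u ++ m ∧ v = m ++ Q :: P :: v') ∨ (∃ m, u = u' ++ Q :: P :: m ∧ v' = m ++ v) ∨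
      (u = u' ++ [Q] ∧ v = P :: v') := by
  rcases List.append_eq_append_iff.1 h with ⟨m, h1, h2⟩ | ⟨m, h1, h2⟩
  · exact .inl ⟨m, h1, h2⟩
  · rcases m with _ | ⟨a, _ | ⟨b, m⟩⟩
    · exact .inl ⟨[], by simpa using h1.symm, by simpa using h2.symm⟩
    · simp only [List.cons_append, List.nil_append, List.cons.injEq] at h2
      obtain ⟨rfl, rfl⟩ := h2
      exact .inr (.inr ⟨h1, rfl⟩)
    · simp only [List.cons_append, List.cons.injEq] at h2
      obtain ⟨rfl, rfl, rfl⟩ := h2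
      exact .inr (.inl ⟨m, h1, rfl⟩)

theorem overlap_one {u v u' v' : Word} {c : Strand} (h : u ++ c :: v = u' ++ Q :: P :: v') :
    (∃ m, u' = u ++ c :: m ∧ v = m ++ Q :: P :: v') ∨
      (∃ m, u = u' ++ Q :: P :: m ∧ v' = m ++ c :: v) ∨
      (c = Q ∧ u = u' ∧ v = P :: v') ∨ (c = P ∧ u = u' ++ [Q] ∧ v = v') := by
  rcases overlap_nil (u := u) (v := c :: v) h with ⟨m, h1, h2⟩ | ⟨m, h1, h2⟩ | ⟨h1, h2⟩
  · rcases m with _ | ⟨a, m⟩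
    · simp only [List.nil_append, List.cons.injEq] at h2
      exact .inr (.inr (.inl ⟨h2.1, by simpa using h1.symm, h2.2⟩))
    · simp only [List.cons_append, List.cons.injEq] at h2
      obtain ⟨rfl, rfl⟩ := h2
      exact .inl ⟨m, h1, rfl⟩
  · exact .inr (.inl ⟨m, h1, h2⟩)
  · simp only [List.cons.injEq] at h2
    exact .inr (.inr (.inr ⟨h2.1, h1, h2.2⟩))

theorem overlap_two {u v u' v' : Word} {c d : Strand}
    (h : u ++ c :: d :: v = u' ++ Q :: P :: v') :
    (∃ m, u' = u ++ c :: d :: m ∧ v = m ++ Q :: P :: v') ∨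
      (∃ m, u = u' ++ Q :: P :: m ∧ v' = m ++ c :: d :: v) ∨
      (c = Q ∧ d = P ∧ u = u' ∧ v = v') ∨ (d = Q ∧ u' = u ++ [c] ∧ v = P :: v') ∨
      (c = P ∧ u = u' ++ [Q] ∧ v' = d :: v) := by
  rcases overlap_one (u := u) (v := d :: v) h with
    ⟨m, h1, h2⟩ | ⟨m, h1, h2⟩ | ⟨h1, h2, h3⟩ | ⟨h1, h2, h3⟩
  · rcases m with _ | ⟨a, m⟩
    · simp only [List.nil_append, List.cons.injEq] at h2
      exact .inr (.inr (.inr (.inl ⟨h2.1, h1, h2.2⟩)))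
    · simp only [List.cons_append, List.cons.injEq] at h2
      obtain ⟨rfl, rfl⟩ := h2
      exact .inl ⟨m, h1, rfl⟩
  · exact .inr (.inl ⟨m, h1, h2⟩)
  · simp only [List.cons.injEq] at h3
    exact .inr (.inr (.inl ⟨h1, h3.1, h2, h3.2⟩))
  · exact .inr (.inr (.inr (.inr ⟨h1, h2, h3.symm⟩)))

namespace Mor

open Term

local infixr:80 " ⊚ " => Mor.comp

/-- The `2`-morphisms from `w` to `s` that are linear combinations of diagrams of the following
form: first a composite of crossings `QP → PQ`, caps `QP → 𝟏` and dotted caps `QP → 𝟏`, then a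
composite of elementary diagrams between standard words. -/
inductive Reduced (s : Word) : ∀ {w : Word}, Mor w s → Prop
  | id : Reduced s (mk (.id s))
  | zero (w : Word) : Reduced s (0 : Mor w s)
  | add {w : Word} {x y : Mor w s} : Reduced s x → Reduced s y → Reduced s (x + y)
  | smul {w : Word} (c : ℂ) {x : Mor w s} : Reduced s x → Reduced s (c • x)
  | std {w w' u v a b : Word} (g : Gen a b) (h : w = u ++ a ++ v) (h' : w' = u ++ b ++ v)
      (hw : Std w) (hw' : Std w') {x : Mor w' s} : Reduced s x → Reduced s (lay u g v h h' ⊚ x)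
  | cross {w w' u v : Word} (h : w = u ++ [Q, P] ++ v) (h' : w' = u ++ [P, Q] ++ v)
      {x : Mor w' s} : Reduced s x → Reduced s (lay u (.cross Q P) v h h' ⊚ x)
  | cap {w w' u v : Word} (h : w = u ++ [Q, P] ++ v) (h' : w' = u ++ [] ++ v)
      {x : Mor w' s} : Reduced s x → Reduced s (lay u (.cap Q) v h h' ⊚ x)
  | dotCap {w w' u u' v : Word} (k : w = u' ++ [P] ++ v) (k' : w = u' ++ [P] ++ v)
      (h : w = u ++ [Q, P] ++ v) (h' : w' = u ++ [] ++ v) (hu : u' = u ++ [Q])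
      {x : Mor w' s} : Reduced s x →
        Reduced s (lay u' (.dot P) v k k' ⊚ lay u (.cap Q) v h h' ⊚ x)

namespace Reduced

variable {s : Word}

theorem neg {w : Word} {x : Mor w s} (h : Reduced s x) : Reduced s (-x) := by
  simpa using h.smul (-1)

/-- It suffices to test a `2`-morphism on the three summands of `QP`. -/
theorem of_QP {u v w w₁ w₂ : Word} (h : w = u ++ Q :: P :: v) (h₁ : w₁ = u ++ P :: Q :: v)
    (h₂ : w₂ = u ++ v) (z : Mor w s)
    (H₁ : Reduced s (lay u (.cross P Q) v (by simp [h₁]) (by simp [h]) ⊚ z : Mor w₁ s))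
    (H₂ : Reduced s ((lay u (.cup Q) v (by simp [h₂]) (by simp [h, Strand.dual]) : Mor w₂ w) ⊚
      lay (u ++ [Q]) (.dot P) v (by simp [h]) (by simp [h]) ⊚ z : Mor w₂ s))
    (H₃ : Reduced s (lay u (.cup Q) v (by simp [h₂]) (by simp [h, Strand.dual]) ⊚ z :
      Mor w₂ s)) : Reduced s z := by
  rw [id_eq_QP h h₁ h₂ z]
  exact .add (.cross _ _ H₁) (.add (.cap _ _ H₂) (.dotCap _ _ _ _ rfl H₃))

/-- The constructors `id` and `std` start at standard words. Out of any other word a reduced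
2-morphism is thus a combination of composites beginning with a crossing, cap or dotted cap on QP,
and linear properties need only be tested on these. -/
theorem of_not_std {w : Word} (hw : ¬Std w) {p : Mor w s → Prop} {x : Mor w s}
    (hx : Reduced s x) (hs : Std s) (zero : p 0) (add : ∀ x y, p x → p y → p (x + y))
    (smul : ∀ (c : ℂ) x, p x → p (c • x))
    (cross : ∀ {w' u v : Word} (h : w = u ++ [Q, P] ++ v) (h' : w' = u ++ [P, Q] ++ v)
      {x : Mor w' s}, Reduced s x → p (lay u (.cross Q P) v h h' ⊚ x))
    (cap : ∀ {w' u v : Word} (h : w = u ++ [Q, P] ++ v) (h' : w' = u ++ [] ++ v)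
      {x : Mor w' s}, Reduced s x → p (lay u (.cap Q) v h h' ⊚ x))
    (dotCap : ∀ {w' u u' v : Word} (k : w = u' ++ [P] ++ v) (k' : w = u' ++ [P] ++ v)
      (h : w = u ++ [Q, P] ++ v) (h' : w' = u ++ [] ++ v) (_ : u' = u ++ [Q])
      {x : Mor w' s}, Reduced s x →
        p (lay u' (.dot P) v k k' ⊚ lay u (.cap Q) v h h' ⊚ x)) : p x := by
  induction hx with
  | id => exact absurd hs hw
  | zero => exact zero
  | add _ _ h h' =>
    exact add _ _ (h hw zero add smul cross cap dotCap) (h' hw zero add smul cross cap dotCap)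
  | smul c _ h => exact smul c _ (h hw zero add smul cross cap dotCap)
  | std _ _ _ h => exact absurd h hw
  | cross h h' hx => exact cross h h' hx
  | cap h h' hx => exact cap h h' hx
  | dotCap k k' h h' hu hx => exact dotCap k k' h h' hu hx

end Reduced

end Mor

end HeisCat

end

/-! ### Layers that meet a reducing move -/

noncomputable section

namespace HeisCat

open Strand

namespace Mor

open Term

local infixr:80 " ⊚ " => Mor.comp

namespace Reduced

theorem congr {s w : Word} {x y : Mor w s} (h : x = y) (hy : Reduced s y) : Reduced s x := h ▸ hy

/-- Elementary diagrams between words with less than `N` inversions preserve reduced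
`2`-morphisms. -/
def ClosedBelow (s : Word) (N : ℕ) : Prop :=
  ∀ ⦃w w' u v a b : Word⦄ (g : Gen a b) (h : w = u ++ a ++ v) (h' : w' = u ++ b ++ v)
    (x : Mor w' s), inv w < N → inv w' < N → Reduced s x → Reduced s (lay u g v h h' ⊚ x)

/-- The composites of `z` with the reducing moves at a given position are reduced. -/
def MoveClosed (s : Word) {w w' : Word} (z : Mor w w') (u v : Word) : Prop :=
  (∀ (w₁ : Word) (h : w' = u ++ [Q, P] ++ v) (h₁ : w₁ = u ++ [P, Q] ++ v) (y : Mor w₁ s),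
    Reduced s y → Reduced s (z ⊚ lay u (.cross Q P) v h h₁ ⊚ y)) ∧
  (∀ (w₁ : Word) (h : w' = u ++ [Q, P] ++ v) (h₁ : w₁ = u ++ [] ++ v) (y : Mor w₁ s),
    Reduced s y → Reduced s (z ⊚ lay u (.cap Q) v h h₁ ⊚ y)) ∧
  (∀ (w₁ : Word) (k : w' = (u ++ [Q]) ++ [P] ++ v) (k' : w' = (u ++ [Q]) ++ [P] ++ v)
    (h : w' = u ++ [Q, P] ++ v) (h₁ : w₁ = u ++ [] ++ v) (y : Mor w₁ s),
    Reduced s y →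
      Reduced s (z ⊚ lay (u ++ [Q]) (.dot P) v k k' ⊚ lay u (.cap Q) v h h₁ ⊚ y))

variable {s : Word} {N : ℕ} {u v : Word}

/-- The dot slides through the crossing to a word with fewer inversions, or around the cap to the
strand P, where it forms a dotted cap. -/
theorem moveClosed_dotQ (ih : ClosedBelow s N) (hN : inv (u ++ Q :: P :: v) ≤ N) :
    MoveClosed s (lay u (.dot Q) (P :: v) : Mor (u ++ Q :: P :: v) (u ++ Q :: P :: v)) u v := by
  have i₁ := (inv_swap u v).trans_le hN
  refine ⟨fun w₁ h h₁ y hy => ?_, fun w₁ h h₁ y hy => ?_, fun w₁ k k' h h₁ y hy => ?_⟩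
  · obtain rfl : w₁ = u ++ P :: Q :: v := by simp [h₁]
    exact .congr (dot_cross_tail Q P _) (.cross _ _ (ih _ _ _ _ i₁ i₁ hy))
  · obtain rfl : w₁ = u ++ v := by simp [h₁]
    exact .congr (dot_capQ_tail _) (.dotCap _ _ _ _ rfl hy)
  · obtain rfl : w₁ = u ++ v := by simp [h₁]
    -- With a dotted cap there are two dots: after exchanging their heights the dot on Q slides
    -- around the cap onto the other dot, and v² = 0.
    refine .congr (swap_odd [] (.dot Q) (.dot P) _) (.neg ?_)
    exact .congr ((congrArg (Mor.comp _) (dot_capQ_tail _)).trans (dot_dot_tail P _)) (.zero _)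

theorem moveClosed_dotP (ih : ClosedBelow s N) (hN : inv (u ++ Q :: P :: v) ≤ N) :
    MoveClosed s (lay (u ++ [Q]) (.dot P) v : Mor (u ++ Q :: P :: v) (u ++ Q :: P :: v)) u v := by
  have i₁ := (inv_swap u v).trans_le hN
  refine ⟨fun w₁ h h₁ y hy => ?_, fun w₁ h h₁ y hy => ?_, fun w₁ k k' h h₁ y hy => ?_⟩
  · obtain rfl : w₁ = u ++ P :: Q :: v := by simp [h₁]
    exact .congr (dot_cross'_tail Q P _) (.cross _ _ (ih _ _ _ _ i₁ i₁ hy))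
  · exact .dotCap _ _ _ _ rfl hy
  · exact .congr (dot_dot_tail P _) (.zero _)

/-- The double crossing of PQ is the identity, and the crossing followed by the cap is a rotated
left curl, also when a dot slides through it. -/
theorem moveClosed_crossPQ :
    MoveClosed s (lay u (.cross P Q) v : Mor (u ++ P :: Q :: v) (u ++ Q :: P :: v)) u v := by
  refine ⟨fun w₁ h h₁ y hy => ?_, fun w₁ h h₁ y hy => ?_, fun w₁ k k' h h₁ y hy => ?_⟩
  · obtain rfl : w₁ = u ++ P :: Q :: v := by simp [h₁]
    exact .congr (cross_cross_tail P Q (by simp) _) hy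
  · exact .congr (crossPQ_capQ _) (.zero _)
  · refine .congr (dot_cross_tail P Q _).symm ?_
    exact .congr ((congrArg (Mor.comp _) (crossPQ_capQ _)).trans (comp_zero _)) (.zero _)

/-- The crossing shares a strand with the reducing crossing, so heights cannot be exchanged. But the
source QQP itself contains QP, and it suffices to test on the three summands of that factor: on PQ
the triple point relation puts a reducing crossing first, and on the two empty summands a pitchfork
creates a double crossing of PQ, which disappears. Caps are handled directly by a pitchfork. -/
theorem moveClosed_crossQQ (ih : ClosedBelow s N) (hN : inv (u ++ Q :: Q :: P :: v) ≤ N) :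
    MoveClosed s (lay u (.cross Q Q) (P :: v) :
      Mor (u ++ Q :: Q :: P :: v) (u ++ Q :: Q :: P :: v)) (u ++ [Q]) v := by
  have i₁ : inv (u ++ Q :: P :: Q :: v) < N :=
    lt_of_lt_of_le (by simpa using inv_swap (u ++ [Q]) v) hN
  have i₂ : inv (u ++ P :: Q :: Q :: v) < N := (inv_swap u (Q :: v)).trans i₁
  have i₃ : inv (u ++ Q :: v) < N := (inv_insert_QP u (Q :: v)).trans i₁
  refine ⟨fun w₁ h h₁ y hy => ?_, fun w₁ h h₁ y hy => ?_, fun w₁ k k' h h₁ y hy => ?_⟩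
  · obtain rfl : w₁ = u ++ Q :: P :: Q :: v := by simp [h₁]
    refine of_QP (u := u ++ [Q]) (v := v) (w₁ := u ++ Q :: P :: Q :: v) (w₂ := u ++ Q :: v)
      (by simp) (by simp) (by simp) _ ?_ ?_ ?_
    · exact .congr (triple_tail Q P Q _).symm
        (.cross _ _ (ih _ _ _ _ i₂ i₂ (ih _ _ _ _ i₂ i₁ hy)))
    · refine .congr (congrArg (Mor.comp _) ((swap_even [] (.cross Q Q) (.dot P) _).symm.trans
        (congrArg (Mor.comp _) (dot_cross'_tail (u := u ++ [Q]) Q P _)))) ?_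
      refine .congr (pitchfork_cupQ_tail Q _) ?_
      refine .congr (congrArg (Mor.comp _) (cross_cross_tail P Q (by simp) _)) ?_
      exact ih _ _ _ _ i₃ i₁ (ih _ _ _ _ i₁ i₁ hy)
    · refine .congr (pitchfork_cupQ_tail Q _) ?_
      refine .congr (congrArg (Mor.comp _) (cross_cross_tail P Q (by simp) _)) ?_
      exact ih _ _ _ _ i₃ i₁ hy
  · obtain rfl : w₁ = u ++ Q :: v := by simp [h₁]
    exact .congr (pitchfork_capQ_tail Q _).symm (.cross _ _ (.cap _ _ hy))
  · obtain rfl : w₁ = u ++ Q :: v := by simp [h₁]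
    refine .congr (swap_even [] (.cross Q Q) (.dot P) _) ?_
    refine .congr (congrArg (Mor.comp _) (pitchfork_capQ_tail Q _).symm) ?_
    refine .congr (dot_cross'_tail (u := u ++ [Q]) Q P _) ?_
    exact .cross _ _ (.dotCap _ _ _ _ rfl hy)

/-- The mirror image of `moveClosed_crossQQ`, with the triple point relation for P, Q, P. -/
theorem moveClosed_crossPP (ih : ClosedBelow s N) (hN : inv (u ++ Q :: P :: P :: v) ≤ N) :
    MoveClosed s (lay (u ++ [Q]) (.cross P P) v :
      Mor (u ++ Q :: P :: P :: v) (u ++ Q :: P :: P :: v)) u (P :: v) := by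
  have i₁ : inv (u ++ P :: Q :: P :: v) < N := (inv_swap u (P :: v)).trans_le hN
  have i₂ : inv (u ++ P :: P :: Q :: v) < N :=
    lt_trans (by simpa using inv_swap (u ++ [P]) v) i₁
  have i₃ : inv (u ++ P :: v) < N := (inv_insert_QP u (P :: v)).trans_le hN
  refine ⟨fun w₁ h h₁ y hy => ?_, fun w₁ h h₁ y hy => ?_, fun w₁ k k' h h₁ y hy => ?_⟩
  · obtain rfl : w₁ = u ++ P :: Q :: P :: v := by simp [h₁]
    refine of_QP (u := u) (v := P :: v) (w₁ := u ++ P :: Q :: P :: v) (w₂ := u ++ P :: v)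
      (by simp) (by simp) (by simp) _ ?_ ?_ ?_
    · exact .congr (triple_tail P Q P _)
        (.cross _ _ (ih _ _ _ _ i₂ i₂ (ih _ _ _ _ i₂ i₁ hy)))
    · refine .congr (congrArg (Mor.comp _) ((dot_cross_tail (u := u ++ [Q]) P P _).trans
        (congrArg (Mor.comp _) (swap_even [] (.cross Q P) (.dot P) _).symm))) ?_
      refine .congr (pitchfork_cupQ_tail P _).symm ?_
      refine .congr (congrArg (Mor.comp _) (cross_cross_tail P Q (by simp) _)) ?_
      exact ih _ _ _ _ i₃ i₁ (ih _ _ _ _ i₁ i₁ hy)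
    · refine .congr (pitchfork_cupQ_tail P _).symm ?_
      refine .congr (congrArg (Mor.comp _) (cross_cross_tail P Q (by simp) _)) ?_
      exact ih _ _ _ _ i₃ i₁ hy
  · obtain rfl : w₁ = u ++ P :: v := by simp [h₁]
    exact .congr (pitchfork_capQ_tail P _) (.cross _ _ (.cap _ _ hy))
  · obtain rfl : w₁ = u ++ P :: v := by simp [h₁]
    refine .congr (dot_cross'_tail (u := u ++ [Q]) P P _).symm ?_
    refine .congr (congrArg (Mor.comp _) (pitchfork_capQ_tail P _)) ?_
    refine .congr (swap_even [] (.cross Q P) (.dot P) _).symm ?_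
    exact .cross _ _ (.dotCap _ _ _ _ (by simp) hy)

/-- The new Q and the old P form the factor QP. A crossing of them is removed by a pitchfork, a cap
on them straightens the zigzag, and a dot on the old P is first moved below the cup. -/
theorem moveClosed_cupP_left (ih : ClosedBelow s N) (hN : inv (u ++ P :: Q :: P :: v) ≤ N) :
    MoveClosed s (lay u (.cup P) (P :: v) : Mor (u ++ P :: v) (u ++ P :: Q :: P :: v))
      (u ++ [P]) v := by
  have i₁ : inv (u ++ P :: P :: Q :: v) < N :=
    lt_of_lt_of_le (by simpa using inv_swap (u ++ [P]) v) hN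
  have i₂ : inv (u ++ P :: v) < N :=
    lt_of_lt_of_le (by simpa using inv_insert_QP (u ++ [P]) v) hN
  refine ⟨fun w₁ h h₁ y hy => ?_, fun w₁ h h₁ y hy => ?_, fun w₁ k k' h h₁ y hy => ?_⟩
  · obtain rfl : w₁ = u ++ P :: P :: Q :: v := by simp [h₁]
    exact .congr (pitchfork_cupP_tail P _).symm (ih _ _ _ _ i₂ i₁ (ih _ _ _ _ i₁ i₁ hy))
  · obtain rfl : w₁ = u ++ P :: v := by simp [h₁]
    exact .congr (zigzag_capQ'_tail _) hy
  · obtain rfl : w₁ = u ++ P :: v := by simp [h₁]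
    refine .congr (swap_even [] (.cup P) (.dot P) _) ?_
    refine .congr (congrArg (Mor.comp _) (zigzag_capQ'_tail _)) ?_
    exact ih _ _ _ _ i₂ i₂ hy

theorem moveClosed_cupP_right (ih : ClosedBelow s N) (hN : inv (u ++ Q :: P :: Q :: v) ≤ N) :
    MoveClosed s (lay (u ++ [Q]) (.cup P) v : Mor (u ++ Q :: v) (u ++ Q :: P :: Q :: v))
      u (Q :: v) := by
  have i₁ : inv (u ++ P :: Q :: Q :: v) < N := (inv_swap u (Q :: v)).trans_le hN
  have i₂ : inv (u ++ Q :: v) < N := (inv_insert_QP u (Q :: v)).trans_le hN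
  refine ⟨fun w₁ h h₁ y hy => ?_, fun w₁ h h₁ y hy => ?_, fun w₁ k k' h h₁ y hy => ?_⟩
  · obtain rfl : w₁ = u ++ P :: Q :: Q :: v := by simp [h₁]
    exact .congr (pitchfork_cupP_tail Q _) (ih _ _ _ _ i₂ i₁ (ih _ _ _ _ i₁ i₁ hy))
  · obtain rfl : w₁ = u ++ Q :: v := by simp [h₁]
    exact .congr (zigzag_capQ_tail _) hy
  · obtain rfl : w₁ = u ++ Q :: v := by simp [h₁]
    refine .congr (dot_cupP_tail (u := u ++ [Q]) _) ?_
    refine .congr (congrArg (Mor.comp _) (swap_even [] (.cap Q) (.dot Q) _).symm) ?_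
    refine .congr (zigzag_capQ_tail _) ?_
    exact ih _ _ _ _ i₂ i₂ hy

/-- The three reducing moves take the counterclockwise cup to 0 (curl), 0 (plain circle) and the
identity (dotted circle). -/
theorem moveClosed_cupQ :
    MoveClosed s (lay u (.cup Q) v : Mor (u ++ v) (u ++ Q :: P :: v)) u v := by
  refine ⟨fun w₁ h h₁ y hy => ?_, fun w₁ h h₁ y hy => ?_, fun w₁ k k' h h₁ y hy => ?_⟩
  · exact .congr (cupQ_crossQP _) (.zero _)
  · obtain rfl : w₁ = u ++ v := by simp [h₁]
    exact .congr (circle_tail _) (.zero _)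
  · obtain rfl : w₁ = u ++ v := by simp [h₁]
    exact .congr (circle_dot_tail _) hy

/-- Here the factor QP lies in the source and is destroyed by the cap, so the target may already be
standard. Testing on the three summands of this QP gives a pitchfork or a zigzag in each case. -/
theorem capP_left (ih : ClosedBelow s N) (hN : inv (u ++ P :: Q :: P :: v) ≤ N) {x : Mor (u ++ P :: v) s}
    (hx : Reduced s x) :
    Reduced s ((lay u (.cap P) (P :: v) : Mor (u ++ P :: Q :: P :: v) (u ++ P :: v)) ⊚ x) := by
  have i₁ : inv (u ++ P :: P :: Q :: v) < N :=
    lt_of_lt_of_le (by simpa using inv_swap (u ++ [P]) v) hN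
  have i₂ : inv (u ++ P :: v) < N :=
    lt_of_lt_of_le (by simpa using inv_insert_QP (u ++ [P]) v) hN
  refine of_QP (u := u ++ [P]) (v := v) (w₁ := u ++ P :: P :: Q :: v) (w₂ := u ++ P :: v)
      (by simp) (by simp) (by simp) _ ?_ ?_ ?_
  · exact .congr (pitchfork_capP_tail P _) (ih _ _ _ _ i₁ i₁ (ih _ _ _ _ i₁ i₂ hx))
  · refine .congr ((congrArg (Mor.comp _) (swap_odd' [] (.cap P) (.dot P) _)).trans
      (comp_neg _ _)) (.neg ?_)
    exact .congr (zigzag_capP_tail _) (ih _ _ _ _ i₂ i₂ hx)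
  · exact .congr (zigzag_capP_tail _) hx

theorem capP_right (ih : ClosedBelow s N) (hN : inv (u ++ Q :: P :: Q :: v) ≤ N) {x : Mor (u ++ Q :: v) s}
    (hx : Reduced s x) :
    Reduced s ((lay (u ++ [Q]) (.cap P) v : Mor (u ++ Q :: P :: Q :: v) (u ++ Q :: v)) ⊚ x) := by
  have i₁ : inv (u ++ P :: Q :: Q :: v) < N := (inv_swap u (Q :: v)).trans_le hN
  have i₂ : inv (u ++ Q :: v) < N := (inv_insert_QP u (Q :: v)).trans_le hN
  refine of_QP (u := u) (v := Q :: v) (w₁ := u ++ P :: Q :: Q :: v) (w₂ := u ++ Q :: v)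
      (by simp) (by simp) (by simp) _ ?_ ?_ ?_
  · exact .congr (pitchfork_capP_tail Q _).symm (ih _ _ _ _ i₁ i₁ (ih _ _ _ _ i₁ i₂ hx))
  · refine .congr ((congrArg (Mor.comp _) (dot_capP_tail (u := u ++ [Q]) _)).trans
      (swap_odd [] (.cup Q) (.dot Q) _)) (.neg ?_)
    refine .congr ((congrArg (Mor.comp _) (zigzag_capP'_tail _)).trans (comp_neg _ _)) (.neg ?_)
    exact ih _ _ _ _ i₂ i₂ hx
  · exact .congr (zigzag_capP'_tail _) hx.neg

end Reduced

end Mor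

end HeisCat

end

/-! ### All diagrams into a standard word are reduced -/

noncomputable section

namespace HeisCat

open Strand

namespace Mor

open Term

local infixr:80 " ⊚ " => Mor.comp

namespace Reduced

variable {s : Word} {N : ℕ}

/-- The reducing move acts to the left of `g` and is exchanged with it. Then `g` connects words in
which a factor QP has been resolved, so that the induction hypothesis applies to it. The dotted cap
needs two exchanges. -/
theorem moveClosed_of_left (ih : ClosedBelow s N) {u m v w w' u₃ v₄ a b : Word} (g : Gen a b)
    (hu₃ : u₃ = u ++ Q :: P :: m) (hv₄ : v₄ = m ++ b ++ v)
    (h : w = u₃ ++ a ++ v) (h' : w' = u₃ ++ b ++ v) (hN : inv w ≤ N) (hN' : inv w' ≤ N) :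
    MoveClosed s (lay u₃ g v h h') u v₄ := by
  subst hu₃ hv₄ h h'
  have e : ∀ x : Word, u ++ Q :: P :: m ++ x ++ v = u ++ Q :: P :: (m ++ x ++ v) := by simp
  rw [e] at hN hN'
  have i₁ := (inv_swap u (m ++ a ++ v)).trans_le hN
  have i₂ := (inv_swap u (m ++ b ++ v)).trans_le hN'
  have j₁ := (inv_insert_QP u (m ++ a ++ v)).trans_le hN
  have j₂ := (inv_insert_QP u (m ++ b ++ v)).trans_le hN'
  refine ⟨fun w₁ h h₁ y hy => ?_, fun w₁ h h₁ y hy => ?_, fun w₁ k k' h h₁ y hy => ?_⟩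
  · obtain rfl : w₁ = u ++ P :: Q :: (m ++ b ++ v) := by simp [h₁]
    exact .congr (swap_tail' m (.cross Q P) g _ (w₂ := u ++ P :: Q :: (m ++ a ++ v)))
      (.smul _ (.cross _ _ (ih _ _ _ _ i₁ i₂ hy)))
  · obtain rfl : w₁ = u ++ (m ++ b ++ v) := by simp [h₁]
    exact .congr (swap_tail' m (.cap Q) g _ (w₂ := u ++ (m ++ a ++ v)))
      (.smul _ (.cap _ _ (ih _ _ _ _ j₁ j₂ hy)))
  · obtain rfl : w₁ = u ++ (m ++ b ++ v) := by simp [h₁]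
    refine .congr (swap_tail' m (.dot P) g _ (u := u ++ [Q]) (v₁ := m ++ a ++ v)
      (w₂ := u ++ Q :: P :: m ++ a ++ v)) (.smul _ ?_)
    refine .congr ((congrArg (Mor.comp _) (swap_tail' m (.cap Q) g _
      (v₁ := m ++ a ++ v) (w₂ := u ++ (m ++ a ++ v)))).trans (comp_smul _ _ _)) (.smul _ ?_)
    exact .dotCap _ _ _ _ rfl (ih _ _ _ _ j₁ j₂ hy)

theorem moveClosed_of_right (ih : ClosedBelow s N) {u m v w w' u₂ v₁ a b : Word} (g : Gen a b)
    (hu₂ : u₂ = u ++ b ++ m) (hv₁ : v₁ = m ++ Q :: P :: v)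
    (h : w = u ++ a ++ v₁) (h' : w' = u ++ b ++ v₁) (hN : inv w ≤ N) (hN' : inv w' ≤ N) :
    MoveClosed s (lay u g v₁ h h') u₂ v := by
  subst hu₂ hv₁ h h'
  have e : ∀ x : Word, u ++ x ++ (m ++ Q :: P :: v) = u ++ x ++ m ++ Q :: P :: v := by simp
  rw [e] at hN hN'
  have i₁ := (inv_swap (u ++ a ++ m) v).trans_le hN
  have i₂ := (inv_swap (u ++ b ++ m) v).trans_le hN'
  have j₁ := (inv_insert_QP (u ++ a ++ m) v).trans_le hN
  have j₂ := (inv_insert_QP (u ++ b ++ m) v).trans_le hN'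
  refine ⟨fun w₁ h h₁ y hy => ?_, fun w₁ h h₁ y hy => ?_, fun w₁ k k' h h₁ y hy => ?_⟩
  · obtain rfl : w₁ = u ++ b ++ m ++ P :: Q :: v := by simp [h₁]
    exact .congr (swap_tail m g (.cross Q P) _ (w₂' := u ++ a ++ m ++ P :: Q :: v))
      (.smul _ (.cross _ _ (ih _ _ _ _ i₁ i₂ hy)))
  · obtain rfl : w₁ = u ++ b ++ m ++ v := by simp [h₁]
    exact .congr (swap_tail m g (.cap Q) _ (w₂' := u ++ a ++ m ++ v))
      (.smul _ (.cap _ _ (ih _ _ _ _ j₁ j₂ hy)))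
  · obtain rfl : w₁ = u ++ b ++ m ++ v := by simp [h₁]
    refine .congr (swap_tail (m ++ [Q]) g (.dot P) _ (u₃ := u ++ a ++ m ++ [Q])
      (w₂' := u ++ a ++ (m ++ Q :: P :: v))) (.smul _ ?_)
    refine .congr ((congrArg (Mor.comp _) (swap_tail m g (.cap Q) _
      (u₃ := u ++ a ++ m) (w₂' := u ++ a ++ m ++ v))).trans (comp_smul _ _ _)) (.smul _ ?_)
    exact .dotCap _ _ _ _ rfl (ih _ _ _ _ j₁ j₂ hy)

theorem of_moveClosed {w w' u v a b : Word} (g : Gen a b) (h : w = u ++ a ++ v)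
    (h' : w' = u ++ b ++ v) (hs : Std s) (hw' : ¬Std w') {x : Mor w' s} (hx : Reduced s x)
    (H : ∀ u' v', w' = u' ++ Q :: P :: v' → MoveClosed s (lay u g v h h') u' v') :
    Reduced s (lay u g v h h' ⊚ x) := by
  refine of_not_std hw' (p := fun x => Reduced s (lay u g v h h' ⊚ x)) hx hs ?_ ?_ ?_ ?_ ?_ ?_
  · exact .congr (comp_zero _) (.zero _)
  · intro x y hx hy
    exact .congr (comp_add _ _ _) (.add hx hy)
  · intro c x hx
    exact .congr (comp_smul _ _ _) (.smul c hx)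
  · intro w₁ u' v' k k' y hy
    exact (H u' v' (by simp [k])).1 _ _ _ _ hy
  · intro w₁ u' v' k k' y hy
    exact (H u' v' (by simp [k])).2.1 _ _ _ _ hy
  · intro w₁ u' u'' v' k k' h h' hu y hy
    subst hu
    exact (H u' v' (by simp [h])).2.2 _ _ _ _ _ _ hy

theorem std_of_insert {u v : Word} (h : Std (u ++ P :: Q :: v)) : Std (u ++ v) := by
  intro u' v' e
  rcases overlap_nil e with ⟨m, h1, h2⟩ | ⟨m, h1, h2⟩ | ⟨h1, h2⟩
  · exact h (u ++ P :: Q :: m) v' (by simp [h2])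
  · exact h u' (m ++ P :: Q :: v) (by simp [h1])
  · exact h u' (Q :: P :: v') (by simp [h1, h2])

/-- A factor QP created by inserting PQ must use a Q directly before it or a P directly after it. -/
theorem std_insert {u v : Word} (h : Std (u ++ v)) (hu : ∀ u', u ≠ u' ++ [Q])
    (hv : ∀ v', v ≠ P :: v') : Std (u ++ P :: Q :: v) := by
  intro u' v' e
  rcases overlap_two e with ⟨m, h1, h2⟩ | ⟨m, h1, h2⟩ | ⟨h1, h2, h3⟩ | ⟨h1, h2, h3⟩ | ⟨h1, h2, h3⟩
  · exact h (u ++ m) v' (by simp [h2])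
  · exact h u' (m ++ v) (by simp [h1])
  · cases h1
  · exact hv _ h3
  · exact hu _ h2

/-- If the layer connects standard words it is allowed as it stands; the crossing QP → PQ and the
cap of QP are reducing moves themselves. Otherwise the 2-morphism above usually begins with a
reducing move, and the relative position of this move and the layer selects one of the lemmas above.
Every layer that remains then lies between words with fewer inversions. -/
theorem layer_comp_of_closedBelow (hs : Std s) (ih : ClosedBelow s N)
    {w w' u v a b : Word} (g : Gen a b) (h : w = u ++ a ++ v) (h' : w' = u ++ b ++ v)
    {x : Mor w' s} (hw : inv w ≤ N) (hw' : inv w' ≤ N) (hx : Reduced s x) :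
    Reduced s (lay u g v h h' ⊚ x) := by
  cases g with
  | cross c d =>
    cases c <;> cases d
    · by_cases hS : Std w'
      · exact .std _ _ _ (by rwa [h, ← h']) hS hx
      refine of_moveClosed _ _ _ hs hS hx fun u' v' e => ?_
      rcases overlap_two (u := u) (v := v) (c := P) (d := P) (by rw [← e, h']; simp) with
        ⟨m, h1, h2⟩ | ⟨m, h1, h2⟩ | ⟨h1, h2, h3⟩ | ⟨h1, h2, h3⟩ | ⟨h1, h2, h3⟩
      · exact moveClosed_of_right ih _ (by simp [h1]) h2 _ _ hw hw'
      · exact moveClosed_of_left ih _ h1 (by simp [h2]) _ _ hw hw'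
      · cases h1
      · cases h1
      · subst h2 h3
        obtain rfl : w = u' ++ Q :: P :: P :: v := by simp [h]
        obtain rfl : w' = u' ++ Q :: P :: P :: v := by simp [h']
        exact moveClosed_crossPP ih hw
    · refine of_moveClosed _ _ _ hs (fun hS => hS u v (by simp [h'])) hx fun u' v' e => ?_
      rcases overlap_two (u := u) (v := v) (c := Q) (d := P) (by rw [← e, h']; simp) with
        ⟨m, h1, h2⟩ | ⟨m, h1, h2⟩ | ⟨h1, h2, h3, h4⟩ | ⟨h1, h2, h3⟩ | ⟨h1, h2, h3⟩
      · exact moveClosed_of_right ih _ (by simp [h1]) h2 _ _ hw hw'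
      · exact moveClosed_of_left ih _ h1 (by simp [h2]) _ _ hw hw'
      · subst h3 h4
        obtain rfl : w = u ++ P :: Q :: v := by simp [h]
        obtain rfl : w' = u ++ Q :: P :: v := by simp [h']
        exact moveClosed_crossPQ
      · cases h1
      · cases h1
    · exact .cross _ _ hx
    · by_cases hS : Std w'
      · exact .std _ _ _ (by rwa [h, ← h']) hS hx
      refine of_moveClosed _ _ _ hs hS hx fun u' v' e => ?_
      rcases overlap_two (u := u) (v := v) (c := Q) (d := Q) (by rw [← e, h']; simp) with
        ⟨m, h1, h2⟩ | ⟨m, h1, h2⟩ | ⟨h1, h2, h3⟩ | ⟨h1, h2, h3⟩ | ⟨h1, h2, h3⟩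
      · exact moveClosed_of_right ih _ (by simp [h1]) h2 _ _ hw hw'
      · exact moveClosed_of_left ih _ h1 (by simp [h2]) _ _ hw hw'
      · cases h2
      · subst h2 h3
        obtain rfl : w = u ++ Q :: Q :: P :: v' := by simp [h]
        obtain rfl : w' = u ++ Q :: Q :: P :: v' := by simp [h']
        exact moveClosed_crossQQ ih hw
      · cases h1
  | dot c =>
    by_cases hS : Std w'
    · exact .std _ _ _ (by rwa [h, ← h']) hS hx
    refine of_moveClosed _ _ _ hs hS hx fun u' v' e => ?_
    rcases overlap_one (u := u) (v := v) (c := c) (by rw [← e, h']; simp) with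
      ⟨m, h1, h2⟩ | ⟨m, h1, h2⟩ | ⟨h1, h2, h3⟩ | ⟨h1, h2, h3⟩
    · exact moveClosed_of_right ih _ (by simp [h1]) h2 _ _ hw hw'
    · exact moveClosed_of_left ih _ h1 (by simp [h2]) _ _ hw hw'
    · subst h1 h2 h3
      obtain rfl : w = u ++ Q :: P :: v' := by simp [h]
      obtain rfl : w' = u ++ Q :: P :: v' := by simp [h']
      exact moveClosed_dotQ ih hw
    · subst h1 h2 h3
      obtain rfl : w = u' ++ Q :: P :: v := by simp [h]
      obtain rfl : w' = u' ++ Q :: P :: v := by simp [h']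
      exact moveClosed_dotP ih hw
  | cup c =>
    cases c
    · by_cases hS : Std w'
      · have hS' : Std (u ++ P :: Q :: v) := by simpa [h', Strand.dual] using hS
        exact .std _ _ _ (by rw [h]; simpa using std_of_insert hS') hS hx
      refine of_moveClosed _ _ _ hs hS hx fun u' v' e => ?_
      rcases overlap_two (u := u) (v := v) (c := P) (d := Q)
          (by rw [← e, h']; simp [Strand.dual]) with
        ⟨m, h1, h2⟩ | ⟨m, h1, h2⟩ | ⟨h1, h2, h3⟩ | ⟨h1, h2, h3⟩ | ⟨h1, h2, h3⟩
      · exact moveClosed_of_right ih _ (by simp [h1, Strand.dual]) h2 _ _ hw hw'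
      · exact moveClosed_of_left ih _ h1 (by simp [h2, Strand.dual]) _ _ hw hw'
      · cases h1
      · subst h2 h3
        obtain rfl : w = u ++ P :: v' := by simp [h]
        obtain rfl : w' = u ++ P :: Q :: P :: v' := by simp [h', Strand.dual]
        exact moveClosed_cupP_left ih hw'
      · subst h2 h3
        obtain rfl : w = u' ++ Q :: v := by simp [h]
        obtain rfl : w' = u' ++ Q :: P :: Q :: v := by simp [h', Strand.dual]
        exact moveClosed_cupP_right ih hw'
    · refine of_moveClosed _ _ _ hs (fun hS => hS u v (by simp [h', Strand.dual])) hx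
        fun u' v' e => ?_
      rcases overlap_two (u := u) (v := v) (c := Q) (d := P)
          (by rw [← e, h']; simp [Strand.dual]) with
        ⟨m, h1, h2⟩ | ⟨m, h1, h2⟩ | ⟨h1, h2, h3, h4⟩ | ⟨h1, h2, h3⟩ | ⟨h1, h2, h3⟩
      · exact moveClosed_of_right ih _ (by simp [h1, Strand.dual]) h2 _ _ hw hw'
      · exact moveClosed_of_left ih _ h1 (by simp [h2, Strand.dual]) _ _ hw hw'
      · subst h3 h4
        obtain rfl : w = u ++ v := by simp [h]
        obtain rfl : w' = u ++ Q :: P :: v := by simp [h', Strand.dual]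
        exact moveClosed_cupQ
      · cases h1
      · cases h1
  | cap c =>
    cases c
    -- A clockwise cap is the one layer whose source can contain QP, although the target is standard
    -- and the layer is no reducing move. This happens when a P follows it or a Q precedes it.
    · by_cases hv : ∃ v', v = P :: v'
      · obtain ⟨v', rfl⟩ := hv
        obtain rfl : w = u ++ P :: Q :: P :: v' := by simp [h, Strand.dual]
        obtain rfl : w' = u ++ P :: v' := by simp [h']
        exact capP_left ih hw hx
      by_cases hu : ∃ u', u = u' ++ [Q]
      · obtain ⟨u', rfl⟩ := hu
        obtain rfl : w = u' ++ Q :: P :: Q :: v := by simp [h, Strand.dual]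
        obtain rfl : w' = u' ++ Q :: v := by simp [h']
        exact capP_right ih hw hx
      push Not at hu hv
      by_cases hS : Std w'
      · exact .std _ _ _ (by
          rw [h]; simpa [Strand.dual] using std_insert (by simpa [h'] using hS) hu hv) hS hx
      refine of_moveClosed _ _ _ hs hS hx fun u' v' e => ?_
      rcases overlap_nil (u := u) (v := v) (by rw [← e, h']; simp) with
        ⟨m, h1, h2⟩ | ⟨m, h1, h2⟩ | ⟨h1, h2⟩
      · exact moveClosed_of_right ih _ (by simp [h1]) h2 _ _ hw hw'
      · exact moveClosed_of_left ih _ h1 (by simp [h2]) _ _ hw hw'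
      · exact absurd h1 (hu _)
    · exact .cap _ _ hx

theorem closedBelow (hs : Std s) : ∀ N, ClosedBelow s N
  | 0 => fun _ _ _ _ _ _ _ _ _ _ h => absurd h (Nat.not_lt_zero _)
  | N + 1 => fun _ _ _ _ _ _ g h h' _ hw hw' hx =>
    layer_comp_of_closedBelow hs (closedBelow hs N) g h h' (Nat.lt_succ_iff.1 hw)
      (Nat.lt_succ_iff.1 hw') hx

theorem term_comp (hs : Std s) {w w' : Word} (f : Term w w') {x : Mor w' s} (hx : Reduced s x) :
    Reduced s (mk f ⊚ x) := by
  induction f with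
  | id => exact .congr (id_comp _) hx
  | layer u v g h h' =>
    -- Any bound exceeding the inversions of both ends of the layer will do.
    exact closedBelow hs (max (inv _) (inv _) + 1) g h h' x
      (Nat.lt_succ_of_le (le_max_left _ _)) (Nat.lt_succ_of_le (le_max_right _ _)) hx
  | comp f g hf hg => exact .congr (assoc (mk f) (mk g) x) (hf (hg hx))
  | zero => exact .congr (zero_comp _) (.zero _)
  | add f g hf hg => exact .congr (add_comp (mk f) (mk g) x) ((hf hx).add (hg hx))
  | smul c f hf => exact .congr (smul_comp c (mk f) x) ((hf hx).smul c)

/-- Every `2`-morphism to a standard word is reduced. -/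
theorem of_std (hs : Std s) {w : Word} (x : Mor w s) : Reduced s x := by
  induction x using ind with | h f => exact .congr (comp_id _).symm (term_comp hs f .id)

end Reduced

end Mor

end HeisCat

end

noncomputable section

namespace HeisCat

open Strand

namespace Mor

open Term

local infixr:80 " ⊚ " => Mor.comp

/-! ### The grading by the shifted degree -/

/-- The two degrees differ by a coboundary, the change in the number of letters P. Hence the degree
of a diagram with given ends determines its shifted degree. -/
theorem sdegTwo_eq {a b : Word} (g : Gen a b) :
    sdegTwo a b g = 2 * deg a b g + (numP b - numP a) := by
  cases g with
  | cross a b => cases a <;> cases b <;> simp [sdegTwo, deg, numP]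
  | dot a => simp [sdegTwo, deg]
  | cup a => cases a <;> simp [sdegTwo, deg, numP, Strand.dual]
  | cap a => cases a <;> simp [sdegTwo, deg, numP, Strand.dual]

theorem _root_.HeisCat.Term.IsHomog.of_eq {wt : ∀ a b : Word, Gen a b → ℤ} {w w' : Word}
    {f : Term w w'} {d e : ℤ} (h : IsHomog wt f d) (hde : d = e) : IsHomog wt f e := hde ▸ h

theorem _root_.HeisCat.Term.IsHomog.sdegTwo {w w' : Word} {f : Term w w'} {d : ℤ}
    (h : IsHomog deg f d) : IsHomog sdegTwo f (2 * d + (numP w' - numP w)) := by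
  induction h with
  | id w => exact (IsHomog.id w).of_eq (by simp)
  | layer u v g h h' =>
    refine (IsHomog.layer u v g h h').of_eq ?_
    rw [sdegTwo_eq, h, h']
    simp only [numP_append, Nat.cast_add]
    ring
  | comp _ _ h h' => exact (h.comp h').of_eq (by ring)
  | zero => exact .zero _ _ _
  | add _ _ h h' => exact .add h h'
  | smul c _ h => exact .smul c h

theorem homog_sdegTwo {w w' : Word} {x : Mor w w'} {d : ℤ} (h : x ∈ homog deg w w' d) :
    x ∈ homog sdegTwo w w' (2 * d + (numP w' - numP w)) := by
  obtain ⟨f, hf, rfl⟩ := h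
  exact ⟨f, hf.sdegTwo, rfl⟩

/-- Homogeneity of the defining relations is what makes the shifted degree meaningful on equivalence
classes of diagrams; it is used to define the scaling operator. -/
theorem _root_.HeisCat.Term.LocalRel.isHomog_sdegTwo {w w' : Word} {f g : Term w w'}
    (h : LocalRel f g) : ∃ d, IsHomog sdegTwo f d ∧ IsHomog sdegTwo g d := by
  have G : ∀ {a b : Word} (g : Gen a b), IsHomog HeisCat.sdegTwo (gen g) (HeisCat.sdegTwo a b g) :=
    fun g => .layer _ _ _ _ _
  cases h with
  | zigzag_capP => exact ⟨_, .comp ((G _).whiskL _) ((G _).whiskR _), (IsHomog.id _).of_eq (by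
      simp [HeisCat.sdegTwo])⟩
  | zigzag_capP' => exact ⟨_, .comp ((G _).whiskR _) ((G _).whiskL _),
      .smul _ ((IsHomog.id _).of_eq (by simp [HeisCat.sdegTwo]))⟩
  | zigzag_capQ => exact ⟨_, .comp ((G _).whiskL _) ((G _).whiskR _), (IsHomog.id _).of_eq (by
      simp [HeisCat.sdegTwo])⟩
  | zigzag_capQ' => exact ⟨_, .comp ((G _).whiskR _) ((G _).whiskL _), (IsHomog.id _).of_eq (by
      simp [HeisCat.sdegTwo])⟩
  | pitchfork_cup a c => exact ⟨_, .comp ((G _).whiskL _) ((G _).whiskR _),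
      .comp ((G _).whiskR _) ((G _).whiskL _)⟩
  | pitchfork_cap a c => exact ⟨_, .comp ((G _).whiskL _) ((G _).whiskR _),
      .comp ((G _).whiskR _) ((G _).whiskL _)⟩
  | dot_cup a => exact ⟨_, .comp (G _) ((G _).whiskR _), .comp (G _) ((G _).whiskL _)⟩
  | dot_cap a => exact ⟨_, .comp ((G _).whiskR _) (G _), .comp ((G _).whiskL _) (G _)⟩
  | dot_cross a b =>
    refine ⟨_, .comp ((G _).whiskR _) (G _), .of_eq (.comp (G _) ((G _).whiskL _)) ?_⟩
    simp [HeisCat.sdegTwo]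
  | dot_cross' a b =>
    refine ⟨_, .comp ((G _).whiskL _) (G _), .of_eq (.comp (G _) ((G _).whiskR _)) ?_⟩
    simp [HeisCat.sdegTwo]
  | dot_dot a => exact ⟨_, .comp (G _) (G _), .zero _ _ _⟩
  | cross_cross a b h => exact ⟨_, .comp (G _) (G _), (IsHomog.id _).of_eq (by
      simp [HeisCat.sdegTwo])⟩
  | cross_cross_QP =>
    refine ⟨0, .add (.of_eq (.comp (G _) (G _)) ?_)
      (.add (.of_eq (.comp (.comp (G _) (G _)) ((G _).whiskL _)) ?_)
        (.of_eq (.comp ((G _).whiskL _) (.comp (G _) (G _))) ?_)), .id _⟩ <;>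
      simp [HeisCat.sdegTwo]
  | triple a b c => exact ⟨_, .comp (.comp ((G _).whiskR _) ((G _).whiskL _)) ((G _).whiskR _),
      .comp (.comp ((G _).whiskL _) ((G _).whiskR _)) ((G _).whiskL _)⟩
  | curl => exact ⟨_, .comp (.comp ((G _).whiskR _) ((G _).whiskL _)) ((G _).whiskR _),
      .zero _ _ _⟩
  | circle => exact ⟨_, .comp (G _) (G _), .zero _ _ _⟩
  | circle_dot => exact ⟨_, .comp (.comp (G _) ((G _).whiskL _)) (G _),
      (IsHomog.id _).of_eq (by simp [HeisCat.sdegTwo])⟩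

theorem whiskL_smul (x : Word) {w w' : Word} (c : ℂ) (f : Mor w w') :
    whiskL x (c • f) = c • whiskL x f := by
  induction f using ind with | h f => rfl

theorem whiskR_smul (x : Word) {w w' : Word} (c : ℂ) (f : Mor w w') :
    whiskR x (c • f) = c • whiskR x f := by
  induction f using ind with | h f => rfl

/-- The `2`-morphism of a term, each elementary diagram of degree `d` being multiplied by `2 ^ d`.
-/
def scaleTerm (wt : ∀ a b : Word, Gen a b → ℤ) : ∀ {w w' : Word}, Term w w' → Mor w w'
  | _, _, .id w => mk (.id w)
  | _, _, .layer (a := a) (b := b) u v g h h' => (2 : ℂ) ^ wt a b g • mk (.layer u v g h h')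
  | _, _, .comp f g => scaleTerm wt f ⊚ scaleTerm wt g
  | _, _, .zero _ _ => 0
  | _, _, .add f g => scaleTerm wt f + scaleTerm wt g
  | _, _, .smul c f => c • scaleTerm wt f

variable {wt : ∀ a b : Word, Gen a b → ℤ}

theorem scaleTerm_of_isHomog {w w' : Word} {f : Term w w'} {d : ℤ} (h : IsHomog wt f d) :
    scaleTerm wt f = (2 : ℂ) ^ d • mk f := by
  induction h with
  | id w => simp [scaleTerm]
  | layer u v g h h' => rfl
  | comp _ _ h h' =>
    rw [scaleTerm, h, h', smul_comp, comp_smul, smul_smul, ← zpow_add₀ (by norm_num), mk_comp]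
  | zero w w' d => exact (smul_zero _).symm
  | add _ _ h h' => rw [scaleTerm, h, h', mk_add, smul_add]
  | smul c _ h => rw [scaleTerm, h, mk_smul, smul_comm]

theorem scaleTerm_mem {wt' : ∀ a b : Word, Gen a b → ℤ} {w w' : Word} {f : Term w w'} {d : ℤ}
    (h : IsHomog wt' f d) : scaleTerm wt f ∈ homog wt' w w' d := by
  induction h with
  | id w => exact homog_id _ _
  | layer u v g h h' => exact Submodule.smul_mem _ _ ⟨_, .layer u v g h h', rfl⟩
  | comp _ _ h h' => exact homog_comp h h'
  | zero w w' d => exact Submodule.zero_mem _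
  | add _ _ h h' => exact Submodule.add_mem _ h h'
  | smul c _ h => exact Submodule.smul_mem _ _ h

theorem scaleTerm_whiskL (x : Word) {w w' : Word} (f : Term w w') :
    scaleTerm wt (Term.whiskL x f) = whiskL x (scaleTerm wt f) := by
  induction f with
  | id => rfl
  | layer u v g h h' => rw [scaleTerm, whiskL_smul]; rfl
  | comp f g hf hg => rw [Term.whiskL, scaleTerm, hf, hg, scaleTerm, whiskL_comp]
  | zero => rfl
  | add f g hf hg => rw [Term.whiskL, scaleTerm, hf, hg, scaleTerm, whiskL_add]
  | smul c f hf => rw [Term.whiskL, scaleTerm, hf, scaleTerm, whiskL_smul]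

theorem scaleTerm_whiskR (x : Word) {w w' : Word} (f : Term w w') :
    scaleTerm wt (Term.whiskR x f) = whiskR x (scaleTerm wt f) := by
  induction f with
  | id => rfl
  | layer u v g h h' => rw [scaleTerm, whiskR_smul]; rfl
  | comp f g hf hg => rw [Term.whiskR, scaleTerm, hf, hg, scaleTerm, whiskR_comp]
  | zero => rfl
  | add f g hf hg => rw [Term.whiskR, scaleTerm, hf, hg, scaleTerm, whiskR_add]
  | smul c f hf => rw [Term.whiskR, scaleTerm, hf, scaleTerm, whiskR_smul]

/-- A homogeneous relation is multiplied by the same power of 2 on both sides. Scaling preserves the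
homogeneous pieces for `deg`, so the interchange law keeps its sign. -/
theorem scaleTerm_rel {w w' : Word} {f g : Term w w'} (h : Rel f g) :
    scaleTerm sdegTwo f = scaleTerm sdegTwo g := by
  induction h with
  | refl => rfl
  | symm _ h => exact h.symm
  | trans _ _ h h' => exact h.trans h'
  | congr_comp _ _ h h' => simp only [scaleTerm, h, h']
  | congr_add _ _ h h' => simp only [scaleTerm, h, h']
  | congr_smul c _ h => simp only [scaleTerm, h]
  | congr_whiskL x _ h => rw [scaleTerm_whiskL, scaleTerm_whiskL, h]
  | congr_whiskR x _ h => rw [scaleTerm_whiskR, scaleTerm_whiskR, h]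
  | add_assoc => exact _root_.add_assoc _ _ _
  | add_comm => exact _root_.add_comm _ _
  | zero_add => exact _root_.zero_add _
  | neg_add => simp [scaleTerm]
  | smul_add => exact _root_.smul_add _ _ _
  | add_smul => exact _root_.add_smul _ _ _
  | mul_smul => exact SemigroupAction.mul_smul _ _ _
  | one_smul => exact _root_.one_smul _ _
  | id_comp => exact id_comp _
  | comp_id => exact comp_id _
  | assoc => exact assoc _ _ _
  | add_comp => exact add_comp _ _ _
  | comp_add => exact comp_add _ _ _
  | smul_comp => exact smul_comp _ _ _
  | comp_smul => exact comp_smul _ _ _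
  | interchange hf hg =>
    simp only [scaleTerm, scaleTerm_whiskL, scaleTerm_whiskR]
    exact interchange (scaleTerm_mem hf) (scaleTerm_mem hg)
  | of h =>
    obtain ⟨d, hf, hg⟩ := h.isHomog_sdegTwo
    rw [scaleTerm_of_isHomog hf, scaleTerm_of_isHomog hg, sound (.of h)]

/-- Multiplication by `2 ^ d` on the `2`-morphisms of twice the shifted degree `d`. -/
def scale (w w' : Word) : Module.End ℂ (Mor w w') where
  toFun := Quotient.lift (scaleTerm sdegTwo) fun _ _ h => scaleTerm_rel h
  map_add' := by rintro ⟨f⟩ ⟨g⟩; rfl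
  map_smul' := by rintro c ⟨f⟩; rfl

theorem homog_le_eigenspace (w w' : Word) (d : ℤ) :
    homog sdegTwo w w' d ≤ (scale w w').eigenspace ((2 : ℂ) ^ d) := by
  rintro _ ⟨f, hf, rfl⟩
  rw [Module.End.mem_eigenspace_iff]
  exact scaleTerm_of_isHomog hf

/-- The part of degree d lies in the eigenspace of `scale` for 2 ^ d. These numbers are distinct, as
2 is not a root of unity, and eigenspaces for distinct eigenvalues are independent. -/
theorem iSupIndep_homog (w w' : Word) : iSupIndep (homog sdegTwo w w') := by
  have h : iSupIndep fun d : ℤ => (scale w w').eigenspace ((2 : ℂ) ^ d) := ?_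
  · exact h.mono (homog_le_eigenspace w w')
  refine (scale w w').eigenspaces_iSupIndep.comp fun d e h => ?_
  exact zpow_right_injective₀ (a := (2 : ℝ)) (by norm_num) (by norm_num)
    (by simpa using congrArg norm h)

/-! ### `2`-morphisms between standard words -/

/-- The `2`-morphisms of positive shifted degree. -/
def posPart (w s : Word) : Submodule ℂ (Mor w s) := ⨆ d : {d : ℤ // 0 < d}, homog sdegTwo w s d

theorem comp_posPart {w w' s : Word} {f : Mor w w'} {d : ℤ} (hd : 0 ≤ d)
    (hf : f ∈ homog sdegTwo w w' d) {x : Mor w' s} (hx : x ∈ posPart w' s) :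
    f ⊚ x ∈ posPart w s := by
  induction hx using Submodule.iSup_induction' with
  | mem e x hx =>
    exact Submodule.mem_iSup_of_mem (p := fun d : {d : ℤ // 0 < d} => homog sdegTwo w s d)
      ⟨d + e, by have := e.2; omega⟩ (homog_comp hf hx)
  | zero => rw [comp_zero]; exact Submodule.zero_mem _
  | add x y _ _ hx hy => rw [comp_add]; exact Submodule.add_mem _ hx hy

theorem comp_sub {w w' w'' : Word} (f : Mor w w') (x y : Mor w' w'') :
    f ⊚ (x - y) = f ⊚ x - f ⊚ y := by
  rw [sub_eq_add_neg, sub_eq_add_neg, comp_add, comp_neg]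

/-- The linear combinations of composites of crossings of strands with the same orientation. -/
inductive CrossComb (s : Word) : ∀ {w : Word}, Mor w s → Prop
  | id : CrossComb s (mk (.id s))
  | zero (w : Word) : CrossComb s (0 : Mor w s)
  | add {w : Word} {x y : Mor w s} : CrossComb s x → CrossComb s y → CrossComb s (x + y)
  | smul {w : Word} (c : ℂ) {x : Mor w s} : CrossComb s x → CrossComb s (c • x)
  | cross {w w' u v : Word} (a : Strand) (h : w = u ++ [a, a] ++ v) (h' : w' = u ++ [a, a] ++ v)
      {x : Mor w' s} : CrossComb s x → CrossComb s (lay u (.cross a a) v h h' ⊚ x)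

theorem CrossComb.mem_homog {w s : Word} {x : Mor w s} (h : CrossComb s x) :
    x ∈ homog sdegTwo w s 0 := by
  induction h with
  | id => exact homog_id _ _
  | zero => exact Submodule.zero_mem _
  | add _ _ h h' => exact Submodule.add_mem _ h h'
  | smul c _ h => exact Submodule.smul_mem _ _ h
  | cross a h h' _ hx =>
    simpa [sdegTwo] using homog_comp (lay_homog sdegTwo (.cross a a) h h') hx

/-- A crossing of equally oriented strands does not change the word, so no composite of such
crossings leads from one word to a different one. -/
theorem CrossComb.eq_zero {w s : Word} {x : Mor w s} (h : CrossComb s x) (hw : w ≠ s) : x = 0 := by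
  induction h with
  | id => exact absurd rfl hw
  | zero => rfl
  | add _ _ h h' => rw [h hw, h' hw, _root_.add_zero]
  | smul c _ h => rw [h hw, smul_zero]
  | cross a h h' _ hx => rw [hx (by rwa [h', ← h]), comp_zero]

/-- Out of a standard word only `std` layers are available, since reducing moves need a factor QP.
Crossings of equal orientation preserve the shape of the decomposition; dots and clockwise cups and
caps have positive shifted degree and push everything into the positive part. -/
theorem Reduced.decomp {w s : Word} {x : Mor w s} (hx : Reduced s x) (hw : Std w) :
    ∃ p, CrossComb s p ∧ x - p ∈ posPart w s := by
  have H : ∀ {w w' : Word} {f : Mor w w'} {d : ℤ} {x : Mor w' s}, f ∈ homog sdegTwo w w' d →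
      0 < d → (∃ p, CrossComb s p ∧ x - p ∈ posPart w' s) →
      ∃ p, CrossComb s p ∧ f ⊚ x - p ∈ posPart w s := by
    rintro w w' f d x hf hd ⟨p, hp, hq⟩
    -- A layer of positive degree leaves no permutation part: it moves the old one, which has degree
    -- zero, into positive degree.
    refine ⟨0, .zero _, ?_⟩
    have e : f ⊚ x - 0 = f ⊚ (x - p) + f ⊚ p := by
      rw [← comp_add, sub_add_cancel, sub_zero]
    rw [e]
    exact Submodule.add_mem _ (comp_posPart hd.le hf hq) (Submodule.mem_iSup_of_mem
      (p := fun d : {d : ℤ // 0 < d} => homog sdegTwo w s d) ⟨d, hd⟩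
      (by simpa using homog_comp hf hp.mem_homog))
  induction hx with
  | id => exact ⟨_, .id, by simp⟩
  | zero => exact ⟨_, .zero _, by simp⟩
  | add _ _ h h' =>
    obtain ⟨p, hp, hq⟩ := h hw
    obtain ⟨p', hp', hq'⟩ := h' hw
    exact ⟨p + p', .add hp hp', by rw [add_sub_add_comm]; exact Submodule.add_mem _ hq hq'⟩
  | smul c _ h =>
    obtain ⟨p, hp, hq⟩ := h hw
    exact ⟨c • p, .smul c hp, by rw [← smul_sub]; exact Submodule.smul_mem _ _ hq⟩
  | cross h => exact absurd (by simpa using h) (hw _ _)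
  | cap h => exact absurd (by simpa using h) (hw _ _)
  | dotCap _ _ h => exact absurd (by simpa using h) (hw _ _)
  | std g h h' _ hw' _ ih =>
    specialize ih hw'
    have hg := lay_homog sdegTwo g h h'
    cases g with
    | cross a b =>
      by_cases hab : a = b
      · subst hab
        obtain ⟨p, hp, hq⟩ := ih
        refine ⟨_, .cross a h h' hp, ?_⟩
        rw [← comp_sub]
        exact comp_posPart le_rfl hg hq
      · cases a <;> cases b
        · exact absurd rfl hab
        · exact absurd (by simpa using h') (hw' _ _)
        · exact absurd (by simpa using h) (hw _ _)
        · exact absurd rfl hab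
    | dot a => exact H hg (by simp [sdegTwo]) ih
    | cup a =>
      cases a
      · exact H hg (by simp [sdegTwo]) ih
      · exact absurd (by simpa [Strand.dual] using h') (hw' _ _)
    | cap a =>
      cases a
      · exact H hg (by simp [sdegTwo]) ih
      · exact absurd (by simpa [Strand.dual] using h) (hw _ _)

/-- Between standard words, the `2`-morphisms of shifted degree zero are combinations of
crossings. -/
theorem crossComb_of_homog {w s : Word} (hw : Std w) (hs : Std s) {x : Mor w s}
    (hx : x ∈ homog sdegTwo w s 0) : CrossComb s x := by
  obtain ⟨p, hp, hq⟩ := (Reduced.of_std hs x).decomp hw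
  have h0 : x - p ∈ homog sdegTwo w s 0 := Submodule.sub_mem _ hx hp.mem_homog
  -- The difference `x - p` is homogeneous of shifted degree zero and also a sum of terms of
  -- positive degree, so independence makes it vanish.
  have hle : posPart w s ≤ ⨆ (d) (_ : d ≠ 0), homog sdegTwo w s d :=
    iSup_le fun d => le_iSup₂_of_le d.1 d.2.ne' le_rfl
  have h : x - p = 0 := Submodule.disjoint_def.1 (iSupIndep_homog w s 0) _ h0 (hle hq)
  rwa [sub_eq_zero.1 h]

/-- Between standard words, there are no `2`-morphisms of negative shifted degree. -/
theorem eq_zero_of_homog_neg {w s : Word} (hw : Std w) (hs : Std s) {d : ℤ} (hd : d < 0)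
    {x : Mor w s} (hx : x ∈ homog sdegTwo w s d) : x = 0 := by
  obtain ⟨p, hp, hq⟩ := (Reduced.of_std hs x).decomp hw
  -- Being `(x - p) + p`, the element lies in the sum of the parts of degree at least zero, which
  -- meets the part of degree `d < 0` trivially.
  refine Submodule.disjoint_def.1 (iSupIndep_homog w s d) _ hx ?_
  rw [← sub_add_cancel x p]
  refine Submodule.add_mem _ ?_ ?_
  · have hle : posPart w s ≤ ⨆ (e) (_ : e ≠ d), homog sdegTwo w s e :=
      iSup_le fun e => le_iSup₂_of_le e.1 (hd.trans e.2).ne' le_rfl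
    exact hle hq
  · exact (le_iSup₂_of_le (f := fun (e : ℤ) (_ : e ≠ d) => homog sdegTwo w s e) 0 hd.ne' le_rfl)
      hp.mem_homog

/-- The word has no inversions, whereas a word with a factor QP has at least one. -/
theorem std_replicate (m n : ℕ) : Std (List.replicate m P ++ List.replicate n Q) := by
  intro u v h
  have h0 : inv (List.replicate m P ++ List.replicate n Q) = 0 := by
    induction m generalizing u with
    | zero =>
      have hn : ∀ n, numP (List.replicate n Q) = 0 ∧ inv (List.replicate n Q) = 0 := fun n => by
        induction n with
        | zero => simp [numP, inv]
        | succ n ih => simp [List.replicate_succ, numP, inv, ih]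
      simpa using (hn n).2
    | succ m ih =>
      cases u with
      | nil => simp [List.replicate_succ] at h
      | cons a u =>
        rw [List.replicate_succ, List.cons_append, List.cons_append] at h
        rw [List.replicate_succ, List.cons_append]
        exact ih u (List.cons.inj h).2
  rw [h] at h0
  exact absurd (inv_swap u v) (by omega)

end Mor

end HeisCat

end

noncomputable section

namespace HeisCat

open Strand

/-! ### The Fock space representation -/

/-- The complement of a point. -/
abbrev Compl {S : Type} (s : S) := {x : S // x ≠ s}

namespace Compl

variable {S T : Type}

/-- Functoriality of complements under bijections. -/
def congr (e : S ≃ T) (t : T) : Compl (e.symm t) ≃ Compl t where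
  toFun x := ⟨e x, fun h => x.2 (by simp [← h])⟩
  invFun y := ⟨e.symm y, fun h => y.2 (by simpa using h)⟩
  left_inv x := by simp
  right_inv y := by simp

/-- Complements of equal points. -/
def ofEq {s t : S} (h : s = t) : Compl s ≃ Compl t where
  toFun x := ⟨x, h ▸ x.2⟩
  invFun x := ⟨x, h ▸ x.2⟩
  left_inv _ := rfl
  right_inv _ := rfl

/-- The complement of the new point. -/
def none : S ≃ Compl (none : Option S) where
  toFun x := ⟨some x, by simp⟩
  invFun x := x.1.get (Option.isSome_iff_ne_none.2 x.2)
  left_inv x := rfl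
  right_inv x := by simp

/-- The complement of an old point. -/
def some (s : S) : Option (Compl s) ≃ Compl (some s) where
  toFun x := ⟨x.map Subtype.val, by
    rcases x with _ | x
    · simp
    · simp [x.2]⟩
  invFun x := match x with
    | ⟨.none, _⟩ => .none
    | ⟨.some y, h⟩ => .some ⟨y, fun e => h (e ▸ rfl)⟩
  left_inv x := by rcases x with _ | x <;> rfl
  right_inv x := by rcases x with ⟨_ | x, h⟩ <;> rfl

open Classical in
/-- Adding the point again. -/
def insert (s : S) : Option (Compl s) ≃ S := Equiv.optionSubtypeNe s

/-- The complement of two points. -/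
def swap {s : S} (t : Compl s) :
    Compl (⟨s, fun h => t.2 h.symm⟩ : Compl t.1) ≃ Compl t where
  toFun x := ⟨⟨x.1.1, fun h => x.2 (Subtype.ext h)⟩, fun h => x.1.2 (congrArg Subtype.val h)⟩
  invFun x := ⟨⟨x.1.1, fun h => x.2 (Subtype.ext h)⟩, fun h => x.1.2 (congrArg Subtype.val h)⟩
  left_inv _ := rfl
  right_inv _ := rfl

@[simp] theorem congr_apply (e : S ≃ T) (t : T) (x) : (congr e t x).1 = e x.1 := rfl
/-- Functoriality of the complement of the new point. -/
def congrNone (e : S ≃ T) : Compl (Option.none : Option S) ≃ Compl (Option.none : Option T) :=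
  congr (Equiv.optionCongr e) .none

/-- Functoriality of the complement of an old point. -/
def congrSome (e : S ≃ T) (t : T) : Compl (.some (e.symm t) : Option S) ≃ Compl (Option.some t) :=
  congr (Equiv.optionCongr e) (.some t)

@[simp] theorem ofEq_apply {s t : S} (h : s = t) (x) : (ofEq h x).1 = x.1 := rfl
@[simp] theorem none_apply (x : S) : (none x).1 = .some x := rfl
@[simp] theorem none_symm (x : S) (h) : none.symm ⟨.some x, h⟩ = x := rfl
@[simp] theorem some_none (s : S) : (some s .none).1 = .none := rfl
@[simp] theorem some_some (s : S) (x : Compl s) : (some s (.some x)).1 = .some x.1 := rfl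
@[simp] theorem some_symm_none (s : S) (h) : (some s).symm ⟨.none, h⟩ = .none := rfl
@[simp] theorem some_symm_some (s : S) (x : S) (h) :
    (some s).symm ⟨.some x, h⟩ = .some ⟨x, fun e => h (e ▸ rfl)⟩ := rfl
@[simp] theorem insert_none (s : S) : insert s .none = s := by simp [insert]
@[simp] theorem insert_some (s : S) (x : Compl s) : insert s (.some x) = x.1 := by simp [insert]
@[simp] theorem insert_symm_self (s : S) : (insert s).symm s = .none := by simp [insert]
theorem insert_symm_of_ne {s x : S} (h : x ≠ s) : (insert s).symm x = .some ⟨x, h⟩ := by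
  simp [insert, h]
@[simp] theorem swap_apply {s : S} (t : Compl s) (x) : (swap t x).1.1 = x.1.1 := rfl

end Compl

/-- Linear species with odd operators `v s`, one for each point, and a parity operator `ε`. -/
structure Sp where
  obj : Type → Type
  [grp : ∀ S, AddCommGroup (obj S)]
  [mod : ∀ S, Module ℂ (obj S)]
  map : ∀ {S T : Type}, (S ≃ T) → obj S →ₗ[ℂ] obj T
  v : ∀ {S : Type}, S → obj S →ₗ[ℂ] obj S
  ε : ∀ {S : Type}, obj S →ₗ[ℂ] obj S
  map_refl : ∀ {S : Type} (m : obj S), map (Equiv.refl S) m = m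
  map_map : ∀ {S T U : Type} (e : S ≃ T) (f : T ≃ U) (m : obj S), map f (map e m) =
    map (e.trans f) m
  map_v : ∀ {S T : Type} (e : S ≃ T) (s : S) (m : obj S), map e (v s m) = v (e s) (map e m)
  map_ε : ∀ {S T : Type} (e : S ≃ T) (m : obj S), map e (ε m) = ε (map e m)
  ε_ε : ∀ {S : Type} (m : obj S), ε (ε m) = m
  v_ε : ∀ {S : Type} (s : S) (m : obj S), v s (ε m) = -ε (v s m)
  v_v : ∀ {S : Type} (s t : S) (m : obj S), v s (v t m) = -v t (v s m)

namespace Sp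

attribute [instance] Sp.grp Sp.mod

/-- Families of linear maps. -/
structure Hom (M N : Sp) where
  app : ∀ (S : Type) [Finite S], M.obj S →ₗ[ℂ] N.obj S

@[ext] theorem Hom.ext' {M N : Sp} {f g : Hom M N}
    (h : ∀ (S : Type) [Finite S] (m : M.obj S), f.app S m = g.app S m) : f = g := by
  cases f; cases g
  congr
  funext S _
  exact LinearMap.ext (h S)

/-- Morphisms are not required to be natural: odd diagrams commute with the structure maps only up
to a sign, which is recorded separately by `IsPar`. Components are asked for on finite sets only,
because the clockwise cap sums over the points. -/
instance : Category Sp where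
  Hom := Hom
  id M := ⟨fun _ _ => LinearMap.id⟩
  comp f g := ⟨fun S _ => g.app S ∘ₗ f.app S⟩

variable {M N K : Sp}

@[ext] theorem hom_ext {f g : M ⟶ N}
    (h : ∀ (S : Type) [Finite S] (m : M.obj S), f.app S m = g.app S m) : f = g := Hom.ext' h

instance : Add (M ⟶ N) := ⟨fun f g => ⟨fun S _ => f.app S + g.app S⟩⟩
instance : Zero (M ⟶ N) := ⟨⟨fun _ _ => 0⟩⟩
instance : Neg (M ⟶ N) := ⟨fun f => ⟨fun S _ => -f.app S⟩⟩
instance : SMul ℂ (M ⟶ N) := ⟨fun c f => ⟨fun S _ => c • f.app S⟩⟩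

variable {S : Type} [Finite S]

@[simp] theorem id_app (m : M.obj S) : Hom.app (𝟙 M) S m = m := rfl
@[simp] theorem comp_app (f : M ⟶ N) (g : N ⟶ K) (m : M.obj S) :
    Hom.app (f ≫ g) S m = g.app S (f.app S m) := rfl
@[simp] theorem add_app (f g : M ⟶ N) (m : M.obj S) :
    Hom.app (f + g) S m = f.app S m + g.app S m := rfl
@[simp] theorem zero_app (m : M.obj S) : Hom.app (0 : M ⟶ N) S m = 0 := rfl
@[simp] theorem neg_app (f : M ⟶ N) (m : M.obj S) : Hom.app (-f) S m = -f.app S m := rfl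
@[simp] theorem smul_app (c : ℂ) (f : M ⟶ N) (m : M.obj S) :
    Hom.app (c • f) S m = c • f.app S m := rfl

instance : AddCommGroup (M ⟶ N) where
  add_assoc f g h := by ext; simp [add_assoc]
  zero_add f := by ext; simp
  add_zero f := by ext; simp
  add_comm f g := by ext; simp [add_comm]
  neg_add_cancel f := by ext; simp
  nsmul := nsmulRec
  zsmul := zsmulRec

instance : Module ℂ (M ⟶ N) where
  one_smul f := by ext; simp
  mul_smul c d f := by ext; simp [mul_smul]
  smul_zero c := by ext; simp
  smul_add c f g := by ext; simp
  add_smul c d f := by ext; simp [add_smul]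
  zero_smul f := by ext; simp

instance : Preadditive Sp where
  add_comp _ _ _ f f' g := by ext; simp
  comp_add _ _ _ f g g' := by ext; simp

instance : Linear ℂ Sp where
  smul_comp _ _ _ c f g := by ext; simp
  comp_smul _ _ _ f c g := by ext; simp

/-- Families compatible with the structure maps, up to the sign `c`. -/
structure IsPar (c : ℂ) (f : M ⟶ N) : Prop where
  map : ∀ {S T : Type} [Finite S] [Finite T] (e : S ≃ T) (m : M.obj S),
    f.app T (M.map e m) = N.map e (f.app S m)
  v : ∀ {S : Type} [Finite S] (s : S) (m : M.obj S), f.app S (M.v s m) = c • N.v s (f.app S m)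
  ε : ∀ {S : Type} [Finite S] (m : M.obj S), f.app S (M.ε m) = c • N.ε (f.app S m)

/-- The derivative of a species. -/
def Q (M : Sp) : Sp where
  obj S := M.obj (Option S)
  map e := M.map (Equiv.optionCongr e)
  v s := M.v (some s)
  -- The derivative carries a parity shift. With it, creating the coefficient of 1 at the new point
  -- (the cup 𝟏 → QP) is odd, and reading off the coefficient of `v` there (the cap QP → 𝟏) is even.
  ε := -M.ε
  map_refl m := by simp [Equiv.optionCongr_refl, M.map_refl]
  map_map e f m := by rw [M.map_map, Equiv.optionCongr_trans]
  map_v e s m := M.map_v _ _ _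
  map_ε e m := by simp [M.map_ε]
  ε_ε m := by simp [M.ε_ε]
  v_ε s m := by simp [M.v_ε]
  v_v s t m := M.v_v _ _ _

/-- The identification of the elements of the derivative. -/
def evQ {M : Sp} {S : Type} : M.Q.obj S ≃ₗ[ℂ] M.obj (Option S) := LinearEquiv.refl ℂ _

@[simp] theorem Q_map {S T : Type} (e : S ≃ T) (m : M.Q.obj S) :
    evQ (M.Q.map e m) = M.map (Equiv.optionCongr e) (evQ m) := rfl
@[simp] theorem Q_v {S : Type} (s : S) (m : M.Q.obj S) :
    evQ (M.Q.v s m) = M.v (some s) (evQ m) := rfl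
@[simp] theorem Q_ε {S : Type} (m : M.Q.obj S) : evQ (M.Q.ε m) = -M.ε (evQ m) := rfl

@[simp] theorem v_self (M : Sp) {S : Type} (s : S) (m : M.obj S) : M.v s (M.v s m) = 0 := by
  have h : (2 : ℂ) • M.v s (M.v s m) = 0 := by
    rw [two_smul]
    exact add_eq_zero_iff_eq_neg.2 (M.v_v s s m)
  exact (smul_eq_zero.1 h).resolve_left two_ne_zero

theorem map_eq_map (M : Sp) {S T : Type} {e f : S ≃ T} (h : ∀ x, e x = f x) (m : M.obj S) :
    M.map e m = M.map f m := by rw [Equiv.ext h]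

theorem map_eq_self (M : Sp) {S : Type} {e : S ≃ S} (h : ∀ x, e x = x) (m : M.obj S) :
    M.map e m = m := (M.map_eq_map (f := Equiv.refl S) h m).trans (M.map_refl m)

open Classical in
/-- The product of the species of singletons, with two basis elements, and a species. -/
def P (M : Sp) : Sp where
  obj S := ∀ s : S, Bool → M.obj (Compl s)
  map e :=
    { toFun := fun z t b => M.map (Compl.congr e t) (z (e.symm t) b)
      map_add' := fun x y => by ext t b; simp
      map_smul' := fun x y => by ext t b; simp }
  v s :=
    -- At the removed point the operator is multiplication by `v` in Λ, sending 1 to `v` and `v` to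
    -- 0, where `b` tells which basis element is meant. The factor `ε` makes it anticommute with the
    -- operators of the other points.
    { toFun := fun z t b => if h : s = t then (if b then M.ε (z t false) else 0)
        else M.v ⟨s, h⟩ (z t b)
      map_add' := fun x y => by ext t b; by_cases h : s = t <;> cases b <;> simp [h]
      map_smul' := fun x y => by ext t b; by_cases h : s = t <;> cases b <;> simp [h] }
  ε :=
    { toFun := fun z t b => if b then -M.ε (z t b) else M.ε (z t b)
      map_add' := fun x y => by ext t b; cases b <;> simp [add_comm]
      map_smul' := fun x y => by ext t b; cases b <;> simp }
  map_refl m := by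
    ext t b
    exact M.map_eq_self (fun _ => rfl) _
  map_map e f m := by
    ext t b
    exact (M.map_map _ _ _).trans (M.map_eq_map (fun _ => rfl) _)
  map_v e s m := by
    ext t b
    by_cases h : e s = t
    · have h' : s = e.symm t := by simp [← h]
      cases b <;> simp [h, h', M.map_ε]
    · have h' : s ≠ e.symm t := fun h' => h (by simp [h'])
      simp only [LinearMap.coe_mk, AddHom.coe_mk, h, h', dite_false]
      exact M.map_v _ _ _
  map_ε e m := by
    ext t b
    cases b <;> simp [M.map_ε]
  ε_ε m := by
    ext t b
    cases b <;> simp [M.ε_ε]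
  v_ε s m := by
    ext t b
    by_cases h : s = t <;> cases b <;> simp [h, M.ε_ε, M.v_ε]
  v_v s s' m := by
    ext t b
    by_cases h : s = t
    · by_cases h' : s' = t <;> cases b <;> simp [h, h', M.v_ε]
    · by_cases h' : s' = t
      · cases b <;> simp [h, h', M.v_ε]
      · simp only [LinearMap.coe_mk, AddHom.coe_mk, Pi.neg_apply, h, h', dite_false]
        exact M.v_v _ _ _

/-- Evaluation of an element of `P M` at a point. -/
def evP {S : Type} (s : S) (b : Bool) : M.P.obj S →ₗ[ℂ] M.obj (Compl s) :=
  LinearMap.proj b ∘ₗ LinearMap.proj s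

/-- Linear maps to `P M` are given by their components. -/
def toP {S : Type} {V : Type} [AddCommGroup V] [Module ℂ V]
    (f : ∀ s : S, Bool → V →ₗ[ℂ] M.obj (Compl s)) : V →ₗ[ℂ] M.P.obj S :=
  LinearMap.pi fun s => LinearMap.pi fun b => f s b

theorem P_ext {S : Type} {z z' : M.P.obj S} (h : ∀ t b, evP t b z = evP t b z') : z = z' := by
  funext t b
  exact h t b

/-- Components at equal points have types that agree only propositionally; the transport is
expressed by a relabelling, which can be merged with other relabellings. -/
theorem evP_eq {S : Type} (z : M.P.obj S) {s t : S} (h : s = t) (b : Bool) :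
    evP t b z = M.map (Compl.ofEq h) (evP s b z) := by
  subst h
  exact (M.map_eq_self (fun _ => rfl) _).symm

@[simp] theorem P_map_apply {S T : Type} (e : S ≃ T) (z : M.P.obj S) (t : T) (b : Bool) :
    evP t b (M.P.map e z) = M.map (Compl.congr e t) (evP (e.symm t) b z) := rfl
@[simp high] theorem P_map_none {S T : Type} (e : S ≃ T) (z : M.P.obj (Option S)) (b : Bool) :
    evP none b (M.P.map (Equiv.optionCongr e) z) =
      M.map (Compl.congrNone e) (evP none b z) := rfl
@[simp high] theorem P_map_some {S T : Type} (e : S ≃ T) (z : M.P.obj (Option S)) (t : T)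
    (b : Bool) : evP (some t) b (M.P.map (Equiv.optionCongr e) z) =
      M.map (Compl.congrSome e t) (evP (some (e.symm t)) b z) := rfl
@[simp] theorem P_ε_false {S : Type} (z : M.P.obj S) (t : S) :
    evP t false (M.P.ε z) = M.ε (evP t false z) := rfl
@[simp] theorem P_ε_true {S : Type} (z : M.P.obj S) (t : S) :
    evP t true (M.P.ε z) = -M.ε (evP t true z) := rfl
@[simp] theorem P_v_self_false {S : Type} (z : M.P.obj S) (t : S) :
    evP t false (M.P.v t z) = 0 := (dif_pos rfl).trans rfl
@[simp] theorem P_v_self_true {S : Type} (z : M.P.obj S) (t : S) :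
    evP t true (M.P.v t z) = M.ε (evP t false z) := (dif_pos rfl).trans rfl
theorem P_v_of_ne {S : Type} (z : M.P.obj S) {s t : S} (h : s ≠ t) (b : Bool) :
    evP t b (M.P.v s z) = M.v ⟨s, h⟩ (evP t b z) := dif_neg h
@[simp] theorem P_v_some_none {S : Type} (z : M.P.obj (Option S)) (s : S) (b : Bool) :
    evP none b (M.P.v (some s) z) = M.v ⟨some s, by simp⟩ (evP none b z) := P_v_of_ne _ _ _
@[simp] theorem P_v_none_some {S : Type} (z : M.P.obj (Option S)) (s : S) (b : Bool) :
    evP (some s) b (M.P.v none z) = M.v ⟨none, by simp⟩ (evP (some s) b z) := P_v_of_ne _ _ _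
theorem P_v_some_some {S : Type} (z : M.P.obj (Option S)) {s t : S} (h : s ≠ t) (b : Bool) :
    evP (some t) b (M.P.v (some s) z) = M.v ⟨some s, by simpa using h⟩ (evP (some t) b z) :=
  P_v_of_ne _ _ _

/-- Functoriality of `P`. -/
def mapP (f : M ⟶ N) : M.P ⟶ N.P := ⟨fun _ _ => toP fun t b => f.app (Compl t) ∘ₗ evP t b⟩

/-- Functoriality of `Q`. -/
def mapQ (f : M ⟶ N) : M.Q ⟶ N.Q := ⟨fun S _ => evQ.symm.toLinearMap ∘ₗ f.app (Option S) ∘ₗ evQ.toLinearMap⟩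

@[simp] theorem evP_mapP (f : M ⟶ N) (z : M.P.obj S) (t : S) (b : Bool) :
    evP t b ((mapP f).app S z) = f.app (Compl t) (evP t b z) := rfl
@[simp] theorem evQ_mapQ (f : M ⟶ N) (m : M.Q.obj S) :
    evQ ((mapQ f).app S m) = f.app (Option S) (evQ m) := rfl

theorem IsPar.mapP {c : ℂ} {f : M ⟶ N} (hf : IsPar c f) : IsPar c (Sp.mapP f) := by
  refine ⟨fun e z => P_ext fun t b => ?_, fun s z => P_ext fun t b => ?_,
    fun z => P_ext fun t b => ?_⟩
  · simp [hf.map]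
  · by_cases h : s = t
    · subst h
      cases b <;> simp [hf.ε]
    · simp [P_v_of_ne _ h, hf.v]
  · cases b <;> simp [hf.ε]

theorem IsPar.mapQ {c : ℂ} {f : M ⟶ N} (hf : IsPar c f) : IsPar c (Sp.mapQ f) := by
  refine ⟨fun e z => evQ.injective ?_, fun s z => evQ.injective ?_, fun z => evQ.injective ?_⟩
  · simp [hf.map]
  · simp [hf.v]
  · simp [hf.ε]

/-- The functor given by a letter. -/
def functor : Strand → Sp ⥤ Sp
  | .P =>
    { obj := P
      map := mapP }
  | .Q =>
    { obj := Q
      map := mapQ }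

instance (a : Strand) : (functor a).Additive where
  map_add {_ _ f g} := by
    cases a
    · exact hom_ext fun S _ z => P_ext fun t b => rfl
    · rfl

instance (a : Strand) : (functor a).Linear ℂ where
  map_smul {_ _ f} c := by
    cases a
    · exact hom_ext fun S _ z => P_ext fun t b => rfl
    · rfl

theorem IsPar.functor {c : ℂ} {f : M ⟶ N} (hf : IsPar c f) (a : Strand) :
    IsPar c ((functor a).map f) := by
  cases a
  · exact hf.mapP
  · exact hf.mapQ

end Sp

end HeisCat

end

/-! ### Operators on species for the elementary diagrams -/

noncomputable section

namespace HeisCat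

namespace Sp

variable (M : Sp)

/-- The sign of the crossing with a dotted strand. -/
def sgn (b : Bool) : ℂ := if b then -1 else 1

@[simp] theorem sgn_false : sgn false = 1 := rfl
@[simp] theorem sgn_true : sgn true = -1 := rfl

/-- The exchange of the two newest points. -/
def swapOpt {S : Type} : Option (Option S) ≃ Option (Option S) where
  toFun
    | none => some none
    | some none => none
    | some (some x) => some (some x)
  invFun
    | none => some none
    | some none => none
    | some (some x) => some (some x)
  left_inv x := by rcases x with _ | _ | x <;> rfl
  right_inv x := by rcases x with _ | _ | x <;> rfl

/-- The dot on `P`. -/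
def dotP : M.P ⟶ M.P := ⟨fun _ _ => toP fun s b => if b then M.ε ∘ₗ evP (M := M) s false else 0⟩

/-- The dot on `Q`. -/
def dotQ : M.Q ⟶ M.Q := ⟨fun _ _ => evQ.symm.toLinearMap ∘ₗ M.v none ∘ₗ evQ.toLinearMap⟩

/-- The cup `𝟏 → QP`. -/
def cupQ : M ⟶ M.P.Q := ⟨fun _ _ => evQ.symm.toLinearMap ∘ₗ toP fun t b => match t, b with
  | none, false => M.map Compl.none ∘ₗ M.ε
  | _, _ => 0⟩

/-- The cap `QP → 𝟏`. -/
def capQ : M.P.Q ⟶ M := ⟨fun _ _ => M.map Compl.none.symm ∘ₗ evP none true ∘ₗ evQ.toLinearMap⟩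

/-- The cup `𝟏 → PQ`. -/
def cupP : M ⟶ M.Q.P := ⟨fun _ _ => toP fun s b => evQ.symm.toLinearMap ∘ₗ
  if b then M.map (Compl.insert s).symm else M.v none ∘ₗ M.ε ∘ₗ M.map (Compl.insert s).symm⟩

/-- The cap `PQ → 𝟏`. -/
def capP : M.Q.P ⟶ M := ⟨fun _ _ => ∑ᶠ s, M.map (Compl.insert s) ∘ₗ
  (M.ε ∘ₗ evQ.toLinearMap ∘ₗ evP s false + M.v none ∘ₗ evQ.toLinearMap ∘ₗ evP s true)⟩

/-- The crossing `PQ → QP`. -/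
def crossPQ : M.Q.P ⟶ M.P.Q := ⟨fun _ _ => evQ.symm.toLinearMap ∘ₗ toP fun t b => match t with
  | none => 0
  | some s => sgn b • (M.map (Compl.some s) ∘ₗ evQ.toLinearMap ∘ₗ evP s b)⟩

/-- The crossing `QP → PQ`. -/
def crossQP : M.P.Q ⟶ M.Q.P := ⟨fun _ _ => toP fun s b => evQ.symm.toLinearMap ∘ₗ
  (sgn b • (M.map (Compl.some s).symm ∘ₗ evP (some s) b ∘ₗ evQ.toLinearMap))⟩

/-- The crossing `QQ → QQ`. -/
def crossQQ : M.Q.Q ⟶ M.Q.Q := ⟨fun _ _ => evQ.symm.toLinearMap ∘ₗ evQ.symm.toLinearMap ∘ₗ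
  (-M.map swapOpt) ∘ₗ evQ.toLinearMap ∘ₗ evQ.toLinearMap⟩

/-- The crossing `PP → PP`. -/
def crossPP : M.P.P ⟶ M.P.P := ⟨fun _ _ => toP fun s b => toP fun t c => sgn (b && c) •
  (M.map (Compl.swap t) ∘ₗ evP (⟨s, fun h => t.2 h.symm⟩ : Compl t.1) b ∘ₗ evP t.1 c)⟩

variable {M} {S : Type} [Finite S]

@[simp] theorem dotP_false (z : M.P.obj S) (s : S) : evP s false (M.dotP.app S z) = 0 := rfl
@[simp] theorem dotP_true (z : M.P.obj S) (s : S) :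
    evP s true (M.dotP.app S z) = M.ε (evP s false z) := rfl
@[simp] theorem dotQ_app (z : M.Q.obj S) : evQ (M.dotQ.app S z) = M.v none (evQ z) := rfl
@[simp] theorem cupQ_none_false (m : M.obj S) :
    evP none false (evQ (M.cupQ.app S m)) = M.map Compl.none (M.ε m) := rfl
@[simp] theorem cupQ_none_true (m : M.obj S) :
    evP none true (evQ (M.cupQ.app S m)) = 0 := rfl
@[simp] theorem cupQ_some (m : M.obj S) (s : S) (b : Bool) :
    evP (some s) b (evQ (M.cupQ.app S m)) = 0 := rfl
@[simp] theorem capQ_app (z : M.P.Q.obj S) :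
    M.capQ.app S z = M.map Compl.none.symm (evP none true (evQ z)) := rfl
@[simp] theorem cupP_false (m : M.obj S) (s : S) :
    evQ (evP s false (M.cupP.app S m)) = M.v none (M.ε (M.map (Compl.insert s).symm m)) := rfl
@[simp] theorem cupP_true (m : M.obj S) (s : S) :
    evQ (evP s true (M.cupP.app S m)) = M.map (Compl.insert s).symm m := rfl
theorem capP_app (z : M.Q.P.obj S) : M.capP.app S z = ∑ᶠ s, M.map (Compl.insert s)
    (M.ε (evQ (evP s false z)) + M.v none (evQ (evP s true z))) :=
  AddMonoidHom.map_finsum (LinearMap.applyₗ z : _ →ₗ[ℂ] _).toAddMonoidHom (Set.toFinite _)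
@[simp] theorem crossPQ_none (z : M.Q.P.obj S) (b : Bool) :
    evP none b (evQ (M.crossPQ.app S z)) = 0 := rfl
@[simp] theorem crossPQ_some (z : M.Q.P.obj S) (s : S) (b : Bool) :
    evP (some s) b (evQ (M.crossPQ.app S z)) = sgn b • M.map (Compl.some s) (evQ (evP s b z)) := rfl
@[simp] theorem crossQP_app (z : M.P.Q.obj S) (s : S) (b : Bool) :
    evQ (evP s b (M.crossQP.app S z)) =
      sgn b • M.map (Compl.some s).symm (evP (some s) b (evQ z)) := rfl
@[simp] theorem crossQQ_app (z : M.Q.Q.obj S) :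
    evQ (evQ (M.crossQQ.app S z)) = -M.map swapOpt (evQ (evQ z)) := rfl
@[simp] theorem crossPP_app (z : M.P.P.obj S) (s : S) (b : Bool) (t : Compl s) (c : Bool) :
    evP t c (evP s b (M.crossPP.app S z)) = sgn (b && c) •
      M.map (Compl.swap t) (evP (⟨s, fun h => t.2 h.symm⟩ : Compl t.1) b (evP t.1 c z)) := rfl

end Sp

end HeisCat

end

/-! ### Parity of the operators -/

noncomputable section

namespace HeisCat

namespace Sp

variable (M : Sp)

/-- For each operator the sign is (-1) to the degree of the diagram. For `v s` on a component at
`t`, the cases `s = t` and `s ≠ t` are separate, since only in the first does the operator act on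
the factor Λ. -/
theorem isPar_dotP : IsPar (-1) M.dotP where
  map e z := P_ext fun t b => by cases b <;> simp [M.map_ε]
  v s z := P_ext fun t b => by
    by_cases h : s = t
    · subst h; cases b <;> simp
    · cases b <;> simp [P_v_of_ne _ h, M.v_ε]
  ε z := P_ext fun t b => by cases b <;> simp

theorem isPar_dotQ : IsPar (-1) M.dotQ where
  map e z := evQ.injective <| by simp [M.map_v]
  v s z := evQ.injective <| by simp [M.v_v none]
  ε z := evQ.injective <| by simp [M.v_ε]

theorem isPar_cupQ : IsPar (-1) M.cupQ where
  map e z := evQ.injective <| P_ext fun t b => by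
    rcases t with _ | t <;> cases b <;> simp [M.map_ε, M.map_map]
    refine congrArg _ (M.map_eq_map (fun x => ?_) _)
    rfl
  v s z := evQ.injective <| P_ext fun t b => by
    rcases t with _ | t
    · cases b <;> simp [M.map_ε, M.v_ε, M.map_v]
      rfl
    · by_cases h : s = t
      · subst h; cases b <;> simp
      · simp [P_v_some_some _ h]
  ε z := evQ.injective <| P_ext fun t b => by
    rcases t with _ | t
    · cases b <;> simp [M.map_ε]
    · cases b <;> simp

theorem isPar_capQ : IsPar 1 M.capQ where
  map e z := by
    simp [M.map_map]
    refine M.map_eq_map (fun x => ?_) _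
    rcases x with ⟨_ | x, h⟩
    · exact absurd rfl h
    · rfl
  v s z := by
    simp [M.map_v]
  ε z := by
    simp [M.map_ε]

theorem isPar_cupP : IsPar 1 M.cupP where
  map e z := P_ext fun t b => evQ.injective <| by
    have h : M.map (Compl.insert t).symm (M.map e z) = M.map (Equiv.optionCongr (Compl.congr e t))
      (M.map (Compl.insert (e.symm t)).symm z) := by
      simp only [M.map_map]
      refine M.map_eq_map (fun x => ?_) _
      by_cases h : x = e.symm t
      · subst h; simp
      · have h' : e x ≠ t := fun h' => h (by simp [← h'])
        simp [Compl.insert_symm_of_ne h, Compl.insert_symm_of_ne h']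
        rfl
    cases b <;> simp [h, M.map_v, M.map_ε]
  v s z := P_ext fun t b => evQ.injective <| by
    by_cases h : s = t
    · subst h
      cases b <;> simp [M.map_v, M.v_ε, M.ε_ε]
    · cases b <;> simp [P_v_of_ne _ h, M.map_v, M.v_ε, Compl.insert_symm_of_ne h, M.v_v none]
  ε z := P_ext fun t b => evQ.injective <| by
    cases b <;> simp [M.map_ε, M.v_ε]

theorem map_finsum' {V W ι : Type} [AddCommGroup V] [Module ℂ V] [AddCommGroup W] [Module ℂ W]
    [Finite ι] (L : V →ₗ[ℂ] W) (f : ι → V) : L (∑ᶠ i, f i) = ∑ᶠ i, L (f i) :=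
  AddMonoidHom.map_finsum L.toAddMonoidHom (Set.toFinite _)

theorem isPar_capP : IsPar (-1) M.capP where
  map e z := by
    rw [capP_app, capP_app, map_finsum', ← finsum_comp_equiv e.symm]
    refine finsum_congr fun t => ?_
    have h : ∀ m, M.map (Compl.insert t) (M.map (Equiv.optionCongr (Compl.congr e t)) m) =
        M.map e (M.map (Compl.insert (e.symm t)) m) := fun m => by
      simp only [M.map_map]
      refine M.map_eq_map (fun x => ?_) _
      rcases x with _ | x <;> simp
    rw [← h]
    simp [M.map_ε, M.map_v]
  v s z := by
    rw [capP_app, capP_app, map_finsum', smul_finsum]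
    refine finsum_congr fun t => ?_
    by_cases h : s = t
    · subst h
      simp [M.map_v, M.map_ε, M.v_ε]
    · simp [P_v_of_ne _ h, M.map_v, M.map_ε, M.v_ε, M.v_v none]
  ε z := by
    rw [capP_app, capP_app, map_finsum', smul_finsum]
    refine finsum_congr fun t => ?_
    simp [M.map_v, M.map_ε, M.v_ε]

theorem isPar_crossPQ : IsPar 1 M.crossPQ where
  map e z := evQ.injective <| P_ext fun t b => by
    rcases t with _ | t <;> simp [M.map_map]
    refine congrArg _ (M.map_eq_map (fun x => ?_) _)
    rcases x with _ | x <;> rfl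
  v s z := evQ.injective <| P_ext fun t b => by
    rcases t with _ | t
    · simp
    · by_cases h : s = t
      · subst h
        cases b <;> simp [M.map_ε]
      · simp [P_v_some_some _ h, P_v_of_ne _ h, M.map_v]
        rfl
  ε z := evQ.injective <| P_ext fun t b => by
    rcases t with _ | t <;> cases b <;> simp [M.map_ε]

theorem isPar_crossQP : IsPar 1 M.crossQP where
  map e z := P_ext fun t b => evQ.injective <| by
    simp [M.map_map]
    refine congrArg _ (M.map_eq_map (fun x => ?_) _)
    rcases x with ⟨_ | x, h⟩ <;> rfl
  v s z := P_ext fun t b => evQ.injective <| by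
    by_cases h : s = t
    · subst h
      cases b <;> simp [M.map_ε]
    · simp [P_v_some_some _ h, P_v_of_ne _ h, M.map_v]
  ε z := P_ext fun t b => evQ.injective <| by
    cases b <;> simp [M.map_ε]

theorem isPar_crossQQ : IsPar 1 M.crossQQ where
  map e z := evQ.injective <| evQ.injective <| by
    simp [M.map_map]
    refine M.map_eq_map (fun x => ?_) _
    rcases x with _ | _ | x <;> rfl
  v s z := evQ.injective <| evQ.injective <| by
    simp [M.map_v]
    rfl
  ε z := evQ.injective <| evQ.injective <| by
    simp [M.map_ε]

theorem isPar_crossPP : IsPar 1 M.crossPP where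
  map e z := P_ext fun s b => P_ext fun t c => by
    simp only [crossPP_app, P_map_apply, map_smul]
    congr 1
    erw [M.map_map, M.map_map]
    exact M.map_eq_map (fun x => rfl) _
  v x z := P_ext fun s b => P_ext fun t c => by
    by_cases h : x = s
    · subst h
      cases b <;> cases c <;> simp [P_v_of_ne _ t.2.symm, M.map_ε]
    · by_cases h' : x = t.1
      · obtain ⟨t, ht⟩ := t
        subst h'
        cases b <;> cases c <;> simp [P_v_of_ne _ h, M.map_ε]
      · have h'' : (⟨x, h⟩ : Compl s) ≠ t := fun e => h' (congrArg Subtype.val e)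
        have h₃ : (⟨x, h'⟩ : Compl t.1) ≠ ⟨s, fun h => t.2 h.symm⟩ :=
          fun e => h (congrArg Subtype.val e)
        simp [P_v_of_ne _ h, P_v_of_ne _ h', P_v_of_ne _ h'', P_v_of_ne _ h₃, M.map_v]
        rfl
  ε z := P_ext fun s b => P_ext fun t c => by
    cases b <;> cases c <;> simp [M.map_ε]

end Sp

end HeisCat

end

/-! ### Naturality of the operators up to sign -/

noncomputable section

namespace HeisCat

open Strand

namespace Sp

section

variable {M N : Sp} {c : ℂ} {h : M ⟶ N} (hh : IsPar c h)
include hh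

/-- An operator picks up one factor `c` for each `ε` or `v` in its formula. The odd operators
contain exactly one of these; crossings and the cap of QP contain none. -/
theorem dotP_nat : M.dotP ≫ mapP h = c • mapP h ≫ N.dotP :=
  hom_ext fun S _ z => P_ext fun t b => by cases b <;> simp [hh.ε]

theorem dotQ_nat : M.dotQ ≫ mapQ h = c • mapQ h ≫ N.dotQ :=
  hom_ext fun S _ z => evQ.injective <| by simp [hh.v]

theorem cupQ_nat : M.cupQ ≫ mapQ (mapP h) = c • h ≫ N.cupQ :=
  hom_ext fun S _ z => evQ.injective <| P_ext fun t b => by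
    rcases t with _ | t <;> cases b <;> simp [hh.ε, hh.map]

theorem capQ_nat : M.capQ ≫ h = mapQ (mapP h) ≫ N.capQ :=
  hom_ext fun S _ z => by simp [hh.map]

/-- One component of this cup contains both `v` and `ε` and the other contains neither, so
naturality without a sign requires `c * c = 1`. -/
theorem cupP_nat (hc : c * c = 1) : M.cupP ≫ mapP (mapQ h) = h ≫ N.cupP :=
  hom_ext fun S _ z => P_ext fun t b => evQ.injective <| by
    cases b <;> simp [hh.ε, hh.v, hh.map, smul_smul, hc]

theorem capP_nat : M.capP ≫ h = c • mapP (mapQ h) ≫ N.capP :=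
  hom_ext fun S _ z => by
    simp only [comp_app, smul_app, capP_app, map_finsum', smul_finsum]
    exact finsum_congr fun s => by simp [hh.map, hh.ε, hh.v]

theorem crossPQ_nat : M.crossPQ ≫ mapQ (mapP h) = mapP (mapQ h) ≫ N.crossPQ :=
  hom_ext fun S _ z => evQ.injective <| P_ext fun t b => by
    rcases t with _ | t <;> simp [hh.map]

theorem crossQP_nat : M.crossQP ≫ mapP (mapQ h) = mapQ (mapP h) ≫ N.crossQP :=
  hom_ext fun S _ z => P_ext fun t b => evQ.injective <| by simp [hh.map]

theorem crossQQ_nat : M.crossQQ ≫ mapQ (mapQ h) = mapQ (mapQ h) ≫ N.crossQQ :=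
  hom_ext fun S _ z => evQ.injective <| evQ.injective <| by simp [hh.map]

theorem crossPP_nat : M.crossPP ≫ mapP (mapP h) = mapP (mapP h) ≫ N.crossPP :=
  hom_ext fun S _ z => P_ext fun s b => P_ext fun t c => by simp [hh.map]

end

/-- The endofunctor given by a word. -/
def wordFunctor : Word → Sp ⥤ Sp
  | [] => 𝟭 Sp
  | a :: w => wordFunctor w ⋙ functor a

/-- The natural transformation given by an elementary diagram. -/
def genHom (M : Sp) : ∀ {a b : Word}, Gen a b → ((wordFunctor a).obj M ⟶ (wordFunctor b).obj M)
  | _, _, .cross .P .P => M.crossPP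
  | _, _, .cross .P .Q => M.crossPQ
  | _, _, .cross .Q .P => M.crossQP
  | _, _, .cross .Q .Q => M.crossQQ
  | _, _, .dot .P => M.dotP
  | _, _, .dot .Q => M.dotQ
  | _, _, .cup .P => M.cupP
  | _, _, .cup .Q => M.cupQ
  | _, _, .cap .P => M.capP
  | _, _, .cap .Q => M.capQ

theorem isPar_genHom (M : Sp) {a b : Word} (g : Gen a b) :
    IsPar ((-1) ^ deg a b g) (M.genHom g) := by
  cases g with
  | cross a b =>
    cases a <;> cases b
    · exact M.isPar_crossPP
    · exact M.isPar_crossPQ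
    · exact M.isPar_crossQP
    · exact M.isPar_crossQQ
  | dot a =>
    rw [show ((-1 : ℂ) ^ deg _ _ (Gen.dot a)) = -1 from zpow_one _]
    cases a
    · exact M.isPar_dotP
    · exact M.isPar_dotQ
  | cup a =>
    cases a
    · exact M.isPar_cupP
    · rw [show ((-1 : ℂ) ^ deg _ _ (Gen.cup .Q)) = -1 by simp [deg]]
      exact M.isPar_cupQ
  | cap a =>
    cases a
    · rw [show ((-1 : ℂ) ^ deg _ _ (Gen.cap .P)) = -1 from zpow_one _]
      exact M.isPar_capP
    · exact M.isPar_capQ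

/-- This is the Koszul rule for exchanging an elementary diagram with a family `h` of sign `c` to
its right; it becomes the interchange law when `h` is itself the evaluation of a diagram. -/
theorem genHom_nat {M N : Sp} {c : ℂ} (hc : c * c = 1) {h : M ⟶ N} (hh : IsPar c h)
    {a b : Word} (g : Gen a b) : M.genHom g ≫ (wordFunctor b).map h =
      (c ^ deg a b g) • (wordFunctor a).map h ≫ N.genHom g := by
  cases g with
  | cross a b =>
    refine Eq.trans ?_ (one_smul ℂ _).symm
    cases a <;> cases b
    · exact crossPP_nat hh
    · exact crossPQ_nat hh
    · exact crossQP_nat hh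
    · exact crossQQ_nat hh
  | dot a =>
    rw [show c ^ deg _ _ (Gen.dot a) = c from zpow_one _]
    cases a
    · exact dotP_nat hh
    · exact dotQ_nat hh
  | cup a =>
    cases a
    · exact (cupP_nat hh hc).trans (one_smul ℂ _).symm
    -- The counterclockwise cup has degree -1, and `c⁻¹ = c`.
    · rw [show c ^ deg _ _ (Gen.cup .Q) = c from
        (zpow_neg_one c).trans (eq_inv_of_mul_eq_one_left hc).symm]
      exact cupQ_nat hh
  | cap a =>
    cases a
    · rw [show c ^ deg _ _ (Gen.cap .P) = c from zpow_one _]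
      exact capP_nat hh
    · exact (capQ_nat hh).trans (one_smul ℂ _).symm

end Sp

end HeisCat

end

/-! ### Circles, curls, double crossings and dots on species -/

noncomputable section

namespace HeisCat

namespace Sp

variable (M : Sp)

variable {M} in
theorem map_eq_zero_of {S T : Type} {e : S ≃ T} {m : M.obj S} (h : m = 0) : M.map e m = 0 := by
  rw [h, map_zero]

variable {M} in
theorem evP_eq_zero_of {S : Type} {t : S} {b : Bool} {z : M.P.obj S} (h : z = 0) :
    evP t b z = 0 := by
  rw [h, map_zero]

/-- The cup writes the coefficient of 1 at the new point and the cap reads the coefficient of `v`. A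
dot in between turns one into the other, which explains `circle_dot`. -/
theorem circle : M.cupQ ≫ M.capQ = 0 := hom_ext fun S _ z => by simp

theorem circle_dot : M.cupQ ≫ mapQ M.dotP ≫ M.capQ = 𝟙 M := hom_ext fun S _ z => by
  simp [M.map_ε, M.ε_ε, M.map_map, M.map_refl]

/-- The cup is supported at the new point. After the crossing, the cap reads a component of it at an
old point, which is zero. -/
theorem curl : M.P.cupQ ≫ mapQ M.crossPP ≫ M.P.capQ = 0 := hom_ext fun S _ z =>
  P_ext fun t b => by
    have h : evP (some t) b (evQ (M.P.cupQ.app S z)) = 0 := cupQ_some _ _ _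
    simp
    refine .inr ?_
    exact map_eq_zero_of (map_eq_zero_of (evP_eq_zero_of h))

theorem dotP_dotP : M.dotP ≫ M.dotP = 0 := hom_ext fun S _ z => P_ext fun t b => by
  cases b <;> simp

theorem dotQ_dotQ : M.dotQ ≫ M.dotQ = 0 := hom_ext fun S _ z => evQ.injective <| by simp

theorem crossPP_crossPP : M.crossPP ≫ M.crossPP = 𝟙 _ :=
  hom_ext fun S _ z => P_ext fun s b => P_ext fun t c => by
    cases b <;> cases c <;> simp [M.map_map]
    all_goals exact M.map_eq_self (fun _ => rfl) _

theorem crossQQ_crossQQ : M.crossQQ ≫ M.crossQQ = 𝟙 _ :=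
  hom_ext fun S _ z => evQ.injective <| evQ.injective <| by
    simp [M.map_map]
    refine M.map_eq_self (fun x => ?_) _
    rcases x with _ | _ | x <;> rfl

theorem crossPQ_crossQP : M.crossPQ ≫ M.crossQP = 𝟙 _ :=
  hom_ext fun S _ z => P_ext fun s b => evQ.injective <| by
    cases b <;> simp [M.map_map, M.map_refl]

/-- The two crossings lose exactly the component at the new point. Its two coefficients, of 1 and of
`v`, are restored by the two terms with a cap, a cup and a dot. -/
theorem crossQP_crossPQ : M.crossQP ≫ M.crossPQ + (M.capQ ≫ M.cupQ ≫ mapQ M.dotP +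
    mapQ M.dotP ≫ M.capQ ≫ M.cupQ) = 𝟙 _ :=
  hom_ext fun S _ z => evQ.injective <| P_ext fun t b => by
    rcases t with _ | t <;> cases b <;> simp [M.map_map, M.map_refl, M.ε_ε, M.map_ε]

theorem crossPP_dot : M.P.dotP ≫ M.crossPP = M.crossPP ≫ mapP M.dotP :=
  hom_ext fun S _ z => P_ext fun s b => P_ext fun t c => by
    cases b <;> cases c <;> simp [M.map_ε]

theorem crossPP_dot' : mapP M.dotP ≫ M.crossPP = M.crossPP ≫ M.P.dotP :=
  hom_ext fun S _ z => P_ext fun s b => P_ext fun t c => by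
    cases b <;> cases c <;> simp [M.map_ε]

theorem crossPQ_dot : M.Q.dotP ≫ M.crossPQ = M.crossPQ ≫ mapQ M.dotP :=
  hom_ext fun S _ z => evQ.injective <| P_ext fun t b => by
    rcases t with _ | t <;> cases b <;> simp [M.map_ε]

theorem crossPQ_dot' : mapP M.dotQ ≫ M.crossPQ = M.crossPQ ≫ M.P.dotQ :=
  hom_ext fun S _ z => evQ.injective <| P_ext fun t b => by
    rcases t with _ | t <;> cases b <;> simp [M.map_v]
    all_goals rfl

theorem crossQP_dot : M.P.dotQ ≫ M.crossQP = M.crossQP ≫ mapP M.dotQ :=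
  hom_ext fun S _ z => P_ext fun t b => evQ.injective <| by
    cases b <;> simp [M.map_v]

theorem crossQP_dot' : mapQ M.dotP ≫ M.crossQP = M.crossQP ≫ M.Q.dotP :=
  hom_ext fun S _ z => P_ext fun t b => evQ.injective <| by
    cases b <;> simp [M.map_ε]

theorem crossQQ_dot : M.Q.dotQ ≫ M.crossQQ = M.crossQQ ≫ mapQ M.dotQ :=
  hom_ext fun S _ z => evQ.injective <| evQ.injective <| by
    simp [M.map_v]
    all_goals rfl

theorem crossQQ_dot' : mapQ M.dotQ ≫ M.crossQQ = M.crossQQ ≫ M.Q.dotQ :=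
  hom_ext fun S _ z => evQ.injective <| evQ.injective <| by
    simp [M.map_v]
    all_goals rfl

theorem dot_cupP : M.cupP ≫ M.Q.dotP = M.cupP ≫ mapP M.dotQ :=
  hom_ext fun S _ z => P_ext fun t b => evQ.injective <| by
    cases b <;> simp [M.v_ε, M.ε_ε]

theorem dot_cupQ : M.cupQ ≫ M.P.dotQ = M.cupQ ≫ mapQ M.dotP :=
  hom_ext fun S _ z => evQ.injective <| P_ext fun t b => by
    rcases t with _ | t <;> cases b <;> simp [M.map_ε]

theorem dot_capP : M.Q.dotP ≫ M.capP = mapP M.dotQ ≫ M.capP :=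
  hom_ext fun S _ z => by
    simp only [comp_app, capP_app]
    refine finsum_congr fun s => ?_
    simp [M.v_ε]

theorem dot_capQ : M.P.dotQ ≫ M.capQ = mapQ M.dotP ≫ M.capQ :=
  hom_ext fun S _ z => by simp

theorem zigzag_capQ : mapQ M.cupP ≫ M.Q.capQ = 𝟙 _ :=
  hom_ext fun S _ z => evQ.injective <| by
    simp [M.map_map]
    refine M.map_eq_self (fun x => ?_) _
    rcases x with _ | x
    · simp
    · rw [Equiv.trans_apply, Compl.insert_symm_of_ne (by simp)]
      rfl

end Sp

end HeisCat

end

/-! ### Zigzags, pitchforks and triple points on species -/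

noncomputable section

namespace HeisCat

namespace Sp

variable (M : Sp)

theorem zigzag_capQ' : M.P.cupP ≫ mapP M.capQ = 𝟙 _ :=
  hom_ext fun S _ z => P_ext fun t b => by
    have h (b) : M.map Compl.none.symm (M.map (Compl.congr (Compl.insert t).symm none)
        (evP (Compl.insert t none) b z)) = evP t b z := by
      rw [evP_eq z (Compl.insert_none t).symm, M.map_map, M.map_map]
      refine M.map_eq_self (fun x => ?_) _
      exact Compl.none.symm_apply_eq.2 (Subtype.ext (Compl.insert_symm_of_ne x.2))
    cases b <;> simp [M.ε_ε, h]

theorem zigzag_capP : mapP M.cupQ ≫ M.P.capP = 𝟙 _ :=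
  hom_ext fun S _ z => P_ext fun t b => by
    simp only [comp_app, capP_app, map_finsum', id_app]
    -- The cup is supported at the new point, and after reinserting `s` the point `t` is the new one
    -- only for `s = t`.
    rw [finsum_eq_single _ t]
    · have h (w) : evP ((Compl.insert t).symm t) b w =
          M.map (Compl.ofEq (Compl.insert_symm_self t).symm) (evP none b w) := evP_eq w _ b
      have h' (m : M.obj (Compl t)) : M.map (Compl.congr (Compl.insert t) t)
          (M.map (Compl.ofEq (Compl.insert_symm_self t).symm) (M.map Compl.none m)) = m := by
        rw [M.map_map, M.map_map]
        refine M.map_eq_self (fun x => Subtype.ext ?_) _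
        simp
      simp [h]
      cases b <;> simp [M.map_ε, M.ε_ε, h']
    · intro s hs
      have h (w) : evP ((Compl.insert s).symm t) b w =
          M.map (Compl.ofEq (Compl.insert_symm_of_ne hs.symm).symm) (evP (some _) b w) :=
        evP_eq w _ b
      cases b <;> simp [h]

theorem zigzag_capP' : M.Q.cupQ ≫ mapQ M.capP = -𝟙 _ :=
  hom_ext fun S _ z => evQ.injective <| by
    simp [capP_app]
    -- Only the new point contributes. The sign comes from the parity shift of the derivative: the
    -- cup applies `-ε` and the cap applies `ε`.
    rw [finsum_eq_single _ none]
    · simp [M.map_map, M.map_ε, M.ε_ε]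
      refine M.map_eq_self (fun x => ?_) _
      rcases x with _ | x
      · simp
      · simp
    · intro s hs
      obtain ⟨s, rfl⟩ := Option.ne_none_iff_exists'.1 hs
      simp

theorem pitchfork_cupPP : mapP M.cupP ≫ M.Q.crossPP = M.P.cupP ≫ mapP M.crossQP :=
  hom_ext fun S _ z => P_ext fun s b => P_ext fun t c => evQ.injective <| by
    have h (m) : M.map t.swap.optionCongr (M.map (Compl.insert ⟨s, fun h => t.2 h.symm⟩).symm m) =
        M.map (Compl.some t).symm (M.map (Compl.congr (Compl.insert s).symm (some t))
          (M.map (Compl.ofEq (Compl.insert_some s t).symm) m)) := by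
      simp only [M.map_map]
      refine M.map_eq_map (fun x => ?_) _
      refine (Compl.some t).eq_symm_apply.2 (Subtype.ext ?_)
      by_cases hx : x.1 = s
      · obtain ⟨x, h⟩ := x
        obtain rfl : x = s := hx
        simp
      · have hx' : x ≠ ⟨s, fun h => t.2 h.symm⟩ := fun h => hx (congrArg Subtype.val h)
        simp [Compl.insert_symm_of_ne hx, Compl.insert_symm_of_ne hx']
        rfl
    cases b <;> cases c <;>
      simp [evP_eq z (Compl.insert_some s t).symm, ← h, M.map_v, M.map_ε]

theorem pitchfork_cupPQ : mapQ M.cupP ≫ M.Q.crossQP = M.Q.cupP ≫ mapP M.crossQQ :=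
  hom_ext fun S _ z => P_ext fun t c => evQ.injective <| evQ.injective <| by
    have h (m) : M.map (Compl.some t).optionCongr.symm (M.map (Compl.insert (some t)).symm m) =
        M.map swapOpt (M.map (Compl.insert t).optionCongr.symm m) := by
      simp only [M.map_map]
      refine M.map_eq_map (fun x => ?_) _
      rcases x with _ | x
      · simp [Compl.insert_symm_of_ne]
        rfl
      · by_cases hx : x = t
        · subst hx
          rw [Equiv.trans_apply, Compl.insert_symm_self, Equiv.trans_apply,
            ← Equiv.optionCongr_symm, ← Equiv.optionCongr_symm, Equiv.optionCongr_apply,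
            Equiv.optionCongr_apply, Option.map_some, Compl.insert_symm_self]
          rfl
        · have hx' : some x ≠ some t := by simpa using hx
          rw [Equiv.trans_apply, Compl.insert_symm_of_ne hx', Equiv.trans_apply,
            ← Equiv.optionCongr_symm, ← Equiv.optionCongr_symm, Equiv.optionCongr_apply,
            Equiv.optionCongr_apply, Option.map_some, Option.map_some, Compl.insert_symm_of_ne hx]
          rfl
    cases c <;> simp [← h, M.map_v, M.map_ε]
    rfl

theorem pitchfork_cupQP : mapP M.cupQ ≫ M.P.crossPQ = M.P.cupQ ≫ mapQ M.crossPP :=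
  hom_ext fun S _ z => evQ.injective <| P_ext fun t c => P_ext fun s b => by
    obtain ⟨s, hs⟩ := s
    rcases t with _ | t
    · obtain ⟨s, rfl⟩ := Option.ne_none_iff_exists'.1 hs
      simp
    · rcases s with _ | s
      · cases b
        · have h : evP ⟨some t, hs.symm⟩ c (evP none false (evQ (M.P.cupQ.app S z))) =
            M.map (Compl.congr Compl.none ⟨some t, hs.symm⟩) (sgn c • M.ε (evP t c z)) := by
            cases c <;> simp <;> rfl
          have h' (m : M.obj (Compl t)) : M.map (Compl.congr (Compl.some t) ⟨none, hs⟩)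
              (M.map Compl.none m) = M.map (Compl.swap ⟨none, hs⟩)
                (M.map (Compl.congr Compl.none ⟨some t, hs.symm⟩) m) := by
            refine (M.map_map _ _ _).trans (Eq.trans ?_ (M.map_map _ _ _).symm)
            refine M.map_eq_map (fun _ => ?_) _
            rfl
          simp only [comp_app, evQ_mapQ, crossPP_app, h, Bool.and_false, sgn_false, one_smul,
            crossPQ_some, evP_mapP]
          refine Eq.trans ?_ (h' _)
          simp
          refine (congrArg (fun x => sgn c • M.map _ x) (cupQ_none_false _)).trans ?_
          exact (map_smul _ _ _).symm
        · simp
          exact .inr (map_eq_zero_of (cupQ_none_true _))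
      · simp
        exact .inr (map_eq_zero_of (cupQ_some _ _ _))

theorem pitchfork_cupQQ : mapQ M.cupQ ≫ M.P.crossQQ = M.Q.cupQ ≫ mapQ M.crossPQ :=
  hom_ext fun S _ z => evQ.injective <| evQ.injective <| P_ext fun s b => by
    rcases s with _ | _ | s
    · simp
      exact map_eq_zero_of (cupQ_some _ _ _)
    · simp
      cases b
      · refine (congrArg (fun x => - M.map _ x) (cupQ_none_false _)).trans ?_
        simp
        refine (M.map_map _ _ _).trans (Eq.trans ?_ (M.map_map _ _ _).symm)
        refine M.map_eq_map (fun x => ?_) _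
        rcases x with _ | x <;> rfl
      · refine (congrArg (fun x => - M.map _ x) (cupQ_none_true _)).trans ?_
        simp
    · simp
      exact map_eq_zero_of (cupQ_some _ _ _)

theorem pitchfork_capQP : mapQ M.crossPP ≫ M.P.capQ = M.P.crossQP ≫ mapP M.capQ :=
  hom_ext fun S _ z => P_ext fun s b => by
    have h (w : M.P.obj (Compl (some s))) : evP (Compl.some s none) true w =
        M.map (Compl.ofEq (Subtype.ext rfl)) (evP ⟨none, by simp⟩ true w) := evP_eq w _ _
    cases b <;> simp [h]
    all_goals
      refine (M.map_map _ _ _).trans (Eq.trans ?_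
        ((congrArg (M.map _) (M.map_map _ _ _)).trans (M.map_map _ _ _)).symm)
      refine M.map_eq_map (fun x => ?_) _
      rcases x with ⟨⟨_ | x, hx⟩, hx'⟩
      · exact absurd rfl hx'
      · rfl

theorem pitchfork_capQQ : mapQ M.crossQP ≫ M.Q.capQ = M.P.crossQQ ≫ mapQ M.capQ :=
  hom_ext fun S _ z => evQ.injective <| by
    have h (w : M.P.obj (Option (Option S))) : evP (swapOpt.symm none) true w =
        M.map (Compl.ofEq (by rfl)) (evP (some none) true w) := evP_eq w _ _
    simp [h, M.map_map]
    refine M.map_eq_map (fun x => ?_) _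
    rcases x with ⟨_ | _ | x, hx⟩
    · rfl
    · exact absurd rfl hx
    · rfl

/-- Both composites relabel the points in the same way, and the signs are the same product over
pairs of strands, taken in another order. The other orientations follow the same pattern, with
components at a new point treated apart when a crossing PQ → QP annihilates them. -/
theorem triplePPP : M.P.crossPP ≫ mapP M.crossPP ≫ M.P.crossPP =
    mapP M.crossPP ≫ M.P.crossPP ≫ mapP M.crossPP :=
  hom_ext fun S _ z => P_ext fun s b => P_ext fun t c => P_ext fun u d => by
    simp [M.map_map, smul_smul]
    exact congrArg₂ (· • ·) (by ring) (M.map_eq_map (fun x => rfl) _)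

theorem triplePPQ : M.Q.crossPP ≫ mapP M.crossPQ ≫ M.P.crossPQ =
    mapP M.crossPQ ≫ M.P.crossPQ ≫ mapQ M.crossPP :=
  hom_ext fun S _ z => evQ.injective <| P_ext fun s b => P_ext fun t c => by
    obtain ⟨t, ht⟩ := t
    rcases s with _ | s
    · obtain ⟨t, rfl⟩ := Option.ne_none_iff_exists'.1 ht
      simp
      exact (smul_eq_zero_of_right _ (smul_eq_zero_of_right _
        (map_eq_zero_of (map_eq_zero_of (crossPQ_none _ _))))).symm
    · rcases t with _ | t
      · simp
        exact .inr (map_eq_zero_of (crossPQ_none _ _))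
      · simp
        refine (congrArg (fun x => sgn b • M.map _ x) (crossPQ_some _ _ _)).trans (Eq.trans ?_
          (congrArg (fun x => sgn (b && c) • sgn c • M.map _ (M.map _ x))
            (crossPQ_some _ _ _)).symm)
        simp [M.map_map, smul_smul]
        refine congrArg₂ (· • ·) (by ring) ?_
        refine (M.map_map _ _ _).trans (Eq.trans ?_
          ((congrArg (M.map _) (M.map_map _ _ _)).trans (M.map_map _ _ _)).symm)
        refine M.map_eq_map (fun x => ?_) _
        rcases x with _ | x <;> rfl

theorem triplePQP : M.P.crossPQ ≫ mapQ M.crossPP ≫ M.P.crossQP =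
    mapP M.crossQP ≫ M.Q.crossPP ≫ mapP M.crossPQ :=
  hom_ext fun S _ z => P_ext fun s b => evQ.injective <| P_ext fun t c => by
    rcases t with _ | t
    · have h : evP none c (evQ (M.P.crossPQ.app S z)) = 0 := crossPQ_none _ _
      simp
      refine .inr (.inr ?_)
      exact map_eq_zero_of (map_eq_zero_of (evP_eq_zero_of h))
    · have h : evP ⟨some s, fun h => t.2 (Option.some_injective _ h).symm⟩ b
          (evP (some t.1) c (evQ (M.P.crossPQ.app S z))) = sgn c • M.map (Compl.congr
            (Compl.some t.1) ⟨some s, fun h => t.2 (Option.some_injective _ h).symm⟩)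
            (evP ((Compl.some t.1).symm ⟨some s, fun h => t.2 (Option.some_injective _ h).symm⟩) b
              (evQ (evP t.1 c z))) := by
        simp
      simp
      refine (congrArg (fun x => sgn b • sgn (b && c) • M.map _ (M.map _ x)) h).trans ?_
      refine (congrArg (fun x => sgn b • sgn (b && c) • M.map _ x) (map_smul _ _ _)).trans ?_
      refine (congrArg (fun x => sgn b • sgn (b && c) • x) (map_smul _ _ _)).trans ?_
      simp only [smul_smul]
      refine congrArg₂ (· • ·) (by ring) ?_
      refine (congrArg (M.map _) (M.map_map _ _ _)).trans ((M.map_map _ _ _).trans (Eq.trans ?_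
        ((congrArg (M.map _) (M.map_map _ _ _)).trans (M.map_map _ _ _)).symm))
      refine M.map_eq_map (fun x => ?_) _
      rcases x with ⟨_ | x, hx⟩ <;> rfl

theorem tripleQPP : M.P.crossQP ≫ mapP M.crossQP ≫ M.Q.crossPP =
    mapQ M.crossPP ≫ M.P.crossQP ≫ mapP M.crossQP :=
  hom_ext fun S _ z => P_ext fun s b => P_ext fun t c => evQ.injective <| by
    simp [M.map_map, smul_smul]
    refine congrArg₂ (· • ·) (by ring) ?_
    refine Eq.trans ?_ (M.map_map _ _ _).symm
    refine M.map_eq_map (fun x => ?_) _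
    rcases x with ⟨⟨_ | x, hx⟩, hx'⟩ <;> rfl

theorem triplePQQ : M.Q.crossPQ ≫ mapQ M.crossPQ ≫ M.P.crossQQ =
    mapP M.crossQQ ≫ M.Q.crossPQ ≫ mapQ M.crossPQ :=
  hom_ext fun S _ z => evQ.injective <| evQ.injective <| P_ext fun s b => by
    rcases s with _ | _ | s
    · have h : evP (some none) b (evQ (M.crossPQ.app (Option S) (evQ (M.Q.crossPQ.app S z)))) = 0 := by simp
      simp [M.map_map]
      exact map_eq_zero_of h
    · have h : evP none b (evQ (M.crossPQ.app (Option S) (evQ (M.Q.crossPQ.app S z)))) = 0 := by simp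
      simp [M.map_map]
      exact map_eq_zero_of h
    · simp
      refine (congrArg (M.map _) (crossPQ_some _ _ _)).trans ?_
      simp [M.map_map, smul_smul]
      refine congrArg _ ((M.map_map _ _ _).trans (M.map_eq_map (fun x => ?_) _))
      rcases x with _ | _ | x <;> rfl

theorem tripleQPQ : M.Q.crossQP ≫ mapP M.crossQQ ≫ M.Q.crossPQ =
    mapQ M.crossPQ ≫ M.P.crossQQ ≫ mapQ M.crossQP :=
  hom_ext fun S _ z => evQ.injective <| P_ext fun s b => evQ.injective <| by
    rcases s with _ | s
    · have h : evP none b (evQ (M.crossPQ.app (Option S) (evQ z))) = 0 := crossPQ_none _ _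
      simp [M.map_map]
      exact .inr (map_eq_zero_of h)
    · simp
      refine Eq.trans ?_ (congrArg (fun x => sgn b • M.map _ (M.map _ x)) (crossPQ_some _ _ _)).symm
      simp [M.map_map, smul_smul]
      refine congrArg _ (Eq.trans (M.map_eq_map (fun x => ?_) _)
        ((congrArg (M.map _) (M.map_map _ _ _)).trans (M.map_map _ _ _)).symm)
      rcases x with _ | _ | x <;> rfl

theorem tripleQQP : M.P.crossQQ ≫ mapQ M.crossQP ≫ M.Q.crossQP =
    mapQ M.crossQP ≫ M.Q.crossQP ≫ mapP M.crossQQ :=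
  hom_ext fun S _ z => P_ext fun s b => evQ.injective <| evQ.injective <| by
    simp [M.map_map, smul_smul]
    refine congrArg₂ (· • ·) rfl (M.map_eq_map (fun x => ?_) _)
    rcases x with ⟨_ | _ | x, hx⟩ <;> rfl

theorem tripleQQQ : M.Q.crossQQ ≫ mapQ M.crossQQ ≫ M.Q.crossQQ =
    mapQ M.crossQQ ≫ M.Q.crossQQ ≫ mapQ M.crossQQ :=
  hom_ext fun S _ z => evQ.injective <| evQ.injective <| evQ.injective <| by
    simp [M.map_map]
    refine M.map_eq_map (fun x => ?_) _
    rcases x with _ | _ | _ | x <;> rfl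

/-- In a pitchfork with a clockwise cap the two sides sum over sets that differ by one point. The
extra term vanishes, because a crossing PQ → QP has no component at the new point. -/
theorem finsum_compl {V S : Type} [Finite S] [AddCommGroup V] {f : S → V} {s : S} (h : f s = 0) :
    ∑ᶠ t, f t = ∑ᶠ u : Compl s, f u.1 := by
  classical
  have := Fintype.ofFinite S
  rw [finsum_eq_sum_of_fintype, finsum_eq_sum_of_fintype, Fintype.sum_eq_add_sum_subtype_ne f s, h,
    zero_add]

theorem finsum_option {V S : Type} [Finite S] [AddCommGroup V] {f : Option S → V}
    (h : f none = 0) : ∑ᶠ t, f t = ∑ᶠ u, f (some u) := by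
  have := Fintype.ofFinite S
  rw [finsum_eq_sum_of_fintype, finsum_eq_sum_of_fintype, Fintype.sum_option, h, zero_add]

theorem pitchfork_capPQ : mapP M.crossQQ ≫ M.Q.capP = M.Q.crossPQ ≫ mapQ M.capP :=
  hom_ext fun S _ z => evQ.injective <| by
    simp only [comp_app, capP_app, map_finsum', evQ_mapQ]
    refine (map_finsum' evQ.toLinearMap _).trans ?_
    rw [finsum_option]
    · refine finsum_congr fun s => ?_
      have h (m) : M.map (Compl.insert s).optionCongr (M.map swapOpt m) =
          M.map (Compl.insert (some s)) (M.map (Compl.some s).optionCongr m) := by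
        simp only [M.map_map]
        refine M.map_eq_map (fun x => ?_) _
        rcases x with _ | _ | x
        · change some (Compl.insert s none) = Compl.insert (some s) none
          simp
        · change none = Compl.insert (some s) (some (Compl.some s none))
          simp
        · change some (Compl.insert s (some x)) = Compl.insert (some s)
            (some (Compl.some s (some x)))
          simp
      simp [M.map_ε, M.map_v, h]
    · simp

theorem pitchfork_capPP : mapP M.crossPQ ≫ M.P.capP = M.Q.crossPP ≫ mapP M.capP :=
  hom_ext fun S _ z => P_ext fun s b => by
    simp only [comp_app, capP_app, map_finsum', evP_mapP]
    rw [finsum_compl (s := s)]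
    · refine finsum_congr fun u => ?_
      have h (w) : evP ((Compl.insert u.1).symm s) b w =
          M.map (Compl.ofEq (Compl.insert_symm_of_ne u.2.symm).symm) (evP (some _) b w) :=
        evP_eq w _ b
      have h' (m) : M.map (Compl.congr (Compl.insert u.1) s)
          (M.map (Compl.ofEq (Compl.insert_symm_of_ne u.2.symm).symm)
            (M.map (Compl.some (⟨s, u.2.symm⟩ : Compl u.1)) m)) =
          M.map (Compl.insert u) (M.map u.swap.optionCongr m) := by
        simp only [M.map_map]
        refine M.map_eq_map (fun x => Subtype.ext ?_) _
        rcases x with _ | x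
        · change Compl.insert u.1 none = (Compl.insert u none).1
          simp
        · change Compl.insert u.1 (some _) = (Compl.insert u (some (u.swap x))).1
          simp
      have h₃ : Compl.congr (Compl.insert u.1) s (Compl.ofEq
          (Compl.insert_symm_of_ne u.2.symm).symm ⟨none, Option.some_ne_none _ |>.symm⟩) = u :=
        Subtype.ext (Compl.insert_none u.1)
      cases b <;> simp [h, M.map_ε, M.map_v, h', h₃]
    · have h (w) : evP ((Compl.insert s).symm s) b w =
          M.map (Compl.ofEq (Compl.insert_symm_self s).symm) (evP none b w) := evP_eq w _ b
      cases b <;> simp [h]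

end Sp

end HeisCat

end

/-! ### Evaluation of diagrams on species -/

noncomputable section

namespace HeisCat

open Strand Term

namespace Sp

variable {M N K : Sp}

namespace IsPar

theorem id (M : Sp) : IsPar 1 (𝟙 M) := ⟨fun _ _ => rfl, fun _ _ => by simp, fun _ => by simp⟩

theorem comp {c d : ℂ} {f : M ⟶ N} {g : N ⟶ K} (hf : IsPar c f) (hg : IsPar d g) :
    IsPar (c * d) (f ≫ g) :=
  ⟨fun e m => by simp [hf.map, hg.map], fun s m => by simp [hf.v, hg.v, mul_smul],
    fun m => by simp [hf.ε, hg.ε, mul_smul]⟩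

theorem zero (c : ℂ) : IsPar c (0 : M ⟶ N) :=
  ⟨fun _ _ => by simp, fun _ _ => by simp, fun _ => by simp⟩

theorem add {c : ℂ} {f g : M ⟶ N} (hf : IsPar c f) (hg : IsPar c g) : IsPar c (f + g) :=
  ⟨fun e m => by simp [hf.map, hg.map], fun s m => by simp [hf.v, hg.v],
    fun m => by simp [hf.ε, hg.ε]⟩

theorem smul {c : ℂ} {f : M ⟶ N} (d : ℂ) (hf : IsPar c f) : IsPar c (d • f) :=
  ⟨fun e m => by simp [hf.map], fun s m => by simp [hf.v, smul_comm c],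
    fun m => by simp [hf.ε, smul_comm c]⟩

theorem conj {M' N' : Sp} {c : ℂ} {f : M ⟶ N} (hf : IsPar c f) (h : M' = M) (h' : N = N') :
    IsPar c (CategoryTheory.eqToHom h ≫ f ≫ CategoryTheory.eqToHom h') := by
  subst h h'
  simpa using hf

theorem wordFunctor {c : ℂ} {f : M ⟶ N} (hf : IsPar c f) (w : Word) :
    IsPar c ((wordFunctor w).map f) := by
  induction w with
  | nil => exact hf
  | cons a w ih => exact ih.functor a

end IsPar

/-- The letters of a word act from right to left. Strands added on the right therefore change the
species at which a diagram is evaluated, and strands added on the left apply a functor to the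
result. -/
theorem wordFunctor_append (u v : Word) :
    wordFunctor (u ++ v) = wordFunctor v ⋙ wordFunctor u := by
  induction u with
  | nil => rfl
  | cons a u ih => exact congrArg (· ⋙ functor a) ih

theorem wordFunctor_append_obj (u v : Word) (M : Sp) :
    (wordFunctor (u ++ v)).obj M = (wordFunctor u).obj ((wordFunctor v).obj M) := by
  rw [wordFunctor_append]
  rfl

theorem wordFunctor_append_map (u v : Word) (f : M ⟶ N) :
    (wordFunctor (u ++ v)).map f = eqToHom (wordFunctor_append_obj u v M) ≫
      (wordFunctor u).map ((wordFunctor v).map f) ≫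
      eqToHom (wordFunctor_append_obj u v N).symm :=
  Functor.congr_hom (wordFunctor_append u v) f

instance (w : Word) : (wordFunctor w).Additive := by
  induction w with
  | nil => exact inferInstanceAs (𝟭 Sp).Additive
  | cons a w ih => exact inferInstanceAs (wordFunctor w ⋙ functor a).Additive

instance (w : Word) : (wordFunctor w).Linear ℂ := by
  induction w with
  | nil => exact inferInstanceAs ((𝟭 Sp).Linear ℂ)
  | cons a w ih => exact inferInstanceAs ((wordFunctor w ⋙ functor a).Linear ℂ)

theorem wordFunctor_layer {w u a v : Word} (h : w = u ++ a ++ v) (M : Sp) :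
    (wordFunctor w).obj M =
      (wordFunctor u).obj ((wordFunctor a).obj ((wordFunctor v).obj M)) := by
  rw [h, wordFunctor_append_obj, wordFunctor_append_obj]

/-- The natural transformation given by a diagram. -/
def eval (M : Sp) : ∀ {w w' : Word}, Term w w' → ((wordFunctor w).obj M ⟶ (wordFunctor w').obj M)
  | _, _, .id _ => 𝟙 _
  | _, _, .layer u v g h h' => eqToHom (wordFunctor_layer h M) ≫
      (wordFunctor u).map (((wordFunctor v).obj M).genHom g) ≫
      eqToHom (wordFunctor_layer h' M).symm
  | _, _, .comp f g => eval M f ≫ eval M g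
  | _, _, .zero _ _ => 0
  | _, _, .add f g => eval M f + eval M g
  | _, _, .smul c f => c • eval M f

theorem genHom_eq (h : M = N) {a b : Word} (g : Gen a b) :
    M.genHom g = eqToHom (by rw [h]) ≫ N.genHom g ≫ eqToHom (by rw [h]) := by
  subst h
  simp

theorem eval_whiskL (x : Word) {w w' : Word} (f : Term w w') :
    M.eval (Term.whiskL x f) = eqToHom (wordFunctor_append_obj x w M) ≫
      (wordFunctor x).map (M.eval f) ≫ eqToHom (wordFunctor_append_obj x w' M).symm := by
  induction f with
  | id w => simp [eval, Term.whiskL]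
  | layer u v g h h' => simp [eval, Term.whiskL, wordFunctor_append_map, eqToHom_map]
  | comp f g hf hg => simp [eval, Term.whiskL, hf, hg]
  | zero => simp [eval, Term.whiskL]
  | add f g hf hg => simp [eval, Term.whiskL, hf, hg]
  | smul c f hf => simp [eval, Term.whiskL, hf, Functor.map_smul]

theorem eval_whiskR (x : Word) {w w' : Word} (f : Term w w') :
    M.eval (Term.whiskR x f) = eqToHom (wordFunctor_append_obj w x M) ≫
      ((wordFunctor x).obj M).eval f ≫ eqToHom (wordFunctor_append_obj w' x M).symm := by
  induction f with
  | id w => simp [eval, Term.whiskR]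
  | layer u v g h h' =>
    simp [eval, Term.whiskR, genHom_eq (wordFunctor_append_obj v x M), eqToHom_map]
  | comp f g hf hg => simp [eval, Term.whiskR, hf, hg]
  | zero => simp [eval, Term.whiskR]
  | add f g hf hg => simp [eval, Term.whiskR, hf, hg]
  | smul c f hf => simp [eval, Term.whiskR, hf]

theorem isPar_eval {w w' : Word} {f : Term w w'} {d : ℤ} (hf : Term.IsHomog deg f d) :
    IsPar ((-1) ^ d) (M.eval f) := by
  induction hf with
  | id w => exact (zpow_zero (-1 : ℂ)).symm ▸ IsPar.id _
  | layer u v g h h' => exact ((isPar_genHom _ g).wordFunctor u).conj _ _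
  | comp _ _ hf hg =>
    rw [zpow_add₀ (by norm_num)]
    exact hf.comp hg
  | zero => exact IsPar.zero _
  | add _ _ hf hg => exact hf.add hg
  | smul c _ hf => exact hf.smul c

/-- The sign for single layers multiplies along a composite, because `c ^ d` is multiplicative in
the degree `d`. -/
theorem eval_nat {c : ℂ} (hc : c * c = 1) {h : M ⟶ N} (hh : IsPar c h) {w w' : Word}
    {f : Term w w'} {d : ℤ} (hf : Term.IsHomog deg f d) :
    M.eval f ≫ (wordFunctor w').map h = (c ^ d) • (wordFunctor w).map h ≫ N.eval f := by
  have hc' : c ≠ 0 := left_ne_zero_of_mul_eq_one hc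
  induction hf with
  | id w => simp [eval]
  | layer u v g h h' =>
    subst h h'
    have := congrArg (wordFunctor u).map (genHom_nat hc (hh.wordFunctor v) g)
    rw [Functor.map_smul, Functor.map_comp, Functor.map_comp] at this
    simp [eval, wordFunctor_append_map, eqToHom_map, reassoc_of% this]
  | comp _ _ hf hg =>
    rw [zpow_add₀ hc']
    simp [eval, hg, reassoc_of% hf, mul_smul]
    exact smul_comm _ _ _
  | zero => simp [eval]
  | add _ _ hf hg => simp [eval, hf, hg]
  | smul c _ hf => simp [eval, hf, smul_comm c]

set_option maxHeartbeats 1000000 in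
theorem eval_triple (a b c : Strand) :
    M.eval ((((X a b).whiskR [c]).comp ((X a c).whiskL [b])).comp ((X b c).whiskR [a])) =
      M.eval ((((X b c).whiskL [a]).comp ((X a c).whiskR [b])).comp ((X a b).whiskL [c])) := by
  cases a <;> cases b <;> cases c
  · exact M.triplePPP
  · exact M.triplePPQ
  · exact M.triplePQP
  · exact M.triplePQQ
  · exact M.tripleQPP
  · exact M.tripleQPQ
  · exact M.tripleQQP
  · exact M.tripleQQQ

set_option maxHeartbeats 1000000 in
theorem eval_localRel {w w' : Word} {f g : Term w w'} (h : Term.LocalRel f g) :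
    M.eval f = M.eval g := by
  induction h with
  | zigzag_capP => exact M.zigzag_capP
  | zigzag_capP' => 
    refine M.zigzag_capP'.trans (neg_one_smul ℂ _).symm
  | zigzag_capQ => exact M.zigzag_capQ
  | zigzag_capQ' => exact M.zigzag_capQ'
  | pitchfork_cup a c =>
    cases a <;> cases c
    · exact M.pitchfork_cupPP
    · exact M.pitchfork_cupPQ
    · exact M.pitchfork_cupQP
    · exact M.pitchfork_cupQQ
  | pitchfork_cap a c =>
    cases a <;> cases c
    · exact M.pitchfork_capPP
    · exact M.pitchfork_capPQ
    · exact M.pitchfork_capQP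
    · exact M.pitchfork_capQQ
  | dot_cup a =>
    cases a
    · exact M.dot_cupP
    · exact M.dot_cupQ
  | dot_cap a =>
    cases a
    · exact M.dot_capP
    · exact M.dot_capQ
  | dot_cross a b =>
    cases a <;> cases b
    · exact M.crossPP_dot
    · exact M.crossPQ_dot
    · exact M.crossQP_dot
    · exact M.crossQQ_dot
  | dot_cross' a b =>
    cases a <;> cases b
    · exact M.crossPP_dot'
    · exact M.crossPQ_dot'
    · exact M.crossQP_dot'
    · exact M.crossQQ_dot'
  | dot_dot a =>
    cases a
    · exact M.dotP_dotP
    · exact M.dotQ_dotQ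
  | cross_cross a b h =>
    cases a <;> cases b
    · exact M.crossPP_crossPP
    · exact M.crossPQ_crossQP
    · exact absurd ⟨rfl, rfl⟩ h
    · exact M.crossQQ_crossQQ
  | cross_cross_QP => exact M.crossQP_crossPQ
  | triple a b c => exact eval_triple a b c
  | curl => exact M.curl
  | circle => exact M.circle
  | circle_dot => exact M.circle_dot

/-- The species must vary in the induction, since adding strands on the right replaces `M` by
another species. -/
theorem eval_rel {w w' : Word} {f g : Term w w'} (h : Term.Rel f g) (M : Sp) :
    M.eval f = M.eval g := by
  induction h generalizing M with
  | refl f => rfl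
  | symm _ h => exact (h M).symm
  | trans _ _ h h' => exact (h M).trans (h' M)
  | congr_comp _ _ h h' => exact congrArg₂ (· ≫ ·) (h M) (h' M)
  | congr_add _ _ h h' => exact congrArg₂ (· + ·) (h M) (h' M)
  | congr_smul c _ h => exact congrArg (c • ·) (h M)
  | congr_whiskL x _ h => rw [eval_whiskL, eval_whiskL, h M]
  | congr_whiskR x _ h => rw [eval_whiskR, eval_whiskR, h _]
  | add_assoc f g h => exact add_assoc _ _ _
  | add_comm f g => exact add_comm _ _
  | zero_add f => exact zero_add _
  | neg_add f => simp [eval]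
  | smul_add c f g => exact smul_add _ _ _
  | add_smul c d f => exact add_smul _ _ _
  | mul_smul c d f => exact mul_smul _ _ _
  | one_smul f => exact one_smul _ _
  | id_comp f => exact Category.id_comp _
  | comp_id f => exact Category.comp_id _
  | assoc f g h => exact Category.assoc _ _ _
  | add_comp f f' g => exact Preadditive.add_comp _ _ _ _ _ _
  | comp_add f g g' => exact Preadditive.comp_add _ _ _ _ _ _
  | smul_comp c f g => exact Linear.smul_comp _ _ _ _ _ _
  | comp_smul c f g => exact Linear.comp_smul _ _ _ _ _ _
  | @interchange a b c d f g i j hf hg =>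
    -- Evaluating `g` at `M` gives a family of sign `(-1) ^ j`, and moving it past `f` costs `((-1)
    -- ^ j) ^ i`, the Koszul sign.
    have h := eval_nat (by rw [← zpow_add₀ (by norm_num), ← two_mul, zpow_mul]; norm_num)
      (isPar_eval (M := M) hg) hf
    rw [← zpow_mul, mul_comm j i] at h
    simp [eval, eval_whiskL, eval_whiskR, reassoc_of% h]
  | of h => exact eval_localRel h

/-- The one-dimensional species. -/
def unit : Sp where
  obj _ := ℂ
  map _ := LinearMap.id
  v _ := 0
  ε := LinearMap.id
  map_refl _ := rfl
  map_map _ _ _ := rfl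
  map_v _ _ _ := by simp
  map_ε _ _ := rfl
  ε_ε _ := rfl
  v_ε _ _ := by simp
  v_v _ _ _ := by simp

end Sp

/-- The empty diagram is not zero. -/
theorem Mor.id_nil_ne_zero : Mor.mk (.id []) ≠ 0 := by
  intro h
  have h' : Sp.unit.eval (.id []) = Sp.unit.eval (.zero [] []) :=
    Sp.eval_rel (Quotient.exact h) Sp.unit
  -- Equality with the zero diagram would make the identity of ℂ, the value of the unit species at
  -- the empty set, vanish.
  have h₂ := congrArg (fun f : Sp.unit ⟶ Sp.unit => f.app Empty (1 : ℂ)) h'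
  exact one_ne_zero (α := ℂ) h₂

end HeisCat

end

noncomputable section

namespace HeisCat

/-! ### Homomorphisms from symmetric groups -/

/-- The relations of the simple transpositions of `r` points. -/
structure IsBraided {G : Type*} [Monoid G] (r : ℕ) (t : ℕ → G) : Prop where
  sq : ∀ i, i + 1 < r → t i * t i = 1
  comm : ∀ i j, i + 1 < j → j + 1 < r → t i * t j = t j * t i
  braid : ∀ i, i + 2 < r → t i * t (i + 1) * t i = t (i + 1) * t i * t (i + 1)

namespace IsBraided

variable {G : Type*} [Monoid G] {r : ℕ} {t : ℕ → G}

theorem succ (h : IsBraided (r + 1) t) : IsBraided r fun i => t (i + 1) :=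
  ⟨fun i hi => h.sq _ (by omega), fun i j hi hj => h.comm _ _ (by omega) (by omega),
    fun i hi => h.braid _ (by omega)⟩

/-- The product `t 0 * t 1 * … * t (j - 1)`. -/
def cyc (t : ℕ → G) : ℕ → G
  | 0 => 1
  | j + 1 => cyc t j * t j

theorem cyc_mul_pred (h : IsBraided r t) {j : ℕ} (hj : j + 1 < r) :
    cyc t (j + 1) * t j = cyc t j := by
  rw [cyc, mul_assoc, h.sq j hj, mul_one]

theorem cyc_mul_of_lt (h : IsBraided r t) {i j : ℕ} (hij : j < i) (hi : i + 1 < r) :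
    cyc t j * t i = t i * cyc t j := by
  induction j with
  | zero => simp [cyc]
  | succ j ih =>
    rw [cyc, mul_assoc, h.comm j i (by omega) hi, ← mul_assoc, ih (by omega), mul_assoc]

/-- All factors commute with `t i` except `t i` and `t (i + 1)` themselves, where the braid relation
raises the index by one. -/
theorem cyc_mul_of_gt (h : IsBraided r t) {i j : ℕ} (hij : i + 1 < j) (hj : j < r) :
    cyc t j * t i = t (i + 1) * cyc t j := by
  induction j with
  | zero => omega
  | succ j ih =>
    rcases eq_or_lt_of_le (Nat.lt_succ_iff.1 hij) with h' | h'
    · subst h'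
      rw [cyc, cyc, mul_assoc, mul_assoc, ← mul_assoc (t i), h.braid i (by omega), mul_assoc,
        ← mul_assoc, h.cyc_mul_of_lt (by omega) (by omega), mul_assoc, mul_assoc]
    · rw [cyc, mul_assoc, ← h.comm i j h' hj, ← mul_assoc, ih h' (by omega), mul_assoc]

end IsBraided

open Equiv

/-- The simple transpositions. -/
def simple (r i : ℕ) : Perm (Fin r) :=
  if h : i + 1 < r then swap ⟨i, Nat.lt_of_succ_lt h⟩ ⟨i + 1, h⟩ else 1

theorem simple_val {r i : ℕ} (h : i + 1 < r) (x : Fin r) :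
    (simple r i x : ℕ) = if (x : ℕ) = i then i + 1 else if (x : ℕ) = i + 1 then i else x := by
  simp only [simple, h, dite_true, swap_apply_def, Fin.ext_iff]
  split_ifs <;> rfl

theorem isBraided_simple (r : ℕ) : IsBraided r (simple r) where
  sq i h := by simp [simple, h]
  comm i j h h' := Equiv.ext fun x => Fin.ext <| by
    simp only [Perm.mul_apply, simple_val (show i + 1 < r by omega), simple_val h']
    split_ifs <;> omega
  braid i h := Equiv.ext fun x => Fin.ext <| by
    simp only [Perm.mul_apply, simple_val (show i + 1 < r by omega),
      simple_val (show i + 1 + 1 < r by omega)]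
    split_ifs <;> omega

/-- The permutations that fix `0`. -/
def shiftPerm (r : ℕ) : Perm (Fin r) →* Perm (Fin (r + 1)) where
  toFun σ := Perm.decomposeFin.symm (0, σ)
  map_one' := (Perm.decomposeFin_symm_of_one 0).trans (swap_self 0)
  map_mul' σ τ := Equiv.ext fun x => by
    refine Fin.cases ?_ (fun x => ?_) x <;> simp

theorem shiftPerm_zero {r : ℕ} (σ : Perm (Fin r)) : shiftPerm r σ 0 = 0 := by simp [shiftPerm]

theorem shiftPerm_succ {r : ℕ} (σ : Perm (Fin r)) (x : Fin r) :
    shiftPerm r σ x.succ = (σ x).succ := by simp [shiftPerm]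

theorem exists_shiftPerm {r : ℕ} {σ : Perm (Fin (r + 1))} (h : σ 0 = 0) :
    ∃ σ', shiftPerm r σ' = σ := by
  refine ⟨(Perm.decomposeFin σ).2, ?_⟩
  have h' : (Perm.decomposeFin σ).1 = 0 := by simpa [Perm.decomposeFin] using h
  change Perm.decomposeFin.symm (0, _) = σ
  rw [← h']
  simp

theorem shiftPerm_injective (r : ℕ) : Function.Injective (shiftPerm r) := fun σ τ h =>
  (Prod.ext_iff.1 (Perm.decomposeFin.symm.injective h)).2

theorem shiftPerm_simple {r i : ℕ} (h : i + 1 < r) :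
    shiftPerm r (simple r i) = simple (r + 1) (i + 1) := Equiv.ext fun x => Fin.ext <| by
  rw [simple_val (by omega)]
  refine Fin.cases ?_ (fun x => ?_) x
  · simp [shiftPerm_zero]
  · rw [shiftPerm_succ, Fin.val_succ, Fin.val_succ, simple_val h]
    split_ifs <;> omega

theorem closure_simple (r : ℕ) : Submonoid.closure {σ | ∃ i, i + 1 < r ∧ simple r i = σ} = ⊤ := by
  rcases r with _ | r
  · exact eq_top_iff.2 fun σ _ => by rw [Subsingleton.elim σ 1]; exact one_mem _
  · rw [← Perm.mclosure_swap_castSucc_succ r]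
    congr 1
    ext σ
    constructor
    · rintro ⟨i, hi, rfl⟩
      exact ⟨⟨i, by omega⟩, by simp [simple, hi]⟩
    · rintro ⟨i, rfl⟩
      exact ⟨i, by omega, by simp [simple]; rfl⟩

theorem permHom_ext {r : ℕ} {G : Type*} [Monoid G] {f g : Perm (Fin r) →* G}
    (h : ∀ i, i + 1 < r → f (simple r i) = g (simple r i)) : f = g := by
  refine MonoidHom.eq_of_eqOn_denseM (closure_simple r) ?_
  rintro _ ⟨i, hi, rfl⟩
  exact h i hi

theorem cyc_simple_apply {r j : ℕ} (hj : j < r + 1) :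
    IsBraided.cyc (simple (r + 1)) j ⟨j, hj⟩ = 0 := by
  induction j with
  | zero => rfl
  | succ j ih =>
    rw [IsBraided.cyc, Perm.mul_apply]
    have h : simple (r + 1) j ⟨j + 1, hj⟩ = ⟨j, by omega⟩ := Fin.ext (by simp [simple_val hj])
    rw [h, ih]

/-- The products `cyc j` represent the cosets of the stabilizer of 0, and the coset of `σ` is
determined by `j = σ⁻¹ 0`. This normal form replaces reduced words in the presentation. -/
theorem exists_cyc {r : ℕ} (σ : Perm (Fin (r + 1))) :
    ∃ (σ' : Perm (Fin r)) (j : Fin (r + 1)),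
      σ = shiftPerm r σ' * IsBraided.cyc (simple (r + 1)) j := by
  obtain ⟨σ', h⟩ := exists_shiftPerm (σ := σ * (IsBraided.cyc (simple (r + 1)) (σ⁻¹ 0 : Fin _))⁻¹) (by
    rw [Perm.mul_apply, Perm.inv_eq_iff_eq.2 (cyc_simple_apply (σ⁻¹ 0).2).symm]
    simp)
  exact ⟨σ', σ⁻¹ 0, by rw [h, inv_mul_cancel_right]⟩

theorem cyc_unique {r : ℕ} {σ τ : Perm (Fin r)} {i j : Fin (r + 1)}
    (h : shiftPerm r σ * IsBraided.cyc (simple (r + 1)) i =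
      shiftPerm r τ * IsBraided.cyc (simple (r + 1)) j) : σ = τ ∧ i = j := by
  have key : ∀ (σ : Perm (Fin r)) (i : Fin (r + 1)),
      (shiftPerm r σ * IsBraided.cyc (simple (r + 1)) i)⁻¹ 0 = i := fun σ i => by
    rw [Perm.inv_eq_iff_eq, Perm.mul_apply, cyc_simple_apply i.2, shiftPerm_zero]
  have hij : i = j := by rw [← key σ i, h, key]
  subst hij
  exact ⟨shiftPerm_injective r (mul_right_cancel h), rfl⟩

/-- The presentation of the symmetric groups. -/
theorem IsBraided.exists_hom {G : Type*} [Monoid G] (r : ℕ) : ∀ {t : ℕ → G} (_ : IsBraided r t),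
    ∃ f : Perm (Fin r) →* G, ∀ i, i + 1 < r → f (simple r i) = t i := by
  induction r with
  | zero => exact fun _ => ⟨1, fun i h => by omega⟩
  | succ r ih =>
    intro t ht
    obtain ⟨f', hf'⟩ := ih ht.succ
    choose p q hpq using exists_cyc (r := r)
    have key (σ' : Perm (Fin r)) (j : Fin (r + 1)) :
        f' (p (shiftPerm r σ' * cyc (simple (r + 1)) j)) *
          cyc t (q (shiftPerm r σ' * cyc (simple (r + 1)) j)) = f' σ' * cyc t j := by
      obtain ⟨h, h'⟩ := cyc_unique (hpq (shiftPerm r σ' * cyc (simple (r + 1)) j)).symm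
      rw [h, h']
    -- Defined on normal forms; uniqueness of the normal form, in `key`, gives its value on any
    -- product of this shape.
    let f : Perm (Fin (r + 1)) → G := fun σ => f' (p σ) * cyc t (q σ)
    have hs := isBraided_simple (r + 1)
    have mul_simple (σ : Perm (Fin (r + 1))) (i : ℕ) (hi : i + 1 < r + 1) :
        f (σ * simple (r + 1) i) = f σ * t i := by
      obtain ⟨σ', ⟨j, hj⟩, rfl⟩ := exists_cyc σ
      change _ = (f' (p _) * cyc t (q _)) * t i
      rw [key, mul_assoc, mul_assoc]
      -- Right multiplication by `t i` shortens `cyc j` if `i + 1 = j` and lengthens it if `i = j`.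
      -- Otherwise it passes to the left, becoming `t (i + 1)` if `i + 1 < j` and staying `t i` if
      -- `i > j`, where it is absorbed by the stabilizer.
      rcases lt_trichotomy i j with h | rfl | h
      · rcases eq_or_lt_of_le (Nat.succ_le_of_lt h) with rfl | h'
        · rw [hs.cyc_mul_pred hi, ht.cyc_mul_pred hi]
          exact key σ' ⟨i, by omega⟩
        · rw [hs.cyc_mul_of_gt h' hj, ht.cyc_mul_of_gt h' hj,
            ← shiftPerm_simple (by omega), ← mul_assoc, ← map_mul]
          refine (key _ ⟨j, hj⟩).trans ?_
          rw [map_mul, hf' i (by omega), mul_assoc]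
      · exact key σ' ⟨i + 1, hi⟩
      · obtain ⟨i, rfl⟩ : ∃ i', i = i' + 1 := ⟨i - 1, by omega⟩
        rw [hs.cyc_mul_of_lt h hi, ht.cyc_mul_of_lt h hi,
            ← shiftPerm_simple (by omega), ← mul_assoc, ← map_mul]
        refine (key _ ⟨j, hj⟩).trans ?_
        rw [map_mul, hf' i (by omega), mul_assoc]
    have f_one : f 1 = 1 := by
      have := key 1 0
      simpa [cyc] using this
    have mul (τ : Perm (Fin (r + 1))) : ∀ σ, f (σ * τ) = f σ * f τ := by
      have h : τ ∈ Submonoid.closure {σ | ∃ i, i + 1 < r + 1 ∧ simple (r + 1) i = σ} := by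
        rw [closure_simple]; trivial
      induction h using Submonoid.closure_induction_right with
      | one => intro σ; rw [mul_one, f_one, mul_one]
      | mul_right τ _ s hs ih =>
        obtain ⟨i, hi, rfl⟩ := hs
        intro σ
        rw [← mul_assoc, mul_simple _ _ hi, ih, mul_simple _ _ hi, mul_assoc]
    refine ⟨{ toFun := f, map_one' := f_one, map_mul' := fun σ τ => mul τ σ }, fun i hi => ?_⟩
    have := mul_simple 1 i hi
    rwa [one_mul, f_one, one_mul] at this

end HeisCat

end

/-! ### Permutations of parallel strands -/

noncomputable section

namespace HeisCat

open Strand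

/-- The algebra of `2`-endomorphisms of a word. -/
abbrev EndMor (w : Word) := Mor w w

namespace EndMor

open Mor Term

local infixr:80 " ⊚ " => Mor.comp

variable {w : Word}

instance : One (EndMor w) := ⟨Mor.mk (.id w)⟩
-- The product is composition in the order of functions, as for `End`; it is opposite to reading
-- diagrams from bottom to top.
instance : Mul (EndMor w) := ⟨fun f g => Mor.comp g f⟩

theorem mul_def (f g : EndMor w) : f * g = Mor.comp g f := rfl

instance : Ring (EndMor w) where
  __ := (inferInstance : AddCommGroup (Mor w w))
  mul_assoc f g h := (Mor.assoc h g f).symm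
  one_mul f := Mor.comp_id f
  mul_one f := Mor.id_comp f
  left_distrib f g h := Mor.add_comp g h f
  right_distrib f g h := Mor.comp_add h f g
  zero_mul f := Mor.comp_zero f
  mul_zero f := Mor.zero_comp f

instance : Algebra ℂ (EndMor w) :=
  Algebra.ofModule (fun c f g => Mor.comp_smul c g f) (fun c f g => Mor.smul_comp c g f)

variable {u v : Word} {a : Strand} {r : ℕ}

theorem replicate_eq (a : Strand) (p q : ℕ) :
    List.replicate (p + 2 + q) a = List.replicate p a ++ [a, a] ++ List.replicate q a := by
  rw [List.replicate_add, List.replicate_add]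
  rfl

/-- The crossings of parallel strands. -/
def crossAt (h : w = u ++ List.replicate r a ++ v) (i : ℕ) : EndMor w :=
  if hi : i + 1 < r then
    have e : w = (u ++ List.replicate i a) ++ [a, a] ++ (List.replicate (r - i - 2) a ++ v) := by
      rw [h, replicate_split a hi]; simp
    lay (u ++ List.replicate i a) (.cross a a) (List.replicate (r - i - 2) a ++ v) e e
  else 1

theorem crossAt_eq (h : w = u ++ List.replicate r a ++ v) {p q : ℕ} (hr : r = p + 2 + q)
    {u' v' : Word} (hu : u' = u ++ List.replicate p a) (hv : v' = List.replicate q a ++ v)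
    (e : w = u' ++ [a, a] ++ v') (e' : w = u' ++ [a, a] ++ v') :
    crossAt h p = lay u' (.cross a a) v' e e' := by
  subst hr hu hv
  rw [crossAt, dif_pos (by omega)]
  exact lay_congr _ rfl (by congr 2; omega) _ _ _ _

/-- Double crossings give the involutions, height exchange of even diagrams the commutation, and the
triple point relation the braid relation. -/
theorem isBraided_crossAt (h : w = u ++ List.replicate r a ++ v) : IsBraided r (crossAt h) where
  sq i hi := by
    obtain ⟨q, rfl⟩ : ∃ q, r = i + 2 + q := ⟨r - i - 2, by omega⟩
    have e : w = (u ++ List.replicate i a) ++ [a, a] ++ (List.replicate q a ++ v) := by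
      rw [h, replicate_eq]; simp
    rw [crossAt_eq h rfl rfl rfl e e, mul_def, ← Mor.comp_id (Mor.comp _ _), Mor.assoc]
    exact cross_cross_tail a a (by cases a <;> simp) _ e e e e
  comm i j hij hj := by
    obtain ⟨k, rfl⟩ : ∃ k, j = i + 2 + k := ⟨j - i - 2, by omega⟩
    obtain ⟨q, rfl⟩ : ∃ q, r = i + 2 + k + 2 + q := ⟨r - (i + 2 + k) - 2, by omega⟩
    have e : w = (u ++ List.replicate i a) ++ [a, a] ++ (List.replicate (k + 2 + q) a ++ v) := by
      rw [h, show i + 2 + k + 2 + q = i + 2 + (k + 2 + q) by omega, replicate_eq]; simp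
    have e' : w = (u ++ List.replicate (i + 2 + k) a) ++ [a, a] ++ (List.replicate q a ++ v) := by
      rw [h, replicate_eq]; simp
    rw [crossAt_eq h (by omega) rfl rfl e e, crossAt_eq h rfl rfl rfl e' e', mul_def, mul_def]
    refine Eq.trans ?_ ((interchange_of (List.replicate k a) (.cross a a) (.cross a a) e e e' e'
      e' e' e e ?_ ?_ ?_ ?_).trans (one_smul ℂ _)).symm
    · rfl
    all_goals simp [replicate_eq]
  braid i hi := by
    obtain ⟨q, rfl⟩ : ∃ q, r = i + 3 + q := ⟨r - i - 3, by omega⟩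
    have e₀ : w = (u ++ List.replicate i a) ++ [a, a, a] ++ (List.replicate q a ++ v) := by
      rw [h, List.replicate_add, List.replicate_add]; simp [List.replicate_succ]
    have e : w = (u ++ List.replicate i a) ++ [a, a] ++ (a :: (List.replicate q a ++ v)) := by
      rw [e₀]; simp
    have e' : w = (u ++ List.replicate i a ++ [a]) ++ [a, a] ++ (List.replicate q a ++ v) := by
      rw [e₀]; simp
    rw [crossAt_eq h (q := q + 1) (by omega) rfl (by rw [List.replicate_succ]; rfl) e e,
      crossAt_eq h (q := q) (by omega) (by simp [List.replicate_succ']) rfl e' e']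
    simp only [mul_def]
    have := triple_tail (u := u ++ List.replicate i a) (v := List.replicate q a ++ v) a a a
      (Mor.mk (.id w)) rfl rfl rfl rfl rfl rfl e e e' e' e e e' e' e e e' e'
    simpa only [Mor.comp_id] using this

/-- The action of the symmetric group by permutations of parallel strands. -/
def braid (h : w = u ++ List.replicate r a ++ v) : Equiv.Perm (Fin r) →* EndMor w :=
  (isBraided_crossAt h).exists_hom.choose

theorem braid_simple (h : w = u ++ List.replicate r a ++ v) {i : ℕ} (hi : i + 1 < r) :
    braid h (simple r i) = crossAt h i := (isBraided_crossAt h).exists_hom.choose_spec i hi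

theorem braid_induction (h : w = u ++ List.replicate r a ++ v) {p : EndMor w → Prop} (one : p 1)
    (mul : ∀ i x, i + 1 < r → p x → p (crossAt h i * x)) (σ : Equiv.Perm (Fin r)) :
    p (braid h σ) := by
  have hσ : σ ∈ Submonoid.closure {σ | ∃ i, i + 1 < r ∧ simple r i = σ} := by
    rw [closure_simple]; trivial
  induction hσ using Submonoid.closure_induction_left with
  | one => rwa [map_one]
  | mul_left s hs τ _ ih =>
    obtain ⟨i, hi, rfl⟩ := hs
    rw [map_mul, braid_simple h hi]
    exact mul i _ hi ih

theorem crossAt_mem_homog (h : w = u ++ List.replicate r a ++ v) {i : ℕ} (hi : i + 1 < r) :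
    crossAt h i ∈ homog deg w w 0 := by
  rw [crossAt, dif_pos hi]
  exact lay_homog deg (.cross a a) _ _

theorem braid_mem_homog (h : w = u ++ List.replicate r a ++ v) (σ : Equiv.Perm (Fin r)) :
    braid h σ ∈ homog deg w w 0 :=
  braid_induction h (p := (· ∈ homog deg w w 0)) (homog_id _ _)
    (fun i _ hi hx => homog_comp (e := 0) hx (crossAt_mem_homog h hi)) σ

/-- Maps that intertwine the crossings intertwine the actions of the symmetric group. -/
theorem braid_comp_of {w' u' v' : Word} (h : w = u ++ List.replicate r a ++ v)
    (h' : w' = u' ++ List.replicate r a ++ v') (L : Mor w w')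
    (hL : ∀ i, i + 1 < r → crossAt h i ⊚ L = L ⊚ crossAt h' i) (σ : Equiv.Perm (Fin r)) :
    braid h σ ⊚ L = L ⊚ braid h' σ := by
  have hσ : σ ∈ Submonoid.closure {σ | ∃ i, i + 1 < r ∧ simple r i = σ} := by
    rw [closure_simple]; trivial
  induction hσ using Submonoid.closure_induction_left with
  | one => rw [map_one, map_one]; exact (Mor.id_comp L).trans (Mor.comp_id L).symm
  | mul_left s hs τ _ ih =>
    obtain ⟨i, hi, rfl⟩ := hs
    rw [map_mul, map_mul, braid_simple h hi, braid_simple h' hi, mul_def, mul_def, Mor.assoc,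
      hL i hi, ← Mor.assoc, ih, Mor.assoc]

/-- Permutations are even, so they can be exchanged without a sign with any layer to their right. -/
theorem braid_lay_right {w' A m c d B : Word} (g : Gen c d)
    (h : w = u ++ List.replicate r a ++ (m ++ c ++ B))
    (h' : w' = u ++ List.replicate r a ++ (m ++ d ++ B))
    (hA : A = u ++ List.replicate r a ++ m) (e : w = A ++ c ++ B) (e' : w' = A ++ d ++ B)
    (σ : Equiv.Perm (Fin r)) :
    braid h σ ⊚ lay A g B e e' = lay A g B e e' ⊚ braid h' σ := by
  refine braid_comp_of h h' _ (fun i hi => ?_) σ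
  obtain ⟨q, rfl⟩ : ∃ q, r = i + 2 + q := ⟨r - i - 2, by omega⟩
  have k : w = (u ++ List.replicate i a) ++ [a, a] ++ (List.replicate q a ++ (m ++ c ++ B)) := by
    rw [h, replicate_eq]; simp
  have k' : w' = (u ++ List.replicate i a) ++ [a, a] ++ (List.replicate q a ++ (m ++ d ++ B)) := by
    rw [h', replicate_eq]; simp
  rw [crossAt_eq h rfl rfl rfl k k, crossAt_eq h' rfl rfl rfl k' k']
  refine (interchange_of (List.replicate q a ++ m) (.cross a a) g k k e e' e e' k' k'
    ?_ ?_ ?_ ?_).trans ((congrArg (· • _) ?_).trans (one_smul ℂ _))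
  · simp
  · rw [hA, replicate_eq]; simp
  · rw [hA, replicate_eq]; simp
  · simp
  · simp [deg]

theorem whiskL_lay (x : Word) {w' A B c d : Word} (g : Gen c d) (e : w = A ++ c ++ B)
    (e' : w' = A ++ d ++ B) : whiskL x (lay A g B e e') =
      lay (x ++ A) g B (by simp [e]) (by simp [e']) := rfl

theorem whiskR_lay (x : Word) {w' A B c d : Word} (g : Gen c d) (e : w = A ++ c ++ B)
    (e' : w' = A ++ d ++ B) : whiskR x (lay A g B e e') =
      lay A g (B ++ x) (by simp [e]) (by simp [e']) := rfl

theorem whiskL_braid (x : Word) (h : w = u ++ List.replicate r a ++ v)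
    (h' : x ++ w = (x ++ u) ++ List.replicate r a ++ v) (σ : Equiv.Perm (Fin r)) :
    whiskL x (braid h σ) = braid h' σ := by
  have hσ : σ ∈ Submonoid.closure {σ | ∃ i, i + 1 < r ∧ simple r i = σ} := by
    rw [closure_simple]; trivial
  induction hσ using Submonoid.closure_induction_left with
  | one => rw [map_one, map_one]; rfl
  | mul_left s hs τ _ ih =>
    obtain ⟨i, hi, rfl⟩ := hs
    obtain ⟨q, rfl⟩ : ∃ q, r = i + 2 + q := ⟨r - i - 2, by omega⟩
    have k : w = (u ++ List.replicate i a) ++ [a, a] ++ (List.replicate q a ++ v) := by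
      rw [h, replicate_eq]; simp
    rw [map_mul, map_mul, braid_simple h hi, braid_simple h' hi, mul_def, mul_def, whiskL_comp, ih,
      crossAt_eq h rfl rfl rfl k k, whiskL_lay]
    exact congrArg (Mor.comp _) (crossAt_eq h' rfl (by simp) rfl _ _).symm

theorem whiskR_braid (x : Word) (h : w = u ++ List.replicate r a ++ v)
    (h' : w ++ x = u ++ List.replicate r a ++ (v ++ x)) (σ : Equiv.Perm (Fin r)) :
    whiskR x (braid h σ) = braid h' σ := by
  have hσ : σ ∈ Submonoid.closure {σ | ∃ i, i + 1 < r ∧ simple r i = σ} := by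
    rw [closure_simple]; trivial
  induction hσ using Submonoid.closure_induction_left with
  | one => rw [map_one, map_one]; rfl
  | mul_left s hs τ _ ih =>
    obtain ⟨i, hi, rfl⟩ := hs
    obtain ⟨q, rfl⟩ : ∃ q, r = i + 2 + q := ⟨r - i - 2, by omega⟩
    have k : w = (u ++ List.replicate i a) ++ [a, a] ++ (List.replicate q a ++ v) := by
      rw [h, replicate_eq]; simp
    rw [map_mul, map_mul, braid_simple h hi, braid_simple h' hi, mul_def, mul_def, whiskR_comp, ih,
      crossAt_eq h rfl rfl rfl k k, whiskR_lay]
    exact congrArg (Mor.comp _) (crossAt_eq h' rfl rfl (by simp) _ _).symm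

theorem braid_commute {b : Strand} {s : ℕ} {v' : Word} (h : w = u ++ List.replicate r a ++ v)
    {m : Word} (hv : v = m ++ List.replicate s b ++ v')
    (h' : w = (u ++ List.replicate r a ++ m) ++ List.replicate s b ++ v')
    (σ : Equiv.Perm (Fin r)) (τ : Equiv.Perm (Fin s)) : Commute (braid h σ) (braid h' τ) := by
  refine (braid_comp_of h' h' (braid h σ) (fun i hi => ?_) τ)
  obtain ⟨q, rfl⟩ : ∃ q, s = i + 2 + q := ⟨s - i - 2, by omega⟩
  have k : w = (u ++ List.replicate r a ++ m ++ List.replicate i b) ++ [b, b] ++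
      (List.replicate q b ++ v') := by
    rw [h', replicate_eq]; simp
  have k' : v = (m ++ List.replicate i b) ++ [b, b] ++ (List.replicate q b ++ v') := by
    rw [hv, replicate_eq]; simp
  rw [crossAt_eq h' rfl rfl rfl k k]
  subst k'
  exact (braid_lay_right (.cross b b) h h (by simp) _ _ σ).symm

/-- Permutations of all strands but the first. -/
theorem braid_shiftPerm (h : w = u ++ List.replicate (r + 1) a ++ v) {u' : Word}
    (hu : u' = u ++ [a]) (h' : w = u' ++ List.replicate r a ++ v) (σ : Equiv.Perm (Fin r)) :
    braid h (shiftPerm r σ) = braid h' σ := by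
  refine DFunLike.congr_fun (f := (braid h).comp (shiftPerm r)) (permHom_ext fun i hi => ?_) σ
  obtain ⟨q, rfl⟩ : ∃ q, r = i + 2 + q := ⟨r - i - 2, by omega⟩
  have k : w = (u' ++ List.replicate i a) ++ [a, a] ++ (List.replicate q a ++ v) := by
    rw [h', replicate_eq]; simp
  rw [MonoidHom.comp_apply, shiftPerm_simple hi, braid_simple h (by omega), braid_simple h' hi,
    crossAt_eq h' rfl rfl rfl k k,
    crossAt_eq h (q := q) (by omega) (by simp [hu, List.replicate_succ]) rfl k k]

end EndMor

end HeisCat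

end

/-! ### Partial traces over upward strands -/

noncomputable section

namespace HeisCat

open Strand

/-- The stabilizer S_r of 0 has at most two double cosets in S_{r+1}, represented by 1 and by the
first simple transposition. A partial trace that is bilinear over S_r is therefore known from its
values at these two elements. -/
theorem shiftPerm_cases {r : ℕ} (σ : Equiv.Perm (Fin (r + 1))) : (∃ σ', shiftPerm r σ' = σ) ∨
    ∃ r', r = r' + 1 ∧ ∃ α β, σ = shiftPerm r α * simple (r + 1) 0 * shiftPerm r β := by
  by_cases h : σ 0 = 0
  · exact .inl (exists_shiftPerm h)
  · obtain ⟨j, hj⟩ := Fin.exists_succ_eq.2 h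
    rcases r with _ | r
    · exact j.elim0
    -- The shifted transposition exchanges 1 and `σ 0`. Undoing it and then exchanging 0 and 1
    -- brings `σ 0` back to 0, so the rest of `σ` lies in the stabilizer.
    refine .inr ⟨r, rfl, Equiv.swap 0 j, ?_⟩
    have hs : simple (r + 1 + 1) 0 * simple (r + 1 + 1) 0 = 1 :=
      (isBraided_simple _).sq 0 (by omega)
    obtain ⟨β, hβ⟩ := exists_shiftPerm
      (σ := simple (r + 1 + 1) 0 * (shiftPerm (r + 1) (Equiv.swap 0 j))⁻¹ * σ) (by
        rw [Equiv.Perm.mul_apply, ← hj, ← map_inv, Equiv.Perm.mul_apply, shiftPerm_succ]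
        exact Fin.ext (by simp [simple_val]))
    refine ⟨β, ?_⟩
    rw [hβ, mul_assoc, mul_assoc, ← mul_assoc (simple _ _) (simple _ _), hs, one_mul,
      mul_inv_cancel_left]

/-- Conjugation by the reversal. -/
def revConj (r : ℕ) : Equiv.Perm (Fin r) ≃* Equiv.Perm (Fin r) := MulAut.conj Fin.revPerm

theorem revConj_simple {r i q : ℕ} (h : r = i + 2 + q) :
    revConj r (simple r i) = simple r q := Equiv.ext fun x => Fin.ext <| by
  have e (x : Fin r) : revConj r (simple r i) x = (simple r i x.rev).rev := by
    simp [revConj]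
  rw [e, Fin.val_rev, simple_val (by omega), simple_val (by omega), Fin.val_rev]
  have := x.2
  split_ifs <;> omega

theorem revConj_revConj {r : ℕ} (σ : Equiv.Perm (Fin r)) : revConj r (revConj r σ) = σ :=
  Equiv.ext fun x => by simp [revConj]

namespace EndMor

open Mor Term

local infixr:80 " ⊚ " => Mor.comp

variable {w u v : Word} {a : Strand} {r : ℕ}

/-- Permutations of all strands but the last. -/
theorem braid_revConj_shiftPerm (h : w = u ++ List.replicate (r + 1) a ++ v) {v' : Word}
    (hv : v' = a :: v) (h' : w = u ++ List.replicate r a ++ v') (σ : Equiv.Perm (Fin r)) :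
    braid h (revConj _ (shiftPerm r σ)) = braid h' (revConj _ σ) := by
  refine DFunLike.congr_fun (f := (braid h).comp ((revConj _).toMonoidHom.comp (shiftPerm r)))
    (g := (braid h').comp (revConj _).toMonoidHom) (permHom_ext fun i hi => ?_) σ
  obtain ⟨q, rfl⟩ : ∃ q, r = i + 2 + q := ⟨r - i - 2, by omega⟩
  have k : w = (u ++ List.replicate q a) ++ [a, a] ++ (List.replicate i a ++ v') := by
    rw [h', show i + 2 + q = q + 2 + i by omega, replicate_eq]; simp
  change braid h (revConj _ (shiftPerm _ (simple _ i))) = braid h' (revConj _ (simple _ i))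
  rw [shiftPerm_simple hi, revConj_simple (q := q) (by omega), revConj_simple (q := q) (by omega),
    braid_simple h (by omega), braid_simple h' (by omega),
    crossAt_eq h' (q := i) (by omega) rfl rfl k k,
    crossAt_eq h (q := i + 1) (by omega) rfl (by simp [hv, List.replicate_succ']) k k]

theorem whiskL_nil {w w' : Word} (f : Mor w w') : Mor.whiskL [] f = f := by
  induction f using Mor.ind with | h f => ?_
  refine congrArg Mor.mk ?_
  induction f with
  | id => rfl
  | layer => rfl
  | comp f g hf hg => exact congrArg₂ Term.comp hf hg
  | zero => rfl
  | add f g hf hg => exact congrArg₂ Term.add hf hg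
  | smul c f hf => exact congrArg (Term.smul c) hf

theorem whiskL_cons (a : Strand) (x : Word) {w w' : Word} (f : Mor w w') :
    Mor.whiskL (a :: x) f = Mor.whiskL [a] (Mor.whiskL x f) := by
  induction f using Mor.ind with | h f => ?_
  refine congrArg Mor.mk ?_
  induction f with
  | id => rfl
  | layer => rfl
  | comp f g hf hg => exact congrArg₂ Term.comp hf hg
  | zero => rfl
  | add f g hf hg => exact congrArg₂ Term.add hf hg
  | smul c f hf => exact congrArg (Term.smul c) hf

/-- A 2-morphism of degree zero passes any layer to its left without a sign, whatever the parity of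
the layer. -/
theorem lay_slide {w w' a b : Word} (g : Gen a b) {f : Mor w w'} (hf : f ∈ homog deg w w' 0) :
    (lay [] g w rfl rfl : Mor (a ++ w) (b ++ w)) ⊚ Mor.whiskL b f =
      Mor.whiskL a f ⊚ (lay [] g w' rfl rfl : Mor (a ++ w') (b ++ w')) := by
  have h := Mor.interchange (f := mk (gen g)) ⟨_, .layer _ _ _ _ _, rfl⟩ hf
  rw [mul_zero, zpow_zero, _root_.one_smul] at h
  exact h

/-- The cup to the left of a word. -/
def cupL (w : Word) : Mor w (Q :: P :: w) := lay [] (.cup Q) w rfl rfl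

/-- The dotted cap to the left of a word. -/
def capL (w : Word) : Mor (Q :: P :: w) w :=
  (lay [Q] (.dot P) w rfl rfl : Mor (Q :: P :: w) (Q :: P :: w)) ⊚ lay [] (.cap Q) w rfl rfl

/-- Adding a strand on the left. -/
def cons (a : Strand) {w w' : Word} (x : Mor w w') : Mor (a :: w) (a :: w') := Mor.whiskL [a] x

theorem cons_comp (a : Strand) {w w' w'' : Word} (x : Mor w w') (y : Mor w' w'') :
    cons a (x ⊚ y) = cons a x ⊚ cons a y := Mor.whiskL_comp _ _ _

theorem cupL_slide {f : Mor w v} (hf : f ∈ homog deg w v 0) :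
    cupL w ⊚ cons Q (cons P f) = f ⊚ cupL v := by
  refine (congrArg (cupL w ⊚ ·) (whiskL_cons Q [P] f).symm).trans ((lay_slide (.cup Q) hf).trans ?_)
  exact congrArg (· ⊚ cupL v) (whiskL_nil f)

theorem capL_slide {f : Mor w v} (hf : f ∈ homog deg w v 0) :
    cons Q (cons P f) ⊚ capL v = capL w ⊚ f := by
  have h₁ : (lay [] (.cap Q) w rfl rfl : Mor (Q :: P :: w) w) ⊚ f =
      cons Q (cons P f) ⊚ (lay [] (.cap Q) v rfl rfl : Mor (Q :: P :: v) v) :=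
    (congrArg (_ ⊚ ·) (whiskL_nil f).symm).trans ((lay_slide (.cap Q) hf).trans
      (congrArg (· ⊚ (lay [] (.cap Q) v rfl rfl : Mor (Q :: P :: v) v)) (whiskL_cons Q [P] f)))
  have h₂ := congrArg (Mor.whiskL [Q]) (lay_slide (.dot P) hf)
  rw [whiskL_comp, whiskL_comp] at h₂
  refine (Mor.assoc _ _ _).symm.trans ((congrArg (· ⊚ _) h₂.symm).trans ?_)
  refine (Mor.assoc _ _ _).trans ((congrArg (_ ⊚ ·) h₁.symm).trans ?_)
  exact (Mor.assoc _ _ _).symm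

theorem cupL_capL (w : Word) : cupL w ⊚ capL w = Mor.mk (.id w) :=
  (Mor.assoc _ _ _).symm.trans (circle_dot [] w)

/-- The partial trace that closes the first strand. -/
def closeL (w : Word) : Mor (P :: w) (P :: w) →ₗ[ℂ] Mor w w where
  toFun x := cupL w ⊚ cons Q x ⊚ capL w
  map_add' x y := by rw [cons, whiskL_add, Mor.add_comp, Mor.comp_add]; rfl
  map_smul' c x := by rw [cons, whiskL_smul, Mor.smul_comp, Mor.comp_smul]; rfl

theorem closeL_apply (x : Mor (P :: w) (P :: w)) :
    closeL w x = cupL w ⊚ cons Q x ⊚ capL w := rfl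

/-- Even diagrams on the strands that are not closed slide out through the cup and the dotted cap,
so the partial trace is bilinear over them. -/
theorem closeL_comp {f g : Mor w w} (hf : f ∈ homog deg w w 0) (hg : g ∈ homog deg w w 0)
    (x : Mor (P :: w) (P :: w)) :
    closeL w (cons P f ⊚ x ⊚ cons P g) = f ⊚ closeL w x ⊚ g := by
  rw [closeL_apply, closeL_apply, cons_comp, cons_comp, Mor.assoc, Mor.assoc, capL_slide hg,
    ← Mor.assoc, cupL_slide hf, Mor.assoc, Mor.assoc, Mor.assoc]

theorem closeL_cons {f : Mor w w} (hf : f ∈ homog deg w w 0) : closeL w (cons P f) = f := by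
  rw [closeL_apply, ← Mor.assoc, cupL_slide hf, Mor.assoc, cupL_capL, Mor.comp_id]

/-- The dot on the cap slides through the crossing to the open strand and then below the cup, at the
cost of a sign as both are odd. What remains of the closed strand is a left curl. -/
theorem closeL_cross (v : Word) (e e') :
    closeL (P :: v) (lay [] (.cross P P) v e e' : Mor (P :: P :: v) (P :: P :: v)) = 0 := by
  have h₁ : (lay [Q] (.cross P P) v rfl rfl : Mor (Q :: P :: P :: v) (Q :: P :: P :: v)) ⊚
      capL (P :: v) = (lay [Q, P] (.dot P) v rfl rfl : Mor (Q :: P :: P :: v) (Q :: P :: P :: v)) ⊚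
        (lay [Q] (.cross P P) v rfl rfl : Mor (Q :: P :: P :: v) (Q :: P :: P :: v)) ⊚
          (lay [] (.cap Q) (P :: v) rfl rfl : Mor (Q :: P :: P :: v) (P :: v)) :=
    (dot_cross'_tail (u := [Q]) P P _ rfl rfl rfl rfl rfl rfl rfl rfl rfl rfl).symm
  have h₂ : cupL (P :: v) ⊚
      (lay [Q, P] (.dot P) v rfl rfl : Mor (Q :: P :: P :: v) (Q :: P :: P :: v)) =
      -((lay [] (.dot P) v rfl rfl : Mor (P :: v) (P :: v)) ⊚ cupL (P :: v)) := by
    refine (interchange_of [] (.cup Q) (.dot P) rfl rfl rfl rfl rfl rfl rfl rfl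
      rfl rfl rfl rfl).trans ?_
    rw [show (-1 : ℂ) ^ (deg _ _ (.cup Q) * deg _ _ (.dot P)) = -1 by simp [deg], neg_one_smul]
    rfl
  have h₃ : cupL (P :: v) ⊚
      (lay [Q] (.cross P P) v rfl rfl : Mor (Q :: P :: P :: v) (Q :: P :: P :: v)) ⊚
        (lay [] (.cap Q) (P :: v) rfl rfl : Mor (Q :: P :: P :: v) (P :: v)) = 0 :=
    (Mor.assoc _ _ _).symm.trans (curl [] v)
  refine (congrArg (cupL (P :: v) ⊚ ·) h₁).trans ?_
  rw [← Mor.assoc, h₂, Mor.neg_comp, Mor.assoc, h₃, Mor.comp_zero, neg_zero]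

theorem cons_braid (b : Strand) {w u v : Word} (h : w = u ++ List.replicate r a ++ v)
    (h' : b :: w = (b :: u) ++ List.replicate r a ++ v) (σ : Equiv.Perm (Fin r)) :
    cons b (braid h σ) = braid h' σ := whiskL_braid [b] h h' σ

/-- Closing the strands one after another from the left. Each closing keeps the permutations that
fix the first strand and kills the other double coset; the diagram `y` on the remaining strands is
carried along unchanged. -/
theorem exists_traceL (m : ℕ) (v : Word) : ∃ T : Mor (List.replicate m P ++ v)
    (List.replicate m P ++ v) →ₗ[ℂ] Mor v v, ∀ (h) (σ : Equiv.Perm (Fin m)) (y : Mor v v),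
      y ∈ homog deg v v 0 →
      T (braid (u := []) (v := v) (w := List.replicate m P ++ v) (a := P) h σ ⊚
        Mor.whiskL (List.replicate m P) y) = if σ = 1 then y else 0 := by
  classical
  induction m with
  | zero =>
    refine ⟨LinearMap.id, fun h σ y hy => ?_⟩
    rw [Subsingleton.elim σ 1, if_pos rfl, map_one]
    exact (Mor.id_comp _).trans (whiskL_nil y)
  | succ m ih =>
    obtain ⟨T, hT⟩ := ih
    refine ⟨T ∘ₗ closeL (List.replicate m P ++ v), fun h σ y hy => ?_⟩
    have hc (σ : Equiv.Perm (Fin m)) : braid h (shiftPerm m σ) =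
        cons P (braid (u := []) (v := v) (w := List.replicate m P ++ v) (a := P) rfl σ) := by
      rw [cons_braid _ _ rfl]
      exact braid_shiftPerm h rfl _ σ
    have hy' : Mor.whiskL (List.replicate (m + 1) P) y =
        cons P (Mor.whiskL (List.replicate m P) y) := whiskL_cons P _ y
    have hy₀ : Mor.whiskL (List.replicate m P) y ∈ homog deg _ _ 0 := homog_whiskL _ hy
    rcases shiftPerm_cases σ with ⟨σ', rfl⟩ | ⟨m', rfl, α, β, rfl⟩
    · rw [LinearMap.comp_apply, hc, hy']
      have e : closeL _ (cons P (braid (u := []) (v := v) (w := List.replicate m P ++ v) (a := P)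
          rfl σ') ⊚ cons P (Mor.whiskL (List.replicate m P) y)) = _ :=
        (congrArg _ (cons_comp _ _ _).symm).trans (closeL_cons (homog_comp (d := 0) (e := 0)
          (braid_mem_homog _ _) hy₀))
      refine (congrArg T e).trans ((hT rfl σ' y hy).trans ?_)
      simp only [map_eq_one_iff _ (shiftPerm_injective m)]
    -- An element of the nontrivial double coset moves 0, so it is not the identity.
    · have hne : shiftPerm _ α * simple (m' + 1 + 1) 0 * shiftPerm _ β ≠ 1 := fun h => by
        have h₂ := DFunLike.congr_fun h (0 : Fin (m' + 2))
        rw [Equiv.Perm.mul_apply, Equiv.Perm.mul_apply, shiftPerm_zero] at h₂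
        have h₃ : simple (m' + 1 + 1) 0 0 = Fin.succ 0 := Fin.ext (by simp [simple_val])
        rw [h₃, shiftPerm_succ] at h₂
        exact Fin.succ_ne_zero _ h₂
      rw [if_neg hne, LinearMap.comp_apply, map_mul, map_mul, hc, hc, hy', braid_simple h (by omega)]
      have e : crossAt h 0 = lay [] (.cross P P) (List.replicate m' P ++ v) rfl rfl :=
        crossAt_eq h (q := m') (by omega) rfl rfl _ _
      have e' := closeL_comp (braid_mem_homog (u := []) (v := v)
        (w := List.replicate (m' + 1) P ++ v) (a := P) rfl β) (homog_comp (d := 0) (e := 0)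
          (braid_mem_homog (u := []) (v := v) (w := List.replicate (m' + 1) P ++ v) (a := P) rfl α)
          hy₀) (lay [] (.cross P P) (List.replicate m' P ++ v) rfl rfl)
      have e₂ := closeL_cross (List.replicate m' P ++ v) rfl rfl
      have e₃ : closeL (List.replicate (m' + 1) P ++ v)
        (lay [] (.cross P P) (List.replicate m' P ++ v) rfl rfl) = 0 := e₂
      rw [e₃, Mor.zero_comp, Mor.comp_zero] at e'
      refine (congrArg T ?_).trans (map_zero T)
      refine Eq.trans ?_ e'
      rw [e, cons_comp]
      refine congrArg _ ?_
      rw [mul_def, mul_def, Mor.assoc, Mor.assoc]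

end EndMor

end HeisCat

end

/-! ### Partial traces over downward strands -/

noncomputable section

namespace HeisCat

open Strand

namespace EndMor

open Mor Term

local infixr:80 " ⊚ " => Mor.comp

variable {W w : Word} {n : ℕ}

theorem append_cupQ (w : Word) (hW : W = w ++ [Q]) : W ++ [P] = w ++ [Q, P] ++ [] := by
  simp [hW]

/-- The cup to the right of a word. -/
def cupR (hW : W = w ++ [Q]) : Mor w (W ++ [P]) :=
  lay w (.cup Q) [] (by simp) (append_cupQ w hW)

/-- The dotted cap to the right of a word. -/
def capR (hW : W = w ++ [Q]) : Mor (W ++ [P]) w :=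
  (lay W (.dot P) [] (by simp) (by simp) : Mor (W ++ [P]) (W ++ [P])) ⊚
    lay w (.cap Q) [] (append_cupQ w hW) (by simp)

/-- The partial trace that closes the last strand. -/
def closeR (hW : W = w ++ [Q]) : Mor W W →ₗ[ℂ] Mor w w where
  toFun x := cupR hW ⊚ whiskR [P] x ⊚ capR hW
  map_add' x y := by rw [whiskR_add, Mor.add_comp, Mor.comp_add]
  map_smul' c x := by rw [whiskR_smul, Mor.smul_comp, Mor.comp_smul]; rfl

theorem closeR_apply (hW : W = w ++ [Q]) (x : Mor W W) :
    closeR hW x = cupR hW ⊚ whiskR [P] x ⊚ capR hW := rfl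

theorem cupR_slide (hW : W = w ++ [Q]) (h : W = [] ++ List.replicate n Q ++ [Q])
    (h' : w = [] ++ List.replicate n Q ++ []) (σ : Equiv.Perm (Fin n)) :
    cupR hW ⊚ whiskR [P] (braid h σ) = braid h' σ ⊚ cupR hW := by
  rw [whiskR_braid [P] h (by rw [h]; simp)]
  exact (braid_lay_right (m := []) (.cup Q) h' _ (by simpa using h') _ _ σ).symm

theorem capR_slide (hW : W = w ++ [Q]) (h : W = [] ++ List.replicate n Q ++ [Q])
    (h' : w = [] ++ List.replicate n Q ++ []) (σ : Equiv.Perm (Fin n)) :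
    whiskR [P] (braid h σ) ⊚ capR hW = capR hW ⊚ braid h' σ := by
  rw [whiskR_braid [P] h (by rw [h]; simp), capR, ← Mor.assoc, Mor.assoc]
  have h₁ := braid_lay_right (w := W ++ [P]) (w' := W ++ [P]) (A := W) (B := []) (m := [Q])
    (.dot P) (u := []) (r := n) (a := Q) (by rw [h]; simp) (by rw [h]; simp) (by simpa using h)
    (by simp) (by simp) σ
  have h₂ := braid_lay_right (w := W ++ [P]) (w' := w) (A := w) (B := []) (m := [])
    (.cap Q) (u := []) (r := n) (a := Q) (by rw [h]; simp; rfl) h' (by simpa using h')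
    (append_cupQ w hW) (by simp) σ
  refine (Mor.assoc _ _ _).symm.trans ((congrArg (· ⊚ _) h₁).trans ?_)
  rw [Mor.assoc, Mor.assoc]
  exact congrArg (Mor.comp _) h₂

theorem closeR_one (hW : W = w ++ [Q]) : closeR hW (1 : EndMor W) = (1 : EndMor w) := by
  refine (congrArg (cupR hW ⊚ ·) (Mor.id_comp (capR hW))).trans ?_
  have := circle_dot_tail (u := w) (v := []) (Mor.mk (.id w)) hW (by simp) (append_cupQ w hW)
    (by simp) (by simp) (append_cupQ w hW) (by simp)
  rw [Mor.comp_id] at this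
  exact this

theorem closeR_braid (hW : W = w ++ [Q]) (h : W = [] ++ List.replicate n Q ++ [Q])
    (h' : w = [] ++ List.replicate n Q ++ []) (σ τ : Equiv.Perm (Fin n)) (x : EndMor W) :
    closeR hW (braid h σ * x * braid h τ) =
      (braid h' σ * closeR hW x * braid h' τ : EndMor w) := by
  simp only [closeR_apply, mul_def, whiskR_comp, Mor.assoc]
  rw [capR_slide hW h h', ← Mor.assoc (cupR hW), cupR_slide hW h h']
  simp only [Mor.assoc]

/-- Downward strands are closed on the right, so that the arcs are again counterclockwise. The
pitchfork relation turns the crossing into one of P with Q, the dot slides past it, and the crossing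
followed by the cap vanishes by `crossPQ_capQ`. -/
theorem closeR_cross {u : Word} (hW : W = w ++ [Q]) (hw : w = u ++ [Q])
    (e e' : W = u ++ [Q, Q] ++ []) :
    closeR hW (lay u (.cross Q Q) [] e e' : EndMor W) = 0 := by
  have hW' : W ++ [P] = u ++ [Q, Q] ++ [P] := by rw [e]; simp
  have k₁ : w = u ++ [] ++ [Q] := by rw [hw]; simp
  have k₂ : u ++ [Q, P, Q] = u ++ [Q, P] ++ [Q] := by simp
  have k₃ : u ++ [Q, P, Q] = (u ++ [Q]) ++ [P, Q] ++ [] := by simp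
  have k₄ : W ++ [P] = (u ++ [Q]) ++ [Q, P] ++ [] := by simp [e]
  have k₅ : u ++ [Q, P, Q] = (u ++ [Q]) ++ [P] ++ [Q] := by simp
  have h₁ := pitchfork_cupQ_tail (u := u) (v := []) (w0 := w) (w1 := W ++ [P]) (w2 := W ++ [P])
    (x1 := u ++ [Q, P, Q]) Q (capR hW) hw rfl rfl rfl (by simp) (append_cupQ w hW) hW' hW'
    k₁ k₂ k₃ k₄
  have h₂ := dot_cross_tail (u := u ++ [Q]) (v := []) (w0 := u ++ [Q, P, Q])
    (w1 := u ++ [Q, P, Q]) (w2 := W ++ [P]) (x1 := W ++ [P]) (ub1 := W) P Q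
    (lay w (.cap Q) [] (append_cupQ w hW) (by simp) : Mor (W ++ [P]) w) rfl (by simp [e])
    k₅ k₅ k₃ k₄ k₃ k₄ (by simp) (by simp)
  have h₃ := crossPQ_capQ (u := u ++ [Q]) (v := []) (w := u ++ [Q, P, Q]) (w₁ := W ++ [P])
    (w₂ := w) (Mor.mk (.id w)) (h := k₃) (h' := k₄) (k := k₄) (k' := by simp [hw])
  have h₄ : (lay w (.cap Q) [] (append_cupQ w hW) (by simp) : Mor (W ++ [P]) w) =
      lay (u ++ [Q]) (.cap Q) [] k₄ (by simp [hw]) := lay_congr _ hw rfl _ _ _ _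
  rw [Mor.comp_id] at h₃
  refine Eq.trans h₁ ((congrArg (_ ⊚ ·) (h₂.symm.trans ?_)).trans (Mor.comp_zero _))
  rw [h₄]
  exact (congrArg (_ ⊚ ·) h₃).trans (Mor.comp_zero _)

/-- The argument of `exists_traceL` mirrored: strands are removed from the right end, with the same
two double cosets. -/
theorem exists_traceR (n : ℕ) : ∀ (W : Word) (h : W = [] ++ List.replicate n Q ++ []),
    ∃ T : EndMor W →ₗ[ℂ] EndMor [], ∀ σ : Equiv.Perm (Fin n),
      T (braid h σ) = if σ = 1 then 1 else 0 := by
  classical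
  induction n with
  | zero =>
    rintro _ rfl
    refine ⟨LinearMap.id, fun σ => ?_⟩
    rw [Subsingleton.elim σ 1, if_pos rfl, map_one]
    rfl
  | succ n ih =>
    intro W h
    have hW : W = List.replicate n Q ++ [Q] := by rw [h, List.replicate_succ']; simp
    obtain ⟨T, hT⟩ := ih (List.replicate n Q) (by simp)
    refine ⟨T ∘ₗ closeR hW, fun σ => ?_⟩
    have hc (σ : Equiv.Perm (Fin n)) : braid h (revConj _ (shiftPerm n σ)) =
        braid (show W = [] ++ List.replicate n Q ++ [Q] by simpa using hW) (revConj _ σ) :=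
      braid_revConj_shiftPerm h rfl _ σ
    -- Writing the permutation as a conjugate by the reversal turns the stabilizer of the last
    -- strand into that of the first, to which `shiftPerm_cases` applies.
    obtain ⟨σ, rfl⟩ : ∃ σ', revConj _ σ' = σ := ⟨_, revConj_revConj σ⟩
    simp only [map_eq_one_iff _ (revConj _).injective]
    rcases shiftPerm_cases σ with ⟨σ', rfl⟩ | ⟨m', rfl, α, β, rfl⟩
    · have e := closeR_braid hW (by simpa using hW) (by simp) (revConj _ σ') 1 (1 : EndMor W)
      rw [(braid _).map_one, (braid _).map_one, mul_one, mul_one, closeR_one, mul_one,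
        mul_one] at e
      rw [LinearMap.comp_apply, hc, e, hT]
      simp only [map_eq_one_iff _ (revConj _).injective,
        map_eq_one_iff _ (shiftPerm_injective n)]
    · have hne : shiftPerm _ α * simple (m' + 1 + 1) 0 * shiftPerm _ β ≠ 1 := fun h => by
        have h₂ := DFunLike.congr_fun h (0 : Fin (m' + 2))
        rw [Equiv.Perm.mul_apply, Equiv.Perm.mul_apply, shiftPerm_zero] at h₂
        have h₃ : simple (m' + 1 + 1) 0 0 = Fin.succ 0 := Fin.ext (by simp [simple_val])
        rw [h₃, shiftPerm_succ] at h₂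
        exact Fin.succ_ne_zero _ h₂
      have k : W = List.replicate m' Q ++ [Q, Q] ++ [] := by
        rw [hW, List.replicate_succ']; simp
      rw [if_neg hne, LinearMap.comp_apply, (revConj _).map_mul, (revConj _).map_mul,
        (braid h).map_mul, (braid h).map_mul, hc, hc,
        closeR_braid hW (by simpa using hW) (by simp), revConj_simple (q := m') (by omega),
        braid_simple h (by omega), crossAt_eq h (q := 0) (by omega) rfl rfl k k,
        show closeR hW (lay ([] ++ List.replicate m' Q) (.cross Q Q) (List.replicate 0 Q ++ []) k k) =
          0 from closeR_cross hW List.replicate_succ' k k, mul_zero, zero_mul, map_zero]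

end EndMor

end HeisCat

end

/-! ### Degree zero endomorphisms of P^m Q^n -/

noncomputable section

namespace HeisCat

open Strand

namespace EndMor

open Mor Term

local infixr:80 " ⊚ " => Mor.comp

variable {m n : ℕ}

/-- The word `P^m Q^n`. -/
abbrev word (m n : ℕ) : Word := List.replicate m P ++ List.replicate n Q

theorem word_left (m n : ℕ) : word m n = [] ++ List.replicate m P ++ List.replicate n Q := rfl

theorem word_right (m n : ℕ) : word m n = List.replicate m P ++ List.replicate n Q ++ [] := by simp

theorem braid_congr {w u v u' v' : Word} {a : Strand} {r : ℕ}
    (h : w = u ++ List.replicate r a ++ v) (h' : w = u' ++ List.replicate r a ++ v')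
    (hu : u = u') (hv : v = v') : braid h = braid h' := by subst hu hv; rfl

theorem pq_commute (σ : Equiv.Perm (Fin m)) (τ : Equiv.Perm (Fin n)) :
    Commute (braid (word_left m n) σ) (braid (word_right m n) τ) := by
  have h : word m n = ([] ++ List.replicate m P ++ []) ++ List.replicate n Q ++ [] := by simp
  rw [braid_congr (word_right m n) h (by simp) rfl]
  exact braid_commute (word_left m n) (by simp) h σ τ

theorem commute_lift {G H : Type} [Monoid G] [Monoid H] {A : Type*} [Ring A] [Algebra ℂ A]
    {f : G →* A} {g : H →* A} (h : ∀ σ τ, Commute (f σ) (g τ)) (x : MonoidAlgebra ℂ G)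
    (y : MonoidAlgebra ℂ H) :
    Commute (MonoidAlgebra.lift ℂ _ _ f x) (MonoidAlgebra.lift ℂ _ _ g y) := by
  have h' (σ) : Commute (f σ) (MonoidAlgebra.lift ℂ _ _ g y) := by
    induction y using MonoidAlgebra.induction_linear with
    | zero => rw [map_zero]; exact .zero_right _
    | add f g hf hg => rw [map_add]; exact hf.add_right hg
    | single τ c => rw [MonoidAlgebra.lift_single]; exact (h σ τ).smul_right c
  induction x using MonoidAlgebra.induction_linear with
  | zero => rw [map_zero]; exact .zero_left _
  | add f g hf hg => rw [map_add]; exact hf.add_left hg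
  | single σ c => rw [MonoidAlgebra.lift_single]; exact (h' σ).smul_left c

/-- The action of permutations on `P^m Q^n`. -/
def pqBraid (m n : ℕ) : SymAlg m ⊗[ℂ] SymAlg n →ₐ[ℂ] EndMor (word m n) :=
  Algebra.TensorProduct.lift (MonoidAlgebra.lift ℂ _ _ (braid (word_left m n)))
    (MonoidAlgebra.lift ℂ _ _ (braid (word_right m n))) (commute_lift pq_commute)

theorem pqBraid_of (σ : Equiv.Perm (Fin m)) (τ : Equiv.Perm (Fin n)) :
    pqBraid m n (MonoidAlgebra.of ℂ _ σ ⊗ₜ MonoidAlgebra.of ℂ _ τ) =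
      braid (word_left m n) σ * braid (word_right m n) τ := by
  simp [pqBraid]

/-- First the upward strands are closed, with the permutation of the downward strands as the
spectator `y`, then the downward strands. The values are multiples of the empty diagram. -/
theorem exists_trace (m n : ℕ) : ∃ T : EndMor (word m n) →ₗ[ℂ] EndMor [],
    ∀ (σ : Equiv.Perm (Fin m)) (τ : Equiv.Perm (Fin n)),
      T (braid (word_left m n) σ * braid (word_right m n) τ) =
        (if σ = 1 then (1 : ℂ) else 0) • (if τ = 1 then (1 : ℂ) else 0) • 1 := by
  classical
  have h : List.replicate n Q = [] ++ List.replicate n Q ++ [] := by simp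
  obtain ⟨S, hS⟩ := exists_traceL m (List.replicate n Q)
  obtain ⟨T, hT⟩ := exists_traceR n _ h
  refine ⟨T ∘ₗ S, fun σ τ => ?_⟩
  have h' : word m n = (List.replicate m P ++ []) ++ List.replicate n Q ++ [] := by simp
  rw [(pq_commute σ τ).eq, braid_congr (word_right m n) h' (by simp) rfl,
    ← whiskL_braid (List.replicate m P) h h' τ, LinearMap.comp_apply]
  refine (congrArg T (hS (word_left m n) σ _ (braid_mem_homog h τ))).trans ?_
  by_cases hσ : σ = 1
  · rw [if_pos hσ, if_pos hσ, hT, one_smul]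
    split_ifs <;> simp
  · rw [if_neg hσ, if_neg hσ, map_zero, zero_smul]

/-- The trace reads off coefficients: after right multiplication by the inverse of a pair of
permutations, it returns the coefficient at this pair times the empty diagram, which is not zero. -/
theorem pqBraid_injective (m n : ℕ) : Function.Injective (pqBraid m n) := by
  classical
  obtain ⟨T, hT⟩ := exists_trace m n
  refine (injective_iff_map_eq_zero _).2 fun x hx => ?_
  let b := (MonoidAlgebra.basis (Equiv.Perm (Fin m)) ℂ).tensorProduct
    (MonoidAlgebra.basis (Equiv.Perm (Fin n)) ℂ)
  refine b.repr.injective (Finsupp.ext fun ⟨σ, τ⟩ => ?_)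
  rw [map_zero, Finsupp.zero_apply]
  have key : T ∘ₗ (pqBraid m n).toLinearMap ∘ₗ LinearMap.mulRight ℂ
      (MonoidAlgebra.of ℂ _ σ⁻¹ ⊗ₜ[ℂ] MonoidAlgebra.of ℂ _ τ⁻¹) =
      (b.coord (σ, τ)).smulRight (1 : EndMor []) := by
    refine b.ext fun ⟨σ', τ'⟩ => ?_
    have e : b (σ', τ') = MonoidAlgebra.of ℂ _ σ' ⊗ₜ MonoidAlgebra.of ℂ _ τ' := by
      simp [b, Module.Basis.tensorProduct_apply]
    have e₂ : b.coord (σ, τ) (b (σ', τ')) = if (σ', τ') = (σ, τ) then 1 else 0 := by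
      simp [Finsupp.single_apply]
    rw [LinearMap.smulRight_apply, e₂, LinearMap.comp_apply, LinearMap.comp_apply,
      LinearMap.mulRight_apply, e, Algebra.TensorProduct.tmul_mul_tmul, ← map_mul, ← map_mul,
      AlgHom.toLinearMap_apply, pqBraid_of, hT, smul_smul]
    simp only [mul_inv_eq_one, Prod.mk.injEq]
    congr 1
    split_ifs <;> simp_all
  have h := DFunLike.congr_fun key x
  rw [LinearMap.smulRight_apply, LinearMap.comp_apply, LinearMap.comp_apply,
    AlgHom.toLinearMap_apply, LinearMap.mulRight_apply, map_mul, hx, zero_mul, map_zero] at h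
  exact (smul_eq_zero.1 h.symm).resolve_right Mor.id_nil_ne_zero

/-- Two adjacent equal letters of P^m Q^n lie in the same block, so a crossing of equally oriented
strands is a simple transposition of one of the two symmetric groups. -/
theorem word_eq_append {u v : Word} {a : Strand} (h : word m n = u ++ [a, a] ++ v) :
    (a = P ∧ ∃ p q, m = p + 2 + q ∧ u = List.replicate p P ∧
      v = List.replicate q P ++ List.replicate n Q) ∨
    (a = Q ∧ ∃ p q, n = p + 2 + q ∧ u = List.replicate m P ++ List.replicate p Q ∧
      v = List.replicate q Q) := by
  induction m generalizing u with
  | zero =>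
    have h' : List.replicate n Q = u ++ [a, a] ++ v := h
    have hn := congrArg List.length h'
    obtain ⟨h₁, h₂, h₃⟩ := List.append_eq_replicate_iff.1 h'.symm
    obtain ⟨h₄, h₅, h₆⟩ := List.append_eq_replicate_iff.1 h₂
    refine .inr ⟨by simpa using h₆, u.length, v.length, ?_, ?_, h₃⟩
    · simp at hn; omega
    · simpa using h₅
  | succ m ih =>
    rcases u with _ | ⟨b, u⟩
    · simp only [word, List.replicate_succ, List.cons_append, List.nil_append,
        List.cons.injEq] at h
      obtain ⟨rfl, h⟩ := h
      rcases m with _ | m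
      · rcases n with _ | n <;> simp [List.replicate_succ] at h
      · simp only [List.replicate_succ, List.cons_append, List.cons.injEq] at h
        exact .inl ⟨rfl, 0, m, by omega, rfl, h.2.symm⟩
    · simp only [word, List.replicate_succ, List.cons_append, List.cons.injEq] at h
      obtain ⟨rfl, h⟩ := h
      rcases ih (by simpa [word] using h) with ⟨rfl, p, q, rfl, rfl, rfl⟩ |
        ⟨rfl, p, q, rfl, rfl, rfl⟩
      · exact .inl ⟨rfl, p + 1, q, by omega, by simp [List.replicate_succ], rfl⟩
      · exact .inr ⟨rfl, p, q, rfl, by simp [List.replicate_succ], rfl⟩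

/-- The induction runs over 2-morphisms with variable source, while the range consists of
endomorphisms; heterogeneous equality bridges the two once the source is known to be the same word.
-/
theorem _root_.HeisCat.Mor.CrossComb.mem_range {w : Word} {x : Mor w (word m n)}
    (hx : CrossComb (word m n) x) (hw : w = word m n) :
    ∀ y : EndMor (word m n), HEq x y → y ∈ (pqBraid m n).range := by
  induction hx with
  | id => rintro y hy; obtain rfl := eq_of_heq hy; exact one_mem (pqBraid m n).range
  | zero => subst hw; rintro y hy; obtain rfl := eq_of_heq hy; exact zero_mem _
  | add _ _ h h' =>
    subst hw; rintro y hy; obtain rfl := eq_of_heq hy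
    exact add_mem (h rfl _ .rfl) (h' rfl _ .rfl)
  | smul c _ h =>
    subst hw; rintro y hy; obtain rfl := eq_of_heq hy
    exact Subalgebra.smul_mem _ (h rfl _ .rfl) c
  | @cross w w' u v a e e' x _ h =>
    obtain rfl : w' = w := e'.trans e.symm
    subst hw; rintro y hy; obtain rfl := eq_of_heq hy
    rw [← mul_def]
    refine mul_mem (h rfl _ .rfl) ?_
    rcases word_eq_append e with ⟨rfl, p, q, rfl, rfl, rfl⟩ | ⟨rfl, p, q, rfl, rfl, rfl⟩
    · refine ⟨MonoidAlgebra.of ℂ _ (simple _ p) ⊗ₜ MonoidAlgebra.of ℂ _ 1, ?_⟩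
      change pqBraid _ _ _ = _
      rw [pqBraid_of, map_one, mul_one, braid_simple _ (by omega),
        crossAt_eq _ (q := q) rfl rfl rfl e e]
      rfl
    · refine ⟨MonoidAlgebra.of ℂ _ 1 ⊗ₜ MonoidAlgebra.of ℂ _ (simple _ p), ?_⟩
      change pqBraid _ _ _ = _
      rw [pqBraid_of, map_one, one_mul, braid_simple _ (by omega),
        crossAt_eq _ (q := q) rfl rfl (by simp) e e]

end EndMor

open EndMor

/-- The action of permutations of parallel strands by degree zero endomorphisms. -/
def braidEnd {A : Shifted} {u v : Word} {a : Strand} {r : ℕ}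
    (h : A.word = u ++ List.replicate r a ++ v) : Equiv.Perm (Fin r) →* End A where
  toFun σ := ⟨braid h σ, by
    rw [show A.shift - A.shift = 0 from sub_self _]; exact braid_mem_homog h σ⟩
  map_one' := Subtype.ext (map_one (braid h))
  map_mul' σ τ := Subtype.ext (map_mul (braid h) σ τ)

/-- The underlying endomorphism. -/
def endVal (A : Shifted) : End A →ₐ[ℂ] EndMor A.word where
  toFun f := Shifted.val f
  map_one' := rfl
  map_mul' _ _ := rfl
  map_zero' := rfl
  map_add' _ _ := rfl
  commutes' _ := rfl

theorem endVal_injective (A : Shifted) : Function.Injective (endVal A) :=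
  fun _ _ h => Shifted.hom_ext h

theorem endVal_braidEnd {A : Shifted} {u v : Word} {a : Strand} {r : ℕ}
    (h : A.word = u ++ List.replicate r a ++ v) (σ : Equiv.Perm (Fin r)) :
    endVal A (braidEnd h σ) = braid h σ := rfl

/-- The canonical homomorphism `ℂ[S_r] → End(a^r)₀`. -/
def canonicalHom (a : Strand) (r : ℕ) : SymAlg r →ₐ[ℂ] End (strandPow a r) :=
  MonoidAlgebra.lift ℂ _ _ (braidEnd (A := strandPow a r) (u := []) (v := []) (a := a) (r := r)
    (List.append_nil _).symm)

theorem isCanonical_canonicalHom (a : Strand) (r : ℕ) : IsCanonical a r (canonicalHom a r) := by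
  intro i h
  have e : Equiv.swap (⟨i, Nat.lt_of_succ_lt h⟩ : Fin r) ⟨i + 1, h⟩ = simple r i := by
    rw [simple, dif_pos h]
  rw [canonicalHom, MonoidAlgebra.lift_of, e]
  refine endVal_injective _ ((endVal_braidEnd _ _).trans ((braid_simple _ h).trans ?_))
  obtain ⟨q, rfl⟩ : ∃ q, r = i + 2 + q := ⟨r - i - 2, by omega⟩
  exact crossAt_eq _ (q := i + 2 + q - i - 2) (by omega) rfl (by simp) _ _

/-- `ℂ[S_m] ⊗ ℂ[S_n]` acts on `P^m Q^n`. -/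
def pqHom (m n : ℕ) (l : ℤ) : SymAlg m ⊗[ℂ] SymAlg n →ₐ[ℂ] End (PQ m n l) :=
  Algebra.TensorProduct.lift
    (MonoidAlgebra.lift ℂ _ _ (braidEnd (A := PQ m n l) (word_left m n)))
    (MonoidAlgebra.lift ℂ _ _ (braidEnd (A := PQ m n l) (word_right m n)))
    (commute_lift fun σ τ => endVal_injective _ (pq_commute σ τ))

theorem pqHom_of {m n : ℕ} (l : ℤ) (σ : Equiv.Perm (Fin m)) (τ : Equiv.Perm (Fin n)) :
    pqHom m n l (MonoidAlgebra.of ℂ _ σ ⊗ₜ MonoidAlgebra.of ℂ _ τ) =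
      braidEnd (A := PQ m n l) (word_left m n) σ * braidEnd (A := PQ m n l) (word_right m n) τ := by
  rw [pqHom, Algebra.TensorProduct.lift_tmul, MonoidAlgebra.lift_of, MonoidAlgebra.lift_of]

theorem endVal_pqHom (m n : ℕ) (l : ℤ) (x : SymAlg m ⊗[ℂ] SymAlg n) :
    endVal (PQ m n l) (pqHom m n l x) = pqBraid m n x := by
  have h (σ τ) : endVal (PQ m n l) (pqHom m n l (MonoidAlgebra.of ℂ _ σ ⊗ₜ
      MonoidAlgebra.of ℂ _ τ)) = pqBraid m n (MonoidAlgebra.of ℂ _ σ ⊗ₜ MonoidAlgebra.of ℂ _ τ) := by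
    rw [pqHom_of, pqBraid_of]; rfl
  refine DFunLike.congr_fun (f := (endVal (PQ m n l)).comp (pqHom m n l)) (g := pqBraid m n) ?_ x
  refine Algebra.TensorProduct.ext (MonoidAlgebra.algHom_ext' (MonoidHom.ext fun σ => ?_)
    (Subsingleton.elim _ _)) (MonoidAlgebra.algHom_ext' (MonoidHom.ext fun τ => ?_)
      (Subsingleton.elim _ _))
  · exact h σ 1
  · exact h 1 τ

/-- `End(P^m Q^n)₀ ≃ ℂ[S_m] ⊗ ℂ[S_n]`. -/
def pqEquiv (m n : ℕ) (l : ℤ) : (SymAlg m ⊗[ℂ] SymAlg n) ≃ₐ[ℂ] End (PQ m n l) :=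
  AlgEquiv.ofBijective (pqHom m n l) ⟨fun x y h => pqBraid_injective m n (by
    rw [← endVal_pqHom m n l, ← endVal_pqHom m n l, h]), fun f => by
    have hf : Shifted.val f ∈ Mor.homog deg (word m n) (word m n) 0 := by
      have := Shifted.val_mem f
      rwa [sub_self] at this
    -- Source and target have equally many letters P, so degree zero forces shifted degree zero.
    have hf' := Mor.homog_sdegTwo hf
    rw [sub_self, mul_zero, add_zero] at hf'
    obtain ⟨x, hx⟩ := (Mor.crossComb_of_homog (Mor.std_replicate m n) (Mor.std_replicate m n)
      hf').mem_range rfl _ .rfl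
    exact ⟨x, endVal_injective _ ((endVal_pqHom m n l x).trans hx)⟩⟩

end HeisCat

end

/-! ### Splitting idempotents over a triangular family -/

noncomputable section

namespace HeisCat

/-- The trace of a complex idempotent matrix is its rank. This integer bounds the induction in
`SplitData.exists_splits`. -/
theorem exists_trace_eq_natCast {ι : Type*} [Fintype ι] [DecidableEq ι] {M : Matrix ι ι ℂ}
    (h : IsIdempotentElem M) : ∃ n : ℕ, M.trace = n := by
  have h' : IsIdempotentElem (Matrix.toLin' M) := by
    rw [IsIdempotentElem, Module.End.mul_eq_comp, ← Matrix.toLin'_mul, h.eq]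
  exact ⟨_, (Matrix.trace_toLin'_eq M).symm.trans (LinearMap.IsIdempotentElem.isProj_range _ h').trace⟩

section Splitting

variable {D : Type*} [Category D] [Preadditive D] {S : Type*}

/-- Objects of a linear category which are pairwise non-isomorphic, have only scalar endomorphisms,
and whose morphisms are triangular with respect to a weight. -/
structure SplitData (G : S → D) where
  coef : ∀ {s t : S}, (G s ⟶ G t) →+ ℂ
  coef_id : ∀ s, coef (𝟙 (G s)) = 1
  coef_comp : ∀ {s t r : S} (f : G s ⟶ G t) (g : G t ⟶ G r), coef (f ≫ g) = coef f * coef g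
  coef_inj : ∀ {s : S} (f : G s ⟶ G s), coef f = 0 → f = 0
  coef_surj : ∀ (s : S) (c : ℂ), ∃ f : G s ⟶ G s, coef f = c
  weight : S → ℤ
  tri : ∀ {s t : S} (f : G s ⟶ G t), s ≠ t → weight t ≤ weight s → f = 0

/-- A morphism that factors through a finite sum of objects of a family. -/
structure Factors (G : S → D) {X Y : D} (h : X ⟶ Y) where
  ι : Type
  [fin : Fintype ι]
  t : ι → S
  f : ∀ j, X ⟶ G (t j)
  x : ∀ j, G (t j) ⟶ Y
  sum_eq : ∑ j, f j ≫ x j = h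

attribute [instance] Factors.fin

/-- An idempotent that is a sum of orthogonal idempotents which split through the objects of a
family. -/
inductive Splits (G : S → D) {X : D} : (X ⟶ X) → Multiset S → Prop
  | zero : Splits G 0 0
  | cons (s : S) (y : G s ⟶ X) (g : X ⟶ G s) {e : X ⟶ X} {L : Multiset S} (h : y ≫ g = 𝟙 _)
      (hy : y ≫ e = 0) (hg : e ≫ g = 0) (he : Splits G e L) : Splits G (e + g ≫ y) (s ::ₘ L)

theorem Splits.idem {G : S → D} {X : D} {e : X ⟶ X} {L : Multiset S} (h : Splits G e L) :
    e ≫ e = e := by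
  induction h with
  | zero => exact Limits.zero_comp
  | cons s y g h hy hg _ ih =>
    rw [Preadditive.add_comp, Preadditive.comp_add, Preadditive.comp_add, ih, reassoc_of% hg,
      Category.assoc, hy, Category.assoc, reassoc_of% h]
    simp

theorem Splits.map {G : S → D} {X Y : D} {e : X ⟶ X} {L : Multiset S} (h : Splits G e L)
    (i : X ⟶ Y) (p : Y ⟶ X) (hip : i ≫ p = 𝟙 X) : Splits G (p ≫ e ≫ i) L := by
  induction h with
  | zero => simpa using Splits.zero
  | @cons s y g e L h hy hg _ ih =>
    have := Splits.cons s (y ≫ i) (p ≫ g) (e := p ≫ e ≫ i) (L := L)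
      (by rw [Category.assoc, reassoc_of% hip, h])
      (by rw [Category.assoc, reassoc_of% hip, reassoc_of% hy, Limits.zero_comp])
      (by rw [Category.assoc, Category.assoc, reassoc_of% hip, hg, Limits.comp_zero]) ih
    simpa using this

/-- Functions that are additive on orthogonal idempotents. -/
theorem Splits.apply_eq_sum {G : S → D} {X : D} {M : Type*} [AddCommMonoid M]
    (F : (e : X ⟶ X) → e ≫ e = e → M) (c : S → M) (h₀ : F 0 Limits.zero_comp = 0)
    (hadd : ∀ e f he hf hef, e ≫ f = 0 → f ≫ e = 0 → F (e + f) hef = F e he + F f hf)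
    (hc : ∀ s (y : G s ⟶ X) (g : X ⟶ G s) (_ : y ≫ g = 𝟙 _) (hi), F (g ≫ y) hi = c s)
    {e : X ⟶ X} {L : Multiset S} (h : Splits G e L) : F e h.idem = (L.map c).sum := by
  induction h with
  | zero => simpa using h₀
  | cons s y g h hy hg he ih =>
    rw [Multiset.map_cons, Multiset.sum_cons, hadd _ (g ≫ y) he.idem
      (by rw [Category.assoc, reassoc_of% h]) _ (by rw [reassoc_of% hg, Limits.zero_comp])
      (by rw [Category.assoc, hy, Limits.comp_zero]), ih, hc s y g h, add_comm]

namespace SplitData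

variable {G : S → D} {X : D}

/-- For distinct objects one of the two directions vanishes, according to the order of the weights,
so every round trip is zero. -/
theorem comp_eq_zero (A : SplitData G) {s t : S} (h : s ≠ t) (f : G s ⟶ G t) (g : G t ⟶ G s) : f ≫ g = 0 := by
  rcases le_total (A.weight t) (A.weight s) with h' | h'
  · rw [A.tri f h h', Limits.zero_comp]
  · rw [A.tri g h.symm h', Limits.comp_zero]

variable (A : SplitData G)

theorem coef_comp_comm {s t : S} (f : G s ⟶ G t) (g : G t ⟶ G s) :
    A.coef (f ≫ g) = A.coef (g ≫ f) := by
  rw [A.coef_comp, A.coef_comp, mul_comm]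

/-- The matrix of scalars of an endomorphism. -/
def mat (F : Factors G (𝟙 X)) (e : X ⟶ X) : Matrix F.ι F.ι ℂ :=
  .of fun j k => A.coef (F.x j ≫ e ≫ F.f k)

theorem sum_comp (F : Factors G (𝟙 X)) {Y : D} (a : X ⟶ Y) : ∑ j, F.f j ≫ F.x j ≫ a = a := by
  simp_rw [← Category.assoc]
  rw [← Preadditive.sum_comp, F.sum_eq, Category.id_comp]

/-- Inserting the identity as the sum of all `f j ≫ x j` between `e` and `e'` gives matrix
multiplication, because scalars are multiplicative. Idempotents thus give idempotent matrices. -/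
theorem mat_comp (F : Factors G (𝟙 X)) (e e' : X ⟶ X) :
    A.mat F (e ≫ e') = A.mat F e * A.mat F e' := by
  ext j k
  rw [Matrix.mul_apply]
  simp only [mat, Matrix.of_apply]
  simp_rw [← A.coef_comp]
  rw [← map_sum]
  congr 1
  simp only [Category.assoc]
  rw [← Preadditive.comp_sum, ← Preadditive.comp_sum, sum_comp]

/-- The multiplicity of `G s` in an idempotent. -/
def mult (F : Factors G (𝟙 X)) (s : S) (e : X ⟶ X) : ℂ :=
  open Classical in ∑ j, if F.t j = s then A.coef (F.x j ≫ e ≫ F.f j) else 0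

/-- Cyclicity of the trace: scalars do not depend on the order of a round trip, and the sum over `j`
is a resolution of the identity. -/
theorem sum_coef (F : Factors G (𝟙 X)) {s : S} (y : G s ⟶ X) (g : X ⟶ G s) :
    ∑ j, A.coef (F.x j ≫ (g ≫ y) ≫ F.f j) = A.coef (y ≫ g) := by
  rw [← sum_comp F g, Preadditive.comp_sum, map_sum]
  refine Finset.sum_congr rfl fun j _ => ?_
  rw [← Category.assoc y, sum_comp, A.coef_comp_comm (y ≫ F.f j), Category.assoc, Category.assoc]

theorem trace_mat (F : Factors G (𝟙 X)) {s : S} (y : G s ⟶ X) (g : X ⟶ G s) (h : y ≫ g = 𝟙 _) :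
    (A.mat F (g ≫ y)).trace = 1 :=
  (A.sum_coef F y g).trans (by rw [h, A.coef_id])

theorem mult_comp [DecidableEq S] (F : Factors G (𝟙 X)) {s : S} (y : G s ⟶ X) (g : X ⟶ G s)
    (h : y ≫ g = 𝟙 _) (r : S) : A.mult F r (g ≫ y) = if r = s then 1 else 0 := by
  have h₀ (j) (hj : F.t j ≠ s) : A.coef (F.x j ≫ (g ≫ y) ≫ F.f j) = 0 := by
    rw [Category.assoc, ← Category.assoc, A.comp_eq_zero hj, map_zero]
  split_ifs with hr
  · subst hr
    refine Eq.trans (Finset.sum_congr rfl fun j _ => ?_) (A.trace_mat F y g h)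
    split_ifs with hj
    · rfl
    · exact (h₀ j hj).symm
  · refine Finset.sum_eq_zero fun j _ => ?_
    split_ifs with hj
    · exact h₀ j (hj ▸ hr)
    · rfl

theorem mult_add (F : Factors G (𝟙 X)) (s : S) (e e' : X ⟶ X) :
    A.mult F s (e + e') = A.mult F s e + A.mult F s e' := by
  rw [mult, mult, mult, ← Finset.sum_add_distrib]
  refine Finset.sum_congr rfl fun j _ => ?_
  split_ifs <;> simp

/-- The trace over the indices of type `s` is additive and takes the value 1 on a copy of `G s` and
0 on a copy of any other object, so it counts multiplicities. -/
theorem mult_eq_count [DecidableEq S] (F : Factors G (𝟙 X)) {e : X ⟶ X} {L : Multiset S}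
    (h : Splits G e L) (s : S) : A.mult F s e = L.count s := by
  induction h with
  | zero => simp [mult]
  | cons r y g h hy hg _ ih =>
    rw [mult_add, ih, mult_comp A F y g h, Multiset.count_cons]
    push_cast
    rfl

/-- The multiplicities are unique. -/
theorem eq_of_splits (A : SplitData G) (F : Factors G (𝟙 X)) {e : X ⟶ X} {L L' : Multiset S}
    (h : Splits G e L) (h' : Splits G e L') : L = L' := by
  classical
  refine Multiset.ext' fun s => ?_
  have := (A.mult_eq_count F h s).symm.trans (A.mult_eq_count F h' s)
  exact_mod_cast this

/-- If all scalars vanish, the matrix of morphisms of `e` is strictly triangular for the weight;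
such an idempotent is nilpotent, hence zero. Concretely, `x j ≫ e` is a sum of terms through indices
of larger weight, which vanish by induction on the number of such indices. -/
theorem eq_zero_of_coef (F : Factors G (𝟙 X)) {e : X ⟶ X} (he : e ≫ e = e)
    (h : ∀ s (y : G s ⟶ X) (g : X ⟶ G s), A.coef (y ≫ e ≫ g) = 0) : e = 0 := by
  have hs : ∀ j k, F.t j = F.t k → F.x j ≫ e ≫ F.f k = 0 := by
    have : ∀ (s) (k) (_ : s = F.t k) (y : G s ⟶ X), y ≫ e ≫ F.f k = 0 := by
      rintro _ k rfl y
      exact A.coef_inj _ (h _ _ _)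
    exact fun j k hjk => this _ k hjk _
  have key : ∀ (n : ℕ) (j : F.ι),
      (Finset.univ.filter fun k => A.weight (F.t j) < A.weight (F.t k)).card ≤ n →
      F.x j ≫ e = 0 := by
    intro n
    induction n using Nat.strong_induction_on with | _ n ih => ?_
    intro j hj
    have hsum : F.x j ≫ e = ∑ k, (F.x j ≫ e ≫ F.f k) ≫ F.x k ≫ e := by
      simp only [Category.assoc]
      rw [← Preadditive.comp_sum, ← Preadditive.comp_sum, sum_comp, he]
    rw [hsum]
    refine Finset.sum_eq_zero fun k _ => ?_
    by_cases hjk : F.t j = F.t k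
    · rw [hs j k hjk, Limits.zero_comp]
    rcases le_or_gt (A.weight (F.t k)) (A.weight (F.t j)) with hle | hlt
    · rw [A.tri (F.x j ≫ e ≫ F.f k) hjk hle, Limits.zero_comp]
    refine (congrArg (_ ≫ ·) (ih _ (lt_of_lt_of_le (Finset.card_lt_card ?_) hj) k le_rfl)).trans
      Limits.comp_zero
    refine Finset.ssubset_iff_of_subset (fun i hi => ?_) |>.2 ⟨k, ?_, ?_⟩
    · simp only [Finset.mem_filter, Finset.mem_univ, true_and] at hi ⊢
      exact hlt.trans hi
    · simpa using hlt
    · simp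
  rw [← sum_comp F e]
  exact Finset.sum_eq_zero fun j _ => (congrArg (_ ≫ ·) (key _ j le_rfl)).trans Limits.comp_zero

/-- A nonzero scalar of `e` can be normalised to split off a copy of some `G s`, which lowers the
trace by one. The trace is a natural number, so this stops, and it stops only at zero by
`eq_zero_of_coef`. -/
theorem exists_splits (A : SplitData G) (F : Factors G (𝟙 X)) {e : X ⟶ X} (he : e ≫ e = e) :
    ∃ L, Splits G e L := by
  classical
  have hidem (e : X ⟶ X) (he : e ≫ e = e) : IsIdempotentElem (A.mat F e) := by
    rw [IsIdempotentElem, ← mat_comp, he]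
  obtain ⟨n, hn⟩ := exists_trace_eq_natCast (hidem e he)
  induction n using Nat.strong_induction_on generalizing e with | _ n ih => ?_
  by_cases h : ∀ s (y : G s ⟶ X) (g : X ⟶ G s), A.coef (y ≫ e ≫ g) = 0
  · exact ⟨0, A.eq_zero_of_coef F he h ▸ .zero⟩
  · push Not at h
    obtain ⟨s, y, g, h⟩ := h
    -- The scalar that makes `y ≫ e ≫ g` into the identity of `G s`; composing with `e` moreover
    -- places both maps inside the image of `e`.
    obtain ⟨a, ha⟩ := A.coef_surj s (A.coef (y ≫ e ≫ g))⁻¹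
    obtain ⟨y', g', h₁, hy, hg⟩ : ∃ (y' : G s ⟶ X) (g' : X ⟶ G s), y' ≫ g' = 𝟙 _ ∧
        y' ≫ e = y' ∧ e ≫ g' = g' := by
      refine ⟨a ≫ y ≫ e, e ≫ g, sub_eq_zero.1 (A.coef_inj _ ?_), ?_, ?_⟩
      · rw [map_sub, A.coef_id, Category.assoc, Category.assoc, reassoc_of% he, A.coef_comp, ha,
          inv_mul_cancel₀ h, sub_self]
      · rw [Category.assoc, Category.assoc, he]
      · rw [← Category.assoc, he]
    have he' : (e - g' ≫ y') ≫ (e - g' ≫ y') = e - g' ≫ y' := by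
      rw [Preadditive.sub_comp, Preadditive.comp_sub, Preadditive.comp_sub, he,
        Category.assoc, hy, reassoc_of% hg, Category.assoc, reassoc_of% h₁]
      simp
    have hmat : (A.mat F e).trace = (A.mat F (e - g' ≫ y')).trace + 1 := by
      rw [← A.trace_mat F y' g' h₁, ← Matrix.trace_add]
      congr 1
      ext j k
      rw [Matrix.add_apply]
      simp only [mat, Matrix.of_apply]
      rw [← map_add, ← Preadditive.comp_add, ← Preadditive.add_comp, sub_add_cancel]
    obtain ⟨n', hn'⟩ := exists_trace_eq_natCast (hidem _ he')
    have hlt : n = n' + 1 := by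
      rw [hn, hn'] at hmat
      exact_mod_cast hmat
    obtain ⟨L, hL⟩ := ih n' (by omega) he' hn'
    refine ⟨s ::ₘ L, ?_⟩
    have := Splits.cons s y' g' h₁ (by rw [Preadditive.comp_sub, hy, reassoc_of% h₁, sub_self])
      (by rw [Preadditive.sub_comp, hg, Category.assoc, h₁, Category.comp_id, sub_self]) hL
    rwa [sub_add_cancel] at this

end SplitData

end Splitting

end HeisCat

end

/-! ### Projective modules over rings with triangular idempotents -/

noncomputable section

namespace HeisCat

namespace Factors

variable {D : Type*} [Category D] [Preadditive D] {S : Type*} {G : S → D} {X Y Z : D}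

theorem nonempty_zero : Nonempty (Factors G (0 : X ⟶ Y)) :=
  ⟨⟨PEmpty, PEmpty.elim, fun j => j.elim, fun j => j.elim, rfl⟩⟩

theorem nonempty_gen {s : S} (f : X ⟶ G s) (x : G s ⟶ Y) : Nonempty (Factors G (f ≫ x)) :=
  ⟨⟨PUnit, fun _ => s, fun _ => f, fun _ => x, by simp⟩⟩

theorem nonempty_add {h h' : X ⟶ Y} : Nonempty (Factors G h) → Nonempty (Factors G h') →
    Nonempty (Factors G (h + h')) := by
  rintro ⟨F⟩ ⟨F'⟩
  refine ⟨⟨F.ι ⊕ F'.ι, Sum.elim F.t F'.t, fun j => ?_, fun j => ?_, ?_⟩⟩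
  · exact match j with
      | .inl j => F.f j
      | .inr j => F'.f j
  · exact match j with
      | .inl j => F.x j
      | .inr j => F'.x j
  · rw [Fintype.sum_sum_type]
    exact congrArg₂ (· + ·) F.sum_eq F'.sum_eq

theorem nonempty_comp {W : D} {h : X ⟶ Y} (a : W ⟶ X) (b : Y ⟶ Z) :
    Nonempty (Factors G h) → Nonempty (Factors G (a ≫ h ≫ b)) := by
  rintro ⟨F⟩
  refine ⟨⟨F.ι, F.t, fun j => a ≫ F.f j, fun j => F.x j ≫ b, ?_⟩⟩
  simpa [Preadditive.sum_comp, Preadditive.comp_sum] using congrArg (a ≫ · ≫ b) F.sum_eq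

theorem nonempty_sum {ι : Type*} (s : Finset ι) (h : ι → (X ⟶ Y))
    (H : ∀ i ∈ s, Nonempty (Factors G (h i))) : Nonempty (Factors G (∑ i ∈ s, h i)) := by
  classical
  induction s using Finset.induction_on with
  | empty => exact nonempty_zero
  | insert i s hi ih =>
    rw [Finset.sum_insert hi]
    exact nonempty_add (H i (Finset.mem_insert_self _ _))
      (ih fun j hj => H j (Finset.mem_insert_of_mem hj))

end Factors

/-- Idempotents `u s 1` of a ring with corners `ℂ` that generate the unit ideal and are triangular
with respect to a weight. -/
structure SplitSystem (A : Type) [Ring A] (S : Type) where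
  u : S → ℂ →+ A
  u_mul : ∀ s c d, u s c * u s d = u s (c * d)
  ne : ∀ s, u s 1 ≠ 0
  corner : ∀ s a, ∃ c, u s 1 * a * u s 1 = u s c
  weight : S → ℤ
  tri : ∀ s t, s ≠ t → weight t ≤ weight s → ∀ a, u t 1 * a * u s 1 = 0
  full : (1 : A) ∈ AddSubmonoid.closure {z | ∃ s a b, z = a * u s 1 * b}

namespace SplitSystem

variable {A : Type} [Ring A] {S : Type} (U : SplitSystem A S)

/-- The idempotents. -/
def e (s : S) : A := U.u s 1

theorem e_mul_u (s : S) (c : ℂ) : U.e s * U.u s c = U.u s c := by rw [e, U.u_mul, one_mul]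
theorem u_mul_e (s : S) (c : ℂ) : U.u s c * U.e s = U.u s c := by rw [e, U.u_mul, mul_one]
theorem e_mul_e (s : S) : U.e s * U.e s = U.e s := U.e_mul_u s 1

theorem u_injective (s : S) : Function.Injective (U.u s) := by
  refine (injective_iff_map_eq_zero _).2 fun c hc => ?_
  by_contra h
  refine U.ne s ?_
  rw [← mul_inv_cancel₀ h, ← U.u_mul, hc, zero_mul]

/-- The coefficient of an element in a corner. -/
def cornerCoef (s : S) (a : A) : ℂ := (U.corner s a).choose

theorem u_cornerCoef (s : S) (a : A) : U.u s (U.cornerCoef s a) = U.e s * a * U.e s :=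
  (U.corner s a).choose_spec.symm

/-- The right ideal `e_s A`. -/
def ideal (s : S) : Submodule Aᵐᵒᵖ A where
  carrier := {a | U.e s * a = a}
  zero_mem' := mul_zero _
  add_mem' {a b} ha hb := by
    change _ * _ = _ at ha hb
    change _ * _ = _
    rw [mul_add, ha, hb]
  smul_mem' r a ha := by
    change _ * _ = _ at ha
    change _ * (_ * _) = _ * _
    rw [← mul_assoc, ha]

/-- The right ideal `e_s A` as an object of the category of right modules. -/
def obj (s : S) : ModuleCat.{0} Aᵐᵒᵖ := ModuleCat.of _ (U.ideal s)

/-- The generator. -/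
def gen (s : S) : U.ideal s := ⟨U.e s, U.e_mul_e s⟩

/-- The element of `e_t A e_s` of a homomorphism `e_s A → e_t A`. -/
def elt {s t : S} (f : U.obj s ⟶ U.obj t) : A := (show U.ideal t from f.hom (U.gen s)).1

/-- A homomorphism e_s A → e_t A is left multiplication by the image of the generator, an element of
e_t A e_s. The conditions on the ring become conditions on homomorphisms in this way. -/
theorem hom_apply {s t : S} (f : U.obj s ⟶ U.obj t) (z : U.ideal s) :
    (show U.ideal t from f.hom z).1 = U.elt f * z.1 := by
  have h : z = MulOpposite.op z.1 • U.gen s := Subtype.ext z.2.symm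
  have h' : f.hom z = MulOpposite.op z.1 • f.hom (U.gen s) :=
    (congrArg _ h).trans (f.hom.map_smul _ _)
  exact congrArg Subtype.val h'

theorem e_mul_elt {s t : S} (f : U.obj s ⟶ U.obj t) : U.e t * U.elt f = U.elt f :=
  (show U.ideal t from f.hom (U.gen s)).2

theorem elt_mul_e {s t : S} (f : U.obj s ⟶ U.obj t) : U.elt f * U.e s = U.elt f :=
  (U.hom_apply f (U.gen s)).symm

theorem elt_comp {s t r : S} (f : U.obj s ⟶ U.obj t) (g : U.obj t ⟶ U.obj r) :
    U.elt (f ≫ g) = U.elt g * U.elt f := U.hom_apply g (f.hom (U.gen s))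

theorem eq_zero_of_elt {s t : S} (f : U.obj s ⟶ U.obj t) (h : U.elt f = 0) : f = 0 := by
  refine ModuleCat.hom_ext (LinearMap.ext fun z => Subtype.ext ?_)
  refine (U.hom_apply f z).trans ?_
  rw [h, zero_mul]
  rfl

theorem elt_eq_zero {s t : S} (f : U.obj s ⟶ U.obj t) (h : s ≠ t)
    (hw : U.weight t ≤ U.weight s) : U.elt f = 0 := by
  rw [← U.e_mul_elt f, ← U.elt_mul_e f, ← mul_assoc]
  exact U.tri s t h hw _

theorem u_cornerCoef_elt {s : S} (f : U.obj s ⟶ U.obj s) :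
    U.u s (U.cornerCoef s (U.elt f)) = U.elt f := by
  rw [u_cornerCoef, e_mul_elt, elt_mul_e]

/-- Left multiplication. -/
def mulHom {s t : S} (a : A) (ha : U.e t * a = a) : U.obj s ⟶ U.obj t := ModuleCat.ofHom
  { toFun z := ⟨a * z.1, by change _ * _ = _; rw [← mul_assoc, ha]⟩
    map_add' x y := Subtype.ext (mul_add _ _ _)
    map_smul' r x := Subtype.ext (mul_assoc _ _ _).symm }

theorem elt_mulHom {s t : S} (a : A) (ha : U.e t * a = a) :
    U.elt (U.mulHom (s := s) a ha) = a * U.e s := rfl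

/-- The scalar of a homomorphism. -/
def homCoef {s t : S} : (U.obj s ⟶ U.obj t) →+ ℂ where
  toFun f := open Classical in if s = t then U.cornerCoef s (U.elt f) else 0
  map_zero' := by
    split_ifs with h
    · subst h
      exact U.u_injective s (by rw [u_cornerCoef_elt, map_zero]; rfl)
    · rfl
  map_add' f g := by
    split_ifs with h
    · subst h
      exact U.u_injective s (by
        rw [map_add, u_cornerCoef_elt, u_cornerCoef_elt, u_cornerCoef_elt]; rfl)
    · rw [add_zero]

theorem homCoef_ne {s t : S} (f : U.obj s ⟶ U.obj t) (h : s ≠ t) : U.homCoef f = 0 := if_neg h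

theorem u_homCoef {s : S} (f : U.obj s ⟶ U.obj s) : U.u s (U.homCoef f) = U.elt f :=
  (congrArg (U.u s) (if_pos rfl)).trans (U.u_cornerCoef_elt f)

/-- The right ideals `e_s A`. -/
def splitData : SplitData U.obj where
  coef := U.homCoef
  coef_id s := U.u_injective s (U.u_homCoef _)
  coef_comp {s t r} f g := by
    by_cases hst : s = t
    · subst hst
      by_cases hsr : s = r
      · subst hsr
        refine U.u_injective s ?_
        rw [u_homCoef, mul_comm, ← U.u_mul, u_homCoef, u_homCoef, elt_comp]
      · rw [U.homCoef_ne _ hsr, U.homCoef_ne _ hsr, mul_zero]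
    · rw [U.homCoef_ne f hst, zero_mul]
      by_cases hsr : s = r
      · subst hsr
        refine U.u_injective s ?_
        rw [u_homCoef, map_zero, elt_comp]
        rcases le_total (U.weight t) (U.weight s) with h' | h'
        · rw [U.elt_eq_zero f hst h', mul_zero]
        · rw [U.elt_eq_zero g (Ne.symm hst) h', zero_mul]
      · exact U.homCoef_ne _ hsr
  coef_inj f h := U.eq_zero_of_elt f (by rw [← u_homCoef, h, map_zero])
  coef_surj s c := ⟨U.mulHom (U.u s c) (U.e_mul_u s c), U.u_injective s (by
    rw [u_homCoef, elt_mulHom, u_mul_e])⟩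
  weight := U.weight
  tri f h h' := U.eq_zero_of_elt f (U.elt_eq_zero f h h')

/-- The free right module of rank one. -/
abbrev free (A : Type) [Ring A] : ModuleCat.{0} Aᵐᵒᵖ := ModuleCat.of _ A

/-- Left multiplication on the free module. -/
def mulLeft : A →+ (free A ⟶ free A) where
  toFun a := ModuleCat.ofHom
    { toFun z := a * z
      map_add' := mul_add a
      map_smul' r x := (mul_assoc a x r.unop).symm }
  map_zero' := ModuleCat.hom_ext (LinearMap.ext fun z => zero_mul (M₀ := A) z)
  map_add' a b := ModuleCat.hom_ext (LinearMap.ext fun z => add_mul (R := A) a b z)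

/-- The idempotents generate the unit ideal: writing 1 as a sum of terms a e_s b, each term factors
left multiplication A → A through e_s A. -/
theorem factors_free : Nonempty (Factors U.obj (𝟙 (free A))) := by
  have h : ∀ a ∈ AddSubmonoid.closure {z | ∃ s a b, z = a * U.u s 1 * b},
      Nonempty (Factors U.obj (mulLeft a)) := by
    intro a ha
    induction ha using AddSubmonoid.closure_induction with
    | mem z hz =>
      obtain ⟨s, a, b, rfl⟩ := hz
      have := Factors.nonempty_gen (G := U.obj) (s := s) (X := free A) (Y := free A)
        (ModuleCat.ofHom
          { toFun z := (⟨U.e s * b * z, by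
              change _ * _ = _; rw [← mul_assoc, ← mul_assoc, e_mul_e]⟩ : U.ideal s)
            map_add' x y := Subtype.ext (mul_add _ _ _)
            map_smul' r x := Subtype.ext (mul_assoc _ _ _).symm })
        (ModuleCat.ofHom
          { toFun z := a * z.1
            map_add' x y := mul_add _ _ _
            map_smul' r x := (mul_assoc _ _ _).symm })
      convert this using 2
      refine ModuleCat.hom_ext (LinearMap.ext fun z => ?_)
      change a * U.u s 1 * b * z = a * (U.e s * b * z)
      rw [e, mul_assoc, mul_assoc, mul_assoc]
    | zero => rw [map_zero]; exact Factors.nonempty_zero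
    | add x y _ _ hx hy => rw [map_add]; exact Factors.nonempty_add hx hy
  have h₁ : mulLeft (1 : A) = 𝟙 (free A) :=
    ModuleCat.hom_ext (LinearMap.ext fun z => one_mul (M := A) z)
  exact h₁ ▸ h 1 U.full

/-- A finitely generated projective module as an object of the category of right modules. -/
abbrev toCat (P : FGProj A) : ModuleCat.{0} Aᵐᵒᵖ := ModuleCat.of _ P.carrier

/-- A finitely generated projective module is a summand of a finite free one; its dual basis factors
the identity through copies of A. -/
theorem factors_id (P : FGProj A) : Nonempty (Factors U.obj (𝟙 (toCat P))) := by
  obtain ⟨n, f, hf⟩ := Module.Finite.exists_fin' Aᵐᵒᵖ P.carrier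
  obtain ⟨g, hg⟩ := Module.projective_lifting_property f LinearMap.id hf
  have h : 𝟙 (toCat P) = ∑ i : Fin n,
      (ModuleCat.ofHom
        { toFun p := (g p i).unop
          map_add' x y := by rw [map_add]; rfl
          map_smul' r x := by rw [map_smul]; rfl } : toCat P ⟶ free A) ≫ 𝟙 _ ≫
      (ModuleCat.ofHom
        { toFun a := MulOpposite.op a • f (Pi.single i 1)
          map_add' x y := by rw [MulOpposite.op_add, add_smul]
          map_smul' r x := by rw [smul_smul]; rfl } : free A ⟶ toCat P) := by
    refine ModuleCat.hom_ext (LinearMap.ext fun p => ?_)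
    rw [ModuleCat.hom_sum, LinearMap.sum_apply]
    have h₁ : p = f (g p) := (DFunLike.congr_fun hg p).symm
    have h₂ : g p = ∑ i, g p i • (Pi.single i 1 : Fin n → Aᵐᵒᵖ) := by
      ext i
      simp [Finset.sum_apply, Pi.single_apply]
    refine h₁.trans ((congrArg f h₂).trans ?_)
    rw [map_sum]
    exact Finset.sum_congr rfl fun i _ => f.map_smul _ _
  rw [h]
  exact Factors.nonempty_sum _ _ fun i _ => Factors.nonempty_comp _ _ U.factors_free

/-- The class of a finitely generated projective module. -/
def pcls (P : FGProj A) : ProjClass A := Quotient.mk _ P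

theorem pcls_iso {P P' : FGProj A} (e : P.carrier ≃ₗ[Aᵐᵒᵖ] P'.carrier) : pcls P = pcls P' :=
  Quotient.sound ⟨e⟩

theorem pcls_add (P P' : FGProj A) : pcls P + pcls P' = pcls ⟨P.carrier × P'.carrier⟩ := rfl

/-- The free right module of rank one. -/
def unopEquiv (A : Type) [Ring A] : Aᵐᵒᵖ ≃ₗ[Aᵐᵒᵖ] A where
  toFun := MulOpposite.unop
  invFun := MulOpposite.op
  map_add' _ _ := rfl
  map_smul' _ _ := rfl

instance : Module.Finite Aᵐᵒᵖ A := Module.Finite.equiv (unopEquiv A)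

instance : Module.Projective Aᵐᵒᵖ A := Module.Projective.of_equiv (unopEquiv A)

instance (s : S) : Module.Finite Aᵐᵒᵖ (U.ideal s) :=
  Module.Finite.of_surjective
    ({ toFun z := ⟨U.e s * z, by change _ * _ = _; rw [← mul_assoc, e_mul_e]⟩
       map_add' x y := Subtype.ext (mul_add _ _ _)
       map_smul' r x := Subtype.ext (mul_assoc _ _ _).symm } : A →ₗ[Aᵐᵒᵖ] U.ideal s)
    fun z => ⟨z.1, Subtype.ext z.2⟩

instance (s : S) : Module.Projective Aᵐᵒᵖ (U.ideal s) :=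
  Module.Projective.of_split (U.ideal s).subtype
    ({ toFun z := ⟨U.e s * z, by change _ * _ = _; rw [← mul_assoc, e_mul_e]⟩
       map_add' x y := Subtype.ext (mul_add _ _ _)
       map_smul' r x := Subtype.ext (mul_assoc _ _ _).symm } : A →ₗ[Aᵐᵒᵖ] U.ideal s)
    (LinearMap.ext fun z => Subtype.ext z.2)

/-- The right ideal `e_s A` as a projective module. -/
def proj (s : S) : FGProj A := ⟨U.ideal s⟩

/-- The range of an idempotent endomorphism. -/
def rangeProj (P : FGProj A) (f : toCat P ⟶ toCat P) (h : f ≫ f = f) : FGProj A where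
  carrier := LinearMap.range f.hom
  fin := inferInstance
  proj := Module.Projective.of_split (LinearMap.range f.hom).subtype f.hom.rangeRestrict
    (LinearMap.ext fun ⟨_, z, hz⟩ => Subtype.ext (by
      subst hz
      exact DFunLike.congr_fun (congrArg ModuleCat.Hom.hom h) z))

/-- The class of the range of an idempotent is additive on orthogonal idempotents and equals the
class of e_s A on an idempotent that splits through e_s A. -/
theorem pcls_eq_sum {P : FGProj A} {L : Multiset S} (h : Splits U.obj (𝟙 (toCat P)) L) :
    pcls P = (L.map fun s => pcls (U.proj s)).sum := by
  refine Eq.trans ?_ (h.apply_eq_sum (fun f hf => pcls (rangeProj P f hf)) _ ?_ ?_ ?_)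
  · refine pcls_iso (LinearEquiv.ofBijective
      (LinearMap.codRestrict (LinearMap.range (ModuleCat.Hom.hom (𝟙 (toCat P)))) LinearMap.id fun z => ⟨z, rfl⟩)
      ⟨fun x y h => congrArg Subtype.val h, fun ⟨_, z, hz⟩ => ⟨z, Subtype.ext hz⟩⟩)
  · refine pcls_iso (P' := ⟨PUnit⟩) ?_
    have : Subsingleton (rangeProj P 0 Limits.zero_comp).carrier :=
      ⟨fun ⟨_, _, hx⟩ ⟨_, _, hy⟩ => Subtype.ext (hx.symm.trans hy)⟩
    exact LinearEquiv.ofSubsingleton _ _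
  · intro f g hf hg hfg h₁ h₂
    rw [pcls_add]
    have kf (z) : f.hom (f.hom z) = f.hom z := DFunLike.congr_fun (congrArg ModuleCat.Hom.hom hf) z
    have kg (z) : g.hom (g.hom z) = g.hom z := DFunLike.congr_fun (congrArg ModuleCat.Hom.hom hg) z
    have k₁ (z) : g.hom (f.hom z) = 0 := DFunLike.congr_fun (congrArg ModuleCat.Hom.hom h₁) z
    have k₂ (z) : f.hom (g.hom z) = 0 := DFunLike.congr_fun (congrArg ModuleCat.Hom.hom h₂) z
    have ka (z) : (f + g).hom z = f.hom z + g.hom z := rfl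
    -- The range of `f + g` is identified with the product of the two ranges by sending z to (f z, g
    -- z); orthogonality gives injectivity and surjectivity.
    refine pcls_iso (LinearEquiv.ofBijective
      ((f.hom.rangeRestrict.prod g.hom.rangeRestrict).comp
        (LinearMap.range (f + g).hom).subtype) ⟨?_, ?_⟩)
    · rintro ⟨_, x, rfl⟩ ⟨_, y, rfl⟩ hxy
      have h₃ : f.hom ((f + g).hom x) = f.hom ((f + g).hom y) :=
        congrArg (fun z => (z.1 : P.carrier)) hxy
      have h₄ : g.hom ((f + g).hom x) = g.hom ((f + g).hom y) :=
        congrArg (fun z => (z.2 : P.carrier)) hxy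
      rw [ka, ka, map_add, map_add, kf, kf, k₂, k₂, add_zero, add_zero] at h₃
      rw [ka, ka, map_add, map_add, kg, kg, k₁, k₁, zero_add, zero_add] at h₄
      exact Subtype.ext ((ka x).trans ((congrArg₂ (· + ·) h₃ h₄).trans (ka y).symm))
    · rintro ⟨⟨_, x, rfl⟩, ⟨_, y, rfl⟩⟩
      refine ⟨⟨f.hom x + g.hom y, f.hom x + g.hom y, ?_⟩, ?_⟩
      · rw [ka, map_add, map_add, kf, kg, k₁, k₂, add_zero, zero_add]
      · refine Prod.ext (Subtype.ext ?_) (Subtype.ext ?_)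
        · change f.hom (f.hom x + g.hom y) = _
          rw [map_add, kf, k₂, add_zero]
        · change g.hom (f.hom x + g.hom y) = _
          rw [map_add, kg, k₁, zero_add]
  · intro s y g hyg hi
    have k (z) : g.hom (y.hom z) = z := DFunLike.congr_fun (congrArg ModuleCat.Hom.hom hyg) z
    refine pcls_iso (P' := U.proj s) (LinearEquiv.ofBijective
      (g.hom.comp (LinearMap.range (g ≫ y).hom).subtype) ⟨?_, ?_⟩)
    · rintro ⟨_, x, rfl⟩ ⟨_, x', rfl⟩ h
      have h' : g.hom (y.hom (g.hom x)) = g.hom (y.hom (g.hom x')) := h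
      rw [k, k] at h'
      exact Subtype.ext (congrArg y.hom h')
    · intro z
      refine ⟨⟨y.hom z, y.hom z, ?_⟩, k z⟩
      change y.hom (g.hom (y.hom z)) = _
      rw [k]

/-- The direct sum of the chosen ideals realises any prescribed multiset. This links equality of
classes to the uniqueness of splittings. -/
theorem exists_model (L : Multiset S) : ∃ P : FGProj A,
    pcls P = (L.map fun s => pcls (U.proj s)).sum ∧ Splits U.obj (𝟙 (toCat P)) L := by
  induction L using Multiset.induction_on with
  | empty =>
    refine ⟨⟨PUnit⟩, rfl, ?_⟩
    have : 𝟙 (toCat (A := A) ⟨PUnit⟩) = 0 := ModuleCat.hom_ext (LinearMap.ext fun z => rfl)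
    rw [this]
    exact .zero
  | cons s L ih =>
    obtain ⟨P, hP, h⟩ := ih
    refine ⟨⟨(U.proj s).carrier × P.carrier⟩, ?_, ?_⟩
    · rw [Multiset.map_cons, Multiset.sum_cons, ← hP]; rfl
    · let Y : FGProj A := ⟨(U.proj s).carrier × P.carrier⟩
      let i : toCat P ⟶ toCat Y := ModuleCat.ofHom (LinearMap.inr Aᵐᵒᵖ (U.proj s).carrier P.carrier)
      let p : toCat Y ⟶ toCat P := ModuleCat.ofHom (LinearMap.snd Aᵐᵒᵖ (U.proj s).carrier P.carrier)
      let y : U.obj s ⟶ toCat Y := ModuleCat.ofHom (LinearMap.inl Aᵐᵒᵖ (U.proj s).carrier P.carrier)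
      let g : toCat Y ⟶ U.obj s := ModuleCat.ofHom (LinearMap.fst Aᵐᵒᵖ (U.proj s).carrier P.carrier)
      have h' := h.map i p rfl
      have := Splits.cons s y g rfl (by rw [Category.id_comp]; rfl) (by rw [Category.id_comp]; rfl) h'
      convert this using 1
      refine ModuleCat.hom_ext (LinearMap.ext fun z => ?_)
      change z = (0, z.2) + (z.1, 0)
      simp

/-- Projective modules are classified by multiplicities. -/
def projClassEquiv : Multiset S ≃+ ProjClass A :=
  AddEquiv.ofBijective (Multiset.sumAddMonoidHom.comp
    (Multiset.mapAddMonoidHom fun s => pcls (U.proj s))) ⟨fun L L' h => by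
      obtain ⟨P, hP, k⟩ := U.exists_model L
      obtain ⟨P', hP', k'⟩ := U.exists_model L'
      obtain ⟨φ⟩ : Nonempty (P.carrier ≃ₗ[Aᵐᵒᵖ] P'.carrier) :=
        Quotient.exact (hP.trans (h.trans hP'.symm))
      obtain ⟨F⟩ := U.factors_id P'
      -- An isomorphism of the two models transports the splitting of one identity to the other,
      -- where multiplicities are unique.
      refine U.splitData.eq_of_splits F ?_ k'
      have := k.map (Y := toCat P') (ModuleCat.ofHom φ.toLinearMap)
        (ModuleCat.ofHom φ.symm.toLinearMap)
        (ModuleCat.hom_ext (LinearMap.ext fun z => φ.symm_apply_apply z))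
      convert this using 1
      exact ModuleCat.hom_ext (LinearMap.ext fun z => (φ.apply_symm_apply z).symm), fun x => by
      induction x using Quotient.inductionOn with | h P => ?_
      obtain ⟨F⟩ := U.factors_id P
      obtain ⟨L, hL⟩ := U.splitData.exists_splits F (e := 𝟙 _) (Category.comp_id _)
      exact ⟨L, (U.pcls_eq_sum hL).symm⟩⟩

end SplitSystem

/-- The Grothendieck group of a free commutative monoid. -/
def grothendieckEquiv {M : Type*} [AddCommMonoid M] {S : Type*} (E : Multiset S ≃+ M) :
    Algebra.GrothendieckAddGroup M ≃+ (S →₀ ℤ) := by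
  classical
  exact AddMonoidHom.toAddEquiv
    (Algebra.GrothendieckAddGroup.lift (((Finsupp.mapRange.addMonoidHom (Nat.castAddMonoidHom ℤ)).comp
      (Multiset.toFinsupp (α := S)).toAddMonoidHom).comp E.symm.toAddMonoidHom))
    (Finsupp.liftAddHom fun s => zmultiplesHom _ (Algebra.GrothendieckAddGroup.of (E {s})))
    (Algebra.GrothendieckAddGroup.lift.symm.injective (by
      refine AddMonoidHom.ext fun x => ?_
      obtain ⟨L, rfl⟩ := E.surjective x
      induction L using Multiset.induction_on with
      | empty => simp only [map_zero]
      | cons s L ih =>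
        rw [← Multiset.singleton_add, map_add, map_add, map_add, ih]
        congr 1
        change Finsupp.liftAddHom _ (Algebra.GrothendieckAddGroup.lift _
          (Algebra.GrothendieckAddGroup.of _)) = Algebra.GrothendieckAddGroup.of _
        rw [lift_of]
        simp))
    (by
      refine Finsupp.addHom_ext' fun s => AddMonoidHom.ext_int ?_
      simp only [AddMonoidHom.comp_apply, Finsupp.singleAddHom_apply, Finsupp.liftAddHom_apply_single,
        zmultiplesHom_apply, one_smul, AddMonoidHom.id_apply]
      rw [lift_of]
      simp)

/-- `K₀` of a ring with a split system. -/
def SplitSystem.K0Equiv {A : Type} [Ring A] {S : Type} (U : SplitSystem A S) :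
    K0 A ≃+ (S →₀ ℤ) := grothendieckEquiv U.projClassEquiv

end HeisCat

end

/-! ### Young symmetrizers -/

noncomputable section

namespace HeisCat

section Columns

variable {X : Type*} [Fintype X] {r r' c : X → ℕ}

/-- Within a column `r` is injective, so at most k entries have `r` less than k; and the values of
`r'` fill an initial segment, so either all entries have `r'` less than k or at least k of them do.
-/
theorem card_column_le (hr : ∀ x y, r x = r y → c x = c y → x = y)
    (hd : ∀ x i, i < r' x → ∃ y, c y = c x ∧ r' y = i) (j k : ℕ) :
    (Finset.univ.filter fun x => c x = j ∧ r x < k).card ≤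
      (Finset.univ.filter fun x => c x = j ∧ r' x < k).card := by
  by_cases h : ∀ x, c x = j → r' x < k
  · refine Finset.card_le_card fun x hx => ?_
    simp only [Finset.mem_filter, Finset.mem_univ, true_and] at hx ⊢
    exact ⟨hx.1, h x hx.1⟩
  · push Not at h
    obtain ⟨x₀, hx₀, hk⟩ := h
    calc _ ≤ (Finset.range k).card := by
          refine Finset.card_le_card_of_injOn r (fun x hx => ?_) fun x hx y hy hxy => ?_
          · simp only [Finset.coe_filter, Finset.mem_univ, true_and, Set.mem_setOf_eq] at hx
            simpa using hx.2
          · simp only [Finset.coe_filter, Finset.mem_univ, true_and, Set.mem_setOf_eq] at hx hy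
            exact hr x y hxy (hx.1.trans hy.1.symm)
      _ ≤ ((Finset.univ.filter fun x => c x = j ∧ r' x < k).image r').card := by
          refine Finset.card_le_card fun i hi => ?_
          rw [Finset.mem_range] at hi
          obtain ⟨y, hy, rfl⟩ := hd x₀ i (hi.trans_le hk)
          simp only [Finset.mem_image, Finset.mem_filter, Finset.mem_univ, true_and]
          exact ⟨y, ⟨hy.trans hx₀, hi⟩, rfl⟩
      _ ≤ _ := Finset.card_image_le

theorem card_eq_sum_columns (r c : X → ℕ) (k : ℕ) :
    (Finset.univ.filter fun x => r x < k).card =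
      ∑ j ∈ Finset.univ.image c, (Finset.univ.filter fun x => c x = j ∧ r x < k).card := by
  rw [Finset.card_eq_sum_card_fiberwise (f := c) (t := Finset.univ.image c) fun x _ => by simp]
  refine Finset.sum_congr rfl fun j _ => ?_
  rw [Finset.filter_filter]
  simp only [and_comm]

theorem card_lt_le (hr : ∀ x y, r x = r y → c x = c y → x = y)
    (hd : ∀ x i, i < r' x → ∃ y, c y = c x ∧ r' y = i) (k : ℕ) :
    (Finset.univ.filter fun x => r x < k).card ≤ (Finset.univ.filter fun x => r' x < k).card := by
  rw [card_eq_sum_columns r c, card_eq_sum_columns r' c]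
  exact Finset.sum_le_sum fun j _ => card_column_le hr hd j k

/-- Equality of all the totals forces equality in each column. Then every value of `r` in a column
is also a value of `r'` there, which gives the column-preserving permutation. -/
theorem exists_perm_of_card_eq (hr : ∀ x y, r x = r y → c x = c y → x = y)
    (hd : ∀ x i, i < r' x → ∃ y, c y = c x ∧ r' y = i)
    (hk : ∀ k, (Finset.univ.filter fun x => r x < k).card =
      (Finset.univ.filter fun x => r' x < k).card) :
    ∃ q : Equiv.Perm X, ∀ x, c (q x) = c x ∧ r' (q x) = r x := by
  have key (x : X) : ∃ y, c y = c x ∧ r' y = r x := by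
    -- With k one more than the maximum of `r'` in the column, the count for `r'` is the whole
    -- column; hence `r x` is at most this maximum, and lower values are attained as well.
    obtain ⟨y, hy, hmax⟩ := Finset.exists_max_image (Finset.univ.filter fun y => c y = c x) r'
      ⟨x, by simp⟩
    simp only [Finset.mem_filter, Finset.mem_univ, true_and] at hy hmax
    have h := hk (r' y + 1)
    rw [card_eq_sum_columns r c, card_eq_sum_columns r' c,
      Finset.sum_eq_sum_iff_of_le fun j _ => card_column_le hr hd j _] at h
    have h := h (c x) (by simp)
    have hx : x ∈ Finset.univ.filter fun z => c z = c x ∧ r z < r' y + 1 := by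
      have e : (Finset.univ.filter fun z => c z = c x ∧ r' z < r' y + 1) =
          Finset.univ.filter fun z => c z = c x := by
        refine Finset.filter_congr fun z _ => ⟨fun h => h.1, fun h => ⟨h, ?_⟩⟩
        exact Nat.lt_succ_of_le (hmax z h)
      rw [e] at h
      rw [Finset.eq_of_subset_of_card_le (t := Finset.univ.filter fun z => c z = c x)
        (fun z hz => by simp only [Finset.mem_filter, Finset.mem_univ, true_and] at hz ⊢; exact hz.1)
        h.ge]
      simp
    simp only [Finset.mem_filter, Finset.mem_univ, true_and] at hx
    rcases (Nat.le_of_lt_succ hx).lt_or_eq with hlt | heq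
    · obtain ⟨z, hz, hz'⟩ := hd y _ hlt
      exact ⟨z, hz.trans hy, hz'⟩
    · exact ⟨y, hy, heq.symm⟩
  choose q hq using key
  have hinj : Function.Injective q := fun x y h => by
    refine hr x y ?_ ?_
    · rw [← (hq x).2, ← (hq y).2, h]
    · rw [← (hq x).1, ← (hq y).1, h]
  exact ⟨Equiv.ofBijective q (Finite.injective_iff_bijective.1 hinj), hq⟩

end Columns

theorem perm_apply_inv {X : Type*} (σ : Equiv.Perm X) (x : X) : σ (σ⁻¹ x) = x :=
  σ.apply_symm_apply x

/-- The sum of the permutations that preserve a function, with the signs of a character. -/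
def stabSum {n : ℕ} (f : Fin n → ℕ) (χ : Equiv.Perm (Fin n) →* ℤˣ) : SymAlg n :=
  ∑ g : Equiv.Perm (Fin n) with ∀ x, f (g x) = f x,
    (((χ g : ℤˣ) : ℤ) : ℂ) • MonoidAlgebra.of ℂ _ g

section StabSum

variable {n : ℕ} (f : Fin n → ℕ) (χ : Equiv.Perm (Fin n) →* ℤˣ) {p : Equiv.Perm (Fin n)}

theorem stabSum_mul (hp : ∀ x, f (p x) = f x) :
    stabSum f χ * MonoidAlgebra.of ℂ _ p = (((χ p : ℤˣ) : ℤ) : ℂ) • stabSum f χ := by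
  rw [stabSum, Finset.sum_mul, Finset.smul_sum]
  refine Finset.sum_bij' (fun g _ => g * p) (fun g _ => g * p⁻¹) ?_ ?_ ?_ ?_ ?_
  · intro g hg
    simp only [Finset.mem_filter, Finset.mem_univ, true_and, Equiv.Perm.mul_apply] at hg ⊢
    exact fun x => (hg _).trans (hp x)
  · intro g hg
    simp only [Finset.mem_filter, Finset.mem_univ, true_and, Equiv.Perm.mul_apply] at hg ⊢
    exact fun x => (hg _).trans (by rw [← hp, perm_apply_inv])
  · intro g _; simp
  · intro g _; simp
  · intro g _
    rw [smul_smul, smul_mul_assoc, ← map_mul (MonoidAlgebra.of ℂ (Equiv.Perm (Fin n))), map_mul χ]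
    congr 1
    rw [← Int.cast_mul, ← Units.val_mul, mul_left_comm, Int.units_mul_self, mul_one]

theorem mul_stabSum (hp : ∀ x, f (p x) = f x) :
    MonoidAlgebra.of ℂ _ p * stabSum f χ = (((χ p : ℤˣ) : ℤ) : ℂ) • stabSum f χ := by
  rw [stabSum, Finset.mul_sum, Finset.smul_sum]
  have hp' (x) : f (p⁻¹ x) = f x := by rw [← hp, perm_apply_inv]
  refine Finset.sum_bij' (fun g _ => p * g) (fun g _ => p⁻¹ * g) ?_ ?_ ?_ ?_ ?_
  · intro g hg
    simp only [Finset.mem_filter, Finset.mem_univ, true_and, Equiv.Perm.mul_apply] at hg ⊢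
    exact fun x => (hp _).trans (hg x)
  · intro g hg
    simp only [Finset.mem_filter, Finset.mem_univ, true_and, Equiv.Perm.mul_apply] at hg ⊢
    exact fun x => (hp' _).trans (hg x)
  · intro g _; simp
  · intro g _; simp
  · intro g _
    rw [smul_smul, mul_smul_comm, ← map_mul (MonoidAlgebra.of ℂ (Equiv.Perm (Fin n))), map_mul χ]
    congr 1
    rw [← Int.cast_mul, ← Units.val_mul, ← mul_assoc, Int.units_mul_self, one_mul]

end StabSum

namespace Tableau

variable {n : ℕ} {lam mu : n.Partition} (T : Tableau lam) (T' : Tableau mu)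

theorem rowSum_eq : T.rowSum = stabSum T.row 1 := by simp [rowSum, stabSum]

theorem colSum_eq : T.colSum = stabSum T.col Equiv.Perm.sign := rfl

theorem ext_of_row_col {x y : Fin n} (hr : T.row x = T.row y) (hc : T.col x = T.col y) : x = y := by
  refine T.symm.injective (Sigma.ext (Fin.ext hr) ?_)
  have h : (T.symm x).1 = (T.symm y).1 := Fin.ext hr
  exact (Fin.heq_ext_iff (by rw [h])).2 hc

theorem row_apply (b : Box lam) : T.row (T b) = b.1 :=
  congrArg (fun b : Box lam => (b.1 : ℕ)) (T.symm_apply_apply b)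

theorem col_apply (b : Box lam) : T.col (T b) = b.2 :=
  congrArg (fun b : Box lam => (b.2 : ℕ)) (T.symm_apply_apply b)

theorem exists_of_lt_row (x : Fin n) {i : ℕ} (hi : i < T.row x) :
    ∃ y, T.col y = T.col x ∧ T.row y = i := by
  have hs : (rowLens lam).Pairwise (· ≥ ·) := Multiset.pairwise_sort _ _
  have hlt : i < (rowLens lam).length := hi.trans (T.symm x).1.2
  have hle : (rowLens lam).get (T.symm x).1 ≤ (rowLens lam).get ⟨i, hlt⟩ :=
    List.pairwise_iff_get.1 hs ⟨i, hlt⟩ (T.symm x).1 hi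
  refine ⟨T ⟨⟨i, hlt⟩, ⟨T.col x, (T.symm x).2.2.trans_le hle⟩⟩, ?_, ?_⟩
  · rw [col_apply]
  · rw [row_apply]

/-- The number of entries in the first `k` rows. -/
def rowCount (k : ℕ) : ℕ := (Finset.univ.filter fun x => T.row x < k).card

theorem card_row_eq (i : ℕ) :
    (Finset.univ.filter fun x => T.row x = i).card = (rowLens lam).getD i 0 := by
  by_cases hi : i < (rowLens lam).length
  · rw [List.getD_eq_getElem _ _ hi, ← Fintype.card_fin ((rowLens lam)[i]), ← Finset.card_univ]
    symm
    refine Finset.card_bij (fun j _ => T ⟨⟨i, hi⟩, j⟩) ?_ ?_ ?_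
    · intro j _
      rw [Finset.mem_filter, row_apply]
      exact ⟨Finset.mem_univ _, rfl⟩
    · intro j _ j' _ h
      simpa using h
    · intro x hx
      simp only [Finset.mem_filter, Finset.mem_univ, true_and] at hx
      have h : (T.symm x).1 = ⟨i, hi⟩ := Fin.ext hx
      refine ⟨⟨T.col x, ?_⟩, Finset.mem_univ _, ?_⟩
      · exact (T.symm x).2.2.trans_eq (congrArg (rowLens lam).get h)
      · exact T.ext_of_row_col (by rw [row_apply, hx]) (by rw [col_apply])
  · rw [List.getD_eq_default _ _ (not_lt.1 hi), Finset.card_eq_zero, Finset.filter_eq_empty_iff]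
    intro x _ h
    exact hi (h ▸ (T.symm x).1.2)

/-- Row lengths are the differences of consecutive counts, and they are positive, so the list of
them is determined together with its length. -/
theorem eq_of_rowCount (h : ∀ k, T.rowCount k = T'.rowCount k) : lam = mu := by
  have hs {nu : n.Partition} (U : Tableau nu) (i : ℕ) :
      U.rowCount (i + 1) = U.rowCount i + (rowLens nu).getD i 0 := by
    rw [← U.card_row_eq, rowCount, rowCount, ← Finset.card_union_of_disjoint]
    · congr 1
      ext x
      simp only [Finset.mem_filter, Finset.mem_univ, true_and, Finset.mem_union]
      omega
    · refine Finset.disjoint_filter.2 fun x _ h h' => ?_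
      omega
  have hd (i : ℕ) : (rowLens lam).getD i 0 = (rowLens mu).getD i 0 := by
    have := hs T i
    rw [h, h, hs T'] at this
    omega
  have hpos {nu : n.Partition} {i : ℕ} (hi : i < (rowLens nu).length) :
      (rowLens nu).getD i 0 ≠ 0 := by
    rw [List.getD_eq_getElem _ _ hi]
    have : (rowLens nu)[i] ∈ nu.parts := by
      rw [← Multiset.mem_sort (r := (· ≥ ·))]
      exact List.getElem_mem hi
    exact (nu.parts_pos this).ne'
  have hlen : (rowLens lam).length = (rowLens mu).length := by
    rcases lt_trichotomy (rowLens lam).length (rowLens mu).length with hlt | heq | hlt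
    · exact absurd ((hd _).symm.trans (List.getD_eq_default _ _ le_rfl)) (hpos hlt)
    · exact heq
    · exact absurd ((hd _).trans (List.getD_eq_default _ _ le_rfl)) (hpos hlt)
  have hl : rowLens lam = rowLens mu := List.ext_getElem hlen fun i h₁ h₂ => by
    have := hd i
    rwa [List.getD_eq_getElem _ _ h₁, List.getD_eq_getElem _ _ h₂] at this
  refine Nat.Partition.ext ?_
  rw [← Multiset.sort_eq lam.parts (· ≥ ·), ← Multiset.sort_eq mu.parts (· ≥ ·)]
  exact congrArg _ hl

/-- The transposition of `x` and `y` is absorbed by the row sum; carried through `σ` it becomes a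
transposition within a column, absorbed by the column sum with sign -1. The product equals its
negative. -/
theorem mul_eq_zero_of_pair {σ : Equiv.Perm (Fin n)} {x y : Fin n} (hxy : x ≠ y)
    (hr : T.row x = T.row y) (hc : T'.col (σ x) = T'.col (σ y)) :
    T.rowSum * MonoidAlgebra.of ℂ _ σ⁻¹ * T'.colSum = 0 ∧
      T'.colSum * MonoidAlgebra.of ℂ _ σ * T.rowSum = 0 := by
  have self_eq_neg {z : SymAlg n} (h : z = -z) : z = 0 := by
    have h₂ : (2 : ℂ) • z = 0 := by
      rw [two_smul]
      nth_rewrite 1 [h]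
      exact neg_add_cancel z
    exact (smul_eq_zero.1 h₂).resolve_left two_ne_zero
  have h₁ (z) : T.row (Equiv.swap x y z) = T.row z := by
    by_cases hx : z = x
    · rw [hx, Equiv.swap_apply_left, hr]
    · by_cases hy : z = y
      · rw [hy, Equiv.swap_apply_right, hr]
      · rw [Equiv.swap_apply_of_ne_of_ne hx hy]
  have h₂ (z) : T'.col (Equiv.swap (σ x) (σ y) z) = T'.col z := by
    by_cases hx : z = σ x
    · rw [hx, Equiv.swap_apply_left, hc]
    · by_cases hy : z = σ y
      · rw [hy, Equiv.swap_apply_right, hc]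
      · rw [Equiv.swap_apply_of_ne_of_ne hx hy]
  have hs : Equiv.Perm.sign (Equiv.swap (σ x) (σ y)) = -1 :=
    Equiv.Perm.sign_swap fun h => hxy (σ.injective h)
  have hσ : Equiv.swap (σ x) (σ y) * σ = σ * Equiv.swap x y :=
    (Equiv.mul_swap_eq_swap_mul σ x y).symm
  have hσ' : σ⁻¹ * Equiv.swap (σ x) (σ y) = Equiv.swap x y * σ⁻¹ := by
    rw [inv_mul_eq_iff_eq_mul, ← mul_assoc, ← hσ, mul_inv_cancel_right]
  have k₁ := stabSum_mul T.row 1 h₁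
  have k₂ := mul_stabSum T.row 1 h₁
  have k₃ := stabSum_mul T'.col Equiv.Perm.sign h₂
  have k₄ := mul_stabSum T'.col Equiv.Perm.sign h₂
  rw [hs] at k₃ k₄
  rw [← rowSum_eq] at k₁ k₂
  rw [← colSum_eq] at k₃ k₄
  simp only [MonoidHom.one_apply, Units.val_one, Int.cast_one, one_smul, Units.val_neg,
    Int.cast_neg, neg_smul] at k₁ k₂ k₃ k₄
  constructor
  · refine self_eq_neg ?_
    calc _ = T.rowSum * MonoidAlgebra.of ℂ _ (Equiv.swap x y) * MonoidAlgebra.of ℂ _ σ⁻¹ *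
          T'.colSum := by rw [k₁]
      _ = T.rowSum * MonoidAlgebra.of ℂ _ σ⁻¹ *
          (MonoidAlgebra.of ℂ _ (Equiv.swap (σ x) (σ y)) * T'.colSum) := by
        rw [mul_assoc T.rowSum, ← map_mul, ← hσ', map_mul]; simp only [mul_assoc]
      _ = _ := by rw [k₄, mul_neg]
  · refine self_eq_neg ?_
    calc _ = T'.colSum * MonoidAlgebra.of ℂ _ σ *
          (MonoidAlgebra.of ℂ _ (Equiv.swap x y) * T.rowSum) := by rw [k₂]
      _ = T'.colSum * MonoidAlgebra.of ℂ _ (Equiv.swap (σ x) (σ y)) *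
          MonoidAlgebra.of ℂ _ σ * T.rowSum := by
        rw [mul_assoc T'.colSum (MonoidAlgebra.of ℂ _ (Equiv.swap (σ x) (σ y))), ← map_mul, hσ,
          map_mul]
        simp only [mul_assoc]
      _ = _ := by rw [k₃, neg_mul, neg_mul]

/-- If `σ` sends entries of one row of `T` to different columns of `T'`, then the shape of `T'`
dominates that of `T`. This is column counting with `T'` pulled back along `σ`. -/
theorem rowCount_le_of_injective {σ : Equiv.Perm (Fin n)}
    (h : ∀ x y, T.row x = T.row y → T'.col (σ x) = T'.col (σ y) → x = y) (k : ℕ) :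
    T.rowCount k ≤ T'.rowCount k := by
  refine (card_lt_le (r := T.row) (r' := T'.row ∘ σ) (c := T'.col ∘ σ) h ?_ k).trans_eq ?_
  · intro x i hi
    obtain ⟨y, hy⟩ := T'.exists_of_lt_row (σ x) hi
    exact ⟨σ⁻¹ y, by simpa using hy⟩
  · refine Finset.card_bij (fun x _ => σ x) ?_ ?_ ?_
    · intro x hx; simpa using hx
    · intro x _ y _ h; exact σ.injective h
    · intro x hx; exact ⟨σ⁻¹ x, by simpa using hx, by simp⟩

theorem mul_eq_zero_of_not_le (h : ¬∀ k, T.rowCount k ≤ T'.rowCount k) (z : SymAlg n) :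
    T.rowSum * z * T'.colSum = 0 ∧ T'.colSum * z * T.rowSum = 0 := by
  have key (σ : Equiv.Perm (Fin n)) : T.rowSum * MonoidAlgebra.of ℂ _ σ⁻¹ * T'.colSum = 0 ∧
      T'.colSum * MonoidAlgebra.of ℂ _ σ * T.rowSum = 0 := by
    by_contra hσ
    refine h fun k => T.rowCount_le_of_injective T' (σ := σ) (fun x y hr hc => ?_) k
    by_contra hxy
    exact hσ (T.mul_eq_zero_of_pair T' hxy hr hc)
  induction z using MonoidAlgebra.induction_linear with
  | zero => simp
  | add f g hf hg => simp only [mul_add, add_mul, hf, hg, add_zero, and_self]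
  | single σ c =>
    have e : MonoidAlgebra.single σ c = c • MonoidAlgebra.of ℂ _ σ := by simp
    rw [e]
    simp only [mul_smul_comm, smul_mul_assoc]
    have h₁ := (key σ⁻¹).1
    rw [inv_inv] at h₁
    rw [h₁, (key σ).2, smul_zero]
    exact ⟨rfl, rfl⟩

/-- Von Neumann's lemma. For a single permutation either a pair of entries as in
`mul_eq_zero_of_pair` exists and the product vanishes, or the permutation is a row permutation times
a column permutation, and these are absorbed up to sign. -/
theorem exists_smul (z : SymAlg n) : ∃ c : ℂ, T.rowSum * z * T.colSum =
    c • (T.rowSum * T.colSum) := by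
  have key (σ : Equiv.Perm (Fin n)) : ∃ c : ℂ, T.rowSum * MonoidAlgebra.of ℂ _ σ⁻¹ * T.colSum =
      c • (T.rowSum * T.colSum) := by
    by_cases h : ∀ x y, T.row x = T.row y → T.col (σ x) = T.col (σ y) → x = y
    · obtain ⟨q, hq⟩ := exists_perm_of_card_eq (r := T.row) (r' := T.row ∘ σ) (c := T.col ∘ σ) h
        (fun x i hi => by
          obtain ⟨y, hy⟩ := T.exists_of_lt_row (σ x) hi
          exact ⟨σ⁻¹ y, by simpa using hy⟩) (fun k => by
          symm
          refine Finset.card_bij (fun x _ => σ x) ?_ ?_ ?_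
          · intro x hx; simpa using hx
          · intro x _ y _ h; exact σ.injective h
          · intro x hx; exact ⟨σ⁻¹ x, by simpa using hx, by simp⟩)
      -- The column-preserving `q` was chosen so that `σ * q` maps each entry to one in the same
      -- row; hence the first factor preserves rows and the second preserves columns.
      have e : σ⁻¹ = (σ * q)⁻¹ * (σ * q * σ⁻¹) := by group
      have hp (x) : T.row ((σ * q)⁻¹ x) = T.row x := by
        have := (hq ((σ * q)⁻¹ x)).2
        rw [← this]
        exact congrArg T.row (perm_apply_inv (σ * q) x)
      have hq' (x) : T.col ((σ * q * σ⁻¹) x) = T.col x := by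
        have := (hq (σ⁻¹ x)).1
        refine this.trans ?_
        exact congrArg T.col (perm_apply_inv σ x)
      have k₁ := stabSum_mul T.row 1 hp
      have k₂ := mul_stabSum T.col Equiv.Perm.sign hq'
      rw [← rowSum_eq] at k₁
      rw [← colSum_eq] at k₂
      simp only [MonoidHom.one_apply, Units.val_one, Int.cast_one, one_smul] at k₁
      refine ⟨((Equiv.Perm.sign (σ * q * σ⁻¹) : ℤ) : ℂ), ?_⟩
      have k₃ := congrArg (MonoidAlgebra.of ℂ _) e
      rw [map_mul] at k₃
      rw [k₃, ← mul_assoc, k₁, mul_assoc, k₂, mul_smul_comm]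
    · push Not at h
      obtain ⟨x, y, hr, hc, hxy⟩ := h
      exact ⟨0, by rw [(T.mul_eq_zero_of_pair T hxy hr hc).1, zero_smul]⟩
  induction z using MonoidAlgebra.induction_linear with
  | zero => exact ⟨0, by simp⟩
  | add f g hf hg =>
    obtain ⟨c, hc⟩ := hf
    obtain ⟨d, hd⟩ := hg
    exact ⟨c + d, by rw [mul_add, add_mul, hc, hd, add_smul]⟩
  | single σ a =>
    have e : MonoidAlgebra.single σ a = a • MonoidAlgebra.of ℂ _ σ := by simp
    obtain ⟨c, hc⟩ := key σ⁻¹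
    rw [inv_inv] at hc
    exact ⟨a * c, by rw [e, mul_smul_comm, smul_mul_assoc, hc, smul_smul]⟩

theorem trace_mulRight_of (g : Equiv.Perm (Fin n)) :
    LinearMap.trace ℂ _ (LinearMap.mulRight ℂ (MonoidAlgebra.of ℂ _ g)) =
      if g = 1 then (n.factorial : ℂ) else 0 := by
  classical
  rw [LinearMap.trace_eq_matrix_trace ℂ (MonoidAlgebra.basis (Equiv.Perm (Fin n)) ℂ),
    Matrix.trace]
  have h (x : Equiv.Perm (Fin n)) : Matrix.diag (LinearMap.toMatrix
      (MonoidAlgebra.basis (Equiv.Perm (Fin n)) ℂ) (MonoidAlgebra.basis (Equiv.Perm (Fin n)) ℂ)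
      (LinearMap.mulRight ℂ (MonoidAlgebra.of ℂ _ g))) x = if g = 1 then 1 else 0 := by
    rw [Matrix.diag_apply, LinearMap.toMatrix_apply, MonoidAlgebra.basis_apply,
      LinearMap.mulRight_apply, MonoidAlgebra.of_apply, MonoidAlgebra.single_mul_single, one_mul]
    change Finsupp.single (x * g) (1 : ℂ) x = _
    rw [Finsupp.single_apply]
    simp
  simp only [h, Finset.sum_const, Finset.card_univ, Fintype.card_perm, Fintype.card_fin]
  split_ifs <;> simp

/-- Right multiplication by a permutation other than 1 has trace zero, so the trace is n! times the
coefficient of 1 in the product. This coefficient is 1, as only the identity preserves both rows and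
columns. -/
theorem trace_mulRight :
    LinearMap.trace ℂ _ (LinearMap.mulRight ℂ (T.rowSum * T.colSum)) = n.factorial := by
  classical
  have e : LinearMap.trace ℂ _ (LinearMap.mulRight ℂ (T.rowSum * T.colSum)) =
      ((LinearMap.trace ℂ (SymAlg n)).comp (LinearMap.mul ℂ (SymAlg n)).flip)
        (T.rowSum * T.colSum) := rfl
  have e' (g : Equiv.Perm (Fin n)) : ((LinearMap.trace ℂ (SymAlg n)).comp
      (LinearMap.mul ℂ (SymAlg n)).flip) (MonoidAlgebra.of ℂ _ g) =
      if g = 1 then (n.factorial : ℂ) else 0 := trace_mulRight_of g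
  rw [e, rowSum, colSum, Finset.sum_mul_sum, map_sum]
  simp only [map_sum, mul_smul_comm, map_smul, ← map_mul, e']
  rw [Finset.sum_eq_single 1, Finset.sum_eq_single 1]
  · simp
  · intro q _ hq
    rw [one_mul, if_neg hq, smul_zero]
  · intro h; simp at h
  · intro p hp hp1
    refine Finset.sum_eq_zero fun q hq => ?_
    rw [if_neg, smul_zero]
    intro hpq
    simp only [Finset.mem_filter, Finset.mem_univ, true_and] at hp hq
    refine hp1 (Equiv.ext fun x => T.ext_of_row_col (hp x) ?_)
    rw [← hq, ← Equiv.Perm.mul_apply, mul_eq_one_comm.1 hpq]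
  · intro h; simp at h

/-- The square is a multiple c of the element by von Neumann's lemma. Dividing right multiplication
by c gives an idempotent, whose trace n!/c is its rank, the dimension of V_λ; this evaluates c. -/
theorem rowSum_mul_colSum_sq : T.rowSum * T.colSum * (T.rowSum * T.colSum) =
      ((n.factorial : ℂ) / T.dimIrrep) • (T.rowSum * T.colSum) ∧
    (n.factorial : ℂ) / T.dimIrrep ≠ 0 := by
  obtain ⟨c, hc'⟩ := T.exists_smul (T.colSum * T.rowSum)
  have hc : T.rowSum * T.colSum * (T.rowSum * T.colSum) = c • (T.rowSum * T.colSum) := by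
    rw [← hc']; simp only [mul_assoc]
  have hn : (n.factorial : ℂ) ≠ 0 := by exact_mod_cast n.factorial_ne_zero
  have hM : LinearMap.mulRight ℂ (T.rowSum * T.colSum) * LinearMap.mulRight ℂ (T.rowSum * T.colSum)
      = c • LinearMap.mulRight ℂ (T.rowSum * T.colSum) := by
    refine LinearMap.ext fun z => ?_
    rw [Module.End.mul_apply, LinearMap.smul_apply, LinearMap.mulRight_apply,
      LinearMap.mulRight_apply, mul_assoc, hc, mul_smul_comm]
  have htr := T.trace_mulRight
  -- For c = 0 right multiplication would be nilpotent, contradicting the trace n!.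
  have hc₀ : c ≠ 0 := by
    rintro rfl
    rw [zero_smul] at hM
    refine hn ?_
    rw [← htr]
    exact (LinearMap.isNilpotent_trace_of_isNilpotent ⟨2, by rw [pow_two, hM]⟩).eq_zero
  have hi : IsIdempotentElem (c⁻¹ • LinearMap.mulRight ℂ (T.rowSum * T.colSum)) := by
    rw [IsIdempotentElem, smul_mul_smul_comm, hM, smul_smul]
    congr 1
    field_simp
  have hd := (LinearMap.IsIdempotentElem.isProj_range _ hi).trace
  rw [map_smul, htr, LinearMap.range_smul _ _ (inv_ne_zero hc₀)] at hd
  have hd' : c⁻¹ * (n.factorial : ℂ) = T.dimIrrep := hd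
  have hk : (n.factorial : ℂ) / T.dimIrrep = c := by
    rw [← hd']
    field_simp
  rw [hk]
  exact ⟨hc, hc₀⟩

theorem isIdempotentElem_youngSymmetrizer : IsIdempotentElem T.youngSymmetrizer := by
  obtain ⟨hc, h₀⟩ := T.rowSum_mul_colSum_sq
  rw [youngSymmetrizer, IsIdempotentElem, smul_mul_smul_comm, hc, smul_smul, mul_assoc,
    inv_mul_cancel₀ h₀, mul_one]

theorem youngSymmetrizer_ne_zero : T.youngSymmetrizer ≠ 0 := by
  intro h
  rcases smul_eq_zero.1 h with h | h
  · exact inv_ne_zero T.rowSum_mul_colSum_sq.2 h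
  · have htr := T.trace_mulRight
    rw [h, LinearMap.mulRight_zero_eq_zero, map_zero] at htr
    exact n.factorial_ne_zero (by exact_mod_cast htr.symm)

end Tableau

end HeisCat

end

/-! ### Split semisimple algebras and completeness of the Young symmetrizers -/

noncomputable section

namespace HeisCat

/-- Idempotents of a split semisimple algebra, one for each simple module. -/
structure SplitFamily {B : Type} [Ring B] [Algebra ℂ B] {I : Type} (e : I → B) : Prop where
  idem : ∀ i, e i * e i = e i
  ne : ∀ i, e i ≠ 0
  corner : ∀ i x, ∃ c : ℂ, e i * x * e i = c • e i
  orth : ∀ i j, i ≠ j → ∀ x, e i * x * e j = 0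
  full : (1 : B) ∈ AddSubmonoid.closure {z | ∃ i a b, z = a * e i * b}

namespace SplitFamily

variable {B B' : Type} [Ring B] [Algebra ℂ B] [Ring B'] [Algebra ℂ B'] {I J : Type} {e : I → B}
  {e' : J → B'}

theorem map_closure (f : B →+* B') {x : B}
    (hx : x ∈ AddSubmonoid.closure {z | ∃ i a b, z = a * e i * b}) :
    f x ∈ AddSubmonoid.closure {z | ∃ i a b, z = a * f (e i) * b} := by
  induction hx using AddSubmonoid.closure_induction with
  | mem x hx =>
    obtain ⟨i, a, b, rfl⟩ := hx
    exact AddSubmonoid.subset_closure ⟨i, f a, f b, by rw [map_mul, map_mul]⟩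
  | zero => rw [map_zero]; exact zero_mem _
  | add x y _ _ hx hy => rw [map_add]; exact add_mem hx hy

theorem map (h : SplitFamily e) (φ : B ≃ₐ[ℂ] B') : SplitFamily fun i => φ (e i) where
  idem i := by rw [← map_mul, h.idem]
  ne i := (map_ne_zero_iff φ φ.injective).2 (h.ne i)
  corner i x := by
    obtain ⟨c, hc⟩ := h.corner i (φ.symm x)
    exact ⟨c, by rw [← map_smul, ← hc, map_mul, map_mul, AlgEquiv.apply_symm_apply]⟩
  orth i j hij x := by
    have := congrArg φ (h.orth i j hij (φ.symm x))
    rwa [map_mul, map_mul, AlgEquiv.apply_symm_apply, map_zero] at this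
  full := by
    have := map_closure (φ : B →+* B') h.full
    rwa [map_one] at this

theorem tensor (h : SplitFamily e) (h' : SplitFamily e') :
    SplitFamily fun i : I × J => e i.1 ⊗ₜ[ℂ] e' i.2 where
  idem i := by rw [Algebra.TensorProduct.tmul_mul_tmul, h.idem, h'.idem]
  ne i := by
    -- The tensor is nonzero because a product of linear functionals, each nonzero on its factor,
    -- takes a nonzero value on it.
    obtain ⟨f, hf⟩ := not_forall.1 (mt (Module.forall_dual_apply_eq_zero_iff ℂ _).1 (h.ne i.1))
    obtain ⟨g, hg⟩ := not_forall.1 (mt (Module.forall_dual_apply_eq_zero_iff ℂ _).1 (h'.ne i.2))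
    intro h₀
    have h₁ := congrArg (LinearMap.mul' ℂ ℂ ∘ₗ TensorProduct.map f g) h₀
    rw [LinearMap.comp_apply, TensorProduct.map_tmul, LinearMap.mul'_apply, map_zero] at h₁
    exact mul_ne_zero hf hg h₁
  corner i x := by
    induction x using TensorProduct.induction_on with
    | zero => exact ⟨0, by simp⟩
    | tmul x y =>
      obtain ⟨c, hc⟩ := h.corner i.1 x
      obtain ⟨d, hd⟩ := h'.corner i.2 y
      refine ⟨c * d, ?_⟩
      rw [Algebra.TensorProduct.tmul_mul_tmul, Algebra.TensorProduct.tmul_mul_tmul, hc, hd,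
        TensorProduct.smul_tmul_smul]
    | add x y hx hy =>
      obtain ⟨c, hc⟩ := hx
      obtain ⟨d, hd⟩ := hy
      exact ⟨c + d, by rw [mul_add, add_mul, hc, hd, add_smul]⟩
  orth i j hij x := by
    induction x using TensorProduct.induction_on with
    | zero => simp
    | tmul x y =>
      rw [Algebra.TensorProduct.tmul_mul_tmul, Algebra.TensorProduct.tmul_mul_tmul]
      by_cases hi : i.1 = j.1
      · rw [h'.orth i.2 j.2 fun hi' => hij (Prod.ext hi hi'), TensorProduct.tmul_zero]
      · rw [h.orth i.1 j.1 hi, TensorProduct.zero_tmul]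
    | add x y hx hy => rw [mul_add, add_mul, hx, hy, add_zero]
  full := by
    have key : ∀ x ∈ AddSubmonoid.closure {z | ∃ i a b, z = a * e i * b},
        ∀ y ∈ AddSubmonoid.closure {z | ∃ i a b, z = a * e' i * b}, x ⊗ₜ[ℂ] y ∈
        AddSubmonoid.closure {z | ∃ (i : I × J) (a b : B ⊗[ℂ] B'),
          z = a * (e i.1 ⊗ₜ[ℂ] e' i.2) * b} := by
      intro x hx y hy
      induction hx using AddSubmonoid.closure_induction with
      | zero => rw [TensorProduct.zero_tmul]; exact zero_mem _
      | add x x' _ _ hx hx' => rw [TensorProduct.add_tmul]; exact add_mem hx hx'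
      | mem x hx =>
        obtain ⟨i, a, b, rfl⟩ := hx
        induction hy using AddSubmonoid.closure_induction with
        | zero => rw [TensorProduct.tmul_zero]; exact zero_mem _
        | add y y' _ _ hy hy' => rw [TensorProduct.tmul_add]; exact add_mem hy hy'
        | mem y hy =>
          obtain ⟨j, a', b', rfl⟩ := hy
          exact AddSubmonoid.subset_closure ⟨(i, j), a ⊗ₜ a', b ⊗ₜ b', by
            rw [Algebra.TensorProduct.tmul_mul_tmul, Algebra.TensorProduct.tmul_mul_tmul]⟩
    exact key 1 h.full 1 h'.full

/-- The split system of a split semisimple algebra. -/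
def splitSystem (h : SplitFamily e) : SplitSystem B I where
  u i := AddMonoidHom.mk' (fun c => c • e i) fun c d => add_smul c d _
  u_mul i c d := by
    change c • e i * d • e i = (c * d) • e i
    rw [smul_mul_smul_comm, h.idem]
  ne i := by
    change (1 : ℂ) • e i ≠ 0
    rw [one_smul]
    exact h.ne i
  corner i x := by
    change ∃ c, (1 : ℂ) • e i * x * (1 : ℂ) • e i = c • e i
    rw [one_smul]
    exact h.corner i x
  weight _ := 0
  tri i j hij _ x := by
    change (1 : ℂ) • e j * x * (1 : ℂ) • e i = 0
    rw [one_smul, one_smul]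
    exact h.orth j i hij.symm x
  full := by
    change (1 : B) ∈ AddSubmonoid.closure {z | ∃ i a b, z = a * ((1 : ℂ) • e i) * b}
    simp only [one_smul]
    exact h.full

end SplitFamily

section Completeness

variable {n : ℕ}

theorem coeff_conj {z : SymAlg n} (hz : ∀ x, x * z = z * x) {g h : Equiv.Perm (Fin n)}
    (hgh : IsConj g h) : z.coeff g = z.coeff h := by
  obtain ⟨c, rfl⟩ := isConj_iff.1 hgh
  have h₁ := congrArg (fun y => y.coeff (c * g)) (hz (MonoidAlgebra.single c 1))
  simp only [MonoidAlgebra.coeff_single_mul_apply, MonoidAlgebra.coeff_mul_single_apply] at h₁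
  simpa using h₁

/-- The number of central idempotents of the group algebra is at most the number of partitions. -/
theorem card_le_card_partition {k : ℕ} (z : Fin k → SymAlg n) (hz : ∀ i x, x * z i = z i * x)
    (hli : LinearIndependent ℂ z) : k ≤ Fintype.card n.Partition := by
  classical
  have hcard : Fintype.card (Fintype.card (Fin n)).Partition = Fintype.card n.Partition := by
    rw [Fintype.card_fin]
  -- One coefficient is read off for each cycle type. Central elements are class functions, so this
  -- map is injective on the span of the `z i`.
  let Φ : SymAlg n →ₗ[ℂ] ((Fintype.card (Fin n)).Partition → ℂ) := LinearMap.pi fun lam =>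
    if h : ∃ σ : Equiv.Perm (Fin n), σ.partition = lam then
      (MonoidAlgebra.basis (Equiv.Perm (Fin n)) ℂ).coord h.choose else 0
  have hΦ : LinearIndependent ℂ (Φ ∘ z) := by
    refine hli.map (Submodule.disjoint_def.2 fun x hx hx' => ?_)
    have hcent (y) : y * x = x * y := by
      clear hx'
      induction hx using Submodule.span_induction with
      | mem x hx => obtain ⟨i, rfl⟩ := hx; exact hz i y
      | zero => rw [mul_zero, zero_mul]
      | add x x' _ _ h h' => rw [mul_add, add_mul, h, h']
      | smul c x _ h => rw [mul_smul_comm, smul_mul_assoc, h]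
    refine (MonoidAlgebra.basis (Equiv.Perm (Fin n)) ℂ).repr.injective (Finsupp.ext fun σ => ?_)
    have h : ∃ τ : Equiv.Perm (Fin n), τ.partition = σ.partition := ⟨σ, rfl⟩
    have h₁ : Φ x σ.partition = x.coeff h.choose := by
      simp only [Φ, LinearMap.pi_apply, dif_pos h]
      rfl
    rw [LinearMap.mem_ker.1 hx'] at h₁
    rw [map_zero]
    refine (coeff_conj hcent (Equiv.Perm.partition_eq_of_isConj.2 h.choose_spec)).symm.trans ?_
    exact h₁.symm
  have := hΦ.fintype_card_le_finrank
  rwa [Fintype.card_fin, Module.finrank_pi, hcard] at this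

/-- Multiplying a nonzero entry into place by matrix units yields every diagonal matrix unit of the
block, and their sum is the unit of the block. -/
theorem mem_closure_of_matrix {k : ℕ} {d : Fin k → ℕ} {B : Type} [Ring B] [Algebra ℂ B]
    (E : B ≃ₐ[ℂ] Π i, Matrix (Fin (d i)) (Fin (d i)) ℂ) (e : B) (i : Fin k) (h : E e i ≠ 0) :
    E.symm (Pi.single i 1) ∈ AddSubmonoid.closure {z | ∃ a b, z = a * e * b} := by
  obtain ⟨r, s, hrs⟩ : ∃ r s, E e i r s ≠ 0 := by
    by_contra! h'
    exact h (Matrix.ext h')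
  have key : (Pi.single i 1 : Π i, Matrix (Fin (d i)) (Fin (d i)) ℂ) =
      ∑ c, Pi.single i (Matrix.single c r (E e i r s)⁻¹) * E e *
        Pi.single i (Matrix.single s c 1) := by
    ext j : 1
    rw [Finset.sum_apply]
    by_cases hj : j = i
    · subst hj
      simp only [Pi.mul_apply, Pi.single_eq_same]
      ext a b
      rw [Matrix.sum_apply]
      simp only [Matrix.single_mul_mul_single, Matrix.single_apply, Matrix.one_apply]
      rw [inv_mul_cancel₀ hrs]
      by_cases hab : a = b
      · subst hab
        simp
      · rw [if_neg hab]
        refine (Finset.sum_eq_zero fun c _ => if_neg ?_).symm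
        rintro ⟨rfl, rfl⟩
        exact hab rfl
    · simp [Pi.single_eq_of_ne hj]
  rw [key, map_sum]
  exact sum_mem fun c _ => AddSubmonoid.subset_closure
    ⟨E.symm (Pi.single i (Matrix.single c r (E e i r s)⁻¹)),
      E.symm (Pi.single i (Matrix.single s c 1)), by
      rw [map_mul, map_mul, AlgEquiv.symm_apply_apply]⟩

/-- Fullness is by counting. Each symmetrizer is nonzero in some matrix block; orthogonality puts
different symmetrizers into different blocks; and there are at most as many blocks as partitions. So
every block meets a symmetrizer, and these generate the units of all blocks. -/
theorem splitFamily_young (T : ∀ lam : n.Partition, Tableau lam) :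
    SplitFamily fun lam => (T lam).youngSymmetrizer := by
  classical
  have hne (lam : n.Partition) := (T lam).youngSymmetrizer_ne_zero
  have horth (lam mu : n.Partition) (h : lam ≠ mu) (x : SymAlg n) :
      (T lam).youngSymmetrizer * x * (T mu).youngSymmetrizer = 0 := by
    have key : (T lam).rowSum * (T lam).colSum * x * ((T mu).rowSum * (T mu).colSum) = 0 := by
      -- Dominance is antisymmetric, so for different shapes it fails in one direction. Depending on
      -- which, the vanishing factor is the inner product of column sum and row sum, or the outer
      -- one.
      by_cases h₁ : ∀ k, (T lam).rowCount k ≤ (T mu).rowCount k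
      · have h₂ : ¬∀ k, (T mu).rowCount k ≤ (T lam).rowCount k := fun h₂ =>
          h ((T lam).eq_of_rowCount (T mu) fun k => le_antisymm (h₁ k) (h₂ k))
        have := ((T mu).mul_eq_zero_of_not_le (T lam) h₂ x).2
        calc _ = (T lam).rowSum * ((T lam).colSum * x * (T mu).rowSum) * (T mu).colSum := by
              simp only [mul_assoc]
          _ = 0 := by rw [this, mul_zero, zero_mul]
      · have := ((T lam).mul_eq_zero_of_not_le (T mu) h₁ ((T lam).colSum * x * (T mu).rowSum)).1
        rw [← this]
        simp only [mul_assoc]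
    rw [Tableau.youngSymmetrizer, Tableau.youngSymmetrizer, smul_mul_assoc, smul_mul_smul_comm, key,
      smul_zero]
  refine ⟨fun lam => (T lam).isIdempotentElem_youngSymmetrizer, hne, fun lam x => ?_, horth, ?_⟩
  · obtain ⟨c, hc⟩ := (T lam).exists_smul ((T lam).colSum * x * (T lam).rowSum)
    have h : (T lam).rowSum * (T lam).colSum * x * ((T lam).rowSum * (T lam).colSum) =
        c • ((T lam).rowSum * (T lam).colSum) := by
      rw [← hc]
      simp only [mul_assoc]
    refine ⟨((n.factorial : ℂ) / ((T lam).dimIrrep : ℂ))⁻¹ * c, ?_⟩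
    rw [Tableau.youngSymmetrizer, smul_mul_assoc, smul_mul_smul_comm, h, smul_smul, smul_smul,
      mul_right_comm]
  · obtain ⟨k, d, hd, ⟨E⟩⟩ :=
      IsSemisimpleRing.exists_algEquiv_pi_matrix_of_isAlgClosed ℂ (SymAlg n)
    have hcard : k ≤ Fintype.card n.Partition := by
      refine card_le_card_partition (fun i => E.symm (Pi.single i 1)) (fun i x => ?_) ?_
      · obtain ⟨y, rfl⟩ := E.symm.surjective x
        rw [← map_mul, ← map_mul]
        congr 1
        ext j : 1
        by_cases hj : j = i
        · subst hj; simp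
        · simp [Pi.single_eq_of_ne hj]
      · rw [Fintype.linearIndependent_iff]
        intro c hc i
        have h₁ := congrArg (fun y => E y i) hc
        simp only [map_sum, map_smul, AlgEquiv.apply_symm_apply, map_zero, Finset.sum_apply,
          Pi.smul_apply, Pi.zero_apply] at h₁
        rw [Finset.sum_eq_single i (fun j _ hj => by rw [Pi.single_eq_of_ne hj.symm, smul_zero])
          (fun h => absurd (Finset.mem_univ i) h), Pi.single_eq_same] at h₁
        have := hd i
        have h₂ := congrFun (congrFun h₁ 0) 0
        simpa using h₂
    have hex (lam : n.Partition) : ∃ i, E (T lam).youngSymmetrizer i ≠ 0 := by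
      by_contra! h
      exact hne lam ((map_eq_zero_iff E E.injective).1 (funext h))
    choose i hi using hex
    have hinj : Function.Injective i := fun lam mu h => by
      by_contra hne'
      have h₁ := hi lam
      have h₂ := hi mu
      rw [← h] at h₂
      obtain ⟨a, b, hab⟩ : ∃ a b, E (T lam).youngSymmetrizer (i lam) a b ≠ 0 := by
        by_contra! h'; exact h₁ (Matrix.ext h')
      obtain ⟨a', b', hab'⟩ : ∃ a b, E (T mu).youngSymmetrizer (i lam) a b ≠ 0 := by
        by_contra! h'; exact h₂ (Matrix.ext h')
      -- If both symmetrizers had nonzero entries in one block, a matrix unit between them would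
      -- give a product with a nonzero entry, against orthogonality.
      have h₃ := congrArg (fun y => E y (i lam) a b')
        (horth lam mu hne' (E.symm (Pi.single (i lam) (Matrix.single b a' 1))))
      simp only [map_mul, AlgEquiv.apply_symm_apply, Pi.mul_apply, Pi.single_eq_same, map_zero,
        Pi.zero_apply, Matrix.zero_apply] at h₃
      rw [Matrix.mul_apply, Finset.sum_eq_single a'] at h₃
      · rw [Matrix.mul_single_apply_same, mul_one] at h₃
        exact (mul_ne_zero hab hab') h₃
      · intro c _ hc
        exact mul_eq_zero_of_left (Matrix.mul_single_apply_of_ne _ _ _ _ _ hc _) _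
      · intro h; exact absurd (Finset.mem_univ _) h
    have hsurj : Function.Surjective i := by
      refine ((Fintype.bijective_iff_injective_and_card i).2 ⟨hinj, ?_⟩).2
      exact le_antisymm (Fintype.card_le_of_injective i hinj) (by rwa [Fintype.card_fin])
    have h1 : (1 : SymAlg n) = ∑ j, E.symm (Pi.single j 1) := by
      have := Finset.univ_sum_single (1 : Π i, Matrix (Fin (d i)) (Fin (d i)) ℂ)
      rw [← map_sum]
      exact (map_one E.symm).symm.trans (congrArg E.symm this.symm)
    rw [h1]
    refine sum_mem fun j _ => ?_
    obtain ⟨lam, rfl⟩ := hsurj j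
    refine AddSubmonoid.closure_mono ?_ (mem_closure_of_matrix E _ _ (hi lam))
    rintro _ ⟨a, b, rfl⟩
    exact ⟨lam, a, b, rfl⟩

end Completeness

end HeisCat

end

/-! ### Endomorphism rings of sums of triangular objects -/

noncomputable section

namespace HeisCat

/-- Transport along a ring isomorphism. -/
def SplitSystem.map {A A' : Type} [Ring A] [Ring A'] {S : Type} (U : SplitSystem A S)
    (φ : A ≃+* A') : SplitSystem A' S where
  u s := (φ : A →+ A').comp (U.u s)
  u_mul s c d := (map_mul φ _ _).symm.trans (congrArg φ (U.u_mul s c d))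
  ne s h := U.ne s (φ.injective (h.trans (map_zero φ).symm))
  corner s a := by
    obtain ⟨c, hc⟩ := U.corner s (φ.symm a)
    refine ⟨c, ?_⟩
    have := congrArg φ hc
    rwa [map_mul, map_mul, φ.apply_symm_apply] at this
  weight := U.weight
  tri s t h h' a := by
    have := congrArg φ (U.tri s t h h' (φ.symm a))
    rwa [map_mul, map_mul, φ.apply_symm_apply, map_zero] at this
  full := by
    have h (x : A) (hx : x ∈ AddSubmonoid.closure {z | ∃ s a b, z = a * U.u s 1 * b}) :
        φ x ∈ AddSubmonoid.closure {z | ∃ s a b, z = a * φ (U.u s 1) * b} := by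
      induction hx using AddSubmonoid.closure_induction with
      | mem x hx =>
        obtain ⟨i, a, b, rfl⟩ := hx
        exact AddSubmonoid.subset_closure ⟨i, φ a, φ b, by rw [map_mul, map_mul]⟩
      | zero => rw [map_zero]; exact zero_mem _
      | add x y _ _ hx hy => rw [map_add]; exact add_mem hx hy
    exact map_one φ ▸ h 1 U.full

/-- Objects with split semisimple endomorphism rings, and morphisms which are triangular with
respect to a weight. -/
structure SplitObjects {C : Type*} [Category.{0} C] [Preadditive C] {X : Type} (b : X → C)
    (I : X → Type) where
  sys : ∀ x, SplitSystem (End (b x)) (I x)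
  orth : ∀ x (i j : I x), i ≠ j → ∀ a, (sys x).u i 1 * a * (sys x).u j 1 = 0
  weight : X → ℤ
  tri : ∀ {x y} (f : b x ⟶ b y), x ≠ y → weight y ≤ weight x → f = 0

namespace SplitObjects

variable {C : Type*} [Category.{0} C] [Preadditive C] {X : Type} {b : X → C} {I : X → Type}
  (B : SplitObjects b I)

/-- Restriction to a subfamily. -/
def restrict {Y : Type} {g : Y → X} (hg : Function.Injective g) :
    SplitObjects (fun y => b (g y)) (fun y => I (g y)) where
  sys y := B.sys (g y)
  orth y := B.orth (g y)
  weight y := B.weight (g y)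
  tri f h h' := B.tri f (hg.ne h) h'

/-- The scalar multiples of the idempotents, as morphisms. -/
def scal {x : X} (i : I x) (c : ℂ) : b x ⟶ b x := (B.sys x).u i c

theorem scal_add {x : X} (i : I x) (c d : ℂ) : B.scal i (c + d) = B.scal i c + B.scal i d :=
  map_add ((B.sys x).u i) c d

theorem scal_comp_scal {x : X} (i : I x) (c d : ℂ) :
    B.scal i c ≫ B.scal i d = B.scal i (c * d) :=
  ((B.sys x).u_mul i d c).trans (by rw [mul_comm]; rfl)

theorem scal_corner {x : X} (i : I x) (f : b x ⟶ b x) :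
    ∃ c, B.scal i 1 ≫ f ≫ B.scal i 1 = B.scal i c := by
  obtain ⟨c, hc⟩ := (B.sys x).corner i f
  refine ⟨c, Eq.trans ?_ hc⟩
  rw [← Category.assoc]
  exact Category.assoc (B.scal i 1) f (B.scal i 1)

theorem scal_orth {x : X} {i j : I x} (h : i ≠ j) (f : b x ⟶ b x) :
    B.scal i 1 ≫ f ≫ B.scal j 1 = 0 :=
  (Category.assoc (B.scal i 1) f (B.scal j 1)).symm.trans
    ((Category.assoc _ _ _).trans (B.orth x j i h.symm f))

theorem scal_ne {x : X} (i : I x) : B.scal i 1 ≠ 0 := (B.sys x).ne i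

theorem scal_injective {x : X} (i : I x) : Function.Injective (B.scal i) :=
  (B.sys x).u_injective i

theorem scal_zero {x : X} (i : I x) : B.scal i 0 = 0 := map_zero ((B.sys x).u i)

theorem id_mem (x : X) : 𝟙 (b x) ∈ AddSubmonoid.closure
    {z : b x ⟶ b x | ∃ (i : I x) (f g : b x ⟶ b x), z = f ≫ B.scal i 1 ≫ g} := by
  refine AddSubmonoid.closure_mono ?_ (B.sys x).full
  rintro _ ⟨i, f, g, rfl⟩
  exact ⟨i, g, f, rfl⟩

/-- An object that is a direct summand of a sum of objects `b x`, all of which occur, and a ring of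
endomorphisms of it which contains sufficiently many elements. -/
structure Cover (b : X → C) (M : C) {A : Type} [Ring A] (φ : A →+* End M) where
  inj : Function.Injective φ
  P : ∀ x, Set (M ⟶ b x)
  Q : ∀ x, Set (b x ⟶ M)
  exists_eq : ∀ x, ∀ p ∈ P x, ∀ (f : b x ⟶ b x), ∀ q ∈ Q x, ∃ a, φ a = p ≫ f ≫ q
  inc : ∀ x, b x ⟶ M
  pr : ∀ x, M ⟶ b x
  inc_mem : ∀ x, inc x ∈ Q x
  pr_mem : ∀ x, pr x ∈ P x
  inc_pr : ∀ x, inc x ≫ pr x = 𝟙 _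
  full : 𝟙 M ∈ AddSubmonoid.closure {z : M ⟶ M | ∃ x, ∃ p ∈ P x, ∃ q ∈ Q x, z = p ≫ q}

variable {M : C} {A : Type} [Ring A] {φ : A →+* End M} (K : Cover b M φ)

namespace Cover

/-- An endomorphism of a summand as an element of the ring. -/
def emb {x : X} (f : b x ⟶ b x) : A :=
  (K.exists_eq x _ (K.pr_mem x) f _ (K.inc_mem x)).choose

theorem map_emb {x : X} (f : b x ⟶ b x) : φ (K.emb f) = K.pr x ≫ f ≫ K.inc x :=
  (K.exists_eq x _ (K.pr_mem x) f _ (K.inc_mem x)).choose_spec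

theorem emb_add {x : X} (f g : b x ⟶ b x) : K.emb (f + g) = K.emb f + K.emb g := by
  refine K.inj ?_
  rw [map_add, map_emb, map_emb, map_emb, Preadditive.add_comp, Preadditive.comp_add]

theorem emb_mul {x : X} (f g : b x ⟶ b x) : K.emb f * K.emb g = K.emb (g ≫ f) := by
  refine K.inj ?_
  rw [map_mul, map_emb, map_emb, map_emb]
  change (K.pr x ≫ g ≫ K.inc x) ≫ K.pr x ≫ f ≫ K.inc x = _
  simp only [Category.assoc, reassoc_of% K.inc_pr x]

theorem emb_mul_mul {x y : X} (f : b x ⟶ b x) (a : A) (g : b y ⟶ b y) :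
    φ (K.emb f * a * K.emb g) =
      K.pr y ≫ g ≫ (K.inc y ≫ φ a ≫ K.pr x) ≫ f ≫ K.inc x := by
  rw [map_mul, map_mul, map_emb, map_emb]
  change (K.pr y ≫ g ≫ K.inc y) ≫ φ a ≫ K.pr x ≫ f ≫ K.inc x = _
  simp only [Category.assoc]

/-- A factorisation of an endomorphism of `b x` through its idempotents is lifted to the ring: `p`
and `q` with any endomorphism between them belong to the ring, and inserting `inc x ≫ pr x`, which
is the identity, splits the composite into three such factors. -/
theorem emb_mem {x : X} {p : M ⟶ b x} (hp : p ∈ K.P x) {q : b x ⟶ M} (hq : q ∈ K.Q x)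
    {f : b x ⟶ b x} (hf : f ∈ AddSubmonoid.closure
      {z : b x ⟶ b x | ∃ (i : I x) (f g : b x ⟶ b x), z = f ≫ B.scal i 1 ≫ g}) :
    ∃ a ∈ AddSubmonoid.closure {z : A | ∃ (s : Σ x, I x) (a a' : A),
      z = a * K.emb (B.scal s.2 1) * a'}, φ a = p ≫ f ≫ q := by
  induction hf using AddSubmonoid.closure_induction with
  | mem f hf =>
    obtain ⟨i, f, g, rfl⟩ := hf
    obtain ⟨a, ha⟩ := K.exists_eq x p hp f _ (K.inc_mem x)
    obtain ⟨a', ha'⟩ := K.exists_eq x _ (K.pr_mem x) g q hq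
    refine ⟨_, AddSubmonoid.subset_closure ⟨⟨x, i⟩, a', a, rfl⟩, ?_⟩
    rw [map_mul, map_mul, map_emb, ha, ha']
    change (p ≫ f ≫ K.inc x) ≫ (K.pr x ≫ B.scal i 1 ≫ K.inc x) ≫ K.pr x ≫ g ≫ q = _
    simp only [Category.assoc, reassoc_of% K.inc_pr x]
  | zero => exact ⟨0, zero_mem _, by rw [map_zero, Limits.zero_comp, Limits.comp_zero]⟩
  | add f g _ _ hf hg =>
    obtain ⟨a, ha, ha'⟩ := hf
    obtain ⟨c, hc, hc'⟩ := hg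
    exact ⟨a + c, add_mem ha hc, by
      rw [map_add, ha', hc', Preadditive.add_comp, Preadditive.comp_add]⟩

theorem one_mem {z : M ⟶ M} (hz : z ∈ AddSubmonoid.closure
      {z : M ⟶ M | ∃ x, ∃ p ∈ K.P x, ∃ q ∈ K.Q x, z = p ≫ q}) :
    ∃ a ∈ AddSubmonoid.closure {z : A | ∃ (s : Σ x, I x) (a a' : A),
      z = a * K.emb (B.scal s.2 1) * a'}, φ a = z := by
  induction hz using AddSubmonoid.closure_induction with
  | mem z hz =>
    obtain ⟨x, p, hp, q, hq, rfl⟩ := hz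
    obtain ⟨a, ha, ha'⟩ := emb_mem B K hp hq (B.id_mem x)
    exact ⟨a, ha, by rw [ha', Category.id_comp]⟩
  | zero => exact ⟨0, zero_mem _, map_zero φ⟩
  | add f g _ _ hf hg =>
    obtain ⟨a, ha, ha'⟩ := hf
    obtain ⟨c, hc, hc'⟩ := hg
    exact ⟨a + c, add_mem ha hc, by rw [map_add, ha', hc']⟩

/-- The split system of a ring of endomorphisms. -/
def splitSystem : SplitSystem A (Σ x, I x) where
  u s := AddMonoidHom.mk' (fun c => K.emb (B.scal s.2 c)) fun c d => by
    rw [B.scal_add, emb_add]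
  u_mul s c d := by
    change K.emb _ * K.emb _ = K.emb _
    rw [emb_mul, scal_comp_scal, mul_comm]
  ne s h := by
    refine B.scal_ne s.2 ?_
    have h' := congrArg φ h
    change φ (K.emb _) = _ at h'
    rw [map_emb, map_zero] at h'
    have h₂ : K.inc s.1 ≫ (K.pr s.1 ≫ B.scal s.2 1 ≫ K.inc s.1) ≫ K.pr s.1 = 0 := by
      rw [h']
      exact (congrArg (_ ≫ ·) Limits.zero_comp).trans Limits.comp_zero
    simpa only [Category.assoc, K.inc_pr, reassoc_of% K.inc_pr, Category.comp_id] using h₂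
  corner s a := by
    obtain ⟨c, hc⟩ := B.scal_corner s.2 (K.inc s.1 ≫ φ a ≫ K.pr s.1)
    refine ⟨c, K.inj ?_⟩
    change φ (K.emb _ * a * K.emb _) = φ (K.emb _)
    rw [emb_mul_mul, map_emb, ← hc]
    simp only [Category.assoc]
  weight s := B.weight s.1
  tri s t h h' a := by
    refine K.inj ?_
    change φ (K.emb _ * a * K.emb _) = _
    rw [emb_mul_mul, map_zero]
    obtain ⟨x, i⟩ := s
    obtain ⟨y, j⟩ := t
    by_cases hxy : x = y
    · subst hxy
      have hij : i ≠ j := fun hij => h (by rw [hij])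
      have h₀ := B.scal_orth hij (K.inc x ≫ φ a ≫ K.pr x)
      change K.pr x ≫ B.scal i 1 ≫ (K.inc x ≫ φ a ≫ K.pr x) ≫ B.scal j 1 ≫ K.inc x = 0
      simp only [Category.assoc]
      rw [reassoc_of% h₀, Limits.zero_comp, Limits.comp_zero]
    · rw [B.tri (K.inc x ≫ φ a ≫ K.pr y) hxy h', Limits.zero_comp, Limits.comp_zero,
        Limits.comp_zero]
  full := by
    obtain ⟨a, ha, ha'⟩ := one_mem B K K.full
    rwa [K.inj (ha'.trans (map_one φ).symm)] at ha

end Cover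

end SplitObjects

end HeisCat

end

/-! ### The objects P^m Q^n⟨l⟩ form a triangular family -/

noncomputable section

namespace HeisCat

/-- The functor from a category to its additive envelope is fully faithful. -/
def embEnd (A : Shifted) : End A ≃+* End ((Mat_.embedding Shifted).obj A) where
  toFun f := (Mat_.embedding Shifted).map f
  invFun g := (show (Mat_.embedding Shifted).obj A ⟶ (Mat_.embedding Shifted).obj A from g) ⟨⟩ ⟨⟩
  left_inv _ := rfl
  right_inv _ := rfl
  map_mul' f g := (Mat_.embedding Shifted).map_comp g f
  map_add' f g := (Mat_.embedding Shifted).map_add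

/-- The weight that makes morphisms between the objects `P^m Q^n ⟨l⟩` triangular. -/
def pqWeight (x : ℕ × ℕ × ℤ) : ℤ := 2 * x.2.2 + x.1

theorem numP_word (m n : ℕ) : numP (EndMor.word m n) = m := by
  have h : numP (List.replicate n Strand.Q) = 0 := by
    induction n with
    | zero => rfl
    | succ n ih => exact ih
  induction m with
  | zero => exact h
  | succ m ih => exact congrArg (· + 1) ih

/-- The degree is the difference of the shifts, and the number of letters P is m; hence twice the
shifted degree is the difference of the weights 2l + m. -/
theorem val_mem_sdegTwo {x y : ℕ × ℕ × ℤ} (f : PQ x.1 x.2.1 x.2.2 ⟶ PQ y.1 y.2.1 y.2.2) :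
    Shifted.val f ∈ Mor.homog sdegTwo _ _ (pqWeight y - pqWeight x) := by
  have h := Mor.homog_sdegTwo (Shifted.val_mem f)
  have e : pqWeight y - pqWeight x = 2 * (y.2.2 - x.2.2) +
      (numP (EndMor.word y.1 y.2.1) - numP (EndMor.word x.1 x.2.1)) := by
    rw [numP_word, numP_word, pqWeight, pqWeight]
    ring
  rw [e]
  exact h

theorem word_injective {m n m' n' : ℕ} (h : EndMor.word m n = EndMor.word m' n') :
    m = m' ∧ n = n' := by
  have h₁ := congrArg (fun w => numP w) h
  have h₂ := congrArg List.length h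
  simp only [numP_word] at h₁
  simp only [List.length_append, List.length_replicate] at h₂
  omega

/-- Negative shifted degree is impossible between standard words. In degree zero the morphism is a
combination of crossings of equal orientation, which preserve the word; then equal weights force
equal shifts, hence equal objects. -/
theorem pq_eq_zero {x y : ℕ × ℕ × ℤ} (f : PQ x.1 x.2.1 x.2.2 ⟶ PQ y.1 y.2.1 y.2.2) (hxy : x ≠ y)
    (h : pqWeight y ≤ pqWeight x) : f = 0 := by
  refine Shifted.hom_ext ?_
  have hf := val_mem_sdegTwo f
  rcases h.lt_or_eq with h' | h'
  · exact Mor.eq_zero_of_homog_neg (Mor.std_replicate _ _) (Mor.std_replicate _ _)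
      (sub_neg.2 h') hf
  · rw [h', sub_self] at hf
    refine (Mor.crossComb_of_homog (Mor.std_replicate _ _) (Mor.std_replicate _ _) hf).eq_zero
      fun hw => hxy ?_
    obtain ⟨h₁, h₂⟩ := word_injective hw
    rw [pqWeight, pqWeight, h₁] at h'
    exact Prod.ext h₁ (Prod.ext h₂ (by omega))

/-- The object `P^m Q^n ⟨l⟩` of `'H'`. -/
abbrev pqObj (x : ℕ × ℕ × ℤ) : HPre := (Mat_.embedding Shifted).obj (PQ x.1 x.2.1 x.2.2)

section

variable (T : ∀ (r : ℕ) (lam : r.Partition), Tableau lam)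

/-- The idempotent `e_λ ⊗ e_μ`. -/
def youngTensor {m n : ℕ} (s : m.Partition × n.Partition) : SymAlg m ⊗[ℂ] SymAlg n :=
  (T m s.1).youngSymmetrizer ⊗ₜ (T n s.2).youngSymmetrizer

theorem splitFamily_youngTensor (m n : ℕ) :
    SplitFamily (youngTensor T : m.Partition × n.Partition → _) :=
  (splitFamily_young (T m)).tensor (splitFamily_young (T n))

/-- The objects `P^m Q^n ⟨l⟩`. -/
def pqObjects : SplitObjects pqObj fun x => x.1.Partition × x.2.1.Partition where
  sys x := ((splitFamily_youngTensor T x.1 x.2.1).map (pqEquiv x.1 x.2.1 x.2.2)).splitSystem.map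
    (embEnd _)
  orth x i j h a := by
    obtain ⟨a, rfl⟩ := (embEnd _).surjective a
    refine ((map_mul (embEnd _) _ _).trans (congrArg (· * _) (map_mul (embEnd _) _ _))).symm.trans ?_
    refine Eq.trans (congrArg (embEnd _) ?_) (map_zero (embEnd _))
    change (1 : ℂ) • _ * a * (1 : ℂ) • _ = 0
    rw [one_smul, one_smul]
    exact ((splitFamily_youngTensor T x.1 x.2.1).map (pqEquiv x.1 x.2.1 x.2.2)).orth i j h a
  weight := pqWeight
  tri f h h' := by
    refine Mat_.hom_ext _ _ fun i j => ?_
    exact pq_eq_zero (f i j) h h'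

theorem pqObjects_scal (x : ℕ × ℕ × ℤ) (s : x.1.Partition × x.2.1.Partition) :
    (pqObjects T).scal s 1 =
      (Mat_.embedding Shifted).map (pqHom x.1 x.2.1 x.2.2 (youngTensor T s)) :=
  congrArg (embEnd _) (one_smul ℂ _)

end

end HeisCat

end

/-! ### The Grothendieck groups of R and R⁰ -/

noncomputable section

namespace HeisCat

section

variable {C : Type} [Category.{0} C] [Preadditive C] (M : Mat_ C)

/-- The inclusion of a summand. -/
def matInc (i : M.ι) : (Mat_.embedding C).obj (M.X i) ⟶ M := fun _ j => (𝟙 M : M ⟶ M) i j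

/-- The projection to a summand. -/
def matPr (i : M.ι) : M ⟶ (Mat_.embedding C).obj (M.X i) := fun j _ => (𝟙 M : M ⟶ M) j i

theorem comp_apply_of_embedding {M N : Mat_ C} {X : C} (f : M ⟶ (Mat_.embedding C).obj X)
    (g : (Mat_.embedding C).obj X ⟶ N) (i : M.ι) (j : N.ι) :
    (f ≫ g) i j = (f i ⟨⟩ : M.X i ⟶ X) ≫ (g ⟨⟩ j : X ⟶ N.X j) :=
  (Mat_.comp_apply f g i j).trans
    (Fintype.sum_unique (ι := PUnit) fun a => (f i a : M.X i ⟶ X) ≫ (g a j : X ⟶ N.X j))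

theorem hom_sum_apply {M N : Mat_ C} {κ : Type} (s : Finset κ) (f : κ → (M ⟶ N)) (i : M.ι)
    (j : N.ι) : (∑ a ∈ s, f a) i j = ∑ a ∈ s, f a i j :=
  map_sum (AddMonoidHom.mk' (fun f : M ⟶ N => f i j) fun _ _ => rfl) f s

theorem matInc_matPr (i : M.ι) : matInc M i ≫ matPr M i = 𝟙 _ := by
  refine Mat_.hom_ext _ _ fun _ _ => ?_
  refine (congrFun (congrFun (Category.comp_id (𝟙 M)) i) i).trans ?_
  exact (Mat_.id_apply_self M i).trans (Mat_.id_apply_self ((Mat_.embedding C).obj (M.X i)) ⟨⟩).symm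

theorem sum_matPr_matInc : ∑ i, matPr M i ≫ matInc M i = 𝟙 M := by
  refine Mat_.hom_ext _ _ fun j k => ?_
  refine Eq.trans ?_ (congrFun (congrFun (Category.comp_id (𝟙 M)) j) k)
  refine (hom_sum_apply _ _ _ _).trans (Eq.trans ?_ (Mat_.comp_apply (𝟙 M) (𝟙 M) j k).symm)
  exact Finset.sum_congr rfl fun i _ => comp_apply_of_embedding (matPr M i) (matInc M i) j k

end

section

variable {k : ℕ} (m n : Fin k → ℕ) (l : Fin k → ℤ)

/-- The triple with a given index. -/
def tripleAt (i : Fin k) : triples m n l :=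
  ⟨(m i, n i, l i), Finset.mem_image_of_mem _ (Finset.mem_univ i)⟩

/-- The morphisms to `P^m Q^n ⟨l⟩` of shifted degree zero. -/
def homogTo (x : triples m n l) : Set (sumPQ m n l ⟶ pqObj x.1) :=
  {p | ∀ j, Shifted.val (p j ⟨⟩) ∈ Mor.homog sdegTwo _ _ 0}

/-- The morphisms from `P^m Q^n ⟨l⟩` of shifted degree zero. -/
def homogFrom (x : triples m n l) : Set (pqObj x.1 ⟶ sumPQ m n l) :=
  {q | ∀ j, Shifted.val (q ⟨⟩ j) ∈ Mor.homog sdegTwo _ _ 0}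

theorem matPr_mem (i : Fin k) : matPr (sumPQ m n l) i ∈ homogTo m n l (tripleAt m n l i) :=
  fun j => (subringR0 m n l).one_mem j i

theorem matInc_mem (i : Fin k) : matInc (sumPQ m n l) i ∈ homogFrom m n l (tripleAt m n l i) :=
  fun j => (subringR0 m n l).one_mem i j

/-- Endomorphisms of a single P^m Q^n⟨l⟩ automatically have shifted degree zero, so the composite
does too if the two outer morphisms do. -/
theorem comp_mem_subringR0 {x : triples m n l} {p : sumPQ m n l ⟶ pqObj x.1}
    (hp : p ∈ homogTo m n l x) (f : pqObj x.1 ⟶ pqObj x.1) {q : pqObj x.1 ⟶ sumPQ m n l}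
    (hq : q ∈ homogFrom m n l x) : p ≫ f ≫ q ∈ subringR0 m n l := by
  intro i j
  have e : entry (p ≫ f ≫ q) i j = p i ⟨⟩ ≫ f ⟨⟩ ⟨⟩ ≫ q ⟨⟩ j :=
    (comp_apply_of_embedding p (f ≫ q) i j).trans
      (congrArg (p i ⟨⟩ ≫ ·) (comp_apply_of_embedding f q ⟨⟩ j))
  rw [e]
  have hf := val_mem_sdegTwo (x := x.1) (y := x.1) (f ⟨⟩ ⟨⟩)
  rw [sub_self] at hf
  exact Mor.homog_comp (hp i) (Mor.homog_comp hf (hq j))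

/-- Equal triples may occur several times in the sum; one index is chosen for each triple. -/
theorem exists_summand (x : triples m n l) : ∃ q ∈ homogFrom m n l x, ∃ p ∈ homogTo m n l x,
    q ≫ p = 𝟙 _ := by
  obtain ⟨x, hx⟩ := x
  obtain ⟨i, -, rfl⟩ := Finset.mem_image.1 hx
  exact ⟨_, matInc_mem m n l i, _, matPr_mem m n l i, matInc_matPr (sumPQ m n l) i⟩

/-- `⊕ P^{m_i} Q^{n_i} ⟨l_i⟩` is a sum of copies of the `P^m Q^n ⟨l⟩`. -/
def sumCover {A : Type} [Ring A] (φ : A →+* End (sumPQ m n l)) (hφ : Function.Injective φ)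
    (hr : ∀ f ∈ subringR0 m n l, f ∈ φ.range) :
    SplitObjects.Cover (fun x : triples m n l => pqObj x.1) (sumPQ m n l) φ where
  inj := hφ
  P := homogTo m n l
  Q := homogFrom m n l
  exists_eq x p hp f q hq := hr _ (comp_mem_subringR0 m n l hp f hq)
  inc x := (exists_summand m n l x).choose
  pr x := (exists_summand m n l x).choose_spec.2.choose
  inc_mem x := (exists_summand m n l x).choose_spec.1
  pr_mem x := (exists_summand m n l x).choose_spec.2.choose_spec.1
  inc_pr x := (exists_summand m n l x).choose_spec.2.choose_spec.2
  full := by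
    rw [← sum_matPr_matInc]
    exact sum_mem fun i _ => AddSubmonoid.subset_closure
      ⟨tripleAt m n l i, _, matPr_mem m n l i, _, matInc_mem m n l i, rfl⟩

/-- The pairs of partitions that label the simple modules. -/
abbrev PartPair (x : ℕ × ℕ × ℤ) := x.1.Partition × x.2.1.Partition

/-- The objects `P^m Q^n ⟨l⟩` that occur in `⊕ P^{m_i} Q^{n_i} ⟨l_i⟩`. -/
def sumObjects (T : ∀ (r : ℕ) (lam : r.Partition), Tableau lam) :
    SplitObjects (fun x : triples m n l => pqObj x.1) fun x => PartPair x.1 :=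
  (pqObjects T).restrict Subtype.val_injective

/-- The cover uses only inclusions and projections of shifted degree zero, and these lie in R⁰
already. So R and R⁰ receive split systems with the same index set; the entries of positive degree
in R play no role in the count. -/
theorem K0_end_sumPQ :
    Nonempty (K0 (End (sumPQ m n l)) ≃+ ((Σ x : triples m n l, PartPair x.1) →₀ ℤ)) :=
  ⟨(SplitObjects.Cover.splitSystem (sumObjects m n l fun _ _ => default)
    (sumCover m n l (RingHom.id _) Function.injective_id fun f _ => ⟨f, rfl⟩)).K0Equiv⟩

theorem K0_subringR0 :
    Nonempty (K0 (subringR0 m n l) ≃+ ((Σ x : triples m n l, PartPair x.1) →₀ ℤ)) :=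
  ⟨(SplitObjects.Cover.splitSystem (sumObjects m n l fun _ _ => default)
    (sumCover m n l (subringR0 m n l).subtype Subtype.val_injective
      fun f hf => ⟨⟨f, hf⟩, rfl⟩)).K0Equiv⟩

end

theorem K0_symAlg (m n : ℕ) :
    Nonempty (K0 (SymAlg m ⊗[ℂ] SymAlg n) ≃+ ((m.Partition × n.Partition) →₀ ℤ)) :=
  ⟨(splitFamily_youngTensor (fun _ _ => default) m n).splitSystem.K0Equiv⟩

theorem K0_end_pq (m n : ℕ) (l : ℤ) :
    Nonempty (K0 (End (PQ m n l)) ≃+ ((m.Partition × n.Partition) →₀ ℤ)) :=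
  ⟨((splitFamily_youngTensor (fun _ _ => default) m n).map (pqEquiv m n l)).splitSystem.K0Equiv⟩

theorem directSum_congr {ι : Type*} {A B : ι → Type*} [∀ i, AddCommGroup (A i)]
    [∀ i, AddCommGroup (B i)] (h : ∀ i, Nonempty (A i ≃+ B i)) :
    Nonempty ((⨁ i, A i) ≃+ ⨁ i, B i) :=
  ⟨DFinsupp.mapRange.addEquiv fun i => (h i).some⟩

theorem finsupp_sigma {ι : Type} (I : ι → Type) :
    Nonempty (((Σ i, I i) →₀ ℤ) ≃+ ⨁ i, (I i →₀ ℤ)) := by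
  classical
  exact ⟨sigmaFinsuppAddEquivDFinsupp⟩

/-- All the groups are free abelian on the pairs of partitions (λ, μ), grouped by the triples that
occur. -/
theorem K0_isos {k : ℕ} (m n : Fin k → ℕ) (l : Fin k → ℤ) :
    Nonempty (K0 (End (sumPQ m n l)) ≃+ K0 (subringR0 m n l)) ∧
    Nonempty (K0 (subringR0 m n l) ≃+ ⨁ x : triples m n l, K0 (End (PQ x.1.1 x.1.2.1 0))) ∧
    Nonempty ((⨁ x : triples m n l, K0 (End (PQ x.1.1 x.1.2.1 0))) ≃+
      ⨁ x : triples m n l, K0 (SymAlg x.1.1 ⊗[ℂ] SymAlg x.1.2.1)) := by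
  obtain ⟨e₁⟩ := K0_end_sumPQ m n l
  obtain ⟨e₂⟩ := K0_subringR0 m n l
  obtain ⟨e₃⟩ := finsupp_sigma fun x : triples m n l => PartPair x.1
  obtain ⟨e₄⟩ := directSum_congr fun x : triples m n l => K0_end_pq x.1.1 x.1.2.1 0
  obtain ⟨e₅⟩ := directSum_congr fun x : triples m n l => K0_symAlg x.1.1 x.1.2.1
  exact ⟨⟨e₁.trans e₂.symm⟩, ⟨e₂.trans (e₃.trans e₄.symm)⟩, ⟨e₄.trans e₅.symm⟩⟩

end HeisCat

end

/-! ### Idempotents and classes in the Karoubi envelope -/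

noncomputable section

namespace HeisCat

namespace SplitObjects

variable {C : Type*} [Category.{0} C] [Preadditive C] {X : Type} {b : X → C} {I : X → Type}
  (B : SplitObjects b I)

/-- The direct summands of the objects. -/
def obj (s : Σ x, I x) : Karoubi C where
  X := b s.1
  p := B.scal s.2 1
  idem := by rw [scal_comp_scal, mul_one]

variable {s t r : Σ x, I x}

theorem exists_scal (f : B.obj s ⟶ B.obj s) : ∃ c, B.scal s.2 c = f.f := by
  obtain ⟨c, hc⟩ := B.scal_corner s.2 f.f
  exact ⟨c, hc.symm.trans f.comm⟩

theorem obj_tri (f : B.obj s ⟶ B.obj t) (h : s ≠ t) (hw : B.weight t.1 ≤ B.weight s.1) :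
    f = 0 := by
  refine Karoubi.hom_ext _ _ ?_
  obtain ⟨x, i⟩ := s
  obtain ⟨y, j⟩ := t
  by_cases hxy : x = y
  · subst hxy
    have hij : i ≠ j := fun hij => h (by rw [hij])
    exact f.comm.symm.trans (B.scal_orth hij f.f)
  · exact B.tri f.f hxy hw

/-- The scalar of an endomorphism of a summand. -/
def objCoef (f : B.obj s ⟶ B.obj t) : ℂ :=
  open Classical in
  if h : s = t then (B.exists_scal (f ≫ eqToHom (congrArg B.obj h.symm))).choose else 0

theorem objCoef_ne (f : B.obj s ⟶ B.obj t) (h : s ≠ t) : B.objCoef f = 0 := dif_neg h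

theorem scal_objCoef (f : B.obj s ⟶ B.obj s) : B.scal s.2 (B.objCoef f) = f.f := by
  rw [objCoef, dif_pos rfl]
  refine (B.exists_scal (f ≫ eqToHom _)).choose_spec.trans ?_
  rw [eqToHom_refl, Category.comp_id]

/-- The direct summands have only scalar endomorphisms. -/
def splitData : SplitData B.obj where
  coef {s t} := AddMonoidHom.mk' B.objCoef fun f g => by
    by_cases h : s = t
    · subst h
      refine B.scal_injective s.2 ?_
      rw [scal_add, scal_objCoef, scal_objCoef, scal_objCoef]
      rfl
    · rw [B.objCoef_ne _ h, B.objCoef_ne _ h, B.objCoef_ne _ h, add_zero]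
  coef_id s := B.scal_injective s.2 (B.scal_objCoef _)
  coef_comp {s t r} f g := by
    change B.objCoef _ = B.objCoef _ * B.objCoef _
    by_cases hst : s = t
    · subst hst
      by_cases hsr : s = r
      · subst hsr
        refine B.scal_injective s.2 ?_
        rw [← scal_comp_scal, scal_objCoef, scal_objCoef, scal_objCoef]
        rfl
      · rw [B.objCoef_ne _ hsr, B.objCoef_ne _ hsr, mul_zero]
    · rw [B.objCoef_ne f hst, zero_mul]
      by_cases hsr : s = r
      · subst hsr
        refine B.scal_injective s.2 ?_
        rw [scal_objCoef, scal_zero]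
        rcases le_total (B.weight t.1) (B.weight s.1) with h' | h'
        · rw [B.obj_tri f hst h', Limits.zero_comp]
          rfl
        · rw [B.obj_tri g (Ne.symm hst) h', Limits.comp_zero]
          rfl
      · exact B.objCoef_ne _ hsr
  coef_inj {s} f h := by
    refine Karoubi.hom_ext _ _ ((B.scal_objCoef f).symm.trans ?_)
    rw [show B.objCoef f = 0 from h, scal_zero]
    rfl
  coef_surj s c := by
    have hc : B.scal s.2 1 ≫ B.scal s.2 c ≫ B.scal s.2 1 = B.scal s.2 c := by
      rw [scal_comp_scal, scal_comp_scal, one_mul, mul_one]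
    exact ⟨⟨B.scal s.2 c, hc⟩, B.scal_injective s.2 (B.scal_objCoef _)⟩
  weight s := B.weight s.1
  tri f h h' := B.obj_tri f h h'

/-- In the Karoubi envelope a composite f e g with e one of the idempotents factors through the
image of e. -/
theorem factors_end {x : X} {f : b x ⟶ b x} (hf : f ∈ AddSubmonoid.closure
    {z : b x ⟶ b x | ∃ (i : I x) (f g : b x ⟶ b x), z = f ≫ B.scal i 1 ≫ g}) :
    Nonempty (Factors B.obj ((toKaroubi C).map f)) := by
  induction hf using AddSubmonoid.closure_induction with
  | mem f hf =>
    obtain ⟨i, f, g, rfl⟩ := hf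
    have hi := (B.obj ⟨x, i⟩).idem
    change B.scal i 1 ≫ B.scal i 1 = B.scal i 1 at hi
    let p : (toKaroubi C).obj (b x) ⟶ B.obj ⟨x, i⟩ := ⟨f ≫ B.scal i 1, by
      change 𝟙 _ ≫ (f ≫ B.scal i 1) ≫ B.scal i 1 = _
      rw [Category.id_comp, Category.assoc, hi]
      rfl⟩
    let q : B.obj ⟨x, i⟩ ⟶ (toKaroubi C).obj (b x) := ⟨B.scal i 1 ≫ g, by
      change B.scal i 1 ≫ (B.scal i 1 ≫ g) ≫ 𝟙 _ = _
      rw [Category.comp_id, reassoc_of% hi]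
      rfl⟩
    have hpq : (toKaroubi C).map (f ≫ B.scal i 1 ≫ g) = p ≫ q := by
      refine Karoubi.hom_ext _ _ ?_
      change f ≫ B.scal i 1 ≫ g = (f ≫ B.scal i 1) ≫ B.scal i 1 ≫ g
      rw [Category.assoc, reassoc_of% hi]
    rw [hpq]
    exact Factors.nonempty_gen p q
  | zero => rw [Functor.map_zero]; exact Factors.nonempty_zero
  | add x y _ _ hx hy => rw [Functor.map_add]; exact Factors.nonempty_add hx hy

theorem factors {M N : C} {z : M ⟶ N} (hz : z ∈ AddSubmonoid.closure
    {z : M ⟶ N | ∃ x, ∃ (p : M ⟶ b x) (q : b x ⟶ N), z = p ≫ q}) :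
    Nonempty (Factors B.obj ((toKaroubi C).map z)) := by
  induction hz using AddSubmonoid.closure_induction with
  | mem z hz =>
    obtain ⟨x, p, q, rfl⟩ := hz
    have := Factors.nonempty_comp ((toKaroubi C).map p) ((toKaroubi C).map q)
      (B.factors_end (B.id_mem x))
    rwa [← Functor.map_comp, ← Functor.map_comp, Category.id_comp] at this
  | zero => rw [Functor.map_zero]; exact Factors.nonempty_zero
  | add x y _ _ hx hy => rw [Functor.map_add]; exact Factors.nonempty_add hx hy

end SplitObjects

section

variable {C : Type*} [Category C] [Preadditive C] [HasBinaryBiproducts C] [HasZeroObject C]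

theorem cls_eq_add {X Y Z : C} (i : Y ⟶ X) (p : X ⟶ Y) (j : Z ⟶ X) (q : X ⟶ Z) (hi : i ≫ p = 𝟙 Y)
    (hj : j ≫ q = 𝟙 Z) (hij : i ≫ q = 0) (hji : j ≫ p = 0) (h : p ≫ i + q ≫ j = 𝟙 X) :
    cls X = cls Y + cls Z := by
  rw [← cls_biprod]
  exact cls_iso
    { hom := biprod.lift p q
      inv := biprod.desc i j
      hom_inv_id := by rw [biprod.lift_desc, h]
      inv_hom_id := by
        refine biprod.hom_ext' _ _ ?_ ?_ <;> refine biprod.hom_ext _ _ ?_ ?_ <;>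
          simp [hi, hj, hij, hji] }

end

section

variable {C : Type*} [Category C] [Preadditive C] [HasBinaryBiproducts (Karoubi C)]
  [HasZeroObject (Karoubi C)] {S : Type*} {G : S → Karoubi C}

/-- The image of an idempotent. -/
def karoubiImage {M : C} (e : (toKaroubi C).obj M ⟶ (toKaroubi C).obj M) (he : e ≫ e = e) :
    Karoubi C where
  X := M
  p := e.f
  idem := congrArg Karoubi.Hom.f he

/-- The class of the image of an idempotent is additive on orthogonal idempotents, and an idempotent
that splits through `G s` has image isomorphic to `G s`. -/
theorem cls_karoubiImage {M : C} {e : (toKaroubi C).obj M ⟶ (toKaroubi C).obj M} {L : Multiset S}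
    (h : Splits G e L) : cls (karoubiImage e h.idem) = (L.map fun s => cls (G s)).sum := by
  refine h.apply_eq_sum (fun e he => cls (karoubiImage e he)) _ ?_ ?_ ?_
  · exact cls_isZero ((IsZero.iff_id_eq_zero _).2 (Karoubi.hom_ext _ _ rfl))
  · intro e f he hf hef h₁ h₂
    have ke : e.f ≫ e.f = e.f := congrArg Karoubi.Hom.f he
    have kf : f.f ≫ f.f = f.f := congrArg Karoubi.Hom.f hf
    have k₁ : e.f ≫ f.f = 0 := congrArg Karoubi.Hom.f h₁
    have k₂ : f.f ≫ e.f = 0 := congrArg Karoubi.Hom.f h₂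
    refine cls_eq_add (X := karoubiImage (e + f) hef) (Y := karoubiImage e he)
      (Z := karoubiImage f hf) ⟨e.f, ?_⟩ ⟨e.f, ?_⟩ ⟨f.f, ?_⟩ ⟨f.f, ?_⟩ ?_ ?_ ?_ ?_ ?_
    · change e.f ≫ e.f ≫ (e.f + f.f) = _
      rw [Preadditive.comp_add, k₁, add_zero, ke, ke]
    · change (e.f + f.f) ≫ e.f ≫ e.f = _
      rw [ke, Preadditive.add_comp, k₂, add_zero, ke]
    · change f.f ≫ f.f ≫ (e.f + f.f) = _
      rw [Preadditive.comp_add, k₂, zero_add, kf, kf]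
    · change (e.f + f.f) ≫ f.f ≫ f.f = _
      rw [kf, Preadditive.add_comp, k₁, zero_add, kf]
    · exact Karoubi.hom_ext _ _ ke
    · exact Karoubi.hom_ext _ _ kf
    · exact Karoubi.hom_ext _ _ k₁
    · exact Karoubi.hom_ext _ _ k₂
    · exact Karoubi.hom_ext _ _ (congrArg₂ (· + ·) ke kf)
  · intro s y g hyg hi
    have k : y.f ≫ g.f = (G s).p := congrArg Karoubi.Hom.f hyg
    refine cls_iso (X := karoubiImage (g ≫ y) hi) (Y := G s)
      { hom := ⟨g.f, ?_⟩
        inv := ⟨y.f, ?_⟩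
        hom_inv_id := Karoubi.hom_ext _ _ rfl
        inv_hom_id := Karoubi.hom_ext _ _ k }
    · change (g.f ≫ y.f) ≫ g.f ≫ (G s).p = g.f
      rw [Karoubi.comp_p, Category.assoc, k, Karoubi.comp_p]
    · change (G s).p ≫ y.f ≫ g.f ≫ y.f = y.f
      rw [reassoc_of% k, Karoubi.p_comp, Karoubi.p_comp]

/-- An object of the envelope is the image of its idempotent acting on the underlying object, where
the splitting theorem for triangular families applies. -/
theorem exists_cls_eq_sum (A : SplitData G) (N : Karoubi C)
    (hN : Nonempty (Factors G (𝟙 ((toKaroubi C).obj N.X)))) :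
    ∃ L : Multiset S, cls N = (L.map fun s => cls (G s)).sum := by
  obtain ⟨F⟩ := hN
  let e : (toKaroubi C).obj N.X ⟶ (toKaroubi C).obj N.X := (toKaroubi C).map N.p
  have he : e ≫ e = e := by rw [← Functor.map_comp, N.idem]
  obtain ⟨L, hL⟩ := A.exists_splits F he
  exact ⟨L, cls_karoubiImage hL⟩

end

end HeisCat

end

/-! ### Every word factors through sums of P^m Q^n⟨l⟩ -/

noncomputable section

namespace HeisCat

open Strand Mor

theorem eq_word_of_std : ∀ {w : Word}, Std w → ∃ m n, w = EndMor.word m n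
  | [], _ => ⟨0, 0, rfl⟩
  | a :: w, h => by
    obtain ⟨m, n, rfl⟩ := eq_word_of_std (w := w) fun u v e => h (a :: u) v (congrArg (a :: ·) e)
    cases a with
    | P => exact ⟨m + 1, n, rfl⟩
    | Q =>
      cases m with
      | zero => exact ⟨0, n + 1, rfl⟩
      | succ m => exact absurd rfl (h [] _)

/-- The morphisms that factor through sums of objects `P^m Q^n ⟨l⟩`. -/
def pqIdeal (A B : Shifted) : AddSubmonoid (A ⟶ B) :=
  AddSubmonoid.closure {z | ∃ (x : ℕ × ℕ × ℤ) (p : A ⟶ PQ x.1 x.2.1 x.2.2)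
    (q : PQ x.1 x.2.1 x.2.2 ⟶ B), z = p ≫ q}

theorem comp_mem_pqIdeal {A B C D : Shifted} (f : A ⟶ B) {z : B ⟶ C} (hz : z ∈ pqIdeal B C)
    (g : C ⟶ D) : f ≫ z ≫ g ∈ pqIdeal A D := by
  induction hz using AddSubmonoid.closure_induction with
  | mem z hz =>
    obtain ⟨x, p, q, rfl⟩ := hz
    exact AddSubmonoid.subset_closure ⟨x, f ≫ p, q ≫ g, by simp only [Category.assoc]⟩
  | zero => rw [Limits.zero_comp, Limits.comp_zero]; exact zero_mem _
  | add x y _ _ hx hy => rw [Preadditive.add_comp, Preadditive.comp_add]; exact add_mem hx hy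

/-- An elementary diagram as a morphism of shifted words. -/
def layHom {w w' : Word} (l l' : ℤ) (u : Word) {a b : Word} (g : Gen a b) (v : Word)
    (h : w = u ++ a ++ v) (h' : w' = u ++ b ++ v) (hl : l' - l = deg a b g) :
    (⟨w, l⟩ : Shifted) ⟶ ⟨w', l'⟩ :=
  ⟨lay u g v h h', hl ▸ lay_homog deg g h h'⟩

/-- The decomposition of the identity of QP, read with its degrees, shows that u QP v factors
through u PQ v and two shifts of u v, all with fewer inversions; induction ends at standard words.
-/
theorem id_mem_pqIdeal : ∀ (N : ℕ) (w : Word) (l : ℤ), HeisCat.inv w < N →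
    𝟙 (⟨w, l⟩ : Shifted) ∈ pqIdeal ⟨w, l⟩ ⟨w, l⟩
  | 0, _, _, h => absurd h (Nat.not_lt_zero _)
  | N + 1, w, l, hN => by
    by_cases hw : Std w
    · obtain ⟨m, n, rfl⟩ := eq_word_of_std hw
      exact AddSubmonoid.subset_closure ⟨(m, n, l), 𝟙 _, 𝟙 _, (Category.comp_id _).symm⟩
    · obtain ⟨u, v, rfl⟩ : ∃ u v, w = u ++ Q :: P :: v := by
        simpa only [Std, not_forall, not_not] using hw
      have h₁ := id_mem_pqIdeal N (u ++ P :: Q :: v) l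
        ((inv_swap u v).trans_le (Nat.lt_succ_iff.1 hN))
      have h₂ (l) := id_mem_pqIdeal N (u ++ v) l
        ((inv_insert_QP u v).trans_le (Nat.lt_succ_iff.1 hN))
      have k₁ := comp_mem_pqIdeal
        (layHom l l u (.cross Q P) v (w := u ++ Q :: P :: v) (by simp) (by simp) (sub_self l)) h₁
        (layHom l l u (.cross P Q) v (w' := u ++ Q :: P :: v) (by simp) (by simp) (sub_self l))
      -- The cap has degree 0, so the middle object is `u ++ v` with the same shift `l`; the cup of
      -- degree -1 and the dot of degree 1 return to it.
      have k₂ := comp_mem_pqIdeal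
        (layHom l l u (.cap Q) v (w := u ++ Q :: P :: v) (by simp [Strand.dual]) (by simp)
          (sub_self l)) (h₂ l)
        (layHom l (l - 1) u (.cup Q) v (w' := u ++ Q :: P :: v) (by simp) (by simp [Strand.dual])
            (by rw [sub_sub_cancel_left]; rfl) ≫
          layHom (l - 1) l (u ++ [Q]) (.dot P) v (w' := u ++ Q :: P :: v) (by simp) (by simp)
            (by rw [sub_sub_cancel]; rfl))
      -- Here the dot comes before the cap and raises the shift, so the middle object is `u ++ v`
      -- with shift `l + 1`, and the cup of degree -1 lowers it again.
      have k₃ := comp_mem_pqIdeal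
        (layHom l (l + 1) (u ++ [Q]) (.dot P) v (w := u ++ Q :: P :: v) (w' := u ++ Q :: P :: v)
            (by simp) (by simp) (by rw [add_sub_cancel_left]; rfl) ≫
          layHom (l + 1) (l + 1) u (.cap Q) v (by simp [Strand.dual]) (by simp) (sub_self (l + 1)))
        (h₂ (l + 1))
        (layHom (l + 1) l u (.cup Q) v (w' := u ++ Q :: P :: v) (by simp) (by simp [Strand.dual])
          (by rw [sub_add_cancel_left]; rfl))
      convert add_mem k₁ (add_mem k₂ k₃) using 1
      refine Shifted.hom_ext ?_
      simp only [Category.id_comp, Category.assoc]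
      have e := id_eq_QP (u := u) (v := v) (w := u ++ Q :: P :: v) (w₁ := u ++ P :: Q :: v)
        (w₂ := u ++ v) rfl rfl rfl (mk (.id _))
      simp only [comp_id] at e
      exact e

theorem map_mem_of_pqIdeal {A B : Shifted} {z : A ⟶ B} (hz : z ∈ pqIdeal A B) {M N : HPre}
    (f : M ⟶ (Mat_.embedding Shifted).obj A) (g : (Mat_.embedding Shifted).obj B ⟶ N) :
    f ≫ (Mat_.embedding Shifted).map z ≫ g ∈ AddSubmonoid.closure
      {z : M ⟶ N | ∃ x, ∃ (p : M ⟶ pqObj x) (q : pqObj x ⟶ N), z = p ≫ q} := by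
  induction hz using AddSubmonoid.closure_induction with
  | mem z hz =>
    obtain ⟨x, p, q, rfl⟩ := hz
    exact AddSubmonoid.subset_closure ⟨x, f ≫ (Mat_.embedding Shifted).map p,
      (Mat_.embedding Shifted).map q ≫ g, by
        rw [Functor.map_comp, Category.assoc, Category.assoc]⟩
  | zero => rw [Functor.map_zero, Limits.zero_comp, Limits.comp_zero]; exact zero_mem _
  | add x y _ _ hx hy =>
    rw [Functor.map_add, Preadditive.add_comp, Preadditive.comp_add]
    exact add_mem hx hy

theorem id_mem_closure (M : HPre) : 𝟙 M ∈ AddSubmonoid.closure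
    {z : M ⟶ M | ∃ x, ∃ (p : M ⟶ pqObj x) (q : pqObj x ⟶ M), z = p ≫ q} := by
  rw [← sum_matPr_matInc]
  refine sum_mem fun i _ => ?_
  have := map_mem_of_pqIdeal (id_mem_pqIdeal _ (M.X i).word (M.X i).shift (Nat.lt_succ_self _))
    (matPr M i) (matInc M i)
  rwa [CategoryTheory.Functor.map_id, Category.id_comp] at this

theorem factors_id_HPre (T : ∀ (r : ℕ) (lam : r.Partition), Tableau lam) (M : HPre) :
    Nonempty (Factors (pqObjects T).obj (𝟙 ((toKaroubi HPre).obj M))) := by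
  have := (pqObjects T).factors (id_mem_closure M)
  rwa [CategoryTheory.Functor.map_id] at this

theorem factors_id_sumPQ (T : ∀ (r : ℕ) (lam : r.Partition), Tableau lam) {k : ℕ}
    (m n : Fin k → ℕ) (l : Fin k → ℤ) :
    Nonempty (Factors (sumObjects m n l T).obj (𝟙 ((toKaroubi HPre).obj (sumPQ m n l)))) := by
  have := (sumObjects m n l T).factors (M := sumPQ m n l) (N := sumPQ m n l) (z := 𝟙 _) (by
    rw [← sum_matPr_matInc]
    exact sum_mem fun i _ => AddSubmonoid.subset_closure
      ⟨tripleAt m n l i, matPr (sumPQ m n l) i, matInc (sumPQ m n l) i, rfl⟩)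
  rwa [CategoryTheory.Functor.map_id] at this

end HeisCat

end

/-! ### Products of classes of idempotents -/

noncomputable section

namespace HeisCat

open Strand Mor EndMor

/-- Transport of endomorphisms along an equality of words. -/
def castMor {w w' : Word} : w = w' → (EndMor w →ₗ[ℂ] EndMor w')
  | rfl => LinearMap.id

theorem castMor_braid {w w' u v : Word} {a : Strand} {r : ℕ} (e : w = w')
    (h : w = u ++ List.replicate r a ++ v) (h' : w' = u ++ List.replicate r a ++ v)
    (σ : Equiv.Perm (Fin r)) : castMor e (braid h σ) = braid h' σ := by
  subst e
  rfl

theorem castMor_mul {w w' : Word} (e : w = w') (x y : EndMor w) :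
    castMor e (x * y) = castMor e x * castMor e y := by
  subst e
  rfl

/-- Horizontal composition of endomorphisms. -/
def juxt {w w' : Word} : EndMor w →ₗ[ℂ] EndMor w' →ₗ[ℂ] EndMor (w ++ w') :=
  LinearMap.mk₂ ℂ (fun x y => (whiskL w y).comp (whiskR w' x))
    (fun x x' y => by rw [whiskR_add, comp_add]) (fun c x y => by rw [whiskR_smul, comp_smul])
    (fun x y y' => by rw [whiskL_add, add_comp]) (fun c x y => by rw [whiskL_smul, smul_comp])

theorem juxt_apply {w w' : Word} (x : EndMor w) (y : EndMor w') :
    juxt x y = (whiskL w y).comp (whiskR w' x) := rfl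

theorem symAlg_bilinear_ext {m n : ℕ} {V : Type*} [AddCommGroup V] [Module ℂ V]
    {f g : SymAlg m →ₗ[ℂ] SymAlg n →ₗ[ℂ] V}
    (h : ∀ σ τ, f (MonoidAlgebra.of ℂ _ σ) (MonoidAlgebra.of ℂ _ τ) =
      g (MonoidAlgebra.of ℂ _ σ) (MonoidAlgebra.of ℂ _ τ)) (x : SymAlg m) (y : SymAlg n) :
    f x y = g x y := by
  induction x using MonoidAlgebra.induction_on with
  | of σ =>
    induction y using MonoidAlgebra.induction_on with
    | of τ => exact h σ τ
    | add y y' hy hy' => rw [map_add, map_add, hy, hy']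
    | smul c y hy => rw [map_smul, map_smul, hy]
  | add x x' hx hx' => rw [map_add, map_add, LinearMap.add_apply, LinearMap.add_apply, hx, hx']
  | smul c x hx => rw [map_smul, map_smul, LinearMap.smul_apply, LinearMap.smul_apply, hx]

theorem endVal_canonicalHom (a : Strand) {r : ℕ} (σ : Equiv.Perm (Fin r)) :
    endVal (strandPow a r) (canonicalHom a r (MonoidAlgebra.of ℂ _ σ)) =
      braid (w := List.replicate r a) (u := []) (v := []) (List.append_nil _).symm σ := by
  rw [canonicalHom, MonoidAlgebra.lift_of]
  rfl

/-- Both sides are bilinear, so permutations suffice: drawn next to each other they act on the two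
blocks of P^m Q^n. -/
theorem juxt_canonicalHom (m n : ℕ) (x : SymAlg m) (y : SymAlg n) :
    juxt (endVal _ (canonicalHom P m x)) (endVal _ (canonicalHom Q n y)) = pqBraid m n (x ⊗ₜ y) := by
  refine symAlg_bilinear_ext
    (f := juxt.compl₁₂ ((endVal (strandPow P m)).comp (canonicalHom P m)).toLinearMap
      ((endVal (strandPow Q n)).comp (canonicalHom Q n)).toLinearMap)
    (g := (TensorProduct.mk ℂ _ _).compr₂ (pqBraid m n).toLinearMap) (fun σ τ => ?_) x y
  change juxt (endVal (strandPow P m) (canonicalHom P m (MonoidAlgebra.of ℂ _ σ)))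
    (endVal (strandPow Q n) (canonicalHom Q n (MonoidAlgebra.of ℂ _ τ))) =
      pqBraid m n (MonoidAlgebra.of ℂ _ σ ⊗ₜ MonoidAlgebra.of ℂ _ τ)
  rw [pqBraid_of]
  refine (congrArg₂ (fun (f : EndMor (List.replicate m P)) (g : EndMor (List.replicate n Q)) =>
    juxt f g) (endVal_canonicalHom P σ) (endVal_canonicalHom Q τ)).trans ?_
  have h₁ := whiskR_braid (w := List.replicate m P) (u := []) (v := []) (List.replicate n Q)
    (List.append_nil _).symm rfl σ
  have h₂ := whiskL_braid (w := List.replicate n Q) (u := []) (v := []) (List.replicate m P)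
    (List.append_nil _).symm (by simp) τ
  refine (congrArg₂ Mor.comp h₂ h₁).trans ?_
  exact congrArg₂ Mor.comp
    (congrArg (fun f : _ →* EndMor _ => f τ) (braid_congr _ _ (List.append_nil _) rfl)) rfl

/-- Multiplication by the shifted empty word appends an empty word on the right. This is an equality
of words but not a definitional one, hence the transport. -/
theorem juxt_one (m n : ℕ) (e : word m n = word m n ++ []) (x : SymAlg m) (y : SymAlg n) :
    juxt (pqBraid m n (x ⊗ₜ y)) (1 : EndMor []) = castMor e (pqBraid m n (x ⊗ₜ y)) := by
  refine symAlg_bilinear_ext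
    (f := (TensorProduct.mk ℂ _ _).compr₂ ((juxt.flip (1 : EndMor [])).comp
      (pqBraid m n).toLinearMap))
    (g := (TensorProduct.mk ℂ _ _).compr₂ ((castMor e).comp (pqBraid m n).toLinearMap))
    (fun σ τ => ?_) x y
  change juxt (pqBraid m n (MonoidAlgebra.of ℂ _ σ ⊗ₜ MonoidAlgebra.of ℂ _ τ)) (1 : EndMor []) =
    castMor e (pqBraid m n (MonoidAlgebra.of ℂ _ σ ⊗ₜ MonoidAlgebra.of ℂ _ τ))
  rw [pqBraid_of, juxt_apply, castMor_mul,
    castMor_braid e _ (e.symm.trans (word_left m n)),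
    castMor_braid e _ (e.symm.trans (word_right m n))]
  refine (id_comp _).trans ((whiskR_comp [] _ _).trans ?_)
  refine congrArg₂ Mor.comp ?_ ?_
  · refine (whiskR_braid [] (word_right m n) (by simp) τ).trans ?_
    exact congrArg (fun f : _ →* EndMor _ => f τ) (braid_congr _ _ rfl rfl)
  · refine (whiskR_braid [] (word_left m n) (by simp) σ).trans ?_
    exact congrArg (fun f : _ →* EndMor _ => f σ) (braid_congr _ _ rfl (List.append_nil _))

theorem val_tensorHom_end {A B : Shifted} (f : End A) (g : End B) :
    Shifted.val (Shifted.tensorHom f g) = juxt (endVal A f) (endVal B g) := by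
  refine (Shifted.val_tensorHom f g).trans ?_
  rw [sub_self, zero_mul, zpow_zero, one_smul]
  rfl

/-- A product of one-word objects is indexed by a product of singletons instead of a singleton and
has a word equal only propositionally to the expected one. The idempotent itself, as a one-by-one
matrix, is the isomorphism in both directions. -/
theorem cls_eq_wordSummand {ι : Type} [Fintype ι] [Unique ι] {Z Y : Shifted} (h : Z = Y)
    (p : (⟨ι, fun _ => Z⟩ : HPre) ⟶ ⟨ι, fun _ => Z⟩) (hp : p ≫ p = p) (e : End Y)
    (he : IsIdempotentElem e)
    (hpe : ∀ i j, Shifted.val (p i j) =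
      castMor (congrArg Shifted.word h.symm) (endVal Y e)) :
    cls (⟨⟨ι, fun _ => Z⟩, p, hp⟩ : HCat) = cls (wordSummand Y e he) := by
  subst h
  have hpe' (i j) : p i j = (show Z ⟶ Z from e) := Shifted.hom_ext (hpe i j)
  have he' : (show Z ⟶ Z from e) ≫ (show Z ⟶ Z from e) = e := he
  let f : (⟨ι, fun _ => Z⟩ : HPre) ⟶ (Mat_.embedding Shifted).obj Z :=
    fun _ _ => (show Z ⟶ Z from e)
  let g : (Mat_.embedding Shifted).obj Z ⟶ (⟨ι, fun _ => Z⟩ : HPre) :=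
    fun _ _ => (show Z ⟶ Z from e)
  let q : (Mat_.embedding Shifted).obj Z ⟶ (Mat_.embedding Shifted).obj Z :=
    (Mat_.embedding Shifted).map e
  have hfg : f ≫ g = p := Mat_.hom_ext _ _ fun i j =>
    (comp_apply_of_embedding f g i j).trans (he'.trans (hpe' i j).symm)
  have hgf : g ≫ f = q := Mat_.hom_ext _ _ fun i j =>
    (Mat_.comp_apply g f i j).trans ((Fintype.sum_unique (ι := ι) _).trans he')
  have hfq : f ≫ q = f := Mat_.hom_ext _ _ fun i j =>
    (comp_apply_of_embedding f q i j).trans he'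
  have hqg : q ≫ g = g := Mat_.hom_ext _ _ fun i j =>
    (comp_apply_of_embedding q g i j).trans he'
  refine cls_iso (X := (⟨⟨ι, fun _ => Z⟩, p, hp⟩ : HCat)) (Y := wordSummand Z e he)
    { hom := ⟨f, ?_⟩
      inv := ⟨g, ?_⟩
      hom_inv_id := Karoubi.hom_ext _ _ hfg
      inv_hom_id := Karoubi.hom_ext _ _ hgf }
  · change p ≫ f ≫ q = f
    rw [hfq, ← hfg, Category.assoc, hgf, hfq]
  · change q ≫ g ≫ p = g
    rw [← hfg, reassoc_of% hgf, hqg, hqg]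

/-- All the idempotents preserve shifts, so the Koszul signs in the horizontal compositions are
trivial and the product idempotent is the image of `x ⊗ₜ y`. -/
theorem cls_mul_cls_mul_tPow (m n : ℕ) (l : ℤ) (x : SymAlg m) (y : SymAlg n)
    (hx : IsIdempotentElem (canonicalHom P m x)) (hy : IsIdempotentElem (canonicalHom Q n y))
    (hxy : IsIdempotentElem (pqHom m n l (x ⊗ₜ y))) :
    cls (wordSummand (strandPow P m) _ hx) * cls (wordSummand (strandPow Q n) _ hy) * tPow l =
      cls (wordSummand (PQ m n l) _ hxy) := by
  rw [tPow, cls_mul_cls, cls_mul_cls]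
  have hZ : Shifted.tensorObj (Shifted.tensorObj (strandPow P m) (strandPow Q n)) ⟨[], l⟩ =
      PQ m n l := by
    refine congrArg₂ Shifted.mk (List.append_nil _) ?_
    change (0 : ℤ) + 0 + l = l
    rw [zero_add, zero_add]
  let _ : Unique ((PUnit.{1} × PUnit.{1}) × PUnit.{1}) := ⟨⟨((⟨⟩, ⟨⟩), ⟨⟩)⟩, fun _ => rfl⟩
  refine cls_eq_wordSummand (ι := (PUnit.{1} × PUnit.{1}) × PUnit.{1}) hZ _ _ _ _ fun i j => ?_
  refine (congrArg (fun g => Shifted.val (Shifted.tensorHom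
    (Shifted.tensorHom (canonicalHom P m x) (canonicalHom Q n y)) g))
    (Mat_.id_apply_self ((Mat_.embedding Shifted).obj ⟨[], l⟩) ⟨⟩)).trans ?_
  refine (val_tensorHom_end (A := Shifted.tensorObj (strandPow P m) (strandPow Q n))
    (B := ⟨[], l⟩) (Shifted.tensorHom (canonicalHom P m x) (canonicalHom Q n y)) 1).trans ?_
  rw [map_one, endVal_pqHom]
  have h₁ : endVal (Shifted.tensorObj (strandPow P m) (strandPow Q n))
      (Shifted.tensorHom (canonicalHom P m x) (canonicalHom Q n y)) = pqBraid m n (x ⊗ₜ y) :=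
    (val_tensorHom_end _ _).trans (juxt_canonicalHom m n x y)
  rw [h₁]
  exact juxt_one m n _ x y

end HeisCat

end

/-! ### Expansion of classes in the basic classes -/

noncomputable section

namespace HeisCat

section

variable (T : ∀ (r : ℕ) (lam : r.Partition), Tableau lam)

theorem isIdempotentElem_canonicalHom (a : Strand) (r : ℕ) (lam : r.Partition) :
    IsIdempotentElem (canonicalHom a r (T r lam).youngSymmetrizer) :=
  (T r lam).isIdempotentElem_youngSymmetrizer.map _

/-- The class `[(P^m, e_λ)] · [(Q^n, e_μ)] · t^l`. -/
def youngCls (x : ℕ × ℕ × ℤ) (lam : x.1.Partition) (mu : x.2.1.Partition) : K0H :=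
  cls (wordSummand (strandPow .P x.1) _ (isIdempotentElem_canonicalHom T .P x.1 lam)) *
    cls (wordSummand (strandPow .Q x.2.1) _ (isIdempotentElem_canonicalHom T .Q x.2.1 mu)) *
    tPow x.2.2

/-- The summand cut out by e_λ ⊗ e_μ in P^m Q^n⟨l⟩ is a product of three objects, so the abstract
splitting is expressed in the classes of the theorem. -/
theorem cls_obj (s : Σ x, PartPair x) :
    cls ((pqObjects T).obj s) = youngCls T s.1 s.2.1 s.2.2 := by
  obtain ⟨x, lam, mu⟩ := s
  have h : IsIdempotentElem (pqHom x.1 x.2.1 x.2.2 (youngTensor T (lam, mu))) :=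
    IsIdempotentElem.map (M := SymAlg x.1 ⊗[ℂ] SymAlg x.2.1)
      ((splitFamily_youngTensor T x.1 x.2.1).idem (lam, mu)) (pqHom x.1 x.2.1 x.2.2)
  refine Eq.trans ?_ (cls_mul_cls_mul_tPow x.1 x.2.1 x.2.2 _ _ _ _ h).symm
  have key (p : pqObj x ⟶ pqObj x) (hp : p ≫ p = p) (e : p = (Mat_.embedding Shifted).map
      (pqHom x.1 x.2.1 x.2.2 (youngTensor T (lam, mu)))) :
      (⟨pqObj x, p, hp⟩ : HCat) = wordSummand (PQ x.1 x.2.1 x.2.2) _ h := by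
    subst e
    rfl
  exact congrArg cls (key _ _ (pqObjects_scal T x (lam, mu)))

theorem sum_cls_obj (L : Multiset (Σ x, PartPair x)) (s : Finset (ℕ × ℕ × ℤ))
    (hs : ∀ y ∈ L, y.1 ∈ s) :
    ∃ c : ∀ x : ℕ × ℕ × ℤ, x.1.Partition → x.2.1.Partition → ℕ,
      (L.map fun y => cls ((pqObjects T).obj y)).sum =
        ∑ x ∈ s, ∑ lam : x.1.Partition, ∑ mu : x.2.1.Partition,
          c x lam mu • youngCls T x lam mu := by
  classical
  -- The coefficients are the multiplicities in the splitting, which explains why they are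
  -- non-negative.
  refine ⟨fun x lam mu => L.count ⟨x, lam, mu⟩, ?_⟩
  rw [Finset.sum_multiset_map_count]
  have h : L.toFinset ⊆ s.sigma fun _ => Finset.univ := fun y hy =>
    Finset.mem_sigma.2 ⟨hs y (Multiset.mem_toFinset.1 hy), Finset.mem_univ _⟩
  rw [Finset.sum_subset h fun y _ hy => by
    rw [Multiset.count_eq_zero.2 (mt Multiset.mem_toFinset.2 hy), zero_smul], Finset.sum_sigma]
  refine Finset.sum_congr rfl fun x _ => (Fintype.sum_prod_type _).trans ?_
  refine Finset.sum_congr rfl fun lam _ => Finset.sum_congr rfl fun mu _ => ?_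
  rw [cls_obj]

theorem cls_summand_eq {k : ℕ} (m n : Fin k → ℕ) (l : Fin k → ℤ) (e : End (sumPQ m n l))
    (he : IsIdempotentElem e) :
    ∃ c : ∀ x : ℕ × ℕ × ℤ, x.1.Partition → x.2.1.Partition → ℕ,
      cls (summand (sumPQ m n l) e he) =
        ∑ x ∈ triples m n l, ∑ lam : x.1.Partition, ∑ mu : x.2.1.Partition,
          c x lam mu • youngCls T x lam mu := by
  obtain ⟨L, hL⟩ := exists_cls_eq_sum (sumObjects m n l T).splitData (summand (sumPQ m n l) e he)
    (factors_id_sumPQ T m n l)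
  -- The splitting uses only triples that occur in the sum; forgetting this membership gives labels
  -- among all triples.
  let ι : (Σ x : triples m n l, PartPair x.1) → Σ x, PartPair x := fun y => ⟨y.1.1, y.2⟩
  obtain ⟨c, hc⟩ := sum_cls_obj T (L.map ι) (triples m n l) fun y hy => by
    obtain ⟨z, -, rfl⟩ := Multiset.mem_map.1 hy
    exact z.1.2
  refine ⟨c, hL.trans (Eq.trans ?_ hc)⟩
  rw [Multiset.map_map]
  rfl

theorem cls_eq (A : HCat) :
    ∃ (s : Finset (ℕ × ℕ × ℤ)) (c : ∀ x : ℕ × ℕ × ℤ, x.1.Partition → x.2.1.Partition → ℕ),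
      cls A = ∑ x ∈ s, ∑ lam : x.1.Partition, ∑ mu : x.2.1.Partition,
        c x lam mu • youngCls T x lam mu := by
  classical
  obtain ⟨L, hL⟩ := exists_cls_eq_sum (pqObjects T).splitData A (factors_id_HPre T A.X)
  obtain ⟨c, hc⟩ := sum_cls_obj T L (L.map Sigma.fst).toFinset fun y hy =>
    Multiset.mem_toFinset.2 (Multiset.mem_map_of_mem _ hy)
  exact ⟨_, c, hL.trans hc⟩

end

end HeisCat

end

theorem mainTheorem10 (k : ℕ) (m n : Fin k → ℕ) (l : Fin k → ℤ) :
    Nonempty (K0 (End (sumPQ m n l)) ≃+ K0 (subringR0 m n l)) ∧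
    Nonempty (K0 (subringR0 m n l) ≃+ ⨁ x : triples m n l, K0 (End (PQ x.1.1 x.1.2.1 0))) ∧
    Nonempty ((⨁ x : triples m n l, K0 (End (PQ x.1.1 x.1.2.1 0))) ≃+
      ⨁ x : triples m n l, K0 (SymAlg x.1.1 ⊗[ℂ] SymAlg x.1.2.1)) ∧
    ∃ ρ : ∀ (a : Strand) (r : ℕ), SymAlg r →ₐ[ℂ] End (strandPow a r),
      (∀ a r, IsCanonical a r (ρ a r)) ∧
      ∀ T : ∀ (r : ℕ) (lam : r.Partition), Tableau lam,
        ∃ hT : ∀ (a : Strand) (r : ℕ) (lam : r.Partition),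
            IsIdempotentElem (ρ a r (T r lam).youngSymmetrizer),
          (∀ (e : End (sumPQ m n l)) (he : IsIdempotentElem e),
            ∃ c : ∀ x : ℕ × ℕ × ℤ, x.1.Partition → x.2.1.Partition → ℕ,
              cls (summand (sumPQ m n l) e he) =
                ∑ x ∈ triples m n l, ∑ lam : x.1.Partition, ∑ mu : x.2.1.Partition,
                  c x lam mu •
                    (cls (wordSummand (strandPow .P x.1) _ (hT .P x.1 lam)) *
                      cls (wordSummand (strandPow .Q x.2.1) _ (hT .Q x.2.1 mu)) *
                      tPow x.2.2)) ∧
          (∀ A : HCat, ∃ (s : Finset (ℕ × ℕ × ℤ))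
              (c : ∀ x : ℕ × ℕ × ℤ, x.1.Partition → x.2.1.Partition → ℕ),
              cls A =
                ∑ x ∈ s, ∑ lam : x.1.Partition, ∑ mu : x.2.1.Partition,
                  c x lam mu •
                    (cls (wordSummand (strandPow .P x.1) _ (hT .P x.1 lam)) *
                      cls (wordSummand (strandPow .Q x.2.1) _ (hT .Q x.2.1 mu)) *
                      tPow x.2.2)) := by
  obtain ⟨h₁, h₂, h₃⟩ := K0_isos m n l
  exact ⟨h₁, h₂, h₃, canonicalHom, isCanonical_canonicalHom, fun T =>
    ⟨isIdempotentElem_canonicalHom T, cls_summand_eq T m n l, cls_eq T⟩⟩
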